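/- Let $(M,g)$ be a compact smooth Riemannian manifold without boundary of real dimension $n$, with injectivity radius greater than $1$, and let $\phi\in C_c^\infty(B_1(0))$ be a fixed test function on the unit ball of $\mathbb{R}^n$ with $\phi=1$ on $B_{1/2}(0)$. Then there is a constant $C>0$, depending only on $(M,g)$ and on the choice of the cutoff $\phi$, such that the following holds. Let $J_0$ be an almost complex structure on $M$ compatible with $g$ (that is, $J_0^2=-\mathrm{id}$ and $g(J_0\cdot,J_0\cdot)=g$), and let $J(t)$, $t\in[0,T)$, $0<T<\infty$, be a smooth solution of the harmonic heat flow $$\partial_t J=\Delta_g J-J\nabla_pJ\nabla_pJ,\qquad (J\nabla_pJ\nabla_pJ)^k_j=g^{pq}J^a_j\nabla_pJ^b_a\nabla_qJ^k_b,\qquad J(0)=J_0,$$ where $\Delta_g$ is the rough Laplacian. Write $E_0=\int_M|\nabla J_0|^2\,dv$. Let $y\in M$, let $x=(x_1,\dots,x_n)$ be normal coordinates centred at $y$, identifying the geodesic ball $B_1(y)$ with $B_1(0)\subset\mathbb{R}^n$, and let $0<T_0\le T$. Put $$\Psi(R)=\int_{T_0-4R^2}^{T_0-R^2}\int_{\mathbb{R}^n}|\nabla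 J|^2\,G\,\phi^2\sqrt{|g|}\,dx\,dt,\qquad G(x,t)=\frac{1}{(4\pi(T_0-t))^{n/2}}\exp\Big(-\frac{|x|^2}{4(T_0-t)}\Big),$$ where the norm $|\nabla J|^2$ is taken in the metric $g$. Then for all $0<R_2\le R_1\le\min\{\sqrt{T_0}/2,\,1\}$ and all $N>1$, $$\Psi(R_2)\le e^{C(\tilde f(R_2)-\tilde f(R_1))}\,\Psi(R_1)+C\Big(N^{n/2}\big(E_0+\sqrt{E_0}\big)+\frac{1}{\ln^2N}\Big)(R_1-R_2),$$ where $\tilde f(R)=-4R^2\ln^2R+4R^2\ln R-3R^2$. -/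

import Mathlib

open Set MeasureTheory Bundle
open scoped Manifold ContDiff ENNReal

noncomputable section

namespace HarmonicFlow

/-- The Euclidean space `ℝⁿ` with coordinates `x₁, …, xₙ`. -/
abbrev E (n : ℕ) : Type := EuclideanSpace ℝ (Fin n)

/-! ### Tensor calculus in an open set of `ℝⁿ`

A metric is given by its matrix `G x i j = g_{ij}(x)`; an endomorphism field `A` of the tangent
bundle by its components `A x α β = A_α^β(x)` (lower index first), so that
`A ∂_α = ∑ β, A_α^β ∂_β`. -/

section Coordinates

variable {n : ℕ}

/-- The partial derivative `∂f / ∂x_k`. -/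
def pderiv (k : Fin n) (f : E n → ℝ) (x : E n) : ℝ :=
  fderiv ℝ f x (EuclideanSpace.single k 1)

/-- The Christoffel symbol `Γ^k_{ij}` of the Levi-Civita connection of the metric `G`. -/
def christoffel (G : E n → Matrix (Fin n) (Fin n) ℝ) (x : E n) (k i j : Fin n) : ℝ :=
  (1 / 2) * ∑ l, (G x)⁻¹ k l *
    (pderiv i (fun z => G z j l) x + pderiv j (fun z => G z i l) x - pderiv l (fun z => G z i j) x)

/-- The covariant derivative `∇_k A_α^β = ∂_k A_α^β + Γ^β_{lk} A_α^l - Γ^l_{αk} A_l^β`. -/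
def covDeriv (G : E n → Matrix (Fin n) (Fin n) ℝ) (A : E n → Fin n → Fin n → ℝ)
    (x : E n) (k α β : Fin n) : ℝ :=
  pderiv k (fun z => A z α β) x + ∑ l, christoffel G x β l k * A x α l
    - ∑ l, christoffel G x l α k * A x l β

/-- The second covariant derivative `∇_q ∇_p A_α^β`. -/
def covDeriv₂ (G : E n → Matrix (Fin n) (Fin n) ℝ) (A : E n → Fin n → Fin n → ℝ)
    (x : E n) (q p α β : Fin n) : ℝ :=
  pderiv q (fun z => covDeriv G A z p α β) x
    - ∑ l, christoffel G x l p q * covDeriv G A x l α β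
    + ∑ l, christoffel G x β l q * covDeriv G A x p α l
    - ∑ l, christoffel G x l α q * covDeriv G A x p l β

/-- The rough Laplacian `(Δ A)_α^β = g^{pq} ∇_q ∇_p A_α^β`. -/
def roughLaplacian (G : E n → Matrix (Fin n) (Fin n) ℝ) (A : E n → Fin n → Fin n → ℝ)
    (x : E n) (α β : Fin n) : ℝ :=
  ∑ p, ∑ q, (G x)⁻¹ p q * covDeriv₂ G A x q p α β

/-- The quadratic term `(A ∇_p A ∇_p A)_α^β = g^{pq} A_α^a ∇_p A_a^b ∇_q A_b^β`. -/
def quadraticTerm (G : E n → Matrix (Fin n) (Fin n) ℝ) (A : E n → Fin n → Fin n → ℝ)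
    (x : E n) (α β : Fin n) : ℝ :=
  ∑ p, ∑ q, ∑ a, ∑ b,
    (G x)⁻¹ p q * A x α a * covDeriv G A x p a b * covDeriv G A x q b β

/-- The squared norm
`|∇A|² = g_{i₁i₂} g^{j₁j₂} g^{k₁k₂} ∇_{k₁} A_{j₁}^{i₁} ∇_{k₂} A_{j₂}^{i₂}`. -/
def gradNormSq (G : E n → Matrix (Fin n) (Fin n) ℝ) (A : E n → Fin n → Fin n → ℝ)
    (x : E n) : ℝ :=
  ∑ i₁, ∑ i₂, ∑ j₁, ∑ j₂, ∑ k₁, ∑ k₂,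
    G x i₁ i₂ * (G x)⁻¹ j₁ j₂ * (G x)⁻¹ k₁ k₂ * covDeriv G A x k₁ j₁ i₁ * covDeriv G A x k₂ j₂ i₂

/-- The Euclidean heat kernel `(4πs)^{-n/2} exp(-|x|²/(4s))`. -/
def heatKernel (s : ℝ) (x : E n) : ℝ :=
  1 / (4 * Real.pi * s) ^ ((n : ℝ) / 2) * Real.exp (-‖x‖ ^ 2 / (4 * s))

end Coordinates

/-! ### Riemannian manifolds -/

section Manifold

variable {n : ℕ} {M : Type*} [TopologicalSpace M] [ChartedSpace (E n) M]

/-- Fields of endomorphisms of the tangent bundle (with no regularity). -/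
abbrev EndField (n : ℕ) (M : Type*) [TopologicalSpace M] [ChartedSpace (E n) M] : Type _ :=
  ∀ p : M, TangentSpace (𝓡 n) p →L[ℝ] TangentSpace (𝓡 n) p

/-- The coordinate vector field `∂_i` of the chart `e`, at the point with coordinates `x`. -/
def coordVec (e : OpenPartialHomeomorph M (E n)) (x : E n) (i : Fin n) :
    TangentSpace (𝓡 n) (e.symm x) :=
  mfderiv (𝓡 n) (𝓡 n) e.symm x (EuclideanSpace.single i (1 : ℝ) : E n)

/-- The components `J_α^β = dx^β (J ∂_α)` of an endomorphism field in the chart `e`. -/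
def endCoeff (e : OpenPartialHomeomorph M (E n)) (J : EndField n M) (x : E n)
    (α β : Fin n) : ℝ :=
  let v : E n := mfderiv (𝓡 n) (𝓡 n) e (e.symm x) (J (e.symm x) (coordVec e x α))
  v β

section Metric

variable [IsManifold (𝓡 n) ∞ M]

/-- A smooth Riemannian metric on the tangent bundle of `M`. -/
abbrev Metric (n : ℕ) (M : Type*) [TopologicalSpace M] [ChartedSpace (E n) M]
    [IsManifold (𝓡 n) ∞ M] : Type _ :=
  ContMDiffRiemannianMetric (𝓡 n) ∞ (E n) (fun p : M => TangentSpace (𝓡 n) p)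

variable (g : Metric n M)

/-- The matrix `g_{ij} = g(∂_i, ∂_j)` of the metric in the chart `e`. -/
def gram (e : OpenPartialHomeomorph M (E n)) (x : E n) : Matrix (Fin n) (Fin n) ℝ :=
  Matrix.of fun i j => g.inner (e.symm x) (coordVec e x i) (coordVec e x j)

/-- `e` is a normal coordinate system centred at `y` on a ball of radius `r`: a smooth chart onto
the Euclidean ball of radius `r` in which `y` is the origin, `g_{ij}(0) = δ_{ij}`, and the straight
lines through the origin are geodesics, i.e. `Γ^k_{ij}(x) x^i x^j = 0`. Equivalently, the inverse
of `e` is the exponential map at `y` composed with a linear isometry `ℝⁿ → T_y M`. -/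
structure IsNormalChart (y : M) (r : ℝ) (e : OpenPartialHomeomorph M (E n)) : Prop where
  mem_maximalAtlas : e ∈ IsManifold.maximalAtlas (𝓡 n) ∞ M
  mem_source : y ∈ e.source
  map_center : e y = 0
  target_eq : e.target = Metric.ball 0 r
  gram_zero : gram g e 0 = 1
  radial_geodesic : ∀ x ∈ e.target, ∀ k, ∑ i, ∑ j, christoffel (gram g e) x k i j * x i * x j = 0

/-- The injectivity radius at `y`: the supremum of the radii `r` for which the exponential map at
`y` is a diffeomorphism from the ball of radius `r` onto an open set of `M`. -/
def injectivityRadiusAt (y : M) : ℝ≥0∞ :=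
  ⨆ (r : ℝ) (_ : ∃ e, IsNormalChart g y r e), ENNReal.ofReal r

/-- The injectivity radius of `(M, g)`. -/
def injectivityRadius : ℝ≥0∞ := ⨅ y : M, injectivityRadiusAt g y

/-- The Riemannian volume measure of the domain of the chart `e`, `√|g| dx` in coordinates,
extended by zero to `M`. -/
def chartVolume [MeasurableSpace M] (e : OpenPartialHomeomorph M (E n)) : Measure M :=
  ((volume.restrict e.target).withDensity
    fun x => ENNReal.ofReal (Real.sqrt (gram g e x).det)).map e.symm

/-- The Riemannian volume measure: the least measure which dominates the volume measure of every
smooth chart. (The chart measures agree on overlaps, so it restricts to each of them.) -/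
def riemannianVolume [MeasurableSpace M] : Measure M :=
  ⨆ e ∈ IsManifold.maximalAtlas (𝓡 n) ∞ M, chartVolume g e

/-- The energy `E(J) = ∫_M |∇J|² dv`; the (chart independent) function `|∇J|²` is evaluated at `p`
in the preferred chart at `p`. -/
def energy [MeasurableSpace M] (J : EndField n M) : ℝ :=
  ∫ p : M, gradNormSq (gram g (chartAt (E n) p)) (endCoeff (chartAt (E n) p) J)
    (chartAt (E n) p p) ∂(riemannianVolume g)

/-- `J` is an almost complex structure compatible with `g`: `J² = -1` and `g(J·, J·) = g`. -/
def IsCompatible (J : EndField n M) : Prop :=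
  (∀ (p : M) (v : TangentSpace (𝓡 n) p), J p (J p v) = -v) ∧
  ∀ (p : M) (v w : TangentSpace (𝓡 n) p), g.inner p (J p v) (J p w) = g.inner p v w

/-- `J(t)`, `0 ≤ t < T`, is a smooth solution of the harmonic heat flow
`∂_t J = Δ J - J ∇_p J ∇_p J` whose initial value is an almost complex structure compatible with
`g`. -/
structure IsHarmonicHeatFlow (T : ℝ) (J : ℝ → EndField n M) : Prop where
  compatible_initial : IsCompatible g (J 0)
  smooth : ∀ e ∈ IsManifold.maximalAtlas (𝓡 n) ∞ M, ∀ α β,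
    ContDiffOn ℝ ∞ (fun q : ℝ × E n => endCoeff e (J q.1) q.2 α β) (Ico 0 T ×ˢ e.target)
  equation : ∀ e ∈ IsManifold.maximalAtlas (𝓡 n) ∞ M, ∀ t ∈ Ico 0 T, ∀ x ∈ e.target, ∀ α β,
    HasDerivWithinAt (fun s => endCoeff e (J s) x α β)
      (roughLaplacian (gram g e) (endCoeff e (J t)) x α β
        - quadraticTerm (gram g e) (endCoeff e (J t)) x α β) (Ico 0 T) t

/-- The localized space-time energy
`Ψ(R) = ∫_{T₀-4R²}^{T₀-R²} ∫_{ℝⁿ} |∇J|² G φ² √|g| dx dt`, in the coordinates `e`, where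
`G = (4π(T₀-t))^{-n/2} exp(-|x|²/(4(T₀-t)))`. -/
def Psi (φ : E n → ℝ) (e : OpenPartialHomeomorph M (E n)) (J : ℝ → EndField n M)
    (T₀ R : ℝ) : ℝ :=
  ∫ t in (T₀ - 4 * R ^ 2)..(T₀ - R ^ 2), ∫ x : E n,
    gradNormSq (gram g e) (endCoeff e (J t)) x * heatKernel (T₀ - t) x * φ x ^ 2
      * Real.sqrt (gram g e x).det

end Metric

end Manifold

/-- The function `f̃(R) = -4R² ln² R + 4R² ln R - 3R²`. -/
def fTilde (R : ℝ) : ℝ :=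
  -4 * R ^ 2 * Real.log R ^ 2 + 4 * R ^ 2 * Real.log R - 3 * R ^ 2

end HarmonicFlow

end

/-!
The flow is studied through the matrix `A` of `J` in a chart, in the row convention of `endCoeff`.
Covariant derivatives are then `cov G k A = ∂_k A + A Γ_k - Γ_k A`, the adjoint of an endomorphism
with respect to `g` is `adj`, and `trEnergy = g^{pq} tr(∇_p A ∇_q A)`.

*Compatibility.* The flow keeps `J` an almost complex structure compatible with `g`: the defects
`A² + 1` and `A + A†` solve linear parabolic systems with vanishing initial values
(`sq_defect_equation`, `skew_defect_equation`), hence vanish by Gronwall's inequality for their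
`L²` norms (`eq_zero_of_linear_heat`). Consequently `∇A` is skew-adjoint, `|∇A|²` is `-trEnergy`
(`gradNormSq_of_skew`), and the quadratic term of the equation is orthogonal to every endomorphism
that anticommutes with `A` (`trace_mul_mul_gradProd`), in particular to `∂_t A` and to `∇_X A`. The
divergence theorem `integral_covDiv_eq_zero` then shows that the energy does not increase
(`IsHarmonicHeatFlow.energy_le`).

*Uniform geometry.* The constant must be uniform over all normal charts of radius one. If `e` is
centred near the centre of a fixed normal chart `e₀` of radius larger than one, the transition map
from `e` to `e₀` is the time-one map of the geodesic flow of `e₀`, started at one point with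
linearly varying velocity. Its derivatives solve the repeatedly linearized geodesic equation, so
Gronwall's inequality bounds them (`exists_isFlowFamily_tangent`), and with them the metric of `e`
and its first two derivatives; compactness of `M` gives `exists_boundedGeometry`. No information on
the exponential map enters besides the Gauss lemma `IsRadialMetric.gauss`, which also makes the
gradient of the Euclidean heat kernel a radial vector field.

*Local monotonicity.* Let `Z(t)` be the integral of `τ |∇A|² k φ² √|g|` over the chart, where
`τ = T₀ - t` and `k` is the heat kernel at time `τ`. The stress-energy identity `stress_identity`
for the position vector field `X`, combined with the equation, writes the time derivative of the
density as a sum of divergences and of `evolutionError` (`IsCompatibleFlow.dt_localDensity`). The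
latter consists of the square of the self-similar defect `φ (∂_t A - ∇_X A / 2τ) + ∇_{∇φ} A`, which
has a sign, and of terms that `exists_evolutionError_le` bounds by `|∇A|²` (from the region where
`φ` is not constant), by `|log τ|` times the density, and by `|x| |∇A| k φ²` (from the curvature).

*Integration over scales.* At `τ = R² σ` with `1 ≤ σ ≤ 4`, the term of first order in `∇A` is
treated in two ways (`exists_deriv_localEnergy_le_scale`). If `R² N < 1`, then `log² N` is at most
`1 + 4 log² R`, and Young's inequality with a weight of this size leaves `O(1 / log² N)`; otherwise
the heat kernel is at most `N^{n/2}` and there remains `O(N^{n/2} √E₀)`. Finally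
`Ψ(R) = ∫₁⁴ Z(T₀ - R² σ) dσ / σ` (`IsHarmonicHeatFlow.psi_eq`), and since `f̃` has the derivative
`-2R (1 + 4 log² R)`, Gronwall's inequality `gronwall_fTilde` for each `σ` gives the claim
(`exists_localEnergy_monotone`).
-/

noncomputable section
namespace HarmonicFlow
open Filter Topology

set_option linter.unusedSectionVars false

open scoped MatrixOrder Matrix.Norms.L2Operator in
theorem exists_transpose_mul_self {n : ℕ} {S : Matrix (Fin n) (Fin n) ℝ} (hS : S.PosSemidef) :
    ∃ L : Matrix (Fin n) (Fin n) ℝ, S = L.transpose * L := by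
  obtain ⟨L, hL⟩ := CStarAlgebra.nonneg_iff_eq_star_mul_self.mp hS.nonneg
  exact ⟨L, by simpa [Matrix.star_eq_conjTranspose] using hL⟩

attribute [local instance] Matrix.frobeniusNormedRing Matrix.frobeniusNormedAlgebra

/-! ### Calculus of matrix-valued functions -/

/-- Square matrices, normed by the Frobenius norm. -/
abbrev Mat (n : ℕ) : Type := Matrix (Fin n) (Fin n) ℝ

section MatrixCalculus

variable {n : ℕ} {F : Type*} [NormedAddCommGroup F] [NormedSpace ℝ F]

/-- The partial derivative `∂f / ∂x_k` of a function with values in a normed space. -/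
def pd (k : Fin n) (f : E n → F) (x : E n) : F :=
  fderiv ℝ f x (EuclideanSpace.single k 1)

theorem pderiv_eq_pd (k : Fin n) (f : E n → ℝ) (x : E n) : pderiv k f x = pd k f x := rfl

/-- The matrix entry `A ↦ A i j` as a continuous linear map. -/
def entryCLM (i j : Fin n) : Mat n →L[ℝ] ℝ :=
  LinearMap.toContinuousLinearMap (Matrix.entryLinearMap ℝ ℝ i j)

/-- The trace as a continuous linear map. -/
def traceCLM (n : ℕ) : Mat n →L[ℝ] ℝ :=
  LinearMap.toContinuousLinearMap (Matrix.traceLinearMap (Fin n) ℝ ℝ)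

/-- The transpose as a continuous linear map. -/
def transposeCLM (n : ℕ) : Mat n →L[ℝ] Mat n :=
  LinearMap.toContinuousLinearMap (Matrix.transposeLinearEquiv (Fin n) (Fin n) ℝ ℝ).toLinearMap

@[simp] theorem entryCLM_apply (i j : Fin n) (A : Mat n) : entryCLM i j A = A i j := rfl
@[simp] theorem traceCLM_apply (A : Mat n) : traceCLM n A = A.trace := rfl
@[simp] theorem transposeCLM_apply (A : Mat n) : transposeCLM n A = A.transpose := rfl

section General
variable {X : Type*} [NormedAddCommGroup X] [NormedSpace ℝ X] {m : ℕ∞ω} {x : X} {s : Set X}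

theorem contDiffAt_matrix {A : X → Mat n} :
    ContDiffAt ℝ m A x ↔ ∀ i j, ContDiffAt ℝ m (fun z => A z i j) x := by
  constructor
  · intro hA i j
    exact (entryCLM i j).contDiff.contDiffAt.comp x hA
  · intro h
    have : A = fun z => ∑ i, ∑ j, A z i j • Matrix.single i j (1 : ℝ) := by
      funext z
      conv_lhs => rw [Matrix.matrix_eq_sum_single (A z)]
      simp
    rw [this]
    exact ContDiffAt.sum fun i _ => ContDiffAt.sum fun j _ =>
      (h i j).smul contDiffAt_const

theorem contDiffOn_matrix {A : X → Mat n} :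
    ContDiffOn ℝ m A s ↔ ∀ i j, ContDiffOn ℝ m (fun z => A z i j) s := by
  constructor
  · intro hA i j
    exact (entryCLM i j).contDiff.comp_contDiffOn hA
  · intro h
    have : A = fun z => ∑ i, ∑ j, A z i j • Matrix.single i j (1 : ℝ) := by
      funext z
      conv_lhs => rw [Matrix.matrix_eq_sum_single (A z)]
      simp
    rw [this]
    exact ContDiffOn.sum fun i _ => ContDiffOn.sum fun j _ =>
      (h i j).smul contDiffOn_const

theorem _root_.ContDiffAt.matrix_entry {A : X → Mat n} (hA : ContDiffAt ℝ m A x) (i j : Fin n) :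
    ContDiffAt ℝ m (fun z => A z i j) x := contDiffAt_matrix.1 hA i j

theorem _root_.ContDiffAt.matrix_trace {A : X → Mat n} (hA : ContDiffAt ℝ m A x) :
    ContDiffAt ℝ m (fun z => (A z).trace) x :=
  (traceCLM n).contDiff.contDiffAt.comp x hA

theorem _root_.ContDiffAt.matrix_transpose {A : X → Mat n} (hA : ContDiffAt ℝ m A x) :
    ContDiffAt ℝ m (fun z => (A z).transpose) x :=
  (transposeCLM n).contDiff.contDiffAt.comp x hA

theorem _root_.ContDiffAt.matrix_inv {A : X → Mat n} (hA : ContDiffAt ℝ m A x) (h : IsUnit (A x)) :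
    ContDiffAt ℝ m (fun z => (A z)⁻¹) x := by
  simp_rw [Matrix.nonsing_inv_eq_ringInverse]
  obtain ⟨u, hu⟩ := h
  have := contDiffAt_ringInverse ℝ u (n := m)
  rw [hu] at this
  exact this.comp x hA

theorem contDiff_det : ContDiff ℝ m (fun A : Mat n => A.det) := by
  simp_rw [Matrix.det_apply]
  refine ContDiff.sum fun σ _ => ContDiff.const_smul _ ?_
  exact contDiff_prod fun i _ => (entryCLM (σ i) i).contDiff

theorem fderiv_det {A : Mat n} (hA : IsUnit A) (H : Mat n) :
    fderiv ℝ (fun A : Mat n => A.det) A H = A.det * (A⁻¹ * H).trace := by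
  have h1 : HasDerivAt (fun t : ℝ => (A + t • H).det)
      (fderiv ℝ (fun A : Mat n => A.det) A H) 0 := by
    have hd : HasFDerivAt (fun A : Mat n => A.det)
        (fderiv ℝ (fun A : Mat n => A.det) A) (A + (0 : ℝ) • H) := by
      rw [zero_smul, add_zero]
      exact ((contDiff_det (m := 1)).differentiable one_ne_zero A).hasFDerivAt
    have hl : HasDerivAt (fun t : ℝ => A + t • H) H 0 := by
      have := ((hasDerivAt_id (0 : ℝ)).smul_const H).const_add A
      rwa [one_smul] at this
    exact hd.comp_hasDerivAt 0 hl
  have h2 : HasDerivAt (fun t : ℝ => (A + t • H).det) (A.det * (A⁻¹ * H).trace) 0 := by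
    have e : ∀ t : ℝ, (A + t • H).det = A.det * (1 + t • (A⁻¹ * H)).det := by
      intro t
      rw [← Matrix.det_mul, mul_add, mul_one, Matrix.mul_smul, ← mul_assoc,
        Matrix.mul_nonsing_inv _ ((Matrix.isUnit_iff_isUnit_det A).1 hA), one_mul]
    simp_rw [e]
    refine HasDerivAt.const_mul _ ?_
    have hp : DifferentiableAt ℝ (fun t : ℝ => Polynomial.eval t
        ((Matrix.det (1 + (Polynomial.X : Polynomial ℝ) • (A⁻¹ * H).map Polynomial.C)).divX.divX)) 0 :=
      Polynomial.differentiableAt _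
    have h3 := ((((hasDerivAt_id (0 : ℝ)).const_mul (A⁻¹ * H).trace).const_add 1).add
      (hp.hasDerivAt.mul ((hasDerivAt_id (0 : ℝ)).pow 2)))
    refine (h3.congr_deriv (by simp)).congr_of_eventuallyEq (Eventually.of_forall fun t => ?_)
    exact Matrix.det_one_add_smul t (A⁻¹ * H)
  exact h1.unique h2

end General

variable {x : E n} {k : Fin n}

theorem contDiffAt_infty_differentiableAt {X Y : Type*} [NormedAddCommGroup X] [NormedSpace ℝ X]
    [NormedAddCommGroup Y] [NormedSpace ℝ Y] {f : X → Y} {x : X} (hf : ContDiffAt ℝ ∞ f x) :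
    DifferentiableAt ℝ f x := hf.differentiableAt (by simp)

theorem _root_.ContDiffAt.pd {f : E n → F} (hf : ContDiffAt ℝ ∞ f x) (k : Fin n) :
    ContDiffAt ℝ ∞ (HarmonicFlow.pd k f) x :=
  (hf.fderiv_right (m := ∞) (by simp)).clm_apply contDiffAt_const

theorem pd_clm {F' : Type*} [NormedAddCommGroup F'] [NormedSpace ℝ F'] (L : F →L[ℝ] F')
    {f : E n → F} (hf : DifferentiableAt ℝ f x) : pd k (fun z => L (f z)) x = L (pd k f x) := by
  have := (L.hasFDerivAt.comp x hf.hasFDerivAt).fderiv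
  rw [pd, show (fun z => L (f z)) = L ∘ f from rfl, this]
  rfl

theorem pd_entry {A : E n → Mat n} (hA : DifferentiableAt ℝ A x) (i j : Fin n) :
    pd k (fun z => A z i j) x = pd k A x i j := pd_clm (entryCLM i j) hA

theorem pd_trace {A : E n → Mat n} (hA : DifferentiableAt ℝ A x) :
    pd k (fun z => (A z).trace) x = (pd k A x).trace := pd_clm (traceCLM n) hA

theorem pd_transpose {A : E n → Mat n} (hA : DifferentiableAt ℝ A x) :
    pd k (fun z => (A z).transpose) x = (pd k A x).transpose := pd_clm (transposeCLM n) hA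

theorem pd_add {f g : E n → F} (hf : DifferentiableAt ℝ f x) (hg : DifferentiableAt ℝ g x) :
    pd k (fun z => f z + g z) x = pd k f x + pd k g x := by
  rw [pd, fderiv_fun_add hf hg]; rfl

theorem pd_sub {f g : E n → F} (hf : DifferentiableAt ℝ f x) (hg : DifferentiableAt ℝ g x) :
    pd k (fun z => f z - g z) x = pd k f x - pd k g x := by
  rw [pd, fderiv_fun_sub hf hg]; rfl

theorem pd_neg {f : E n → F} : pd k (fun z => -f z) x = -pd k f x := by
  rw [pd, fderiv_fun_neg]; rfl

theorem pd_const (c : F) : pd k (fun _ : E n => c) x = 0 := by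
  simp [pd]

theorem pd_congr {f g : E n → F} (h : f =ᶠ[𝓝 x] g) : pd k f x = pd k g x := by
  rw [pd, h.fderiv_eq]; rfl

theorem pd_mul {R : Type*} [NormedRing R] [NormedAlgebra ℝ R] {f g : E n → R}
    (hf : DifferentiableAt ℝ f x) (hg : DifferentiableAt ℝ g x) :
    pd k (fun z => f z * g z) x = pd k f x * g x + f x * pd k g x := by
  rw [pd, fderiv_fun_mul' hf hg]
  simp [pd, add_comm]

theorem pd_smul {c : E n → ℝ} {f : E n → F}
    (hc : DifferentiableAt ℝ c x) (hf : DifferentiableAt ℝ f x) :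
    pd k (fun z => c z • f z) x = pd k c x • f x + c x • pd k f x := by
  rw [pd, fderiv_fun_smul hc hf]
  simp [pd, add_comm]

theorem pd_sum {ι : Type*} {s : Finset ι} {f : ι → E n → F}
    (hf : ∀ i ∈ s, DifferentiableAt ℝ (f i) x) :
    pd k (fun z => ∑ i ∈ s, f i z) x = ∑ i ∈ s, pd k (f i) x := by
  rw [pd, fderiv_fun_sum hf]
  simp [pd]

theorem pd_const_mul {f : E n → ℝ} (c : ℝ) (hf : DifferentiableAt ℝ f x) :
    pd k (fun z => c * f z) x = c * pd k f x := by
  rw [pd_mul (differentiableAt_const c) hf, pd_const]; simp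

theorem pd_comm {f : E n → F} (hf : ContDiffAt ℝ ∞ f x) (i j : Fin n) :
    pd i (pd j f) x = pd j (pd i f) x := by
  have hs : IsSymmSndFDerivAt ℝ f x := hf.isSymmSndFDerivAt (by
    simpa using (WithTop.coe_le_coe.2 le_top : ((2 : ℕ∞) : ℕ∞ω) ≤ ((⊤ : ℕ∞) : ℕ∞ω)))
  have hd : DifferentiableAt ℝ (fderiv ℝ f) x :=
    contDiffAt_infty_differentiableAt (hf.fderiv_right (m := ∞) (by simp))
  have key : ∀ a b : Fin n, pd a (pd b f) x =
      fderiv ℝ (fderiv ℝ f) x (EuclideanSpace.single a 1) (EuclideanSpace.single b 1) := by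
    intro a b
    have := pd_clm (k := a) (x := x)
      (ContinuousLinearMap.apply ℝ F (EuclideanSpace.single b (1 : ℝ))) hd
    exact this
  rw [key, key, hs.eq]

theorem pd_coord (i k : Fin n) (x : E n) :
    pd k (fun z : E n => z i) x = if k = i then 1 else 0 := by
  have h : pd k (fun z : E n => z i) x
      = (EuclideanSpace.proj i : E n →L[ℝ] ℝ) (pd k (fun z : E n => z) x) :=
    pd_clm (EuclideanSpace.proj i : E n →L[ℝ] ℝ) (f := fun z : E n => z) differentiableAt_id
  rw [h]
  simp [pd, eq_comm]

end MatrixCalculus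

/-! ### The Levi-Civita connection in matrix form -/

section Connection

variable {n : ℕ} {G : E n → Mat n} {x : E n}

/-- `G` is a smooth field of positive definite symmetric matrices near `x`. -/
structure IsMetricAt (G : E n → Mat n) (x : E n) : Prop where
  smooth : ContDiffAt ℝ ∞ G x
  posDef : ∀ᶠ z in 𝓝 x, (G z).PosDef

namespace IsMetricAt

theorem self (h : IsMetricAt G x) : (G x).PosDef := h.posDef.self_of_nhds

theorem isUnit (h : IsMetricAt G x) : IsUnit (G x) := h.self.isUnit

theorem isUnit_det (h : IsMetricAt G x) : IsUnit (G x).det :=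
  (Matrix.isUnit_iff_isUnit_det _).1 h.isUnit

theorem transpose (h : IsMetricAt G x) : (G x).transpose = G x := by
  simpa [Matrix.IsHermitian] using h.self.isHermitian

theorem symm_eventually (h : IsMetricAt G x) (i j : Fin n) :
    (fun z => G z i j) =ᶠ[𝓝 x] fun z => G z j i := by
  filter_upwards [h.posDef] with z hz
  simpa using (hz.isHermitian.apply i j).symm

theorem mul_inv (h : IsMetricAt G x) : G x * (G x)⁻¹ = 1 := Matrix.mul_nonsing_inv _ h.isUnit_det
theorem inv_mul (h : IsMetricAt G x) : (G x)⁻¹ * G x = 1 := Matrix.nonsing_inv_mul _ h.isUnit_det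

theorem inv_transpose (h : IsMetricAt G x) : ((G x)⁻¹).transpose = (G x)⁻¹ := by
  rw [Matrix.transpose_nonsing_inv, h.transpose]

theorem inv_symm (h : IsMetricAt G x) (i j : Fin n) : (G x)⁻¹ i j = (G x)⁻¹ j i := by
  conv_lhs => rw [← h.inv_transpose]
  rfl

theorem smooth_inv (h : IsMetricAt G x) : ContDiffAt ℝ ∞ (fun z => (G z)⁻¹) x :=
  h.smooth.matrix_inv h.isUnit

theorem differentiableAt (h : IsMetricAt G x) : DifferentiableAt ℝ G x :=
  contDiffAt_infty_differentiableAt h.smooth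

theorem pd_symm (h : IsMetricAt G x) (k i j : Fin n) : pd k G x i j = pd k G x j i := by
  rw [← pd_entry h.differentiableAt, ← pd_entry h.differentiableAt]
  exact pd_congr (h.symm_eventually i j)

end IsMetricAt

/-- The matrix `Γ_k` of the connection, `(Γ_k)_α^β = Γ^β_{αk}`, so that
`∇_k ∂_α = ∑ β, (Γ_k)_α^β ∂_β`. -/
def conn (G : E n → Mat n) (k : Fin n) (x : E n) : Mat n :=
  Matrix.of fun a b => christoffel G x b a k

theorem conn_apply (k a b : Fin n) : conn G k x a b = christoffel G x b a k := rfl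

/-- The connection matrix with lowered upper index. -/
def connLow (G : E n → Mat n) (k : Fin n) (x : E n) : Mat n :=
  Matrix.of fun i j => (1 / 2 : ℝ) * (pd i G x k j + pd k G x i j - pd j G x i k)

theorem conn_eq (h : IsMetricAt G x) (k : Fin n) : conn G k x = connLow G k x * (G x)⁻¹ := by
  ext a b
  simp only [conn, connLow, christoffel, Matrix.of_apply, Matrix.mul_apply, Finset.mul_sum]
  refine Finset.sum_congr rfl fun l _ => ?_
  simp only [pderiv_eq_pd, pd_entry h.differentiableAt]
  rw [h.inv_symm b l]
  ring

theorem conn_mul (h : IsMetricAt G x) (k : Fin n) : conn G k x * G x = connLow G k x := by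
  rw [conn_eq h, mul_assoc, h.inv_mul, mul_one]

/-- The connection is torsion free. -/
theorem conn_symm (h : IsMetricAt G x) (k a b : Fin n) : conn G k x a b = conn G a x k b := by
  simp only [conn_apply, christoffel, pderiv_eq_pd, pd_entry h.differentiableAt]
  congr 1
  refine Finset.sum_congr rfl fun l _ => ?_
  rw [h.pd_symm l a k]
  ring

/-- The connection is metric: `∂_k G = Γ_k G + G Γ_kᵀ`. -/
theorem pd_metric (h : IsMetricAt G x) (k : Fin n) :
    pd k G x = conn G k x * G x + G x * (conn G k x).transpose := by
  have e : G x * (conn G k x).transpose = (conn G k x * G x).transpose := by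
    rw [Matrix.transpose_mul, h.transpose]
  rw [e, conn_mul h]
  ext i j
  simp only [connLow, Matrix.add_apply, Matrix.transpose_apply, Matrix.of_apply]
  rw [h.pd_symm j k i, h.pd_symm k j i, h.pd_symm i j k]
  ring

/-- The Levi-Civita connection is the only torsion free metric connection. -/
theorem conn_unique (h : IsMetricAt G x) {Γ : Fin n → Mat n}
    (hm : ∀ k, pd k G x = Γ k * G x + G x * (Γ k).transpose)
    (hs : ∀ k a b, Γ k a b = Γ a k b) (k : Fin n) : Γ k = conn G k x := by
  have e : ∀ k, G x * (Γ k).transpose = (Γ k * G x).transpose := fun k => by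
    rw [Matrix.transpose_mul, h.transpose]
  have hL : ∀ k i j, (Γ k * G x) i j = (Γ i * G x) k j := fun k i j => by
    simp only [Matrix.mul_apply, hs k i]
  have hm' : ∀ k i j, pd k G x i j = (Γ k * G x) i j + (Γ k * G x) j i := fun k i j => by
    rw [hm k, e]; rfl
  have : Γ k * G x = connLow G k x := by
    ext i j
    simp only [connLow, Matrix.of_apply, hm']
    rw [hL i k j, hL i j k, hL j k i]
    ring
  rw [conn_eq h, ← this, mul_assoc, h.mul_inv, mul_one]

theorem pd_metric_inv (h : IsMetricAt G x) (k : Fin n) :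
    pd k (fun z => (G z)⁻¹) x
      = -((conn G k x).transpose * (G x)⁻¹ + (G x)⁻¹ * conn G k x) := by
  have h1 : pd k (fun z => G z * (G z)⁻¹) x = 0 := by
    rw [pd_congr (g := fun _ => (1 : Mat n)), pd_const]
    filter_upwards [h.posDef] with z hz
    exact Matrix.mul_nonsing_inv _ ((Matrix.isUnit_iff_isUnit_det _).1 hz.isUnit)
  rw [pd_mul h.differentiableAt (contDiffAt_infty_differentiableAt h.smooth_inv),
    pd_metric h] at h1
  have h2 := congrArg (fun B => (G x)⁻¹ * B) h1
  simp only [mul_add, add_mul, mul_zero] at h2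
  have e1 : (G x)⁻¹ * (conn G k x * G x * (G x)⁻¹) = (G x)⁻¹ * conn G k x := by
    rw [mul_assoc (conn G k x), h.mul_inv, mul_one]
  have e2 : (G x)⁻¹ * (G x * (conn G k x).transpose * (G x)⁻¹)
      = (conn G k x).transpose * (G x)⁻¹ := by
    rw [← mul_assoc, ← mul_assoc, h.inv_mul, one_mul]
  have e3 : (G x)⁻¹ * (G x * pd k (fun z => (G z)⁻¹) x) = pd k (fun z => (G z)⁻¹) x := by
    rw [← mul_assoc, h.inv_mul, one_mul]
  rw [e1, e2, e3] at h2
  rw [eq_neg_iff_add_eq_zero, ← h2]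
  abel

/-- The volume density `√|g|`. -/
def vol (G : E n → Mat n) (x : E n) : ℝ := Real.sqrt (G x).det

theorem IsMetricAt.vol_pos (h : IsMetricAt G x) : 0 < vol G x := Real.sqrt_pos.2 h.self.det_pos

theorem IsMetricAt.smooth_vol (h : IsMetricAt G x) : ContDiffAt ℝ ∞ (vol G) x :=
  (contDiff_det.contDiffAt.comp x h.smooth).sqrt h.self.det_pos.ne'

theorem pd_vol (h : IsMetricAt G x) (k : Fin n) :
    pd k (vol G) x = vol G x * (conn G k x).trace := by
  have hdet : HasFDerivAt (fun z => (G z).det)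
      ((fderiv ℝ (fun A : Mat n => A.det) (G x)).comp (fderiv ℝ G x)) x :=
    HasFDerivAt.comp x ((contDiff_det (m := 1)).differentiable one_ne_zero _).hasFDerivAt
      h.differentiableAt.hasFDerivAt
  have hs := (hdet.sqrt h.self.det_pos.ne').fderiv
  have hv := h.vol_pos
  have hsq : vol G x * vol G x = (G x).det := Real.mul_self_sqrt h.self.det_pos.le
  have htr : ((G x)⁻¹ * pd k G x).trace = 2 * (conn G k x).trace := by
    rw [pd_metric h, mul_add, Matrix.trace_add, ← mul_assoc, ← mul_assoc, h.inv_mul, one_mul,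
      Matrix.trace_transpose, Matrix.trace_mul_comm, ← mul_assoc, h.mul_inv, one_mul]
    ring
  calc pd k (vol G) x
      = (1 / (2 * vol G x)) * fderiv ℝ (fun A : Mat n => A.det) (G x) (pd k G x) := by
        rw [pd, show vol G = fun z => Real.sqrt (G z).det from rfl, hs]
        rfl
    _ = _ := by
        rw [fderiv_det h.isUnit, htr, ← hsq]
        field_simp

theorem IsMetricAt.smooth_christoffel (h : IsMetricAt G x) (k i j : Fin n) :
    ContDiffAt ℝ ∞ (fun z => christoffel G z k i j) x := by
  have hp : ∀ a b c : Fin n, ContDiffAt ℝ ∞ (fun z => pderiv a (fun z => G z b c) z) x :=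
    fun a b c => (h.smooth.matrix_entry b c).pd a
  refine contDiffAt_const.mul (ContDiffAt.sum fun l _ => ?_)
  exact (h.smooth_inv.matrix_entry k l).mul (((hp i j l).add (hp j i l)).sub (hp l i j))

theorem IsMetricAt.smooth_conn (h : IsMetricAt G x) (k : Fin n) :
    ContDiffAt ℝ ∞ (conn G k) x :=
  contDiffAt_matrix.2 fun a b => h.smooth_christoffel b a k

/-! ### Covariant differentiation of endomorphism fields -/

/-- The covariant derivative `∇_k A = ∂_k A + A Γ_k - Γ_k A` of a field of endomorphisms. -/
def cov (G : E n → Mat n) (k : Fin n) (A : E n → Mat n) (x : E n) : Mat n :=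
  pd k A x + A x * conn G k x - conn G k x * A x

theorem covDeriv_eq_cov {A : E n → Mat n} (hA : DifferentiableAt ℝ A x) (k α β : Fin n) :
    covDeriv G A x k α β = cov G k A x α β := by
  simp only [covDeriv, cov, Matrix.add_apply, Matrix.sub_apply, Matrix.mul_apply, conn_apply,
    pderiv_eq_pd, pd_entry hA]
  congr 2
  exact Finset.sum_congr rfl fun l _ => mul_comm _ _

theorem _root_.ContDiffAt.cov {A : E n → Mat n} (h : IsMetricAt G x) (hA : ContDiffAt ℝ ∞ A x)
    (k : Fin n) : ContDiffAt ℝ ∞ (HarmonicFlow.cov G k A) x :=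
  ((hA.pd k).add (hA.mul (h.smooth_conn k))).sub ((h.smooth_conn k).mul hA)

theorem cov_congr {A B : E n → Mat n} {k : Fin n} (h : A =ᶠ[𝓝 x] B) :
    cov G k A x = cov G k B x := by
  rw [cov, cov, pd_congr h, h.self_of_nhds]

section
variable {A B : E n → Mat n} {k : Fin n}

theorem cov_add (hA : DifferentiableAt ℝ A x) (hB : DifferentiableAt ℝ B x) :
    cov G k (fun z => A z + B z) x = cov G k A x + cov G k B x := by
  simp only [cov, pd_add hA hB]; noncomm_ring

theorem cov_const_one : cov G k (fun _ => (1 : Mat n)) x = 0 := by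
  simp [cov, pd_const]

theorem cov_mul (hA : DifferentiableAt ℝ A x) (hB : DifferentiableAt ℝ B x) :
    cov G k (fun z => A z * B z) x = cov G k A x * B x + A x * cov G k B x := by
  simp only [cov, pd_mul hA hB]; noncomm_ring

theorem cov_smul {c : E n → ℝ} (hc : DifferentiableAt ℝ c x) (hA : DifferentiableAt ℝ A x) :
    cov G k (fun z => c z • A z) x = pd k c x • A x + c x • cov G k A x := by
  simp only [cov, pd_smul hc hA, smul_mul_assoc, mul_smul_comm, smul_sub, smul_add]
  abel

theorem cov_neg : cov G k (fun z => -A z) x = -cov G k A x := by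
  simp only [cov, pd_neg]; noncomm_ring

theorem cov_sum {ι : Type*} {s : Finset ι} {A : ι → E n → Mat n}
    (hA : ∀ i ∈ s, DifferentiableAt ℝ (A i) x) :
    cov G k (fun z => ∑ i ∈ s, A i z) x = ∑ i ∈ s, cov G k (A i) x := by
  simp only [cov, pd_sum hA, Finset.sum_mul, Finset.mul_sum, Finset.sum_add_distrib,
    Finset.sum_sub_distrib]

theorem pd_trace_cov (hA : DifferentiableAt ℝ A x) :
    pd k (fun z => (A z).trace) x = (cov G k A x).trace := by
  rw [pd_trace hA, cov, Matrix.trace_sub, Matrix.trace_add, Matrix.trace_mul_comm (A x)]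
  ring

theorem pd_trace_mul (hA : DifferentiableAt ℝ A x) (hB : DifferentiableAt ℝ B x) :
    pd k (fun z => (A z * B z).trace) x
      = (cov G k A x * B x).trace + (A x * cov G k B x).trace := by
  rw [pd_trace_cov (G := G) (hA.fun_mul hB), cov_mul hA hB, Matrix.trace_add]

/-- The pointwise adjoint `G Aᵀ G⁻¹` of an endomorphism with respect to the metric `G`. -/
def adj (G A : Mat n) : Mat n := G * A.transpose * G⁻¹

theorem cov_adj (h : IsMetricAt G x) (hA : DifferentiableAt ℝ A x) :
    cov G k (fun z => adj (G z) (A z)) x = adj (G x) (cov G k A x) := by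
  have hAt : DifferentiableAt ℝ (fun z => (A z).transpose) x :=
    (transposeCLM n).differentiableAt.comp x hA
  have e1 : pd k (fun z => adj (G z) (A z)) x
      = (pd k G x * (A x).transpose + G x * (pd k A x).transpose) * (G x)⁻¹
        + G x * (A x).transpose * pd k (fun z => (G z)⁻¹) x := by
    rw [show (fun z => adj (G z) (A z)) = fun z => G z * (A z).transpose * (G z)⁻¹ from rfl,
      pd_mul (h.differentiableAt.fun_mul hAt) (contDiffAt_infty_differentiableAt h.smooth_inv),
      pd_mul h.differentiableAt hAt, pd_transpose hA]
  rw [cov, e1, pd_metric h, pd_metric_inv h]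
  simp only [adj, cov, Matrix.transpose_add, Matrix.transpose_sub, Matrix.transpose_mul]
  noncomm_ring

/-- The commutator `[∇_p, ∇_r] A = [A, F_{pr}]`. -/
def curv (G : E n → Mat n) (p r : Fin n) (x : E n) : Mat n :=
  pd p (conn G r) x - pd r (conn G p) x + conn G r x * conn G p x - conn G p x * conn G r x

theorem cov_comm (h : IsMetricAt G x) (hA : ContDiffAt ℝ ∞ A x) (p r : Fin n) :
    cov G p (cov G r A) x = cov G r (cov G p A) x + (A x * curv G p r x - curv G p r x * A x) := by
  have hd := contDiffAt_infty_differentiableAt hA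
  have hp : ∀ k, DifferentiableAt ℝ (pd k A) x := fun k =>
    contDiffAt_infty_differentiableAt (hA.pd k)
  have hc : ∀ k, DifferentiableAt ℝ (conn G k) x := fun k =>
    contDiffAt_infty_differentiableAt (h.smooth_conn k)
  have e : ∀ a b, pd a (cov G b A) x = pd a (pd b A) x
      + (pd a A x * conn G b x + A x * pd a (conn G b) x)
      - (pd a (conn G b) x * A x + conn G b x * pd a A x) := by
    intro a b
    rw [show cov G b A = fun z => pd b A z + A z * conn G b z - conn G b z * A z from rfl,
      pd_sub ((hp b).fun_add (hd.fun_mul (hc b))) ((hc b).fun_mul hd),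
      pd_add (hp b) (hd.fun_mul (hc b)),
      pd_mul hd (hc b), pd_mul (hc b) hd]
  have c : ∀ (a : Fin n) (B : E n → Mat n),
      cov G a B x = pd a B x + B x * conn G a x - conn G a x * B x := fun _ _ => rfl
  rw [c p, c r (cov G p A), e, e, pd_comm hA p r]
  simp only [c, curv]
  noncomm_ring

end

/-- The rough Laplacian in matrix form. -/
def lap (G : E n → Mat n) (A : E n → Mat n) (x : E n) : Mat n :=
  ∑ p, ∑ q, (G x)⁻¹ p q • (cov G q (cov G p A) x - ∑ l, conn G q x p l • cov G l A x)

/-- The contraction `g^{pq} ∇_p A ∇_q B`. -/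
def gradProd (G : E n → Mat n) (A B : E n → Mat n) (x : E n) : Mat n :=
  ∑ p, ∑ q, (G x)⁻¹ p q • (cov G p A x * cov G q B x)

theorem roughLaplacian_eq_lap {A : E n → Mat n} (h : ∀ᶠ z in 𝓝 x, IsMetricAt G z)
    (hA : ∀ᶠ z in 𝓝 x, ContDiffAt ℝ ∞ A z) (α β : Fin n) :
    roughLaplacian G A x α β = lap G A x α β := by
  have hA0 := hA.self_of_nhds
  have hd := contDiffAt_infty_differentiableAt hA0
  have h2 : ∀ p q, pd q (fun z => covDeriv G A z p α β) x = pd q (cov G p A) x α β := by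
    intro p q
    rw [← pd_entry (contDiffAt_infty_differentiableAt (hA0.cov h.self_of_nhds p))]
    refine pd_congr ?_
    filter_upwards [hA] with z hz
    exact covDeriv_eq_cov (contDiffAt_infty_differentiableAt hz) _ _ _
  simp only [roughLaplacian, lap, Matrix.sum_apply, Matrix.smul_apply, smul_eq_mul]
  refine Finset.sum_congr rfl fun p _ => Finset.sum_congr rfl fun q _ => ?_
  congr 1
  simp only [covDeriv₂, pderiv_eq_pd, h2, covDeriv_eq_cov hd]
  conv_rhs => rw [Matrix.sub_apply, cov]
  simp only [Matrix.sub_apply, Matrix.add_apply, Matrix.mul_apply, conn_apply, Matrix.sum_apply,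
    Matrix.smul_apply, smul_eq_mul]
  have : ∀ l, christoffel G x β l q * cov G p A x α l = cov G p A x α l * christoffel G x β l q :=
    fun l => mul_comm _ _
  simp only [this]
  ring

theorem quadraticTerm_eq {A : E n → Mat n} (hA : DifferentiableAt ℝ A x) (α β : Fin n) :
    quadraticTerm G A x α β = (A x * gradProd G A A x) α β := by
  simp only [quadraticTerm, gradProd, Finset.mul_sum, Matrix.sum_apply, covDeriv_eq_cov hA,
    mul_smul_comm, Matrix.smul_apply, smul_eq_mul]
  refine Finset.sum_congr rfl fun p _ => Finset.sum_congr rfl fun q _ => ?_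
  rw [← mul_assoc, Matrix.mul_apply, Finset.mul_sum, Finset.sum_comm]
  refine Finset.sum_congr rfl fun b _ => ?_
  rw [Matrix.mul_apply, Finset.sum_mul, Finset.mul_sum]
  refine Finset.sum_congr rfl fun a _ => ?_
  ring

/-- The inner product `⟨A, B⟩ = g^{αγ} g_{βδ} A_α^β B_γ^δ` of endomorphisms. -/
def inn (G A B : Mat n) : ℝ := (A * adj G B).trace

theorem gradNormSq_eq {A : E n → Mat n} (h : IsMetricAt G x) (hA : DifferentiableAt ℝ A x) :
    gradNormSq G A x = ∑ p, ∑ q, (G x)⁻¹ p q * inn (G x) (cov G p A x) (cov G q A x) := by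
  have hsum : ∀ C D : Mat n, inn (G x) C D
      = ∑ i₁, ∑ i₂, ∑ j₁, ∑ j₂, G x i₁ i₂ * (G x)⁻¹ j₁ j₂ * C j₁ i₁ * D j₂ i₂ := by
    intro C D
    simp only [inn, adj, Matrix.trace, Matrix.diag_apply, Matrix.mul_apply, Matrix.transpose_apply,
      Finset.mul_sum, Finset.sum_mul]
    rw [Finset.sum_comm]
    refine Finset.sum_congr rfl fun i₁ _ => ?_
    conv_rhs => rw [Finset.sum_comm]
    refine Finset.sum_congr rfl fun j₁ _ => ?_
    rw [Finset.sum_comm]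
    refine Finset.sum_congr rfl fun i₂ _ => Finset.sum_congr rfl fun j₂ _ => ?_
    rw [h.inv_symm j₂ j₁]
    ring
  simp only [gradNormSq, hsum, covDeriv_eq_cov hA, Finset.mul_sum]
  have r1 : ∀ f : Fin n → Fin n → Fin n → ℝ,
      ∑ a, ∑ b, ∑ c, f a b c = ∑ b, ∑ c, ∑ a, f a b c := by
    intro f
    rw [Finset.sum_comm]
    exact Finset.sum_congr rfl fun b _ => Finset.sum_comm
  have r2 : ∀ f : Fin n → Fin n → Fin n → Fin n → Fin n → ℝ,
      ∑ a, ∑ b, ∑ c, ∑ d, ∑ e, f a b c d e = ∑ d, ∑ e, ∑ a, ∑ b, ∑ c, f a b c d e := by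
    intro f
    have : ∀ a, ∑ b, ∑ c, ∑ d, ∑ e, f a b c d e = ∑ d, ∑ e, ∑ b, ∑ c, f a b c d e := by
      intro a
      have : ∀ b, ∑ c, ∑ d, ∑ e, f a b c d e = ∑ d, ∑ e, ∑ c, f a b c d e := fun b => r1 _
      simp only [this, r1 (fun b d e => ∑ c, f a b c d e)]
    simp only [this, r1 (fun a d e => ∑ b, ∑ c, f a b c d e)]
  have r3 : ∀ f : Fin n → Fin n → Fin n → Fin n → Fin n → Fin n → ℝ,
      ∑ a, ∑ b, ∑ c, ∑ d, ∑ e, ∑ k, f a b c d e k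
        = ∑ e, ∑ k, ∑ a, ∑ b, ∑ c, ∑ d, f a b c d e k := by
    intro f
    have : ∀ a, ∑ b, ∑ c, ∑ d, ∑ e, ∑ k, f a b c d e k
        = ∑ e, ∑ k, ∑ b, ∑ c, ∑ d, f a b c d e k := fun a => r2 _
    simp only [this, r1 (fun a e k => ∑ b, ∑ c, ∑ d, f a b c d e k)]
  rw [r3]
  refine Finset.sum_congr rfl fun p _ => Finset.sum_congr rfl fun q _ =>
    Finset.sum_congr rfl fun i₁ _ => Finset.sum_congr rfl fun i₂ _ =>
    Finset.sum_congr rfl fun j₁ _ => Finset.sum_congr rfl fun j₂ _ => ?_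
  ring

end Connection

/-! ### Divergence identities -/

section Divergence

variable {n : ℕ} {G : E n → Mat n} {x : E n}

/-- The divergence of a covector field `η`, multiplied by the volume density:
`∂_p (√|g| g^{pq} η_q)`. -/
def divDensity (G : E n → Mat n) (η : Fin n → E n → ℝ) (x : E n) : ℝ :=
  ∑ p, pd p (fun z => ∑ q, vol G z * (G z)⁻¹ p q * η q z) x

theorem divDensity_eq (h : IsMetricAt G x) {η : Fin n → E n → ℝ}
    (hη : ∀ q, DifferentiableAt ℝ (η q) x) :
    divDensity G η x = vol G x * ∑ p, ∑ q, (G x)⁻¹ p q *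
      (pd p (η q) x - ∑ l, conn G q x p l * η l x) := by
  have hv := contDiffAt_infty_differentiableAt h.smooth_vol
  have hi := contDiffAt_infty_differentiableAt h.smooth_inv
  have hie : ∀ p q, DifferentiableAt ℝ (fun z => (G z)⁻¹ p q) x := fun p q =>
    contDiffAt_infty_differentiableAt (h.smooth_inv.matrix_entry p q)
  have e1 : ∀ p q, pd p (fun z => vol G z * (G z)⁻¹ p q * η q z) x
      = vol G x * ((conn G p x).trace * (G x)⁻¹ p q * η q x
        - ((conn G p x).transpose * (G x)⁻¹) p q * η q x
        - ((G x)⁻¹ * conn G p x) p q * η q x + (G x)⁻¹ p q * pd p (η q) x) := by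
    intro p q
    rw [pd_mul (hv.fun_mul (hie p q)) (hη q), pd_mul hv (hie p q), pd_vol h, pd_entry hi,
      pd_metric_inv h]
    simp only [Matrix.neg_apply, Matrix.add_apply]
    ring
  have e2 : ∀ q, ∑ p, ((conn G p x).transpose * (G x)⁻¹) p q
      = ∑ p, (conn G p x).trace * (G x)⁻¹ p q := by
    intro q
    simp only [Matrix.mul_apply, Matrix.transpose_apply, Matrix.trace, Matrix.diag_apply,
      Finset.sum_mul]
    rw [Finset.sum_comm]
    refine Finset.sum_congr rfl fun a _ => Finset.sum_congr rfl fun p _ => ?_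
    rw [conn_symm h p a p]
  have e3 : ∑ p, ∑ q, ((G x)⁻¹ * conn G p x) p q * η q x
      = ∑ p, ∑ q, (G x)⁻¹ p q * ∑ l, conn G q x p l * η l x := by
    simp only [Matrix.mul_apply, Finset.sum_mul, Finset.mul_sum]
    refine Finset.sum_congr rfl fun p _ => ?_
    rw [Finset.sum_comm]
    refine Finset.sum_congr rfl fun a _ => Finset.sum_congr rfl fun q _ => ?_
    rw [conn_symm h p a q]
    ring
  have e4 : ∑ p, ∑ q, ((conn G p x).transpose * (G x)⁻¹) p q * η q x
      = ∑ p, ∑ q, (conn G p x).trace * (G x)⁻¹ p q * η q x := by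
    rw [Finset.sum_comm, Finset.sum_comm (f := fun p q => (conn G p x).trace * (G x)⁻¹ p q * η q x)]
    simp only [← Finset.sum_mul, e2]
  have e5 : divDensity G η x = ∑ p, ∑ q, pd p (fun z => vol G z * (G z)⁻¹ p q * η q z) x :=
    Finset.sum_congr rfl fun p _ => pd_sum fun q _ => (hv.fun_mul (hie p q)).fun_mul (hη q)
  rw [e5]
  simp only [e1, ← Finset.mul_sum, mul_sub, Finset.sum_add_distrib, Finset.sum_sub_distrib]
  rw [e3, e4]
  ring

theorem trace_lap (h : IsMetricAt G x) (A : E n → Mat n) (B : Mat n) :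
    (B * lap G A x).trace = ∑ p, ∑ q, (G x)⁻¹ p q *
      ((B * cov G p (cov G q A) x).trace - ∑ l, conn G q x p l * (B * cov G l A x).trace) := by
  have e : (B * lap G A x).trace = ∑ p, ∑ q, (G x)⁻¹ p q *
      ((B * cov G q (cov G p A) x).trace - ∑ l, conn G q x p l * (B * cov G l A x).trace) := by
    rw [lap, Finset.mul_sum, Matrix.trace_sum]
    refine Finset.sum_congr rfl fun p _ => ?_
    rw [Finset.mul_sum, Matrix.trace_sum]
    refine Finset.sum_congr rfl fun q _ => ?_
    rw [mul_smul_comm, Matrix.trace_smul, mul_sub, Matrix.trace_sub, Finset.mul_sum,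
      Matrix.trace_sum, smul_eq_mul]
    simp only [mul_smul_comm, Matrix.trace_smul, smul_eq_mul]
  rw [e, Finset.sum_comm]
  refine Finset.sum_congr rfl fun p _ => Finset.sum_congr rfl fun q _ => ?_
  rw [h.inv_symm]
  simp only [conn_symm h p q]

/-- Green's identity in divergence form. -/
theorem divDensity_trace (h : IsMetricAt G x) {A B : E n → Mat n} (hA : ContDiffAt ℝ ∞ A x)
    (hB : ContDiffAt ℝ ∞ B x) :
    divDensity G (fun q z => (B z * cov G q A z).trace) x
      = vol G x * ((∑ p, ∑ q, (G x)⁻¹ p q * (cov G p B x * cov G q A x).trace)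
        + (B x * lap G A x).trace) := by
  have hB' := contDiffAt_infty_differentiableAt hB
  have hP : ∀ q, DifferentiableAt ℝ (cov G q A) x := fun q =>
    contDiffAt_infty_differentiableAt (hA.cov h q)
  rw [divDensity_eq h fun q => contDiffAt_infty_differentiableAt (hB.mul (hA.cov h q)).matrix_trace,
    trace_lap h]
  congr 1
  simp only [← Finset.sum_add_distrib]
  refine Finset.sum_congr rfl fun p _ => Finset.sum_congr rfl fun q _ => ?_
  rw [pd_trace_mul hB' (hP q) (G := G)]
  ring

theorem divDensity_mul (h : IsMetricAt G x) {w : E n → ℝ} {η : Fin n → E n → ℝ}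
    (hw : DifferentiableAt ℝ w x) (hη : ∀ q, DifferentiableAt ℝ (η q) x) :
    divDensity G (fun q z => w z * η q z) x = w x * divDensity G η x
      + vol G x * ∑ p, ∑ q, (G x)⁻¹ p q * pd p w x * η q x := by
  rw [divDensity_eq h fun q => hw.fun_mul (hη q), divDensity_eq h hη]
  simp only [pd_mul hw (hη _), Finset.mul_sum, ← Finset.sum_add_distrib]
  refine Finset.sum_congr rfl fun p _ => Finset.sum_congr rfl fun q _ => ?_
  simp only [mul_sub, mul_add, Finset.mul_sum]
  have : ∀ l, vol G x * ((G x)⁻¹ p q * (conn G q x p l * (w x * η l x)))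
    = w x * (vol G x * ((G x)⁻¹ p q * (conn G q x p l * η l x))) := fun l => by ring
  simp only [this]
  ring

/-- The contraction `g^{pq} tr (∇_p A ∇_q A)`. For a compatible almost complex structure this is
`-|∇A|²`. -/
def trEnergy (G A : E n → Mat n) (x : E n) : ℝ :=
  ∑ p, ∑ q, (G x)⁻¹ p q * (cov G p A x * cov G q A x).trace

/-- The derivative `∇_X A` in the direction of the position vector field `X = x^r ∂_r`. -/
def radialCov (G A : E n → Mat n) (x : E n) : Mat n := ∑ r, x r • cov G r A x

/-- The error terms in the stress-energy identity for the position vector field. -/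
def stressError (G A : E n → Mat n) (x : E n) : ℝ :=
  ∑ r, x r * ((∑ p, ∑ q, ((G x)⁻¹ * conn G r x) p q * (cov G p A x * cov G q A x).trace)
    - (1 / 2) * (conn G r x).trace * trEnergy G A x
    + ∑ p, ∑ q, (G x)⁻¹ p q *
        (cov G q A x * (A x * curv G p r x - curv G p r x * A x)).trace)

theorem smooth_trEnergy (h : IsMetricAt G x) {A : E n → Mat n} (hA : ContDiffAt ℝ ∞ A x) :
    ContDiffAt ℝ ∞ (trEnergy G A) x :=
  ContDiffAt.sum fun p _ => ContDiffAt.sum fun q _ =>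
    (h.smooth_inv.matrix_entry p q).mul ((hA.cov h p).mul (hA.cov h q)).matrix_trace

theorem pd_trEnergy (h : IsMetricAt G x) {A : E n → Mat n} (hA : ContDiffAt ℝ ∞ A x) (r : Fin n) :
    pd r (trEnergy G A) x
      = 2 * (∑ p, ∑ q, (G x)⁻¹ p q * (cov G q A x * cov G r (cov G p A) x).trace)
        - 2 * ∑ p, ∑ q, ((G x)⁻¹ * conn G r x) p q * (cov G p A x * cov G q A x).trace := by
  have hi := contDiffAt_infty_differentiableAt h.smooth_inv
  have hie : ∀ p q, DifferentiableAt ℝ (fun z => (G z)⁻¹ p q) x := fun p q =>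
    contDiffAt_infty_differentiableAt (h.smooth_inv.matrix_entry p q)
  have hP : ∀ q, DifferentiableAt ℝ (cov G q A) x := fun q =>
    contDiffAt_infty_differentiableAt (hA.cov h q)
  have hT : ∀ p q, DifferentiableAt ℝ (fun z => (cov G p A z * cov G q A z).trace) x :=
    fun p q => contDiffAt_infty_differentiableAt ((hA.cov h p).mul (hA.cov h q)).matrix_trace
  have e0 : pd r (trEnergy G A) x = ∑ p, ∑ q,
      pd r (fun z => (G z)⁻¹ p q * (cov G p A z * cov G q A z).trace) x := by
    rw [show trEnergy G A = fun z => ∑ p, ∑ q, (G z)⁻¹ p q * (cov G p A z * cov G q A z).trace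
      from rfl, pd_sum fun p _ => DifferentiableAt.fun_sum fun q _ => (hie p q).fun_mul (hT p q)]
    exact Finset.sum_congr rfl fun p _ => pd_sum fun q _ => (hie p q).fun_mul (hT p q)
  have e1 : ∀ p q, pd r (fun z => (G z)⁻¹ p q * (cov G p A z * cov G q A z).trace) x
      = -(((conn G r x).transpose * (G x)⁻¹) p q * (cov G p A x * cov G q A x).trace)
        - ((G x)⁻¹ * conn G r x) p q * (cov G p A x * cov G q A x).trace
        + (G x)⁻¹ p q * (cov G q A x * cov G r (cov G p A) x).trace
        + (G x)⁻¹ p q * (cov G p A x * cov G r (cov G q A) x).trace := by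
    intro p q
    rw [pd_mul (hie p q) (hT p q), pd_entry hi, pd_metric_inv h,
      pd_trace_mul (hP p) (hP q) (G := G),
      Matrix.trace_mul_comm (cov G r (cov G p A) x)]
    simp only [Matrix.neg_apply, Matrix.add_apply]
    ring
  have e2 : ∑ p, ∑ q, ((conn G r x).transpose * (G x)⁻¹) p q * (cov G p A x * cov G q A x).trace
      = ∑ p, ∑ q, ((G x)⁻¹ * conn G r x) p q * (cov G p A x * cov G q A x).trace := by
    rw [Finset.sum_comm]
    refine Finset.sum_congr rfl fun p _ => Finset.sum_congr rfl fun q _ => ?_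
    have : (conn G r x).transpose * (G x)⁻¹ = ((G x)⁻¹ * conn G r x).transpose := by
      rw [Matrix.transpose_mul, h.inv_transpose]
    rw [this, Matrix.transpose_apply, Matrix.trace_mul_comm]
  have e3 : ∑ p, ∑ q, (G x)⁻¹ p q * (cov G p A x * cov G r (cov G q A) x).trace
      = ∑ p, ∑ q, (G x)⁻¹ p q * (cov G q A x * cov G r (cov G p A) x).trace := by
    rw [Finset.sum_comm]
    refine Finset.sum_congr rfl fun p _ => Finset.sum_congr rfl fun q _ => ?_
    rw [h.inv_symm]
  rw [e0]
  simp only [e1, Finset.sum_add_distrib, Finset.sum_sub_distrib, Finset.sum_neg_distrib]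
  rw [e2, e3]
  ring

/-- The stress-energy (Pohozaev) identity for the position vector field, weighted by `w`. -/
theorem stress_identity (h : IsMetricAt G x) {A : E n → Mat n} (hA : ContDiffAt ℝ ∞ A x)
    {w : E n → ℝ} (hw : DifferentiableAt ℝ w x) :
    divDensity G (fun q z => w z * (cov G q A z * radialCov G A z).trace) x
      - (1 / 2) * ∑ r, pd r (fun z => vol G z * (w z * (z r * trEnergy G A z))) x
      = vol G x * ((∑ p, ∑ q, (G x)⁻¹ p q * pd p w x * (cov G q A x * radialCov G A x).trace)
        - (1 / 2) * (∑ r, x r * pd r w x) * trEnergy G A x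
        + w x * ((radialCov G A x * lap G A x).trace + (1 - n / 2) * trEnergy G A x
          + stressError G A x)) := by
  have hP : ∀ q, DifferentiableAt ℝ (cov G q A) x := fun q =>
    contDiffAt_infty_differentiableAt (hA.cov h q)
  have hcoord : ∀ r : Fin n, DifferentiableAt ℝ (fun z : E n => z r) x := fun r =>
    (EuclideanSpace.proj r : E n →L[ℝ] ℝ).differentiableAt
  have hX : ContDiffAt ℝ ∞ (radialCov G A) x :=
    ContDiffAt.sum fun r _ => ((EuclideanSpace.proj r : E n →L[ℝ] ℝ).contDiff.contDiffAt).smul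
      (hA.cov h r)
  have hXd := contDiffAt_infty_differentiableAt hX
  have hv := contDiffAt_infty_differentiableAt h.smooth_vol
  have hE := contDiffAt_infty_differentiableAt (smooth_trEnergy h hA)
  have hcomm : (fun (q : Fin n) (z : E n) => w z * (cov G q A z * radialCov G A z).trace)
      = fun q z => w z * (radialCov G A z * cov G q A z).trace := by
    funext q z; rw [Matrix.trace_mul_comm]
  -- `cov` acts on the endomorphism indices only, so by the product rule the derivative of
  -- `∇_X A = x^r ∇_r A` is `∇_p A + x^r ∇_p (∇_r A)`.
  have hcovX : ∀ p, cov G p (radialCov G A) x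
      = cov G p A x + ∑ r, x r • cov G p (cov G r A) x := by
    intro p
    rw [show radialCov G A = fun z => ∑ r, z r • cov G r A z from rfl,
      cov_sum fun r _ => (hcoord r).fun_smul (hP r)]
    simp only [cov_smul (hcoord _) (hP _), pd_coord, Finset.sum_add_distrib]
    simp
  -- The first divergence, by Green. The commutator `cov_comm` replaces `∇_p ∇_r A` by `∇_r ∇_p A`,
  -- whose trace against `∇_q A` is half a derivative of `trEnergy` up to Christoffel terms, at the
  -- cost of a curvature term.
  have e1 : divDensity G (fun q z => w z * (cov G q A z * radialCov G A z).trace) x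
      = w x * (vol G x * ((trEnergy G A x
          + ∑ r, x r * ((∑ p, ∑ q, (G x)⁻¹ p q * (cov G q A x * cov G r (cov G p A) x).trace)
            + ∑ p, ∑ q, (G x)⁻¹ p q *
              (cov G q A x * (A x * curv G p r x - curv G p r x * A x)).trace))
        + (radialCov G A x * lap G A x).trace))
        + vol G x * ∑ p, ∑ q, (G x)⁻¹ p q * pd p w x * (cov G q A x * radialCov G A x).trace := by
    rw [hcomm, divDensity_mul h hw fun q => contDiffAt_infty_differentiableAt
      (hX.mul (hA.cov h q)).matrix_trace, divDensity_trace h hA hX]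
    have a1 : ∑ p, ∑ q, (G x)⁻¹ p q * (cov G p (radialCov G A) x * cov G q A x).trace
        = trEnergy G A x
          + ∑ r, x r * ((∑ p, ∑ q, (G x)⁻¹ p q * (cov G q A x * cov G r (cov G p A) x).trace)
            + ∑ p, ∑ q, (G x)⁻¹ p q *
              (cov G q A x * (A x * curv G p r x - curv G p r x * A x)).trace) := by
      have b1 : ∀ p q, (G x)⁻¹ p q * (cov G p (radialCov G A) x * cov G q A x).trace
          = (G x)⁻¹ p q * (cov G p A x * cov G q A x).trace
            + ∑ r, x r * ((G x)⁻¹ p q * (cov G q A x * cov G p (cov G r A) x).trace) := by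
        intro p q
        rw [hcovX, add_mul, Matrix.trace_add, mul_add, Finset.sum_mul, Matrix.trace_sum,
          Finset.mul_sum]
        congr 1
        refine Finset.sum_congr rfl fun r _ => ?_
        rw [smul_mul_assoc, Matrix.trace_smul, Matrix.trace_mul_comm, smul_eq_mul]
        ring
      have b2 : ∀ r, x r * ((∑ p, ∑ q, (G x)⁻¹ p q * (cov G q A x * cov G r (cov G p A) x).trace)
            + ∑ p, ∑ q, (G x)⁻¹ p q *
              (cov G q A x * (A x * curv G p r x - curv G p r x * A x)).trace)
          = ∑ p, ∑ q, x r * ((G x)⁻¹ p q * (cov G q A x * cov G p (cov G r A) x).trace) := by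
        intro r
        simp only [← Finset.sum_add_distrib, Finset.mul_sum]
        refine Finset.sum_congr rfl fun p _ => Finset.sum_congr rfl fun q _ => ?_
        rw [cov_comm h hA p r, mul_add (cov G q A x), Matrix.trace_add]
        ring
      simp only [b1, b2, Finset.sum_add_distrib, trEnergy]
      congr 1
      rw [Finset.sum_comm (f := fun r p => ∑ q, x r * ((G x)⁻¹ p q *
        (cov G q A x * cov G p (cov G r A) x).trace))]
      exact Finset.sum_congr rfl fun p _ => Finset.sum_comm
    rw [a1]
    simp only [Matrix.trace_mul_comm (radialCov G A x) (cov G _ A x)]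
  -- The second divergence, by the product rule; `∂_r √|g| = √|g| tr Γ_r`.
  have e2 : ∑ r, pd r (fun z => vol G z * (w z * (z r * trEnergy G A z))) x
      = vol G x * ((∑ r, x r * ((conn G r x).trace * w x * trEnergy G A x
          + w x * pd r (trEnergy G A) x)) + n * (w x * trEnergy G A x)
          + (∑ r, x r * pd r w x) * trEnergy G A x) := by
    have b : ∀ r, pd r (fun z => vol G z * (w z * (z r * trEnergy G A z))) x
        = vol G x * (x r * ((conn G r x).trace * w x * trEnergy G A x
          + w x * pd r (trEnergy G A) x)) + vol G x * (w x * trEnergy G A x)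
          + vol G x * (x r * pd r w x * trEnergy G A x) := by
      intro r
      rw [pd_mul hv (hw.fun_mul ((hcoord r).fun_mul hE)), pd_mul hw ((hcoord r).fun_mul hE),
        pd_mul (hcoord r) hE, pd_coord, pd_vol h, if_pos rfl]
      ring
    simp only [b, Finset.sum_add_distrib, ← Finset.mul_sum, ← Finset.sum_mul]
    simp only [Finset.sum_const, Finset.card_univ, Fintype.card_fin, nsmul_eq_mul]
    ring
  rw [e1, e2]
  simp only [stressError, pd_trEnergy h hA]
  simp only [mul_add, mul_sub, Finset.sum_add_distrib, Finset.sum_sub_distrib]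
  have c1 : ∀ f : Fin n → ℝ, ∑ r, x r * (w x * (2 * f r)) = 2 * w x * ∑ r, x r * f r := fun f => by
    rw [Finset.mul_sum]; exact Finset.sum_congr rfl fun r _ => by ring
  have c2 : ∑ r, x r * ((conn G r x).trace * w x * trEnergy G A x)
      = w x * trEnergy G A x * ∑ r, x r * (conn G r x).trace := by
    rw [Finset.mul_sum]; exact Finset.sum_congr rfl fun r _ => by ring
  have c3 : ∑ r, x r * (1 / 2 * (conn G r x).trace * trEnergy G A x)
      = 1 / 2 * trEnergy G A x * ∑ r, x r * (conn G r x).trace := by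
    rw [Finset.mul_sum]; exact Finset.sum_congr rfl fun r _ => by ring
  rw [c1, c1, c2, c3]
  ring

end Divergence

/-! ### Change of coordinates -/

section Charts

variable {n : ℕ} {M : Type*} [TopologicalSpace M] [ChartedSpace (E n) M]

/-- The vector with coordinates `v` is `∑ v_i e_i`. -/
theorem sum_smul_single (v : E n) : ∑ i, v i • EuclideanSpace.single i (1 : ℝ) = v := by
  ext j
  simp [Pi.single_apply]

theorem clm_apply_eq_sum {F : Type*} [NormedAddCommGroup F] [NormedSpace ℝ F] (L : E n →L[ℝ] F)
    (v : E n) : L v = ∑ i, v i • L (EuclideanSpace.single i 1) := by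
  conv_lhs => rw [← sum_smul_single v]
  simp

/-- The set of smooth charts of `M`. -/
abbrev smoothCharts (n : ℕ) (M : Type*) [TopologicalSpace M] [ChartedSpace (E n) M] :
    Set (OpenPartialHomeomorph M (E n)) := IsManifold.maximalAtlas (𝓡 n) ∞ M

/-- The differential of the inverse of a chart, as a map of model spaces. -/
def dsymm (e : OpenPartialHomeomorph M (E n)) (x : E n) : E n →L[ℝ] E n :=
  mfderiv (𝓡 n) (𝓡 n) e.symm x

/-- The differential of a chart, as a map of model spaces. -/
def dchart (e : OpenPartialHomeomorph M (E n)) (p : M) : E n →L[ℝ] E n :=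
  mfderiv (𝓡 n) (𝓡 n) e p

/-- The value of an endomorphism field, as a map of the model space. -/
def endAt (J : EndField n M) (p : M) : E n →L[ℝ] E n := J p

variable {e e' : OpenPartialHomeomorph M (E n)} {x : E n}

/-- The transition map from the chart `e'` to the chart `e`. -/
def transition (e' e : OpenPartialHomeomorph M (E n)) (x : E n) : E n := e (e'.symm x)

/-- The set where the transition map from `e'` to `e` is defined. -/
def overlap (e' e : OpenPartialHomeomorph M (E n)) : Set (E n) := e'.target ∩ e'.symm ⁻¹' e.source

/-- The Jacobian matrix `(∂_i ψ^a)` of the transition map `ψ`. -/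
def jac (e' e : OpenPartialHomeomorph M (E n)) (x : E n) : Mat n :=
  Matrix.of fun i a => fderiv ℝ (transition e' e) x (EuclideanSpace.single i 1) a

theorem isOpen_overlap : IsOpen (overlap e' e) :=
  e'.symm.isOpen_inter_preimage e.open_source

theorem transition_mem (hx : x ∈ overlap e' e) : transition e' e x ∈ e.target :=
  e.map_source hx.2

theorem symm_transition (hx : x ∈ overlap e' e) : e.symm (transition e' e x) = e'.symm x :=
  e.left_inv hx.2

theorem contDiffAt_transition (he' : e' ∈ smoothCharts n M) (he : e ∈ smoothCharts n M)
    (hx : x ∈ overlap e' e) : ContDiffAt ℝ ∞ (transition e' e) x := by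
  rw [← contMDiffAt_iff_contDiffAt]
  exact (contMDiffAt_of_mem_maximalAtlas he hx.2).comp x
    (contMDiffAt_symm_of_mem_maximalAtlas he' hx.1)

theorem hasFDerivAt_transition (he' : e' ∈ smoothCharts n M) (he : e ∈ smoothCharts n M)
    (hx : x ∈ overlap e' e) :
    HasFDerivAt (transition e' e) (fderiv ℝ (transition e' e) x) x :=
  (contDiffAt_infty_differentiableAt (contDiffAt_transition he' he hx)).hasFDerivAt

theorem mdiff_symm (he : e ∈ smoothCharts n M) (hx : x ∈ e.target) :
    MDifferentiableAt (𝓡 n) (𝓡 n) e.symm x :=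
  (contMDiffAt_symm_of_mem_maximalAtlas he hx).mdifferentiableAt (by simp)

theorem mdiff_chart (he : e ∈ smoothCharts n M) {p : M} (hp : p ∈ e.source) :
    MDifferentiableAt (𝓡 n) (𝓡 n) e p :=
  (contMDiffAt_of_mem_maximalAtlas he hp).mdifferentiableAt (by simp)

theorem dchart_comp_dsymm (he : e ∈ smoothCharts n M) (hx : x ∈ e.target) (v : E n) :
    dchart e (e.symm x) (dsymm e x v) = v := by
  have h1 := mfderiv_comp (I := 𝓡 n) (I' := 𝓡 n) (I'' := 𝓡 n) x
    (mdiff_chart he (e.map_target hx)) (mdiff_symm he hx)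
  have h2 : (mfderiv (𝓡 n) (𝓡 n) (e ∘ e.symm) x : E n →L[ℝ] E n)
      = ContinuousLinearMap.id ℝ (E n) := by
    have h3 : (e ∘ e.symm : E n → E n) =ᶠ[𝓝 x] id := by
      filter_upwards [e.open_target.mem_nhds hx] with z hz using e.right_inv hz
    exact mfderiv_eq_fderiv.trans (h3.fderiv_eq.trans fderiv_id)
  have h3 := DFunLike.congr_fun (h1.symm.trans h2) v
  exact h3

theorem fderiv_transition_dchart (he' : e' ∈ smoothCharts n M) (he : e ∈ smoothCharts n M)
    (hx : x ∈ overlap e' e) (v : E n) :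
    fderiv ℝ (transition e' e) x (dchart e' (e'.symm x) v) = dchart e (e'.symm x) v := by
  have hs : e'.symm x ∈ e'.source := e'.map_target hx.1
  have hx' : e' (e'.symm x) = x := e'.right_inv hx.1
  have hd : MDifferentiableAt (𝓡 n) (𝓡 n) (transition e' e) (e' (e'.symm x)) := by
    rw [hx', mdifferentiableAt_iff_differentiableAt]
    exact (hasFDerivAt_transition he' he hx).differentiableAt
  have h1 := mfderiv_comp (I := 𝓡 n) (I' := 𝓡 n) (I'' := 𝓡 n) (e'.symm x) hd (mdiff_chart he' hs)
  have h2 : mfderiv (𝓡 n) (𝓡 n) (transition e' e ∘ e') (e'.symm x)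
      = mfderiv (𝓡 n) (𝓡 n) e (e'.symm x) := by
    refine Filter.EventuallyEq.mfderiv_eq ?_
    filter_upwards [e'.open_source.mem_nhds hs] with z hz
    simp [transition, e'.left_inv hz]
  rw [h2] at h1
  have h3 := (DFunLike.congr_fun h1 v).symm
  rw [hx', mfderiv_eq_fderiv] at h3
  exact h3

theorem dsymm_eq (he' : e' ∈ smoothCharts n M) (he : e ∈ smoothCharts n M)
    (hx : x ∈ overlap e' e) (v : E n) :
    dsymm e' x v = dsymm e (transition e' e x) (fderiv ℝ (transition e' e) x v) := by
  have hd : MDifferentiableAt (𝓡 n) (𝓡 n) (transition e' e) x := by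
    rw [mdifferentiableAt_iff_differentiableAt]
    exact (hasFDerivAt_transition he' he hx).differentiableAt
  have h1 := mfderiv_comp (I := 𝓡 n) (I' := 𝓡 n) (I'' := 𝓡 n) x
    (mdiff_symm he (transition_mem hx)) hd
  have h2 : mfderiv (𝓡 n) (𝓡 n) (e.symm ∘ transition e' e) x
      = mfderiv (𝓡 n) (𝓡 n) e'.symm x := by
    refine Filter.EventuallyEq.mfderiv_eq ?_
    filter_upwards [isOpen_overlap.mem_nhds hx] with z hz using symm_transition hz
  rw [h2, mfderiv_eq_fderiv] at h1
  exact DFunLike.congr_fun h1 v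

theorem fderiv_transition_apply (v : E n) (a : Fin n) :
    fderiv ℝ (transition e' e) x v a = ∑ i, v i * jac e' e x i a := by
  rw [clm_apply_eq_sum]
  simp [jac]

/-- Transformation law of the components of an endomorphism field. -/
theorem endCoeff_mul_jac (he' : e' ∈ smoothCharts n M) (he : e ∈ smoothCharts n M)
    (hx : x ∈ overlap e' e) (J : EndField n M) :
    (Matrix.of (endCoeff e' J x) * jac e' e x : Mat n)
      = jac e' e x * Matrix.of (endCoeff e J (transition e' e x)) := by
  have hcoef : ∀ p, e.symm (transition e' e x) = p → ∀ a b, endCoeff e J (transition e' e x) a b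
      = dchart e p (endAt J p (dsymm e (transition e' e x) (EuclideanSpace.single a 1))) b := by
    rintro p rfl a b; rfl
  ext α b
  have h1 : (Matrix.of (endCoeff e' J x) * jac e' e x : Mat n) α b
      = fderiv ℝ (transition e' e) x (dchart e' (e'.symm x)
          (endAt J (e'.symm x) (dsymm e' x (EuclideanSpace.single α 1)))) b := by
    rw [fderiv_transition_apply, Matrix.mul_apply]
    rfl
  rw [h1, fderiv_transition_dchart he' he hx, dsymm_eq he' he hx, clm_apply_eq_sum (dsymm e _),
    Matrix.mul_apply]
  simp only [Matrix.of_apply, hcoef _ (symm_transition hx)]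
  simp [jac]

theorem jac_mul_jac (he' : e' ∈ smoothCharts n M) (he : e ∈ smoothCharts n M)
    (hx : x ∈ overlap e' e) : jac e' e x * jac e e' (transition e' e x) = 1 := by
  have hx2 : transition e' e x ∈ overlap e e' :=
    ⟨transition_mem hx, by simpa [symm_transition hx] using e'.map_target hx.1⟩
  have h := (hasFDerivAt_transition he he' hx2).comp x (hasFDerivAt_transition he' he hx)
  have h' : HasFDerivAt (transition e e' ∘ transition e' e) (ContinuousLinearMap.id ℝ (E n)) x := by
    refine (hasFDerivAt_id x).congr_of_eventuallyEq ?_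
    filter_upwards [isOpen_overlap.mem_nhds hx] with z hz
    simp only [Function.comp_apply, id]
    rw [transition, symm_transition hz, e'.right_inv hz.1]
  ext i j
  have := congrArg (fun L : E n →L[ℝ] E n => L (EuclideanSpace.single i 1) j) (h.unique h')
  simp only [ContinuousLinearMap.comp_apply, fderiv_transition_apply,
    ContinuousLinearMap.id_apply] at this
  rw [Matrix.mul_apply, Matrix.one_apply]
  simpa [jac, PiLp.single_apply, eq_comm] using this

theorem isUnit_jac (he' : e' ∈ smoothCharts n M) (he : e ∈ smoothCharts n M)
    (hx : x ∈ overlap e' e) : IsUnit (jac e' e x) := by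
  have h := jac_mul_jac he' he hx
  exact IsUnit.of_mul_eq_one _ h

theorem contDiffAt_jac (he' : e' ∈ smoothCharts n M) (he : e ∈ smoothCharts n M)
    (hx : x ∈ overlap e' e) : ContDiffAt ℝ ∞ (jac e' e) x := by
  refine contDiffAt_matrix.2 fun i a => ?_
  exact (EuclideanSpace.proj a : E n →L[ℝ] ℝ).contDiff.contDiffAt.comp x
    ((contDiffAt_transition he' he hx).pd i)

theorem pd_jac_symm (he' : e' ∈ smoothCharts n M) (he : e ∈ smoothCharts n M)
    (hx : x ∈ overlap e' e) (i j a : Fin n) : pd i (jac e' e) x j a = pd j (jac e' e) x i a := by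
  have hd := contDiffAt_infty_differentiableAt (contDiffAt_jac he' he hx)
  rw [← pd_entry hd, ← pd_entry hd]
  have e1 : ∀ i j, pd i (fun z => jac e' e z j a) x = pd i (pd j (transition e' e)) x a :=
    fun i j => pd_clm (EuclideanSpace.proj a : E n →L[ℝ] ℝ)
      (contDiffAt_infty_differentiableAt ((contDiffAt_transition he' he hx).pd j))
  rw [e1, e1, pd_comm (contDiffAt_transition he' he hx)]

/-- The chain rule for the composition with the transition map. -/
theorem pd_comp_transition {F : Type*} [NormedAddCommGroup F] [NormedSpace ℝ F]
    (he' : e' ∈ smoothCharts n M) (he : e ∈ smoothCharts n M)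
    (hx : x ∈ overlap e' e) {f : E n → F} (hf : DifferentiableAt ℝ f (transition e' e x))
    (k : Fin n) : pd k (fun z => f (transition e' e z)) x
      = ∑ c, jac e' e x k c • pd c f (transition e' e x) := by
  have h := (hf.hasFDerivAt.comp x (hasFDerivAt_transition he' he hx)).fderiv
  rw [pd, show (fun z => f (transition e' e z)) = f ∘ transition e' e from rfl, h,
    ContinuousLinearMap.comp_apply, clm_apply_eq_sum]
  rfl

section Metric
variable [IsManifold (𝓡 n) ∞ M] (g : Metric n M)

/-- The metric at a point, as a bilinear form on the model space. -/
def metricAt (p : M) : E n →L[ℝ] E n →L[ℝ] ℝ := g.inner p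

theorem gram_apply (i j : Fin n) : gram g e x i j = metricAt g (e.symm x)
    (dsymm e x (EuclideanSpace.single i 1)) (dsymm e x (EuclideanSpace.single j 1)) := rfl

theorem contDiffAt_gram (he : e ∈ smoothCharts n M) (hx : x ∈ e.target) :
    ContDiffAt ℝ ∞ (gram g e) x := by
  refine contDiffAt_matrix.2 fun i j => ?_
  have hsec : ∀ i : Fin n, ContMDiffAt (𝓡 n) (𝓡 n).tangent ∞
      (fun z => (⟨e.symm z, coordVec e z i⟩ : TangentBundle (𝓡 n) M)) x := by
    intro i
    have h1 : ContMDiffOn (𝓡 n).tangent (𝓡 n).tangent ∞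
        (tangentMapWithin (𝓡 n) (𝓡 n) e.symm e.target)
        (TotalSpace.proj ⁻¹' e.target : Set (TangentBundle (𝓡 n) (E n))) :=
      (contMDiffOn_symm_of_mem_maximalAtlas he).contMDiffOn_tangentMapWithin (by simp)
        e.open_target.uniqueMDiffOn
    have h2 : ContMDiffAt (𝓡 n) (𝓡 n).tangent ∞
        (fun z : E n => (⟨z, (EuclideanSpace.single i (1 : ℝ) : E n)⟩ : TangentBundle (𝓡 n) (E n)))
        x := by
      rw [contMDiffAt_totalSpace]
      refine ⟨contMDiffAt_id, ?_⟩
      simpa using contMDiffAt_const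
    have h3 := (h1.contMDiffAt (x := (⟨x, (EuclideanSpace.single i (1 : ℝ) : E n)⟩ :
      TangentBundle (𝓡 n) (E n))) ((e.open_target.preimage
        (FiberBundle.continuous_proj _ _)).mem_nhds hx)).comp x h2
    refine h3.congr_of_eventuallyEq ?_
    filter_upwards [e.open_target.mem_nhds hx] with z hz
    simp only [Function.comp_apply, tangentMapWithin, coordVec]
    rw [mfderivWithin_of_isOpen e.open_target hz]
  have hb : ContMDiffAt (𝓡 n) (𝓡 n) ∞ e.symm x := contMDiffAt_symm_of_mem_maximalAtlas he hx
  have : ContMDiffAt (𝓡 n) ((𝓡 n).prod 𝓘(ℝ)) ∞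
      (fun z ↦ TotalSpace.mk' ℝ (E := Bundle.Trivial M ℝ) (e.symm z)
        (g.inner (e.symm z) (coordVec e z i) (coordVec e z j))) x := by
    apply ContMDiffAt.clm_bundle_apply₂ (F₁ := E n) (F₂ := E n)
    · exact ContMDiffAt.comp x g.contMDiff.contMDiffAt hb
    · exact hsec i
    · exact hsec j
  rw [contMDiffAt_totalSpace] at this
  exact contMDiffAt_iff_contDiffAt.1 this.2

theorem metric_sum (p : M) (L : E n →L[ℝ] E n) (v w : E n) : metricAt g p (L v) (L w)
    = ∑ i, ∑ j, v i * w j * metricAt g p (L (EuclideanSpace.single i 1))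
        (L (EuclideanSpace.single j 1)) := by
  rw [clm_apply_eq_sum L v, clm_apply_eq_sum L w]
  simp only [map_sum, map_smul, sum_apply, smul_apply,
    smul_eq_mul, Finset.mul_sum]
  rw [Finset.sum_comm]
  exact Finset.sum_congr rfl fun i _ => Finset.sum_congr rfl fun j _ => by ring

theorem posDef_gram (he : e ∈ smoothCharts n M) (hx : x ∈ e.target) : (gram g e x).PosDef := by
  refine Matrix.PosDef.of_dotProduct_mulVec_pos ?_ fun v hv => ?_
  · ext i j
    simp only [Matrix.conjTranspose_apply, star_trivial]
    exact g.symm _ _ _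
  · have h1 := metric_sum g (e.symm x) (dsymm e x) (WithLp.toLp 2 v) (WithLp.toLp 2 v)
    have h2 : star v ⬝ᵥ (gram g e x).mulVec v = metricAt g (e.symm x)
        (dsymm e x (WithLp.toLp 2 v)) (dsymm e x (WithLp.toLp 2 v)) := by
      rw [h1]
      simp only [dotProduct, Matrix.mulVec, star_trivial, gram_apply, Finset.mul_sum]
      exact Finset.sum_congr rfl fun i _ => Finset.sum_congr rfl fun j _ => by ring
    rw [h2]
    refine g.pos _ _ fun h0 => hv ?_
    have h3 := dchart_comp_dsymm he hx (WithLp.toLp 2 v)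
    have h4 : dsymm e x (WithLp.toLp 2 v) = 0 := h0
    rw [h4, map_zero] at h3
    exact congrArg WithLp.ofLp h3.symm

theorem isMetricAt_gram (he : e ∈ smoothCharts n M) (hx : x ∈ e.target) :
    IsMetricAt (gram g e) x :=
  ⟨contDiffAt_gram g he hx, by
    filter_upwards [e.open_target.mem_nhds hx] with z hz using posDef_gram g he hz⟩

/-- Transformation law of the metric. -/
theorem gram_eq_jac (he' : e' ∈ smoothCharts n M) (he : e ∈ smoothCharts n M)
    (hx : x ∈ overlap e' e) : gram g e' x
      = jac e' e x * gram g e (transition e' e x) * (jac e' e x).transpose := by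
  have hg : ∀ p, e.symm (transition e' e x) = p → ∀ a b, gram g e (transition e' e x) a b
      = metricAt g p (dsymm e (transition e' e x) (EuclideanSpace.single a 1))
        (dsymm e (transition e' e x) (EuclideanSpace.single b 1)) := by
    rintro p rfl a b; rfl
  ext i j
  rw [gram_apply, dsymm_eq he' he hx, dsymm_eq he' he hx, metric_sum]
  simp only [Matrix.mul_apply, hg _ (symm_transition hx), Matrix.transpose_apply, Finset.sum_mul]
  rw [Finset.sum_comm]
  refine Finset.sum_congr rfl fun a _ => Finset.sum_congr rfl fun b _ => ?_
  simp only [jac, Matrix.of_apply]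
  ring

/-- Transformation law of the connection matrices. -/
theorem conn_mul_jac (he' : e' ∈ smoothCharts n M) (he : e ∈ smoothCharts n M)
    (hx : x ∈ overlap e' e) (k : Fin n) : conn (gram g e') k x * jac e' e x
      = pd k (jac e' e) x
        + jac e' e x * ∑ c, jac e' e x k c • conn (gram g e) c (transition e' e x) := by
  set P := jac e' e x with hP
  set y := transition e' e x with hy
  have hPd := contDiffAt_infty_differentiableAt (contDiffAt_jac he' he hx)
  have hm' := isMetricAt_gram g he' hx.1
  have hm := isMetricAt_gram g he (transition_mem hx)
  have hU := (Matrix.isUnit_iff_isUnit_det _).1 (isUnit_jac he' he hx)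
  set C : Fin n → Mat n := fun k => ∑ c, P k c • conn (gram g e) c y with hC
  have hgy : DifferentiableAt ℝ (fun z => gram g e (transition e' e z)) x :=
    DifferentiableAt.comp (g := gram g e) x hm.differentiableAt
      (hasFDerivAt_transition he' he hx).differentiableAt
  have hpg : ∀ k, pd k (fun z => gram g e (transition e' e z)) x
      = C k * gram g e y + gram g e y * (C k).transpose := by
    intro k
    rw [pd_comp_transition he' he hx hm.differentiableAt]
    simp only [pd_metric hm, hC, Finset.sum_mul, Matrix.transpose_sum, Finset.mul_sum,
      smul_add, Finset.sum_add_distrib, smul_mul_assoc, Matrix.transpose_smul, mul_smul_comm]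
    rfl
  have hPt : DifferentiableAt ℝ (fun z => (jac e' e z).transpose) x :=
    (transposeCLM n).differentiableAt.comp x hPd
  have hpd : ∀ k, pd k (gram g e') x = pd k (jac e' e) x * gram g e y * P.transpose
      + P * (C k * gram g e y + gram g e y * (C k).transpose) * P.transpose
      + P * gram g e y * (pd k (jac e' e) x).transpose := by
    intro k
    rw [pd_congr (g := fun z => jac e' e z * gram g e (transition e' e z)
      * (jac e' e z).transpose)]
    · rw [pd_mul (hPd.fun_mul hgy) hPt, pd_mul hPd hgy, pd_transpose hPd, hpg, add_mul]
    · filter_upwards [isOpen_overlap.mem_nhds hx] with z hz using gram_eq_jac g he' he hz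
  -- The connection pulled back from the second chart is torsion free and metric, so it is the
  -- Levi-Civita connection of the first.
  have key := conn_unique hm' (Γ := fun k => (pd k (jac e' e) x + P * C k) * P⁻¹) ?_ ?_ k
  · rw [← key, mul_assoc, Matrix.nonsing_inv_mul _ hU, mul_one]
  · intro k
    have hT : P.transpose * P⁻¹.transpose = 1 := by
      rw [← Matrix.transpose_mul, Matrix.nonsing_inv_mul _ hU, Matrix.transpose_one]
    have c1 : (pd k (jac e' e) x + P * C k) * P⁻¹ * (P * gram g e y * P.transpose)
        = (pd k (jac e' e) x + P * C k) * gram g e y * P.transpose := by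
      rw [show (pd k (jac e' e) x + P * C k) * P⁻¹ * (P * gram g e y * P.transpose)
        = (pd k (jac e' e) x + P * C k) * (P⁻¹ * P) * gram g e y * P.transpose by noncomm_ring,
        Matrix.nonsing_inv_mul _ hU, mul_one]
    have c2 : P * gram g e y * P.transpose * ((pd k (jac e' e) x + P * C k) * P⁻¹).transpose
        = P * gram g e y * (pd k (jac e' e) x + P * C k).transpose := by
      rw [Matrix.transpose_mul, show P * gram g e y * P.transpose
        * (P⁻¹.transpose * (pd k (jac e' e) x + P * C k).transpose)
        = P * gram g e y * (P.transpose * P⁻¹.transpose)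
          * (pd k (jac e' e) x + P * C k).transpose by noncomm_ring, hT, mul_one]
    rw [gram_eq_jac g he' he hx, ← hP, ← hy, c1, c2, hpd, Matrix.transpose_add,
      Matrix.transpose_mul]
    noncomm_ring
  · intro k a b
    have hs : ∀ c, (pd k (jac e' e) x + P * C k) a c = (pd a (jac e' e) x + P * C a) k c := by
      intro c
      rw [Matrix.add_apply, Matrix.add_apply, pd_jac_symm he' he hx k a]
      congr 1
      simp only [hC, Finset.mul_sum, Matrix.sum_apply, Matrix.smul_apply,
        Matrix.mul_apply, smul_eq_mul]
      rw [Finset.sum_comm]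
      refine Finset.sum_congr rfl fun d _ => Finset.sum_congr rfl fun f _ => ?_
      rw [conn_symm hm]
      ring
    rw [Matrix.mul_apply, Matrix.mul_apply]
    exact Finset.sum_congr rfl fun c _ => by rw [hs c]

/-- Transformation law of covariant derivatives. -/
theorem cov_mul_jac (he' : e' ∈ smoothCharts n M) (he : e ∈ smoothCharts n M)
    (hx : x ∈ overlap e' e) {A' A : E n → Mat n} (hA' : DifferentiableAt ℝ A' x)
    (hA : DifferentiableAt ℝ A (transition e' e x))
    (h : ∀ z ∈ overlap e' e, A' z * jac e' e z = jac e' e z * A (transition e' e z)) (k : Fin n) :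
    cov (gram g e') k A' x * jac e' e x
      = jac e' e x * ∑ c, jac e' e x k c • cov (gram g e) c A (transition e' e x) := by
  have hPd := contDiffAt_infty_differentiableAt (contDiffAt_jac he' he hx)
  have hAt : DifferentiableAt ℝ (fun z => A (transition e' e z)) x :=
    DifferentiableAt.comp x hA (hasFDerivAt_transition he' he hx).differentiableAt
  have h1 : pd k A' x * jac e' e x + A' x * pd k (jac e' e) x
      = pd k (jac e' e) x * A (transition e' e x)
        + jac e' e x * ∑ c, jac e' e x k c • pd c A (transition e' e x) := by
    rw [← pd_mul hA' hPd, ← pd_comp_transition he' he hx hA, ← pd_mul hPd hAt]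
    refine pd_congr ?_
    filter_upwards [isOpen_overlap.mem_nhds hx] with z hz using h z hz
  have h0 := h x hx
  have hc := conn_mul_jac g he' he hx k
  have hsum : ∑ c, jac e' e x k c • cov (gram g e) c A (transition e' e x)
      = (∑ c, jac e' e x k c • pd c A (transition e' e x))
        + A (transition e' e x) * (∑ c, jac e' e x k c • conn (gram g e) c (transition e' e x))
        - (∑ c, jac e' e x k c • conn (gram g e) c (transition e' e x))
          * A (transition e' e x) := by
    simp only [cov, smul_add, smul_sub, Finset.sum_add_distrib, Finset.sum_sub_distrib,
      Finset.mul_sum, Finset.sum_mul, mul_smul_comm, smul_mul_assoc]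
  rw [hsum, cov]
  generalize (∑ c, jac e' e x k c • conn (gram g e) c (transition e' e x)) = C at *
  generalize (∑ c, jac e' e x k c • pd c A (transition e' e x)) = D at *
  have e1 : (pd k A' x + A' x * conn (gram g e') k x - conn (gram g e') k x * A' x) * jac e' e x
      = (pd k A' x * jac e' e x + A' x * pd k (jac e' e) x) - A' x * pd k (jac e' e) x
        + A' x * (conn (gram g e') k x * jac e' e x)
        - conn (gram g e') k x * (A' x * jac e' e x) := by noncomm_ring
  have e2 : conn (gram g e') k x * (jac e' e x * A (transition e' e x))
      = (conn (gram g e') k x * jac e' e x) * A (transition e' e x) := by noncomm_ring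
  have e3 : A' x * (pd k (jac e' e) x + jac e' e x * C)
      = A' x * pd k (jac e' e) x + (A' x * jac e' e x) * C := by noncomm_ring
  rw [e1, h1, h0, e2, hc, e3, h0]
  noncomm_ring

end Metric
end Charts

/-! ### The Gauss lemma -/

section Gauss

variable {n : ℕ}

/-- The Cauchy-Schwarz inequality for a positive semidefinite matrix. -/
theorem posSemidef_cauchy_schwarz {S : Mat n} (hS : S.PosSemidef) (u v : Fin n → ℝ) :
    (u ⬝ᵥ S.mulVec v) ^ 2 ≤ (u ⬝ᵥ S.mulVec u) * (v ⬝ᵥ S.mulVec v) := by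
  obtain ⟨L, rfl⟩ := exists_transpose_mul_self hS
  have h : ∀ a b : Fin n → ℝ, a ⬝ᵥ (L.transpose * L).mulVec b = L.mulVec a ⬝ᵥ L.mulVec b := by
    intro a b
    rw [← Matrix.mulVec_mulVec, Matrix.dotProduct_mulVec, Matrix.vecMul_transpose]
  rw [h, h, h]
  simp only [dotProduct]
  have := Finset.sum_mul_sq_le_sq_mul_sq Finset.univ (L.mulVec u) (L.mulVec v)
  simpa [sq] using this

theorem dotProduct_self_eq_norm_sq (v : E n) : v.ofLp ⬝ᵥ v.ofLp = ‖v‖ ^ 2 := by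
  rw [EuclideanSpace.norm_sq_eq]
  simp [dotProduct, sq]

theorem hasDerivAt_ray {F : Type*} [NormedAddCommGroup F] [NormedSpace ℝ F] {f : E n → F}
    {x : E n} {s : ℝ} (hf : DifferentiableAt ℝ f (s • x)) :
    HasDerivAt (fun s : ℝ => f (s • x)) (∑ k, x k • pd k f (s • x)) s := by
  have h1 : HasDerivAt (fun s : ℝ => s • x) x s := by
    simpa using (hasDerivAt_id s).smul_const x
  have h2 := hf.hasFDerivAt.comp_hasDerivAt s h1
  rwa [clm_apply_eq_sum] at h2

theorem smul_mem_ball {x : E n} {r s : ℝ} (hx : x ∈ Metric.ball (0 : E n) r) (h0 : 0 ≤ s)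
    (h1 : s ≤ 1) : s • x ∈ Metric.ball (0 : E n) r := by
  rw [mem_ball_zero_iff] at hx ⊢
  rw [norm_smul, Real.norm_of_nonneg h0]
  exact lt_of_le_of_lt (mul_le_of_le_one_left (norm_nonneg x) h1) hx

/-- A metric on a ball for which the rays through the origin are geodesics. -/
structure IsRadialMetric (G : E n → Mat n) (r : ℝ) : Prop where
  metric : ∀ x ∈ Metric.ball (0 : E n) r, IsMetricAt G x
  zero : G 0 = 1
  radial : ∀ x ∈ Metric.ball (0 : E n) r, ∀ k,
    ∑ i, ∑ j, christoffel G x k i j * x i * x j = 0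

variable {G : E n → Mat n} {r : ℝ}

theorem IsRadialMetric.lowered (h : IsRadialMetric G r) {x : E n}
    (hx : x ∈ Metric.ball (0 : E n) r) (l : Fin n) :
    ∑ i, ∑ j, pd i G x j l * x i * x j = (1 / 2) * ∑ i, ∑ j, pd l G x i j * x i * x j := by
  have hm := h.metric x hx
  have h1 : ∑ i, ∑ j, connLow G j x i l * x i * x j = 0 := by
    have : ∀ i j, connLow G j x i l = ∑ k, christoffel G x k i j * G x k l := by
      intro i j
      rw [← conn_mul hm, Matrix.mul_apply]
      rfl
    simp only [this]
    calc ∑ i, ∑ j, (∑ k, christoffel G x k i j * G x k l) * x i * x j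
        = ∑ k, G x k l * ∑ i, ∑ j, christoffel G x k i j * x i * x j := by
          simp only [Finset.sum_mul, Finset.mul_sum]
          rw [Finset.sum_congr rfl fun i _ => Finset.sum_comm, Finset.sum_comm]
          refine Finset.sum_congr rfl fun k _ => Finset.sum_congr rfl fun i _ =>
            Finset.sum_congr rfl fun j _ => ?_
          ring
      _ = 0 := by simp [h.radial x hx]
  have h2 : ∑ i, ∑ j, connLow G j x i l * x i * x j
      = (1 / 2) * ∑ i, ∑ j, pd i G x j l * x i * x j
        + (1 / 2) * ∑ i, ∑ j, pd j G x i l * x i * x j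
        - (1 / 2) * ∑ i, ∑ j, pd l G x i j * x i * x j := by
    simp only [Finset.mul_sum, ← Finset.sum_add_distrib, ← Finset.sum_sub_distrib]
    refine Finset.sum_congr rfl fun i _ => Finset.sum_congr rfl fun j _ => ?_
    simp only [connLow, Matrix.of_apply]
    ring
  have h3 : ∑ i, ∑ j, pd j G x i l * x i * x j = ∑ i, ∑ j, pd i G x j l * x i * x j := by
    rw [Finset.sum_comm]
    exact Finset.sum_congr rfl fun i _ => Finset.sum_congr rfl fun j _ => by ring
  rw [h1, h3] at h2
  linarith

theorem IsRadialMetric.norm_sq (h : IsRadialMetric G r) {x : E n}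
    (hx : x ∈ Metric.ball (0 : E n) r) : ∑ i, ∑ j, G x i j * x i * x j = ‖x‖ ^ 2 := by
  -- The function `s ↦ g_{sx}(x, x)` is constant, since its derivative vanishes: contracted with
  -- `x`, the two sides of `lowered` are a multiple of this derivative and its half.
  have hd : ∀ s ∈ Icc (0 : ℝ) 1, HasDerivAt (fun s : ℝ => ∑ i, ∑ j, G (s • x) i j * x i * x j)
      (∑ i, ∑ j, (∑ k, x k * pd k G (s • x) i j) * x i * x j) s := by
    intro s hs
    have hm := h.metric _ (smul_mem_ball hx hs.1 hs.2)
    refine HasDerivAt.fun_sum fun i _ => HasDerivAt.fun_sum fun j _ => ?_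
    have := hasDerivAt_ray (x := x) (contDiffAt_infty_differentiableAt (hm.smooth.matrix_entry i j))
    simp only [pd_entry hm.differentiableAt, smul_eq_mul] at this
    exact (this.mul_const _).mul_const _
  have hz : ∀ s ∈ Ioo (0 : ℝ) 1,
      ∑ i, ∑ j, (∑ k, x k * pd k G (s • x) i j) * x i * x j = 0 := by
    intro s hs
    have hl := h.lowered (smul_mem_ball hx hs.1.le hs.2.le)
    have hs3 : s ^ 3 ≠ 0 := pow_ne_zero _ hs.1.ne'
    set c := ∑ i, ∑ j, (∑ k, x k * pd k G (s • x) i j) * x i * x j with hc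
    have e1 : ∑ l, (s • x) l * ∑ i, ∑ j, pd l G (s • x) i j * (s • x) i * (s • x) j
        = s ^ 3 * c := by
      simp only [hc, Finset.mul_sum, Finset.sum_mul]
      rw [Finset.sum_comm, Finset.sum_congr rfl fun i _ => Finset.sum_comm]
      refine Finset.sum_congr rfl fun i _ => Finset.sum_congr rfl fun j _ =>
        Finset.sum_congr rfl fun l _ => ?_
      simp only [PiLp.smul_apply, smul_eq_mul]
      ring
    have e2 : ∑ l, (s • x) l * ∑ i, ∑ j, pd i G (s • x) j l * (s • x) i * (s • x) j
        = s ^ 3 * c := by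
      simp only [hc, Finset.mul_sum, Finset.sum_mul]
      rw [Finset.sum_congr rfl fun i _ => Finset.sum_comm, Finset.sum_comm]
      refine Finset.sum_congr rfl fun i _ => Finset.sum_congr rfl fun j _ =>
        Finset.sum_congr rfl fun l _ => ?_
      simp only [PiLp.smul_apply, smul_eq_mul]
      ring
    simp only [hl] at e2
    have e3 : ∑ l, (s • x) l * (1 / 2 * ∑ i, ∑ j, pd l G (s • x) i j * (s • x) i * (s • x) j)
        = (1 / 2) * ∑ l, (s • x) l * ∑ i, ∑ j, pd l G (s • x) i j * (s • x) i * (s • x) j := by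
      rw [Finset.mul_sum]
      exact Finset.sum_congr rfl fun l _ => by ring
    rw [e3, e1] at e2
    have : s ^ 3 * c = 0 := by linarith
    exact (mul_eq_zero.1 this).resolve_left hs3
  obtain ⟨c, hc, hc'⟩ := exists_hasDerivAt_eq_slope
    (fun s : ℝ => ∑ i, ∑ j, G (s • x) i j * x i * x j) _ zero_lt_one
    (fun s hs => (hd s hs).continuousAt.continuousWithinAt)
    (fun s hs => hd s (Ioo_subset_Icc_self hs))
  rw [hz c hc] at hc'
  simp only [one_smul, zero_smul, h.zero, sub_zero, div_one] at hc'
  have : ∑ i, ∑ j, (1 : Mat n) i j * x i * x j = ‖x‖ ^ 2 := by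
    rw [EuclideanSpace.norm_sq_eq]
    simp [Matrix.one_apply, sq]
  linarith

/-- The Gauss lemma: `g_{lj}(x) x^j = x^l` in normal coordinates. -/
theorem IsRadialMetric.gauss (h : IsRadialMetric G r) {x : E n}
    (hx : x ∈ Metric.ball (0 : E n) r) : (G x).mulVec x.ofLp = x.ofLp := by
  funext l
  -- Differentiate `g_z(z, z) = |z|²` and use `lowered`.
  have hrad : ∀ z ∈ Metric.ball (0 : E n) r, ∑ i, ∑ j, pd i G z j l * z i * z j
      = z l - ∑ j, G z l j * z j := by
    intro z hz
    have hm := h.metric z hz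
    have hco : ∀ i : Fin n, DifferentiableAt ℝ (fun z : E n => z i) z := fun i =>
      (EuclideanSpace.proj i : E n →L[ℝ] ℝ).differentiableAt
    have hGe : ∀ i j, DifferentiableAt ℝ (fun z => G z i j) z := fun i j =>
      contDiffAt_infty_differentiableAt (hm.smooth.matrix_entry i j)
    have e1 : pd l (fun z => ∑ i, ∑ j, G z i j * z i * z j) z
        = pd l (fun z => ∑ i, z i * z i) z := by
      refine pd_congr ?_
      filter_upwards [Metric.isOpen_ball.mem_nhds hz] with w hw
      rw [h.norm_sq hw, EuclideanSpace.norm_sq_eq]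
      simp [sq]
    have e2 : pd l (fun z : E n => ∑ i, z i * z i) z = 2 * z l := by
      rw [pd_sum fun i _ => (hco i).fun_mul (hco i)]
      simp only [pd_mul (hco _) (hco _), pd_coord]
      simp [Finset.sum_add_distrib]
      ring
    have e3 : pd l (fun z => ∑ i, ∑ j, G z i j * z i * z j) z
        = (∑ i, ∑ j, pd l G z i j * z i * z j) + 2 * ∑ j, G z l j * z j := by
      rw [pd_sum fun i _ => DifferentiableAt.fun_sum fun j _ =>
        ((hGe i j).fun_mul (hco i)).fun_mul (hco j)]
      have : ∀ i, pd l (fun z => ∑ j, G z i j * z i * z j) z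
          = ∑ j, (pd l G z i j * z i * z j + G z i j * (if l = i then 1 else 0) * z j
            + G z i j * z i * (if l = j then 1 else 0)) := by
        intro i
        rw [pd_sum fun j _ => ((hGe i j).fun_mul (hco i)).fun_mul (hco j)]
        refine Finset.sum_congr rfl fun j _ => ?_
        rw [pd_mul ((hGe i j).fun_mul (hco i)) (hco j), pd_mul (hGe i j) (hco i), pd_coord,
          pd_coord, pd_entry hm.differentiableAt]
        ring
      simp only [this, Finset.sum_add_distrib]
      have s1 : ∑ i, ∑ j, G z i j * (if l = i then 1 else 0) * z j = ∑ j, G z l j * z j := by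
        simp [mul_ite, ite_mul]
      have s2 : ∑ i, ∑ j, G z i j * z i * (if l = j then 1 else 0) = ∑ j, G z l j * z j := by
        simp only [mul_ite, mul_one, mul_zero, Finset.sum_ite_eq, Finset.mem_univ, if_true]
        refine Finset.sum_congr rfl fun i _ => ?_
        rw [← Matrix.transpose_apply (G z) i l, hm.transpose]
      rw [s1, s2]
      ring
    rw [h.lowered hz]
    linarith
  -- Along the ray, `hrad` says that `s (g_{lj}(sx) x^j - x^l)` has derivative zero; it vanishes
  -- at `s = 0`.
  have hd : ∀ s ∈ Icc (0 : ℝ) 1, HasDerivAt (fun s : ℝ => s * ((∑ j, G (s • x) l j * x j) - x l))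
      (((∑ j, G (s • x) l j * x j) - x l)
        + s * ∑ j, (∑ k, x k * pd k G (s • x) l j) * x j) s := by
    intro s hs
    have hm := h.metric _ (smul_mem_ball hx hs.1 hs.2)
    have h1 : HasDerivAt (fun s : ℝ => ∑ j, G (s • x) l j * x j)
        (∑ j, (∑ k, x k * pd k G (s • x) l j) * x j) s := by
      refine HasDerivAt.fun_sum fun j _ => ?_
      have := hasDerivAt_ray (x := x)
        (contDiffAt_infty_differentiableAt (hm.smooth.matrix_entry l j))
      simp only [pd_entry hm.differentiableAt, smul_eq_mul] at this
      exact this.mul_const _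
    simpa using (hasDerivAt_id s).fun_mul (h1.sub_const (x l))
  obtain ⟨s, hs, hs'⟩ := exists_hasDerivAt_eq_slope
    (fun s : ℝ => s * ((∑ j, G (s • x) l j * x j) - x l)) _ zero_lt_one
    (fun s hs => (hd s hs).continuousAt.continuousWithinAt)
    (fun s hs => hd s (Ioo_subset_Icc_self hs))
  have hm := h.metric _ (smul_mem_ball hx hs.1.le hs.2.le)
  have e := hrad _ (smul_mem_ball hx hs.1.le hs.2.le)
  have e1 : ∑ i, ∑ j, pd i G (s • x) j l * (s • x) i * (s • x) j
      = s ^ 2 * ∑ j, (∑ k, x k * pd k G (s • x) l j) * x j := by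
    simp only [Finset.mul_sum, Finset.sum_mul]
    rw [Finset.sum_comm]
    refine Finset.sum_congr rfl fun j _ => Finset.sum_congr rfl fun k _ => ?_
    rw [hm.pd_symm k j l]
    simp only [PiLp.smul_apply, smul_eq_mul]
    ring
  have e2 : (s • x) l - ∑ j, G (s • x) l j * (s • x) j
      = -(s * ((∑ j, G (s • x) l j * x j) - x l)) := by
    rw [mul_sub, Finset.mul_sum]
    simp only [PiLp.smul_apply, smul_eq_mul]
    rw [Finset.sum_congr rfl fun j _ => show G (s • x) l j * (s * x j)
      = s * (G (s • x) l j * x j) by ring]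
    ring
  rw [e1, e2] at e
  have e3 : ((∑ j, G (s • x) l j * x j) - x l)
        + s * ∑ j, (∑ k, x k * pd k G (s • x) l j) * x j = 0 := by
    have := hs.1
    have h4 : s * (((∑ j, G (s • x) l j * x j) - x l)
        + s * ∑ j, (∑ k, x k * pd k G (s • x) l j) * x j) = 0 := by linear_combination e
    exact (mul_eq_zero.1 h4).resolve_left this.ne'
  rw [e3] at hs'
  simp only [one_smul, zero_mul, one_mul, sub_zero, div_one] at hs'
  simp only [Matrix.mulVec, dotProduct]
  linarith

end Gauss

section NormalCharts

variable {n : ℕ} {M : Type*} [TopologicalSpace M] [ChartedSpace (E n) M] [IsManifold (𝓡 n) ∞ M]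
  {g : Metric n M} {y : M} {r : ℝ} {e : OpenPartialHomeomorph M (E n)}

theorem IsNormalChart.isRadialMetric (h : IsNormalChart g y r e) : IsRadialMetric (gram g e) r where
  metric _ hx := isMetricAt_gram g h.mem_maximalAtlas (h.target_eq ▸ hx)
  zero := h.gram_zero
  radial x hx := h.radial_geodesic x (h.target_eq ▸ hx)

end NormalCharts

/-! ### Uniform bounds for derivatives of families of integral curves -/

section Flow

variable {n : ℕ} {F : Type*} [NormedAddCommGroup F] [NormedSpace ℝ F]

/-- The vector field on `F × F` whose integral curves are the integral curves of `V` together with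
the solutions of the linearized equation along them. -/
def tangentField (V : F → F) (p : F × F) : F × F := (V p.1, fderiv ℝ V p.1 p.2)

/-- A family of curves together with its derivative with respect to the parameter in the
direction `w`. -/
def tangentFamily (w : E n) (u : ℝ → E n → F) (s : ℝ) (x : E n) : F × F :=
  (u s x, fderiv ℝ (u s) x w)

/-- The pairs `(s, x)` for which `s x` lies in the ball of radius `r`. -/
def rayDomain (n : ℕ) (r : ℝ) : Set (ℝ × E n) := {q | q.1 • q.2 ∈ Metric.ball (0 : E n) r}

theorem isOpen_rayDomain {r : ℝ} : IsOpen (rayDomain n r) :=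
  Metric.isOpen_ball.preimage (continuous_fst.smul continuous_snd)

theorem mem_rayDomain {r s : ℝ} {x : E n} (hx : x ∈ Metric.ball (0 : E n) r)
    (hs : s ∈ Icc (0 : ℝ) 1) :
    (s, x) ∈ rayDomain n r := smul_mem_ball hx hs.1 hs.2

/-- A smooth family `u(·, x)` of integral curves of `V`, staying in `K` for times in `[0, 1]`,
whose initial value depends on `x` in an affine way with slope at most `B`. -/
structure IsFlowFamily (V : F → F) (Ω K : Set F) (B r : ℝ) (u : ℝ → E n → F) : Prop where
  smooth : ∀ q ∈ rayDomain n r, ContDiffAt ℝ ∞ (fun q : ℝ × E n => u q.1 q.2) q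
  mem : ∀ q ∈ rayDomain n r, u q.1 q.2 ∈ Ω
  ode : ∀ q ∈ rayDomain n r, HasDerivAt (fun s => u s q.2) (V (u q.1 q.2)) q.1
  mem_compact : ∀ x ∈ Metric.ball (0 : E n) r, ∀ s ∈ Icc (0 : ℝ) 1, u s x ∈ K
  initial : ∃ (c : F) (L : E n →L[ℝ] F), ‖L‖ ≤ B ∧ ∀ x, u 0 x = c + L x

theorem IsFlowFamily.fderiv_eq {V : F → F} {Ω K : Set F} {B r : ℝ} {u : ℝ → E n → F}
    (h : IsFlowFamily V Ω K B r u) {q : ℝ × E n} (hq : q ∈ rayDomain n r) (w : E n) :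
    fderiv ℝ (u q.1) q.2 w = fderiv ℝ (fun q : ℝ × E n => u q.1 q.2) q (0, w) := by
  have h1 := (contDiffAt_infty_differentiableAt (h.smooth q hq)).hasFDerivAt
  have h2 : HasFDerivAt (fun x : E n => (q.1, x)) (ContinuousLinearMap.inr ℝ ℝ (E n)) q.2 :=
    hasFDerivAt_prodMk_right q.1 q.2
  have h3 := (HasFDerivAt.comp (g := fun q : ℝ × E n => u q.1 q.2) q.2 h1 h2).fderiv
  have h4 : fderiv ℝ (u q.1) q.2 = _ := h3
  rw [h4]
  rfl

theorem IsFlowFamily.deriv_eq {V : F → F} {Ω K : Set F} {B r : ℝ} {u : ℝ → E n → F}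
    (h : IsFlowFamily V Ω K B r u) {q : ℝ × E n} (hq : q ∈ rayDomain n r) :
    fderiv ℝ (fun q : ℝ × E n => u q.1 q.2) q (1, 0) = V (u q.1 q.2) := by
  have h1 := (contDiffAt_infty_differentiableAt (h.smooth q hq)).hasFDerivAt
  have h2 : HasDerivAt (fun s : ℝ => (s, q.2)) ((1 : ℝ), (0 : E n)) q.1 :=
    (hasDerivAt_id q.1).prodMk (hasDerivAt_const q.1 q.2)
  have h3 := HasFDerivAt.comp_hasDerivAt (l := fun q : ℝ × E n => u q.1 q.2) q.1 h1 h2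
  exact h3.unique (h.ode q hq)

/-- The parameter derivative of a family of integral curves solves the linearized equation. -/
theorem IsFlowFamily.hasDerivAt_fderiv {V : F → F} {Ω K : Set F} {B r : ℝ} {u : ℝ → E n → F}
    (hV : ∀ z ∈ Ω, ContDiffAt ℝ ∞ V z)
    (h : IsFlowFamily V Ω K B r u) {q : ℝ × E n} (hq : q ∈ rayDomain n r) (w : E n) :
    HasDerivAt (fun s => fderiv ℝ (u s) q.2 w)
      (fderiv ℝ V (u q.1 q.2) (fderiv ℝ (u q.1) q.2 w)) q.1 := by
  set U : ℝ × E n → F := fun q => u q.1 q.2 with hU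
  have hsm := h.smooth q hq
  have hd2 : HasFDerivAt (fderiv ℝ U) (fderiv ℝ (fderiv ℝ U) q) q :=
    (contDiffAt_infty_differentiableAt (hsm.fderiv_right (m := ∞) (by simp))).hasFDerivAt
  -- Exchange the derivatives in time and in the parameter.
  have hsymm : IsSymmSndFDerivAt ℝ U q := hsm.isSymmSndFDerivAt (by
    simpa using (WithTop.coe_le_coe.2 le_top : ((2 : ℕ∞) : ℕ∞ω) ≤ ((⊤ : ℕ∞) : ℕ∞ω)))
  have hline : HasDerivAt (fun s : ℝ => (s, q.2)) ((1 : ℝ), (0 : E n)) q.1 :=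
    (hasDerivAt_id q.1).prodMk (hasDerivAt_const q.1 q.2)
  have h1 : HasDerivAt (fun s => fderiv ℝ U (s, q.2) (0, w))
      (fderiv ℝ (fderiv ℝ U) q (1, 0) (0, w)) q.1 := by
    have := HasFDerivAt.comp_hasDerivAt (l := fderiv ℝ U) q.1 hd2 hline
    exact ((ContinuousLinearMap.apply ℝ F ((0 : ℝ), w)).hasFDerivAt).comp_hasDerivAt q.1 this
  have h2 : fderiv ℝ (fderiv ℝ U) q (0, w) (1, 0)
      = fderiv ℝ V (u q.1 q.2) (fderiv ℝ (u q.1) q.2 w) := by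
    have e1 : HasFDerivAt (fun q => fderiv ℝ U q (1, 0))
        ((ContinuousLinearMap.apply ℝ F ((1 : ℝ), (0 : E n))).comp (fderiv ℝ (fderiv ℝ U) q)) q :=
      ((ContinuousLinearMap.apply ℝ F ((1 : ℝ), (0 : E n))).hasFDerivAt).comp q hd2
    have e2 : HasFDerivAt (fun q => V (U q)) ((fderiv ℝ V (U q)).comp (fderiv ℝ U q)) q :=
      ((contDiffAt_infty_differentiableAt (hV _ (h.mem q hq))).hasFDerivAt).comp q
        (contDiffAt_infty_differentiableAt hsm).hasFDerivAt
    have e3 : HasFDerivAt (fun q => fderiv ℝ U q (1, 0))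
        ((fderiv ℝ V (U q)).comp (fderiv ℝ U q)) q := by
      refine e2.congr_of_eventuallyEq ?_
      filter_upwards [isOpen_rayDomain.mem_nhds hq] with q' hq' using h.deriv_eq hq'
    have := DFunLike.congr_fun (e1.unique e3) (0, w)
    rw [h.fderiv_eq hq]
    exact this
  rw [← h2, hsymm.eq]
  refine h1.congr_of_eventuallyEq ?_
  have : ∀ᶠ s in 𝓝 q.1, (s, q.2) ∈ rayDomain n r :=
    hline.continuousAt.eventually (isOpen_rayDomain.mem_nhds hq)
  filter_upwards [this] with s hs using h.fderiv_eq hs w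

theorem contDiffAt_tangentField {V : F → F} {p : F × F} (hV : ContDiffAt ℝ ∞ V p.1) :
    ContDiffAt ℝ ∞ (tangentField V) p :=
  (hV.comp p contDiffAt_fst).prodMk
    (((hV.fderiv_right (m := ∞) (by simp)).comp p contDiffAt_fst).clm_apply contDiffAt_snd)

/-- Linearization preserves families of integral curves with bounds: by Gronwall's inequality the
solutions of the linearized equation stay in a compact set which depends only on `V`, `K`, `B`. -/
theorem exists_isFlowFamily_tangent [FiniteDimensional ℝ F] {V : F → F} {Ω K : Set F} {B : ℝ}
    (hV : ∀ z ∈ Ω, ContDiffAt ℝ ∞ V z) (hK : IsCompact K) (hKΩ : K ⊆ Ω)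
    (hB : 0 ≤ B) :
    ∃ B', B ≤ B' ∧ ∀ (r : ℝ) (u : ℝ → E n → F), 0 < r → IsFlowFamily V Ω K B r u →
      ∀ w : E n, ‖w‖ ≤ 1 →
        IsFlowFamily (tangentField V) (Ω ×ˢ univ) (K ×ˢ Metric.closedBall (0 : F) B') B r
          (tangentFamily w u) := by
  have hcont : ContinuousOn (fun z => ‖fderiv ℝ V z‖) K := fun z hz =>
    (((hV z (hKΩ hz)).fderiv_right (m := ∞) (by simp)).continuousAt.norm).continuousWithinAt
  -- On `K` the linearized equation has coefficients bounded by `L`, so its solutions grow at most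
  -- by the factor `exp L` up to time one.
  obtain ⟨L, hL⟩ := hK.bddAbove_image hcont
  have hL' : ∀ z ∈ K, ‖fderiv ℝ V z‖ ≤ |L| := fun z hz =>
    (hL (mem_image_of_mem _ hz)).trans (le_abs_self L)
  refine ⟨B * Real.exp |L|, le_mul_of_one_le_right hB (Real.one_le_exp (abs_nonneg _)), ?_⟩
  intro r u hr h w hw
  obtain ⟨c, A, hA, hinit⟩ := h.initial
  have h0 : ∀ x, fderiv ℝ (u 0) x w = A w := by
    intro x
    rw [show u 0 = fun x => c + A x from funext hinit, fderiv_const_add, A.fderiv]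
  refine ⟨fun q hq => ?_, fun q hq => ⟨h.mem q hq, mem_univ _⟩, fun q hq => ?_,
    fun x hx s hs => ⟨h.mem_compact x hx s hs, ?_⟩, ?_⟩
  · refine (h.smooth q hq).prodMk ?_
    have : ContDiffAt ℝ ∞ (fun q => fderiv ℝ (fun q : ℝ × E n => u q.1 q.2) q (0, w)) q :=
      ((h.smooth q hq).fderiv_right (m := ∞) (by simp)).clm_apply contDiffAt_const
    refine this.congr_of_eventuallyEq ?_
    filter_upwards [isOpen_rayDomain.mem_nhds hq] with q' hq' using h.fderiv_eq hq' w
  · exact (h.ode q hq).prodMk (h.hasDerivAt_fderiv hV hq w)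
  · rw [mem_closedBall_zero_iff]
    have hder : ∀ s ∈ Icc (0 : ℝ) 1, HasDerivAt (fun s => fderiv ℝ (u s) x w)
        (fderiv ℝ V (u s x) (fderiv ℝ (u s) x w)) s := fun s hs =>
      h.hasDerivAt_fderiv hV (q := (s, x)) (mem_rayDomain hx hs) w
    have := norm_le_gronwallBound_of_norm_deriv_right_le (δ := B) (K := |L|) (ε := 0)
      (f := fun s => fderiv ℝ (u s) x w) (fun s hs => (hder s hs).continuousAt.continuousWithinAt)
      (fun s hs => (hder s (Ico_subset_Icc_self hs)).hasDerivWithinAt) (by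
        rw [h0]
        exact (A.le_opNorm_of_le hw).trans (by linarith))
      (fun s hs => by
        rw [add_zero]
        exact (ContinuousLinearMap.le_opNorm _ _).trans (mul_le_mul_of_nonneg_right
          (hL' _ (h.mem_compact x hx s (Ico_subset_Icc_self hs))) (norm_nonneg _))) s hs
    rw [gronwallBound_ε0] at this
    refine this.trans (mul_le_mul_of_nonneg_left (Real.exp_le_exp.2 ?_) hB)
    rw [sub_zero]
    exact mul_le_of_le_one_right (abs_nonneg _) hs.2
  · refine ⟨(c, A w), A.prod 0, ?_, fun x => ?_⟩
    · refine ContinuousLinearMap.opNorm_le_bound _ ((norm_nonneg _).trans hA) fun x => ?_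
      have := A.le_of_opNorm_le hA x
      simp only [ContinuousLinearMap.prod_apply, zero_apply, Prod.norm_def,
        norm_zero]
      exact max_le this ((norm_nonneg _).trans this)
    · simp [tangentFamily, hinit x, h0 x]

end Flow

/-! ### The transition map between normal charts with nearby centres -/

section Geodesic

variable {n : ℕ}

theorem sum_comm₄ (f : Fin n → Fin n → Fin n → Fin n → ℝ) :
    ∑ a, ∑ b, ∑ c, ∑ d, f a b c d = ∑ c, ∑ d, ∑ a, ∑ b, f a b c d := by
  have h : ∀ a, ∑ b, ∑ c, ∑ d, f a b c d = ∑ c, ∑ d, ∑ b, f a b c d := fun a => by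
    rw [Finset.sum_comm]
    exact Finset.sum_congr rfl fun c _ => Finset.sum_comm
  simp only [h]
  rw [Finset.sum_comm]
  exact Finset.sum_congr rfl fun c _ => Finset.sum_comm

theorem IsRadialMetric.radial_ray {G : E n → Mat n} {r : ℝ} (h : IsRadialMetric G r) {x : E n}
    {s : ℝ} (hx : s • x ∈ Metric.ball (0 : E n) r) (k : Fin n) :
    ∑ i, ∑ j, christoffel G (s • x) k i j * x i * x j = 0 := by
  have hne : ∀ t : ℝ, t ≠ 0 → t • x ∈ Metric.ball (0 : E n) r →
      ∑ i, ∑ j, christoffel G (t • x) k i j * x i * x j = 0 := by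
    intro t ht hm
    have h1 := h.radial _ hm k
    have h2 : ∑ i, ∑ j, christoffel G (t • x) k i j * (t • x) i * (t • x) j
        = t ^ 2 * ∑ i, ∑ j, christoffel G (t • x) k i j * x i * x j := by
      simp only [Finset.mul_sum, PiLp.smul_apply, smul_eq_mul]
      exact Finset.sum_congr rfl fun i _ => Finset.sum_congr rfl fun j _ => by ring
    rw [h2] at h1
    exact (mul_eq_zero.1 h1).resolve_left (pow_ne_zero _ ht)
  rcases eq_or_ne s 0 with rfl | hs
  · have hc : ContinuousAt (fun t : ℝ => ∑ i, ∑ j, christoffel G (t • x) k i j * x i * x j) 0 := by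
      refine tendsto_finsetSum _ fun i _ => tendsto_finsetSum _ fun j _ => ?_
      have h1 := ((h.metric _ hx).smooth_christoffel k i j).continuousAt
      have h2 : ContinuousAt (fun t : ℝ => t • x) 0 := by fun_prop
      exact ((ContinuousAt.comp (f := fun t : ℝ => t • x) h1 h2).mul continuousAt_const).mul
        continuousAt_const
    have h0 : ∀ᶠ t in 𝓝[≠] (0 : ℝ), ∑ i, ∑ j, christoffel G (t • x) k i j * x i * x j = 0 := by
      have h2 : ContinuousAt (fun t : ℝ => t • x) 0 := by fun_prop
      filter_upwards [self_mem_nhdsWithin, nhdsWithin_le_nhds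
        (h2.eventually (Metric.isOpen_ball.mem_nhds hx))] with t ht ht' using hne t ht ht'
    exact tendsto_nhds_unique (hc.tendsto.mono_left nhdsWithin_le_nhds)
      (tendsto_const_nhds.congr' (h0.mono fun t ht => ht.symm))
  · exact hne s hs hx

/-- The vector field of the geodesic equation `z'' = -Γ(z)(z', z')`. -/
def geodesicField (G : E n → Mat n) (p : E n × E n) : E n × E n :=
  (p.2, WithLp.toLp 2 fun k => -∑ i, ∑ j, christoffel G p.1 k i j * p.2 i * p.2 j)

theorem contDiffAt_geodesicField {G : E n → Mat n} {p : E n × E n} (h : IsMetricAt G p.1) :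
    ContDiffAt ℝ ∞ (geodesicField G) p := by
  refine contDiffAt_snd.prodMk ?_
  rw [contDiffAt_piLp]
  intro k
  have hco : ∀ i : Fin n, ContDiffAt ℝ ∞ (fun p : E n × E n => p.2 i) p := fun i =>
    (EuclideanSpace.proj i : E n →L[ℝ] ℝ).contDiff.contDiffAt.comp p contDiffAt_snd
  refine ContDiffAt.neg (ContDiffAt.sum fun i _ => ContDiffAt.sum fun j _ => ?_)
  exact (((h.smooth_christoffel k i j).comp p contDiffAt_fst).mul (hco i)).mul (hco j)

variable {M : Type*} [TopologicalSpace M] [ChartedSpace (E n) M] [IsManifold (𝓡 n) ∞ M]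
  {g : Metric n M} {y y₀ : M} {r₀ : ℝ} {e e₀ : OpenPartialHomeomorph M (E n)}

/-- Images of rays under the exponential map are geodesics, in any chart. -/
theorem IsNormalChart.hasDerivAt_geodesic (h : IsNormalChart g y 1 e)
    (he₀ : e₀ ∈ smoothCharts n M) {x : E n} {s : ℝ} (hx : s • x ∈ overlap e e₀) :
    HasDerivAt (fun s : ℝ => (transition e e₀ (s • x), fderiv ℝ (transition e e₀) (s • x) x))
      (geodesicField (gram g e₀)
        (transition e e₀ (s • x), fderiv ℝ (transition e e₀) (s • x) x)) s := by
  have he := h.mem_maximalAtlas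
  set z := s • x with hz
  have hline : HasDerivAt (fun s : ℝ => s • x) x s := by
    simpa using (hasDerivAt_id s).smul_const x
  have h1 : HasDerivAt (fun s : ℝ => transition e e₀ (s • x)) (fderiv ℝ (transition e e₀) z x) s :=
    HasFDerivAt.comp_hasDerivAt (l := transition e e₀) s (hasFDerivAt_transition he he₀ hx) hline
  refine h1.prodMk ?_
  have hd2 : HasFDerivAt (fderiv ℝ (transition e e₀)) (fderiv ℝ (fderiv ℝ (transition e e₀)) z) z :=
    (contDiffAt_infty_differentiableAt
      ((contDiffAt_transition he he₀ hx).fderiv_right (m := ∞) (by simp))).hasFDerivAt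
  have h4 : HasDerivAt (fun s : ℝ => fderiv ℝ (transition e e₀) (s • x) x)
      (fderiv ℝ (fderiv ℝ (transition e e₀)) z x x) s :=
    ((ContinuousLinearMap.apply ℝ (E n) x).hasFDerivAt).comp_hasDerivAt s
      (HasFDerivAt.comp_hasDerivAt (l := fderiv ℝ (transition e e₀)) s hd2 hline)
  refine h4.congr_deriv ?_
  ext b
  have hJ := contDiffAt_jac he he₀ hx
  have h2 : HasDerivAt (fun s : ℝ => ∑ i, x i * jac e e₀ (s • x) i b)
      (∑ i, x i * ∑ k, x k * pd k (jac e e₀) z i b) s := by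
    refine HasDerivAt.fun_sum fun i _ => HasDerivAt.const_mul _ ?_
    have := hasDerivAt_ray (x := x) (s := s)
      (contDiffAt_infty_differentiableAt (hJ.matrix_entry i b))
    have hJ' : DifferentiableAt ℝ (jac e e₀) (s • x) := contDiffAt_infty_differentiableAt hJ
    simp only [pd_entry hJ', smul_eq_mul] at this
    exact this
  -- The transformation law of the connection turns the derivative of the Jacobian into
  -- Christoffel symbols of the two charts.
  have h3 : ∑ i, x i * ∑ k, x k * pd k (jac e e₀) z i b
      = -∑ a, ∑ c, christoffel (gram g e₀) (transition e e₀ z) b a c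
          * (fderiv ℝ (transition e e₀) z x) a * (fderiv ℝ (transition e e₀) z x) c := by
    have hc : ∀ k i, pd k (jac e e₀) z i b = (∑ β, conn (gram g e) k z i β * jac e e₀ z β b)
        - ∑ a, jac e e₀ z i a * ∑ c, jac e e₀ z k c
            * conn (gram g e₀) c (transition e e₀ z) a b := by
      intro k i
      have := congrFun (congrFun (conn_mul_jac g he he₀ hx k) i) b
      simp only [Matrix.add_apply, Matrix.mul_apply, Matrix.sum_apply, Matrix.smul_apply,
        smul_eq_mul] at this
      linarith
    -- Those of the first chart drop out, because its rays are geodesics.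
    have hrad : ∑ i, x i * ∑ k, x k * ∑ β, conn (gram g e) k z i β * jac e e₀ z β b = 0 := by
      calc ∑ i, x i * ∑ k, x k * ∑ β, conn (gram g e) k z i β * jac e e₀ z β b
          = ∑ β, jac e e₀ z β b * ∑ i, ∑ k, christoffel (gram g e) (s • x) β i k * x i * x k := by
            simp only [Finset.mul_sum]
            rw [Finset.sum_congr rfl fun i _ => Finset.sum_comm, Finset.sum_comm]
            refine Finset.sum_congr rfl fun β _ => Finset.sum_congr rfl fun i _ =>
              Finset.sum_congr rfl fun k _ => ?_
            rw [conn_apply, hz]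
            ring
        _ = 0 := by
          refine Finset.sum_eq_zero fun β _ => ?_
          rw [h.isRadialMetric.radial_ray (by rw [← h.target_eq]; exact hx.1), mul_zero]
    simp only [hc, mul_sub, Finset.sum_sub_distrib, hrad, zero_sub]
    congr 1
    simp only [fderiv_transition_apply, conn_apply, Finset.mul_sum, Finset.sum_mul]
    rw [sum_comm₄]
    refine Finset.sum_congr rfl fun a _ => Finset.sum_congr rfl fun c _ => ?_
    rw [Finset.sum_comm]
    refine Finset.sum_congr rfl fun i _ => Finset.sum_congr rfl fun k _ => ?_
    ring
  rw [h3] at h2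
  have h5 : HasDerivAt (fun s : ℝ => ∑ i, x i * jac e e₀ (s • x) i b)
      (fderiv ℝ (fderiv ℝ (transition e e₀)) z x x b) s := by
    have := ((EuclideanSpace.proj b : E n →L[ℝ] ℝ).hasFDerivAt).comp_hasDerivAt s h4
    refine this.congr_of_eventuallyEq (Eventually.of_forall fun t => ?_)
    exact (fderiv_transition_apply _ _).symm
  exact h5.unique h2

end Geodesic

section Containment

variable {n : ℕ} {M : Type*} [TopologicalSpace M] [ChartedSpace (E n) M] [IsManifold (𝓡 n) ∞ M]
  {g : Metric n M} {y y₀ : M} {r₀ : ℝ} {e e₀ : OpenPartialHomeomorph M (E n)}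

theorem dotProduct_gram (he : e ∈ smoothCharts n M) (he₀ : e₀ ∈ smoothCharts n M) {z : E n}
    (hz : z ∈ overlap e e₀) (u : E n) : u.ofLp ⬝ᵥ (gram g e z).mulVec u.ofLp
      = (fderiv ℝ (transition e e₀) z u).ofLp ⬝ᵥ
        (gram g e₀ (transition e e₀ z)).mulVec (fderiv ℝ (transition e e₀) z u).ofLp := by
  have hv : (fderiv ℝ (transition e e₀) z u).ofLp = (jac e e₀ z).transpose.mulVec u.ofLp := by
    funext a
    rw [fderiv_transition_apply]
    simp only [Matrix.mulVec, dotProduct, Matrix.transpose_apply]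
    exact Finset.sum_congr rfl fun i _ => mul_comm _ _
  rw [gram_eq_jac g he he₀ hz, hv, ← Matrix.mulVec_mulVec, ← Matrix.mulVec_mulVec,
    Matrix.dotProduct_mulVec, ← Matrix.mulVec_transpose]

theorem IsRadialMetric.mulVec_ray {G : E n → Mat n} {r : ℝ} (h : IsRadialMetric G r) {x : E n}
    {s : ℝ} (hx : s • x ∈ Metric.ball (0 : E n) r) : (G (s • x)).mulVec x.ofLp = x.ofLp := by
  rcases eq_or_ne s 0 with rfl | hs
  · rw [zero_smul, h.zero, Matrix.one_mulVec]
  · have h1 := h.gauss hx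
    rw [WithLp.ofLp_smul, Matrix.mulVec_smul] at h1
    exact smul_right_injective _ hs h1

/-- Geodesics of the first chart issuing from the centre have constant speed in the second. -/
theorem IsNormalChart.speed (h : IsNormalChart g y 1 e) (he₀ : e₀ ∈ smoothCharts n M) {x : E n}
    {s : ℝ} (hx : s • x ∈ overlap e e₀) :
    (fderiv ℝ (transition e e₀) (s • x) x).ofLp ⬝ᵥ (gram g e₀ (transition e e₀ (s • x))).mulVec
      (fderiv ℝ (transition e e₀) (s • x) x).ofLp = ‖x‖ ^ 2 := by
  rw [← dotProduct_gram h.mem_maximalAtlas he₀ hx,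
    h.isRadialMetric.mulVec_ray (by rw [← h.target_eq]; exact hx.1), dotProduct_self_eq_norm_sq]

theorem IsNormalChart.abs_inner_le (h : IsNormalChart g y 1 e) (h₀ : IsNormalChart g y₀ r₀ e₀)
    {x : E n} {s : ℝ} (hx : s • x ∈ overlap e e₀) :
    inner ℝ (transition e e₀ (s • x)) (fderiv ℝ (transition e e₀) (s • x) x)
      ≤ ‖transition e e₀ (s • x)‖ * ‖x‖ := by
  set c := transition e e₀ (s • x) with hc
  set v := fderiv ℝ (transition e e₀) (s • x) x with hv
  have hct : c ∈ Metric.ball (0 : E n) r₀ := by rw [← h₀.target_eq]; exact transition_mem hx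
  have hm := h₀.isRadialMetric.metric c hct
  have hcs := posSemidef_cauchy_schwarz hm.self.posSemidef c.ofLp v.ofLp
  rw [h.speed h₀.mem_maximalAtlas hx, h₀.isRadialMetric.gauss hct, dotProduct_self_eq_norm_sq,
    Matrix.dotProduct_mulVec, ← Matrix.mulVec_transpose, hm.transpose,
    h₀.isRadialMetric.gauss hct] at hcs
  have hin : inner ℝ c v = c.ofLp ⬝ᵥ v.ofLp := by
    rw [PiLp.inner_apply, dotProduct]
    exact Finset.sum_congr rfl fun i _ => by simp [mul_comm]
  rw [hin]
  rw [← mul_pow] at hcs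
  exact abs_le_of_sq_le_sq' hcs (by positivity) |>.2

/-- The unit geodesic ball around a point close to `y₀` stays in a normal chart at `y₀` of radius
larger than one. -/
theorem IsNormalChart.mem_overlap [T2Space M] (h : IsNormalChart g y 1 e)
    (h₀ : IsNormalChart g y₀ r₀ e₀) (hy : y ∈ e₀.source) {δ : ℝ} (hδ : 0 < δ)
    (hr : Real.sqrt (‖e₀ y‖ ^ 2 + δ ^ 2) + 1 < r₀) {x : E n} (hx : x ∈ Metric.ball (0 : E n) 1) :
    x ∈ overlap e e₀ ∧ ‖transition e e₀ x‖ ≤ Real.sqrt (‖e₀ y‖ ^ 2 + δ ^ 2) + 1 := by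
  have hx1 : ‖x‖ ≤ 1 := (mem_ball_zero_iff.1 hx).le
  set a := Real.sqrt (‖e₀ y‖ ^ 2 + δ ^ 2) with ha
  -- A smooth substitute for the norm, with `δ` making it differentiable at the origin.
  set q : ℝ → ℝ := fun s => Real.sqrt (‖transition e e₀ (s • x)‖ ^ 2 + δ ^ 2) with hq
  -- A continuity argument: the set `S` of good parameters contains `0`, is closed in `[0, 1]`,
  -- and contains a right neighbourhood of each of its points.
  set S : Set ℝ := {s | s • x ∈ overlap e e₀ ∧ q s ≤ a + s * ‖x‖} with hS
  have htarget : ∀ s ∈ Icc (0 : ℝ) 1, s • x ∈ e.target := fun s hs => by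
    rw [h.target_eq]; exact smul_mem_ball hx hs.1 hs.2
  have hnorm : ∀ s, ‖transition e e₀ (s • x)‖ ≤ q s := fun s =>
    Real.le_sqrt_of_sq_le (by nlinarith)
  have hψ : ∀ s, s • x ∈ overlap e e₀ → ContinuousAt (fun s : ℝ => transition e e₀ (s • x)) s := by
    intro s hs
    have h1 : ContinuousAt (fun s : ℝ => s • x) s := by fun_prop
    exact ContinuousAt.comp (f := fun s : ℝ => s • x)
      (hasFDerivAt_transition h.mem_maximalAtlas h₀.mem_maximalAtlas hs).continuousAt h1
  have hqc : ∀ s, s • x ∈ overlap e e₀ → ContinuousAt q s := fun s hs =>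
    (((hψ s hs).norm.pow 2).add continuousAt_const).sqrt
  -- By the Gauss lemma in the second chart and constancy of speed, the distance to `y₀` grows at
  -- most with slope `|x|`.
  have hqd : ∀ s, s • x ∈ overlap e e₀ → DifferentiableAt ℝ q s ∧ deriv q s ≤ ‖x‖ := by
    intro s hs
    have hline : HasDerivAt (fun s : ℝ => s • x) x s := by
      simpa using (hasDerivAt_id s).smul_const x
    have h1 : HasDerivAt (fun s : ℝ => transition e e₀ (s • x))
        (fderiv ℝ (transition e e₀) (s • x) x) s :=
      HasFDerivAt.comp_hasDerivAt (l := transition e e₀) s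
        (hasFDerivAt_transition h.mem_maximalAtlas h₀.mem_maximalAtlas hs) hline
    have hpos : 0 < ‖transition e e₀ (s • x)‖ ^ 2 + δ ^ 2 := by positivity
    have h2 := (h1.norm_sq.add_const (δ ^ 2)).sqrt hpos.ne'
    refine ⟨h2.differentiableAt, ?_⟩
    rw [h2.deriv, div_le_iff₀ (by positivity)]
    have h3 := h.abs_inner_le h₀ hs
    have h4 := mul_le_mul_of_nonneg_right (hnorm s) (norm_nonneg x)
    have h5 : q s = Real.sqrt (‖transition e e₀ (s • x)‖ ^ 2 + δ ^ 2) := rfl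
    rw [← h5]
    linarith
  -- For `s ∈ S` the point lies in the image of a fixed compact ball, which is closed in `M`; so
  -- the curve cannot leave the second chart at a limit of `S`.
  have hclosed : IsClosed (S ∩ Icc 0 1) := by
    have hK : IsCompact (e₀.symm '' Metric.closedBall (0 : E n) (a + 1)) := by
      refine (isCompact_closedBall _ _).image_of_continuousOn (e₀.continuousOn_symm.mono ?_)
      rw [h₀.target_eq]
      exact Metric.closedBall_subset_ball hr
    have hc1 : ContinuousOn (fun s : ℝ => e.symm (s • x)) (Icc 0 1) :=
      e.continuousOn_symm.comp (by fun_prop) fun s hs => htarget s hs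
    have hcl1 := hc1.preimage_isClosed_of_isClosed isClosed_Icc hK.isClosed
    have hsub : ∀ s ∈ Icc (0 : ℝ) 1 ∩ (fun s : ℝ => e.symm (s • x)) ⁻¹'
        (e₀.symm '' Metric.closedBall (0 : E n) (a + 1)), s • x ∈ overlap e e₀ := by
      rintro s ⟨hs, z, hz, hz'⟩
      refine ⟨htarget s hs, ?_⟩
      change e.symm (s • x) ∈ e₀.source
      rw [show e.symm (s • x) = e₀.symm z from hz'.symm]
      exact e₀.map_target (by rw [h₀.target_eq]; exact Metric.closedBall_subset_ball hr hz)
    have hc2 : ContinuousOn (fun s => q s - s * ‖x‖) (Icc (0 : ℝ) 1 ∩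
        (fun s : ℝ => e.symm (s • x)) ⁻¹' (e₀.symm '' Metric.closedBall (0 : E n) (a + 1))) :=
      fun s hs => ((hqc s (hsub s hs)).sub (by fun_prop)).continuousWithinAt
    have hcl2 := hc2.preimage_isClosed_of_isClosed hcl1 (isClosed_Iic (a := a))
    convert hcl2 using 1
    ext s
    constructor
    · rintro ⟨⟨h1, h2⟩, h3⟩
      refine ⟨⟨h3, transition e e₀ (s • x), ?_, symm_transition h1⟩, ?_⟩
      · rw [mem_closedBall_zero_iff]
        have := hnorm s
        have : s * ‖x‖ ≤ 1 := mul_le_one₀ h3.2 (norm_nonneg x) hx1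
        linarith
      · simp only [mem_preimage, mem_Iic]
        linarith
    · rintro ⟨h1, h2⟩
      simp only [mem_preimage, mem_Iic] at h2
      exact ⟨⟨hsub s h1, by linarith⟩, h1.1⟩
  have h0 : e.symm 0 = y := by rw [← h.map_center, e.left_inv h.mem_source]
  have h0S : (0 : ℝ) ∈ S := by
    refine ⟨⟨htarget 0 ⟨le_rfl, zero_le_one⟩, ?_⟩, ?_⟩
    · simpa [h0] using hy
    · simp [hq, ha, transition, h0]
  have hstep : ∀ s ∈ S ∩ Ico 0 1, S ∈ 𝓝[>] s := by
    rintro s ⟨⟨h1, h2⟩, h3⟩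
    have hc : ContinuousAt (fun s : ℝ => s • x) s := by fun_prop
    obtain ⟨ε, hε, hball⟩ := Metric.mem_nhds_iff.1 (hc.preimage_mem_nhds
      (isOpen_overlap.mem_nhds h1))
    filter_upwards [Ioo_mem_nhdsGT (show s < s + ε by linarith)] with t ht
    have hov : ∀ t' ∈ Icc s t, t' • x ∈ overlap e e₀ := fun t' ht' => by
      refine hball ?_
      rw [Real.ball_eq_Ioo]
      exact ⟨by linarith [ht'.1], by linarith [ht'.2, ht.2]⟩
    have hmv := (convex_Icc s t).image_sub_le_mul_sub_of_deriv_le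
      (fun t' ht' => (hqc t' (hov t' ht')).continuousWithinAt)
      (fun t' ht' => (hqd t' (hov t' (interior_subset ht'))).1.differentiableWithinAt)
      (fun t' ht' => (hqd t' (hov t' (interior_subset ht'))).2) s ⟨le_rfl, ht.1.le⟩ t
      ⟨ht.1.le, le_rfl⟩ ht.1.le
    refine ⟨hov t ⟨ht.1.le, le_rfl⟩, ?_⟩
    nlinarith
  have := hclosed.Icc_subset_of_forall_mem_nhdsWithin h0S hstep ⟨zero_le_one, le_rfl⟩
  obtain ⟨h1, h2⟩ := this
  rw [one_smul] at h1
  refine ⟨h1, ?_⟩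
  have := hnorm 1
  rw [one_smul] at this
  linarith

end Containment

section QuadraticForms

variable {n : ℕ}

theorem abs_entry_le_norm (A : Mat n) (i j : Fin n) : |A i j| ≤ ‖A‖ := by
  rw [Matrix.frobenius_norm_def, ← Real.sqrt_eq_rpow]
  refine Real.le_sqrt_of_sq_le ?_
  have h1 : ∑ j', ‖A i j'‖ ^ (2 : ℝ) ≤ ∑ i', ∑ j', ‖A i' j'‖ ^ (2 : ℝ) :=
    Finset.single_le_sum (f := fun i' => ∑ j', ‖A i' j'‖ ^ (2 : ℝ))
      (fun i' _ => Finset.sum_nonneg fun j' _ => by positivity) (Finset.mem_univ i)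
  have h2 : ‖A i j‖ ^ (2 : ℝ) ≤ ∑ j', ‖A i j'‖ ^ (2 : ℝ) :=
    Finset.single_le_sum (f := fun j' => ‖A i j'‖ ^ (2 : ℝ))
      (fun j' _ => by positivity) (Finset.mem_univ j)
  have h3 : ‖A i j‖ ^ (2 : ℝ) = |A i j| ^ 2 := by
    rw [Real.norm_eq_abs, Real.rpow_two]
  linarith

theorem norm_sq_eq_sum (A : Mat n) : ‖A‖ ^ 2 = ∑ i, ∑ j, A i j ^ 2 := by
  rw [Matrix.frobenius_norm_def, ← Real.sqrt_eq_rpow, Real.sq_sqrt (by positivity)]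
  simp

theorem norm_toLp_mulVec_le (A : Mat n) (v : E n) :
    ‖(WithLp.toLp 2 (A.mulVec v.ofLp) : E n)‖ ≤ ‖A‖ * ‖v‖ := by
  refine abs_le_of_sq_le_sq' ?_ (by positivity) |>.2
  rw [mul_pow, norm_sq_eq_sum, EuclideanSpace.norm_sq_eq, EuclideanSpace.norm_sq_eq,
    Finset.sum_mul]
  refine Finset.sum_le_sum fun i _ => ?_
  simp only [Real.norm_eq_abs, sq_abs, Matrix.mulVec, dotProduct]
  exact Finset.sum_mul_sq_le_sq_mul_sq _ _ _

theorem dotProduct_le_norm_mul_norm (v w : E n) : v.ofLp ⬝ᵥ w.ofLp ≤ ‖v‖ * ‖w‖ := by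
  refine abs_le_of_sq_le_sq' ?_ (by positivity) |>.2
  rw [mul_pow, EuclideanSpace.norm_sq_eq, EuclideanSpace.norm_sq_eq]
  simpa [dotProduct] using Finset.sum_mul_sq_le_sq_mul_sq Finset.univ v.ofLp w.ofLp

theorem dotProduct_mulVec_le (A : Mat n) (v : E n) :
    v.ofLp ⬝ᵥ A.mulVec v.ofLp ≤ ‖A‖ * ‖v‖ ^ 2 := by
  have h1 := dotProduct_le_norm_mul_norm v (WithLp.toLp 2 (A.mulVec v.ofLp))
  have h2 := mul_le_mul_of_nonneg_left (norm_toLp_mulVec_le A v) (norm_nonneg v)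
  refine h1.trans (h2.trans (le_of_eq (by ring)))

/-- A positive definite matrix is bounded below by the inverse of the norm of its inverse. -/
theorem norm_sq_le_of_posDef {S : Mat n} (hS : S.PosDef) (v : E n) :
    ‖v‖ ^ 2 ≤ ‖S⁻¹‖ * (v.ofLp ⬝ᵥ S.mulVec v.ofLp) := by
  have hu : IsUnit S.det := (Matrix.isUnit_iff_isUnit_det _).1 hS.isUnit
  set u := S⁻¹.mulVec v.ofLp with hu'
  have hSu : S.mulVec u = v.ofLp := by
    rw [hu', Matrix.mulVec_mulVec, Matrix.mul_nonsing_inv _ hu, Matrix.one_mulVec]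
  have h1 := posSemidef_cauchy_schwarz hS.posSemidef v.ofLp u
  rw [hSu, dotProduct_self_eq_norm_sq, dotProduct_comm u, hu'] at h1
  have h2 := dotProduct_mulVec_le S⁻¹ v
  have h3 : 0 ≤ v.ofLp ⬝ᵥ S.mulVec v.ofLp := by
    simpa using hS.posSemidef.dotProduct_mulVec_nonneg v.ofLp
  rcases (norm_nonneg v).eq_or_lt with h0 | h0
  · rw [← h0]; simpa using mul_nonneg (norm_nonneg S⁻¹) h3
  · have h4 : (‖v‖ ^ 2) ^ 2 ≤ (v.ofLp ⬝ᵥ S.mulVec v.ofLp) * (‖S⁻¹‖ * ‖v‖ ^ 2) :=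
      h1.trans (mul_le_mul_of_nonneg_left h2 h3)
    have h5 : 0 < ‖v‖ ^ 2 := by positivity
    nlinarith

/-- A lower bound for a positive definite form bounds the inverse matrix. -/
theorem abs_inv_le_of_posDef {S : Mat n} (hS : S.PosDef) {c : ℝ} (hc : 0 < c)
    (h : ∀ v : E n, c * ‖v‖ ^ 2 ≤ v.ofLp ⬝ᵥ S.mulVec v.ofLp) (i j : Fin n) :
    |S⁻¹ i j| ≤ 1 / c := by
  have hu : IsUnit S.det := (Matrix.isUnit_iff_isUnit_det _).1 hS.isUnit
  set v : E n := EuclideanSpace.single j 1 with hv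
  set u : E n := WithLp.toLp 2 (S⁻¹.mulVec v.ofLp) with hu'
  have hSu : S.mulVec u.ofLp = v.ofLp := by
    rw [hu', Matrix.mulVec_mulVec, Matrix.mul_nonsing_inv _ hu, Matrix.one_mulVec]
  have h1 := h u
  rw [hSu] at h1
  have h2 := dotProduct_le_norm_mul_norm u v
  have hv1 : ‖v‖ = 1 := by simp [hv]
  have h3 : ‖u‖ ≤ 1 / c := by
    rw [le_div_iff₀ hc]
    rcases (norm_nonneg u).eq_or_lt with h0 | h0
    · rw [← h0]; simp
    · rw [hv1] at h2; nlinarith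
  have h4 : u i = S⁻¹ i j := by
    simp [hu', hv]
  rw [← h4]
  exact (PiLp.norm_apply_le u i).trans h3

end QuadraticForms

/-! ### Uniform bounds for the metric in normal coordinates -/

section Bounds

variable {n : ℕ}

/-- Bounds for a metric on the unit ball, its inverse and its first two derivatives. -/
structure HasBoundedGeometry (G : E n → Mat n) (K : ℝ) : Prop where
  entry : ∀ x ∈ Metric.ball (0 : E n) 1, ∀ i j, |G x i j| ≤ K
  inv : ∀ x ∈ Metric.ball (0 : E n) 1, ∀ i j, |(G x)⁻¹ i j| ≤ K
  pd_entry : ∀ x ∈ Metric.ball (0 : E n) 1, ∀ i j k, |pd k (fun z => G z i j) x| ≤ K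
  pd_pd_entry : ∀ x ∈ Metric.ball (0 : E n) 1, ∀ i j k l,
    |pd l (pd k (fun z => G z i j)) x| ≤ K

theorem HasBoundedGeometry.mono {G : E n → Mat n} {K K' : ℝ} (h : HasBoundedGeometry G K)
    (hK : K ≤ K') : HasBoundedGeometry G K' :=
  ⟨fun x hx i j => (h.entry x hx i j).trans hK, fun x hx i j => (h.inv x hx i j).trans hK,
    fun x hx i j k => (h.pd_entry x hx i j k).trans hK,
    fun x hx i j k l => (h.pd_pd_entry x hx i j k l).trans hK⟩

section FlowBounds

variable {F : Type*} [NormedAddCommGroup F] [NormedSpace ℝ F]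

theorem IsFlowFamily.differentiableAt_one {V : F → F} {Ω K : Set F} {B : ℝ} {u : ℝ → E n → F}
    (h : IsFlowFamily V Ω K B 1 u) {x : E n} (hx : x ∈ Metric.ball (0 : E n) 1) :
    DifferentiableAt ℝ (u 1) x := by
  have h1 := contDiffAt_infty_differentiableAt (h.smooth (1, x) (by simpa [rayDomain] using hx))
  have h2 : DifferentiableAt ℝ (fun x : E n => ((1 : ℝ), x)) x := by fun_prop
  exact DifferentiableAt.comp (g := fun q : ℝ × E n => u q.1 q.2) x h1 h2

/-- Derivatives of a function of the time-one map of a family of integral curves are functions of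
the time-one map of the linearized family. -/
theorem IsFlowFamily.pd_comp {V : F → F} {Ω K : Set F} {B : ℝ} {u : ℝ → E n → F}
    (h : IsFlowFamily V Ω K B 1 u) {H : F → ℝ} (hH : ∀ z ∈ Ω, ContDiffAt ℝ ∞ H z) {x : E n}
    (hx : x ∈ Metric.ball (0 : E n) 1) (k : Fin n) :
    pd k (fun z => H (u 1 z)) x
      = (fun p : F × F => fderiv ℝ H p.1 p.2)
          (tangentFamily (EuclideanSpace.single k 1) u 1 x) := by
  have h1 := (h.differentiableAt_one hx).hasFDerivAt
  have h2 := (contDiffAt_infty_differentiableAt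
    (hH _ (h.mem (1, x) (by simpa [rayDomain] using hx)))).hasFDerivAt
  have h3 := (HasFDerivAt.comp x h2 h1).fderiv
  rw [pd, show (fun z => H (u 1 z)) = H ∘ u 1 from rfl, h3]
  rfl

theorem contDiffAt_fderiv_apply {H : F → ℝ} {p : F × F} (hH : ContDiffAt ℝ ∞ H p.1) :
    ContDiffAt ℝ ∞ (fun p : F × F => fderiv ℝ H p.1 p.2) p :=
  ((hH.fderiv_right (m := ∞) (by simp)).comp p contDiffAt_fst).clm_apply contDiffAt_snd

theorem exists_lipschitz_on_convex {V : F → F} {K : Set F} (hK : IsCompact K) (hKc : Convex ℝ K)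
    (hV : ∀ z ∈ K, ContDiffAt ℝ ∞ V z) : ∃ L : NNReal, LipschitzOnWith L V K := by
  have hcont : ContinuousOn (fun z => ‖fderiv ℝ V z‖₊) K := fun z hz =>
    (((hV z hz).fderiv_right (m := ∞) (by simp)).continuousAt.nnnorm).continuousWithinAt
  obtain ⟨L, hL⟩ := hK.bddAbove_image hcont
  exact ⟨L, hKc.lipschitzOnWith_of_nnnorm_fderiv_le
    (fun z hz => contDiffAt_infty_differentiableAt (hV z hz))
    fun z hz => hL (mem_image_of_mem _ hz)⟩

theorem exists_bound_on_compact {H : F → ℝ} {K : Set F} (hK : IsCompact K)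
    (hH : ∀ z ∈ K, ContDiffAt ℝ ∞ H z) : ∃ C, ∀ z ∈ K, |H z| ≤ C := by
  obtain ⟨C, hC⟩ := hK.exists_bound_of_continuousOn
    (fun z hz => (hH z hz).continuousAt.continuousWithinAt)
  exact ⟨C, hC⟩

end FlowBounds

variable {M : Type*} [TopologicalSpace M] [ChartedSpace (E n) M] [IsManifold (𝓡 n) ∞ M]
  {g : Metric n M} {y₀ : M} {r₀ : ℝ} {e₀ : OpenPartialHomeomorph M (E n)}

/-- The rays in a normal chart, as a family of geodesics. -/
theorem isFlowFamily_rays (h₀ : IsNormalChart g y₀ r₀ e₀) {ρ C B : ℝ} (hρ : ρ < r₀)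
    (hC : ρ ≤ C) (hB : 1 ≤ B) :
    IsFlowFamily (n := n) (geodesicField (gram g e₀)) {p | p.1 ∈ Metric.ball (0 : E n) r₀}
      (Metric.closedBall (0 : E n) ρ ×ˢ Metric.closedBall (0 : E n) C) B ρ
      (fun s a => (s • a, a)) where
  smooth q _ := by fun_prop
  mem q hq := Metric.ball_subset_ball hρ.le hq
  ode q hq := by
    have h1 : HasDerivAt (fun s : ℝ => s • q.2) q.2 q.1 := by
      simpa using (hasDerivAt_id q.1).smul_const q.2
    refine (h1.prodMk (hasDerivAt_const q.1 q.2)).congr_deriv ?_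
    refine Prod.ext rfl ?_
    ext k
    have := h₀.isRadialMetric.radial_ray (x := q.2) (s := q.1) (Metric.ball_subset_ball hρ.le hq) k
    change (0 : ℝ) = -_
    rw [this, neg_zero]
  mem_compact x hx s hs :=
    ⟨Metric.ball_subset_closedBall (smul_mem_ball hx hs.1 hs.2),
      Metric.closedBall_subset_closedBall hC (Metric.ball_subset_closedBall hx)⟩
  initial := by
    refine ⟨0, (0 : E n →L[ℝ] E n).prod (ContinuousLinearMap.id ℝ (E n)), ?_, fun x => by simp⟩
    refine ContinuousLinearMap.opNorm_le_bound _ (zero_le_one.trans hB) fun x => ?_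
    simp only [ContinuousLinearMap.prod_apply, zero_apply, Prod.norm_def,
      norm_zero, ContinuousLinearMap.id_apply]
    exact max_le (by positivity) (le_mul_of_one_le_left (norm_nonneg x) hB)

theorem isFlowFamily_transition {y : M} {e : OpenPartialHomeomorph M (E n)}
    (h : IsNormalChart g y 1 e) (h₀ : IsNormalChart g y₀ r₀ e₀) {ρ C B : ℝ}
    (hB : 0 ≤ B)
    (hov : ∀ x ∈ Metric.ball (0 : E n) 1, x ∈ overlap e e₀ ∧ ‖transition e e₀ x‖ ≤ ρ)
    (hv : ∀ x ∈ Metric.ball (0 : E n) 1, ∀ s ∈ Icc (0 : ℝ) 1,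
      ‖fderiv ℝ (transition e e₀) (s • x) x‖ ≤ C)
    (h0B : ∀ w, ‖fderiv ℝ (transition e e₀) 0 w‖ ≤ B * ‖w‖) :
    IsFlowFamily (geodesicField (gram g e₀)) {p | p.1 ∈ Metric.ball (0 : E n) r₀}
      (Metric.closedBall (0 : E n) ρ ×ˢ Metric.closedBall (0 : E n) C) B 1
      (fun s x => (transition e e₀ (s • x), fderiv ℝ (transition e e₀) (s • x) x)) where
  smooth q hq := by
    have h1 := contDiffAt_transition h.mem_maximalAtlas h₀.mem_maximalAtlas (hov _ hq).1
    have h2 : ContDiffAt ℝ ∞ (fun q : ℝ × E n => q.1 • q.2) q := by fun_prop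
    exact (ContDiffAt.comp q h1 h2).prodMk
      ((ContDiffAt.comp q (h1.fderiv_right (m := ∞) (by simp)) h2).clm_apply contDiffAt_snd)
  mem q hq := by
    have := transition_mem (hov _ hq).1
    rwa [h₀.target_eq] at this
  ode q hq := h.hasDerivAt_geodesic h₀.mem_maximalAtlas (hov _ hq).1
  mem_compact x hx s hs :=
    ⟨mem_closedBall_zero_iff.2 (hov _ (smul_mem_ball hx hs.1 hs.2)).2,
      mem_closedBall_zero_iff.2 (hv x hx s hs)⟩
  initial := by
    refine ⟨(transition e e₀ 0, 0), (0 : E n →L[ℝ] E n).prod (fderiv ℝ (transition e e₀) 0), ?_,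
      fun x => by simp⟩
    refine ContinuousLinearMap.opNorm_le_bound _ hB fun x => ?_
    simp only [ContinuousLinearMap.prod_apply, zero_apply, Prod.norm_def, norm_zero]
    exact max_le (by positivity) (h0B x)

theorem IsRadialMetric.christoffel_zero {G : E n → Mat n} {r : ℝ} (hr : 0 < r)
    (h : IsRadialMetric G r) (k i j : Fin n) : christoffel G 0 k i j = 0 := by
  have h0 : (0 : E n) ∈ Metric.ball (0 : E n) r := by simpa using hr
  have hq : ∀ x : E n, ∑ i, ∑ j, christoffel G 0 k i j * x i * x j = 0 := fun x => by
    have := h.radial_ray (x := x) (s := 0) (by simpa using h0) k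
    simpa using this
  have hs : ∀ i j, christoffel G 0 k i j = christoffel G 0 k j i := fun i j =>
    conn_symm (h.metric 0 h0) j i k
  have hd : ∀ i, christoffel G 0 k i i = 0 := fun i => by
    have := hq (EuclideanSpace.single i 1)
    simpa [Pi.single_apply] using this
  have := hq (EuclideanSpace.single i 1 + EuclideanSpace.single j 1)
  simp only [PiLp.add_apply, PiLp.single_apply, mul_add, Finset.sum_add_distrib, mul_ite,
    mul_one, mul_zero, Finset.sum_ite_eq', Finset.mem_univ, if_true] at this
  simp only [hd] at this
  have := hs i j
  linarith

theorem HasBoundedGeometry.pd_entry_le {G : E n → Mat n} {K : ℝ} (hb : HasBoundedGeometry G K)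
    (h : IsRadialMetric G 1) {x : E n} (hx : x ∈ Metric.ball (0 : E n) 1) (i j k : Fin n) :
    |pd k (fun z => G z i j) x| ≤ n * K * ‖x‖ := by
  have h0 : (0 : E n) ∈ Metric.ball (0 : E n) 1 := by simp
  have hz : pd k (fun z => G z i j) 0 = 0 := by
    have hc : ∀ k, conn G k 0 = 0 := fun k => by
      ext a b
      exact h.christoffel_zero one_pos b a k
    rw [HarmonicFlow.pd_entry (h.metric 0 h0).differentiableAt, pd_metric (h.metric 0 h0), hc]
    simp
  have hsm : ∀ z ∈ Metric.ball (0 : E n) 1, ContDiffAt ℝ ∞ (pd k (fun z => G z i j)) z :=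
    fun z hz => ((h.metric z hz).smooth.matrix_entry i j).pd k
  have hf : ∀ z ∈ Metric.ball (0 : E n) 1, ‖fderiv ℝ (pd k (fun z => G z i j)) z‖ ≤ n * K := by
    intro z hz
    have hK : 0 ≤ K := (abs_nonneg _).trans (hb.pd_entry z hz i j k)
    refine ContinuousLinearMap.opNorm_le_bound _ (by positivity) fun v => ?_
    rw [clm_apply_eq_sum]
    refine (norm_sum_le _ _).trans ?_
    calc ∑ l, ‖v l • fderiv ℝ (pd k (fun z => G z i j)) z (EuclideanSpace.single l 1)‖
        ≤ ∑ _l : Fin n, ‖v‖ * K := by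
          refine Finset.sum_le_sum fun l _ => ?_
          rw [norm_smul]
          exact mul_le_mul (PiLp.norm_apply_le v l) (hb.pd_pd_entry z hz i j k l) (norm_nonneg _)
            (norm_nonneg _)
      _ = n * K * ‖v‖ := by
          rw [Finset.sum_const, Finset.card_univ, Fintype.card_fin, nsmul_eq_mul]; ring
  have := (convex_ball (0 : E n) 1).norm_image_sub_le_of_norm_fderiv_le
    (fun z hz => contDiffAt_infty_differentiableAt (hsm z hz)) hf h0 hx
  rw [hz, sub_zero, sub_zero] at this
  exact this

end Bounds

section UniformBounds

variable {n : ℕ}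

/-- A function of the time-one map of a family of integral curves is bounded together with its
first two derivatives, by a constant depending only on the compact set and the initial slope. -/
theorem exists_bound_comp_flow {F : Type*} [NormedAddCommGroup F] [NormedSpace ℝ F]
    [FiniteDimensional ℝ F] {V : F → F} {Ω K : Set F} {B : ℝ}
    (hV : ∀ z ∈ Ω, ContDiffAt ℝ ∞ V z) (hK : IsCompact K) (hKΩ : K ⊆ Ω) (hB : 0 ≤ B)
    {H : F → ℝ} (hH : ∀ z ∈ Ω, ContDiffAt ℝ ∞ H z) :
    ∃ C, ∀ u : ℝ → E n → F, IsFlowFamily V Ω K B 1 u → ∀ x ∈ Metric.ball (0 : E n) 1,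
      |H (u 1 x)| ≤ C ∧ (∀ k, |pd k (fun z => H (u 1 z)) x| ≤ C) ∧
        ∀ k l, |pd l (pd k (fun z => H (u 1 z))) x| ≤ C := by
  -- Two linearizations of the flow carry the first two derivatives of `u 1`.
  obtain ⟨B₁, hB₁, h₁⟩ := exists_isFlowFamily_tangent (n := n) hV hK hKΩ hB
  have hV₁ : ∀ z ∈ Ω ×ˢ (univ : Set F), ContDiffAt ℝ ∞ (tangentField V) z :=
    fun z hz => contDiffAt_tangentField (hV _ hz.1)
  have hK₁ := hK.prod (isCompact_closedBall (0 : F) B₁)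
  have hKΩ₁ : K ×ˢ Metric.closedBall (0 : F) B₁ ⊆ Ω ×ˢ univ := prod_mono hKΩ (subset_univ _)
  obtain ⟨B₂, hB₂, h₂⟩ := exists_isFlowFamily_tangent (n := n) hV₁ hK₁ hKΩ₁ hB
  have hK₂ := hK₁.prod (isCompact_closedBall (0 : F × F) B₂)
  have hKΩ₂ := prod_mono hKΩ₁ (subset_univ (Metric.closedBall (0 : F × F) B₂))
  have hH₁ : ∀ z ∈ Ω ×ˢ (univ : Set F), ContDiffAt ℝ ∞ (fun p : F × F => fderiv ℝ H p.1 p.2) z :=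
    fun z hz => contDiffAt_fderiv_apply (hH _ hz.1)
  have hH₂ : ∀ z ∈ (Ω ×ˢ (univ : Set F)) ×ˢ (univ : Set (F × F)), ContDiffAt ℝ ∞
      (fun p : (F × F) × (F × F) =>
        fderiv ℝ (fun p : F × F => fderiv ℝ H p.1 p.2) p.1 p.2) z :=
    fun z hz => contDiffAt_fderiv_apply (hH₁ _ hz.1)
  obtain ⟨C₀, hC₀⟩ := exists_bound_on_compact hK fun z hz => hH z (hKΩ hz)
  obtain ⟨C₁, hC₁⟩ := exists_bound_on_compact hK₁ fun z hz => hH₁ z (hKΩ₁ hz)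
  obtain ⟨C₂, hC₂⟩ := exists_bound_on_compact hK₂ fun z hz => hH₂ z (hKΩ₂ hz)
  have hs : ∀ k : Fin n, ‖EuclideanSpace.single k (1 : ℝ)‖ ≤ 1 := fun k => by simp
  have hI : (1 : ℝ) ∈ Icc (0 : ℝ) 1 := by simp
  refine ⟨max C₀ (max C₁ C₂), fun u hu x hx => ⟨?_, fun k => ?_, fun k l => ?_⟩⟩
  · exact (hC₀ _ (hu.mem_compact x hx 1 hI)).trans (le_max_left _ _)
  · have hu₁ := h₁ 1 u one_pos hu _ (hs k)
    rw [hu.pd_comp hH hx k]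
    exact (hC₁ _ (hu₁.mem_compact x hx 1 hI)).trans ((le_max_left _ _).trans (le_max_right _ _))
  · have hu₁ := h₁ 1 u one_pos hu _ (hs k)
    have hu₂ := h₂ 1 _ one_pos hu₁ _ (hs l)
    have : pd k (fun z => H (u 1 z)) =ᶠ[𝓝 x] fun z => (fun p : F × F => fderiv ℝ H p.1 p.2)
        (tangentFamily (EuclideanSpace.single k 1) u 1 z) := by
      filter_upwards [Metric.isOpen_ball.mem_nhds hx] with z hz
      exact hu.pd_comp hH hz k
    rw [pd_congr this, hu₁.pd_comp hH₁ hx l]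
    exact (hC₂ _ (hu₂.mem_compact x hx 1 hI)).trans ((le_max_right _ _).trans (le_max_right _ _))

variable {M : Type*} [TopologicalSpace M] [ChartedSpace (E n) M] [IsManifold (𝓡 n) ∞ M]
  {g : Metric n M} {y y₀ : M} {r₀ : ℝ} {e e₀ : OpenPartialHomeomorph M (E n)}

/-- The components of the metric `g` of the target chart, contracted with two tangent vectors which
are stored in the second linearization of the geodesic flow. -/
def pairing (G : E n → Mat n) (q : ((E n × E n) × (E n × E n)) × ((E n × E n) × (E n × E n))) : ℝ :=
  ∑ a, ∑ b, q.1.2.1 a * G q.1.1.1 a b * q.2.1.1 b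

theorem contDiffAt_pairing {G : E n → Mat n}
    {q : ((E n × E n) × (E n × E n)) × ((E n × E n) × (E n × E n))}
    (hG : ContDiffAt ℝ ∞ G q.1.1.1) : ContDiffAt ℝ ∞ (pairing G) q := by
  refine ContDiffAt.sum fun a _ => ContDiffAt.sum fun b _ => ?_
  have h1 : ContDiffAt ℝ ∞ (fun q : ((E n × E n) × (E n × E n)) × ((E n × E n) × (E n × E n)) =>
      G q.1.1.1 a b) q :=
    ContDiffAt.comp q (g := fun z => G z a b) (hG.matrix_entry a b) (by fun_prop)
  refine ContDiffAt.mul (ContDiffAt.mul ?_ h1) ?_ <;> fun_prop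

theorem gram_entry_eq_pairing (he : e ∈ smoothCharts n M) (he₀ : e₀ ∈ smoothCharts n M)
    {x : E n} (hov : x ∈ overlap e e₀) {u : ℝ → E n → E n × E n}
    (hu : ∀ᶠ z in 𝓝 x, (u 1 z).1 = transition e e₀ z) (i j : Fin n)
    (hd : DifferentiableAt ℝ (u 1) x)
    (hd' : DifferentiableAt ℝ (tangentFamily (EuclideanSpace.single i 1) u 1) x) :
    gram g e x i j = pairing (gram g e₀) (tangentFamily (EuclideanSpace.single j 1)
      (tangentFamily (EuclideanSpace.single i 1) u) 1 x) := by
  have key : ∀ w : E n, (fderiv ℝ (u 1) x w).1 = fderiv ℝ (transition e e₀) x w := fun w => by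
    have h1 : fderiv ℝ (fun z => (u 1 z).1) x = fderiv ℝ (transition e e₀) x :=
      Filter.EventuallyEq.fderiv_eq hu
    rw [← h1, fderiv.fst hd]; rfl
  have key2 : ∀ w : E n, (fderiv ℝ (tangentFamily (EuclideanSpace.single i 1) u 1) x w).1
      = fderiv ℝ (u 1) x w := fun w => by
    have h1 : (fun z => (tangentFamily (EuclideanSpace.single i 1) u 1 z).1) = u 1 := rfl
    rw [← h1, fderiv.fst hd']; rfl
  have e1 : ∀ a, (tangentFamily (EuclideanSpace.single j 1)
      (tangentFamily (EuclideanSpace.single i 1) u) 1 x).1.2.1 a = jac e e₀ x i a := fun a => by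
    change (fderiv ℝ (u 1) x (EuclideanSpace.single i 1)).1 a = _
    rw [key]; rfl
  have e2 : ∀ a, (tangentFamily (EuclideanSpace.single j 1)
      (tangentFamily (EuclideanSpace.single i 1) u) 1 x).2.1.1 a = jac e e₀ x j a := fun a => by
    change (fderiv ℝ (tangentFamily (EuclideanSpace.single i 1) u 1) x
      (EuclideanSpace.single j 1)).1.1 a = _
    rw [key2, key]; rfl
  have e3 : (tangentFamily (EuclideanSpace.single j 1)
      (tangentFamily (EuclideanSpace.single i 1) u) 1 x).1.1.1 = transition e e₀ x :=
    hu.self_of_nhds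
  simp only [pairing, e1, e2, e3]
  rw [gram_eq_jac g he he₀ hov]
  simp only [Matrix.mul_apply, Matrix.transpose_apply, Finset.sum_mul]
  exact Finset.sum_comm

theorem exists_norm_le_on_closedBall {G : E n → Mat n} {ρ : ℝ}
    (hG : ∀ z ∈ Metric.closedBall (0 : E n) ρ, ContinuousAt G z) :
    ∃ C, 1 ≤ C ∧ ∀ z ∈ Metric.closedBall (0 : E n) ρ, ‖G z‖ ≤ C := by
  obtain ⟨C, hC⟩ := (isCompact_closedBall (0 : E n) ρ).exists_bound_of_continuousOn
    fun z hz => (hG z hz).continuousWithinAt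
  exact ⟨max 1 C, le_max_left _ _, fun z hz => (hC z hz).trans (le_max_right _ _)⟩

theorem tangentFamily_rays (w x : E n) (s : ℝ) :
    tangentFamily w (fun (s : ℝ) (a : E n) => (s • a, a)) s x = ((s • x, x), (s • w, w)) := by
  have h : HasFDerivAt (fun a : E n => (s • a, a))
      ((s • ContinuousLinearMap.id ℝ (E n)).prod (ContinuousLinearMap.id ℝ (E n))) x :=
    ((hasFDerivAt_id x).const_smul s).prodMk (hasFDerivAt_id x)
  simp [tangentFamily, h.fderiv]

/-- The differential of the transition map at `x` is close to the one at the origin, if the centres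
of the two normal charts are close: both are linearized geodesic flows. -/
theorem exists_norm_fderiv_sub_le (h₀ : IsNormalChart g y₀ r₀ e₀) {ρ C B : ℝ} (hρ : ρ < r₀)
    (hρ0 : 0 < ρ) (hC : ρ ≤ C) (hB : 1 ≤ B) :
    ∃ L : ℝ, 0 < L ∧ ∀ (e : OpenPartialHomeomorph M (E n)),
      IsFlowFamily (geodesicField (gram g e₀)) {p | p.1 ∈ Metric.ball (0 : E n) r₀}
        (Metric.closedBall (0 : E n) ρ ×ˢ Metric.closedBall (0 : E n) C) B 1
        (fun s x => (transition e e₀ (s • x), fderiv ℝ (transition e e₀) (s • x) x)) →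
      ∀ x ∈ Metric.ball (0 : E n) 1, ∀ w : E n, ‖w‖ ≤ 1 →
        ‖fderiv ℝ (transition e e₀) 0 x‖ < ρ → ‖fderiv ℝ (transition e e₀) 0 w‖ ≤ 1 →
        ‖fderiv ℝ (transition e e₀) x w - fderiv ℝ (transition e e₀) 0 w‖
          ≤ ‖transition e e₀ 0‖ * L := by
  set V := geodesicField (gram g e₀) with hVdef
  set Ω : Set (E n × E n) := {p | p.1 ∈ Metric.ball (0 : E n) r₀} with hΩ
  set K : Set (E n × E n) := Metric.closedBall (0 : E n) ρ ×ˢ Metric.closedBall (0 : E n) C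
  have hV : ∀ z ∈ Ω, ContDiffAt ℝ ∞ V z := fun z hz =>
    contDiffAt_geodesicField (h₀.isRadialMetric.metric _ hz)
  have hK : IsCompact K := (isCompact_closedBall _ _).prod (isCompact_closedBall _ _)
  have hKΩ : K ⊆ Ω := fun z hz => Metric.closedBall_subset_ball hρ hz.1
  obtain ⟨B', hB', hlift⟩ := exists_isFlowFamily_tangent (n := n) hV hK hKΩ (zero_le_one.trans hB)
  set K₁ := K ×ˢ Metric.closedBall (0 : E n × E n) B'
  have hK₁ : IsCompact K₁ := hK.prod (isCompact_closedBall _ _)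
  have hK₁c : Convex ℝ K₁ :=
    ((convex_closedBall _ _).prod (convex_closedBall _ _)).prod (convex_closedBall _ _)
  have hK₁Ω : K₁ ⊆ Ω ×ˢ univ := prod_mono hKΩ (subset_univ _)
  obtain ⟨L, hL⟩ := exists_lipschitz_on_convex hK₁ hK₁c
    fun z hz => contDiffAt_tangentField (hV _ (hK₁Ω hz).1)
  refine ⟨Real.exp L, Real.exp_pos _, fun e hu x hx w hw hAx hAw => ?_⟩
  set A := fderiv ℝ (transition e e₀) 0 with hA
  set u : ℝ → E n → E n × E n :=
    fun s x => (transition e e₀ (s • x), fderiv ℝ (transition e e₀) (s • x) x) with hudef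
  have hu₁ := hlift 1 u one_pos hu w hw
  have hm₁ := hlift ρ _ hρ0 (isFlowFamily_rays h₀ hρ hC hB) (A w) hAw
  have hAxb : A x ∈ Metric.ball (0 : E n) ρ := mem_ball_zero_iff.2 hAx
  have hI : ∀ s ∈ Icc (0 : ℝ) 1, (s, x) ∈ rayDomain n 1 := fun s hs => mem_rayDomain hx hs
  have hI' : ∀ s ∈ Icc (0 : ℝ) 1, (s, A x) ∈ rayDomain n ρ := fun s hs => mem_rayDomain hAxb hs
  -- Compare the linearized geodesic through `x` with the linearized ray of the chart at `y₀` that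
  -- has the same initial velocities; the initial values differ by the vector `transition e e₀ 0`.
  have gron := dist_le_of_trajectories_ODE_of_mem (v := fun _ => tangentField V) (s := fun _ => K₁)
    (K := L) (a := 0) (b := 1) (δ := ‖transition e e₀ 0‖)
    (f := fun s => tangentFamily w u s x)
    (g := fun s => tangentFamily (A w) (fun s a => (s • a, a)) s (A x))
    (fun _ _ => hL)
    (fun s hs => (hu₁.ode (s, x) (hI s hs)).continuousAt.continuousWithinAt)
    (fun s hs => (hu₁.ode (s, x) (hI s (Ico_subset_Icc_self hs))).hasDerivWithinAt)
    (fun s hs => hu₁.mem_compact x hx s (Ico_subset_Icc_self hs))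
    (fun s hs => (hm₁.ode (s, A x) (hI' s hs)).continuousAt.continuousWithinAt)
    (fun s hs => (hm₁.ode (s, A x) (hI' s (Ico_subset_Icc_self hs))).hasDerivWithinAt)
    (fun s hs => hm₁.mem_compact _ hAxb s (Ico_subset_Icc_self hs))
    ?_ 1 (by simp)
  · have hd := hu.differentiableAt_one hx
    have e1 : (tangentFamily w u 1 x).2.1 = fderiv ℝ (transition e e₀) x w := by
      have h1 : (fun z => (u 1 z).1) = transition e e₀ := by
        funext z; simp [hudef]
      change (fderiv ℝ (u 1) x w).1 = _
      rw [← h1, fderiv.fst hd]; rfl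
    have e2 : (tangentFamily (A w) (fun (s : ℝ) (a : E n) => (s • a, a)) 1 (A x)).2.1 = A w := by
      rw [tangentFamily_rays]
      simp
    rw [sub_zero, mul_one, dist_eq_norm] at gron
    rw [← e1, ← e2]
    refine le_trans ?_ gron
    exact (norm_fst_le (_ - _ : (E n × E n) × (E n × E n)).2).trans (norm_snd_le _)
  · have hd0 : DifferentiableAt ℝ (u 0) x := by
      have : u 0 = fun z => (transition e e₀ 0, A z) := by funext z; simp [hudef, hA]
      rw [this]; fun_prop
    have e1 : tangentFamily w u 0 x = ((transition e e₀ 0, A x), (0, A w)) := by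
      have : u 0 = fun z => (transition e e₀ 0, A z) := by funext z; simp [hudef, hA]
      simp only [tangentFamily, this]
      rw [((hasFDerivAt_const (transition e e₀ 0) x).prodMk A.hasFDerivAt).fderiv]
      simp
    have e2 : tangentFamily (A w) (fun (s : ℝ) (a : E n) => (s • a, a)) 0 (A x)
        = ((0, A x), (0, A w)) := by
      rw [tangentFamily_rays]
      simp
    rw [e1, e2, dist_eq_norm]
    simp

set_option maxHeartbeats 1000000 in
/-- Normal charts of radius one, centred near `y₀`, have uniformly bounded geometry. -/
theorem IsNormalChart.exists_boundedGeometry_near [T2Space M] (h₀ : IsNormalChart g y₀ r₀ e₀)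
    (hr₀ : 1 < r₀) : ∃ K ε : ℝ, 0 < ε ∧ ∀ y ∈ e₀.source, ‖e₀ y‖ < ε →
      ∀ e, IsNormalChart g y 1 e → HasBoundedGeometry (gram g e) K := by
  set G := gram g e₀ with hG
  -- All geodesics considered stay in the closed ball of radius `ρ`, which is compact in the fixed
  -- chart.
  set ρ : ℝ := (r₀ + 1) / 2 with hρdef
  have hρ1 : 1 < ρ := by rw [hρdef]; linarith
  have hρr : ρ < r₀ := by rw [hρdef]; linarith
  have hρ0 : 0 < ρ := by linarith
  have hmet : ∀ z ∈ Metric.closedBall (0 : E n) ρ, IsMetricAt G z := fun z hz =>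
    h₀.isRadialMetric.metric z (Metric.closedBall_subset_ball hρr hz)
  obtain ⟨CG, hCG1, hCG⟩ := exists_norm_le_on_closedBall fun z hz =>
    (hmet z hz).smooth.continuousAt
  obtain ⟨CI, hCI1, hCI⟩ := exists_norm_le_on_closedBall fun z hz =>
    (hmet z hz).smooth_inv.continuousAt
  have hlow : ∀ z ∈ Metric.closedBall (0 : E n) ρ, ∀ v : E n,
      ‖v‖ ^ 2 ≤ CI * (v.ofLp ⬝ᵥ (G z).mulVec v.ofLp) := fun z hz v =>
    (norm_sq_le_of_posDef (hmet z hz).self v).trans (mul_le_mul_of_nonneg_right (hCI z hz) (by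
      have := (hmet z hz).self.posSemidef.dotProduct_mulVec_nonneg v.ofLp
      simpa using this))
  have hup : ∀ z ∈ Metric.closedBall (0 : E n) ρ, ∀ v : E n,
      v.ofLp ⬝ᵥ (G z).mulVec v.ofLp ≤ CG * ‖v‖ ^ 2 := fun z hz v =>
    (dotProduct_mulVec_le _ v).trans (mul_le_mul_of_nonneg_right (hCG z hz) (by positivity))
  obtain ⟨L, hL0, hL⟩ := exists_norm_fderiv_sub_le (g := g) h₀ (C := max ρ CI) hρr hρ0
    (le_max_left _ _) hCI1
  set V := geodesicField G with hVdef
  set Ω : Set (E n × E n) := {p | p.1 ∈ Metric.ball (0 : E n) r₀} with hΩ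
  set K : Set (E n × E n) :=
    Metric.closedBall (0 : E n) ρ ×ˢ Metric.closedBall (0 : E n) (max ρ CI) with hKdef
  have hV : ∀ z ∈ Ω, ContDiffAt ℝ ∞ V z := fun z hz =>
    contDiffAt_geodesicField (h₀.isRadialMetric.metric _ hz)
  have hK : IsCompact K := (isCompact_closedBall _ _).prod (isCompact_closedBall _ _)
  have hKΩ : K ⊆ Ω := fun z hz => Metric.closedBall_subset_ball hρr hz.1
  have hCI0 : (0 : ℝ) ≤ CI := by linarith
  obtain ⟨B₁, hB₁, h₁⟩ := exists_isFlowFamily_tangent (n := n) hV hK hKΩ hCI0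
  have hV₁ : ∀ z ∈ Ω ×ˢ (univ : Set (E n × E n)), ContDiffAt ℝ ∞ (tangentField V) z :=
    fun z hz => contDiffAt_tangentField (hV _ hz.1)
  have hK₁ := hK.prod (isCompact_closedBall (0 : E n × E n) B₁)
  have hKΩ₁ : K ×ˢ Metric.closedBall (0 : E n × E n) B₁ ⊆ Ω ×ˢ univ :=
    prod_mono hKΩ (subset_univ _)
  obtain ⟨B₂, hB₂, h₂⟩ := exists_isFlowFamily_tangent (n := n) hV₁ hK₁ hKΩ₁ hCI0
  have hV₂ : ∀ z ∈ (Ω ×ˢ (univ : Set (E n × E n))) ×ˢ (univ : Set ((E n × E n) × (E n × E n))),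
      ContDiffAt ℝ ∞ (tangentField (tangentField V)) z :=
    fun z hz => contDiffAt_tangentField (hV₁ _ hz.1)
  have hK₂ := hK₁.prod (isCompact_closedBall (0 : (E n × E n) × (E n × E n)) B₂)
  have hKΩ₂ : (K ×ˢ Metric.closedBall (0 : E n × E n) B₁) ×ˢ
      Metric.closedBall (0 : (E n × E n) × (E n × E n)) B₂ ⊆ (Ω ×ˢ univ) ×ˢ univ :=
    prod_mono hKΩ₁ (subset_univ _)
  obtain ⟨C₃, hC₃⟩ := exists_bound_comp_flow (n := n) hV₂ hK₂ hKΩ₂ hCI0 (H := pairing G)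
    fun z hz => contDiffAt_pairing (h₀.isRadialMetric.metric _ hz.1.1).smooth
  have hη : 0 < 1 - 1 / ρ ^ 2 := by
    rw [sub_pos, div_lt_one (by positivity)]; nlinarith
  -- The smallness of `ε` has three purposes: `ε₁` makes the metric at the centre close to the
  -- identity, the second number keeps the unit ball of `e` inside the ball of radius `ρ`, and the
  -- third bounds the variation of the differential of the transition map.
  obtain ⟨ε₁, hε₁, hnear⟩ := Metric.continuousAt_iff.1
    (hmet 0 (by simpa using hρ0.le)).smooth.continuousAt _ hη
  set c : ℝ := 1 / (4 * CG ^ 2 * CI) with hc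
  have hc0 : 0 < c := by rw [hc]; positivity
  refine ⟨max C₃ (1 / c), min ε₁ (min ((ρ - 1) / 2) (1 / (2 * CI * CG * L))), by
    refine lt_min hε₁ (lt_min (by linarith) (by positivity)), fun y hy hyε e he => ?_⟩
  have hy1 : ‖e₀ y‖ < ε₁ := hyε.trans_le (min_le_left _ _)
  have hy2 : ‖e₀ y‖ ≤ (ρ - 1) / 2 :=
    (hyε.trans_le ((min_le_right _ _).trans (min_le_left _ _))).le
  have hy3 : ‖e₀ y‖ * L ≤ 1 / (2 * CI * CG) := by
    have := (hyε.trans_le ((min_le_right _ _).trans (min_le_right _ _))).le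
    rw [le_div_iff₀ (by positivity)] at this ⊢
    linarith
  have heM := he.mem_maximalAtlas
  have he₀M := h₀.mem_maximalAtlas
  have hsq : Real.sqrt (‖e₀ y‖ ^ 2 + ((ρ - 1) / 2) ^ 2) + 1 ≤ ρ := by
    have : Real.sqrt (‖e₀ y‖ ^ 2 + ((ρ - 1) / 2) ^ 2) ≤ ρ - 1 := by
      refine Real.sqrt_le_iff.2 ⟨by linarith, ?_⟩
      nlinarith [norm_nonneg (e₀ y)]
    linarith
  have hov : ∀ x ∈ Metric.ball (0 : E n) 1, x ∈ overlap e e₀ ∧ ‖transition e e₀ x‖ ≤ ρ :=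
    fun x hx => by
      have := he.mem_overlap h₀ hy (δ := (ρ - 1) / 2) (by linarith) (hsq.trans_lt hρr) hx
      exact ⟨this.1, this.2.trans hsq⟩
  have hball0 : (0 : E n) ∈ Metric.ball (0 : E n) 1 := by simp
  have htr0 : transition e e₀ 0 = e₀ y := by
    rw [transition, ← he.map_center, e.left_inv he.mem_source]
  set A := fderiv ℝ (transition e e₀) 0 with hA
  have hmem : ∀ x ∈ Metric.ball (0 : E n) 1,
      transition e e₀ x ∈ Metric.closedBall (0 : E n) ρ := fun x hx =>
    mem_closedBall_zero_iff.2 (hov x hx).2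
  -- Geodesics have constant speed, so their velocities are bounded in the fixed chart.
  have hspeed : ∀ x ∈ Metric.ball (0 : E n) 1, ∀ s ∈ Icc (0 : ℝ) 1,
      ‖fderiv ℝ (transition e e₀) (s • x) x‖ ≤ max ρ CI := by
    intro x hx s hs
    have hsx := smul_mem_ball hx hs.1 hs.2
    have h1 := hlow _ (hmem _ hsx) (fderiv ℝ (transition e e₀) (s • x) x)
    rw [hG, he.speed he₀M (hov _ hsx).1] at h1
    refine le_trans ?_ (le_max_right _ _)
    have hx1 := mem_ball_zero_iff.1 hx
    nlinarith [norm_nonneg x, norm_nonneg (fderiv ℝ (transition e e₀) (s • x) x),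
      mul_le_mul_of_nonneg_left (show ‖x‖ ^ 2 ≤ 1 by nlinarith [norm_nonneg x]) hCI0]
  -- The differential `A` at the centre is an isometry from the Euclidean norm to `g` at `y`.
  have hA2 : ∀ w : E n, (A w).ofLp ⬝ᵥ (G (transition e e₀ 0)).mulVec (A w).ofLp = ‖w‖ ^ 2 := by
    intro w
    rw [hA, hG, ← dotProduct_gram heM he₀M (hov 0 hball0).1, he.gram_zero, Matrix.one_mulVec,
      dotProduct_self_eq_norm_sq]
  have hA3 : ∀ w : E n, ‖A w‖ ≤ CI * ‖w‖ := by
    intro w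
    have h1 := hlow _ (hmem 0 hball0) (A w)
    rw [hA2] at h1
    refine (sq_le_sq₀ (norm_nonneg _) (by positivity)).1 ?_
    rw [mul_pow]
    nlinarith [sq_nonneg ‖w‖]
  have hA4 : ∀ w : E n, ‖w‖ ≤ CG * ‖A w‖ := by
    intro w
    have h1 := hup _ (hmem 0 hball0) (A w)
    rw [hA2] at h1
    refine (sq_le_sq₀ (norm_nonneg _) (by positivity)).1 ?_
    rw [mul_pow]
    nlinarith [sq_nonneg ‖A w‖]
  -- As `g` at `y` is close to the identity, `A` maps the unit ball into the ball of radius `ρ`.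
  have hA5 : ∀ x ∈ Metric.ball (0 : E n) 1, ‖A x‖ < ρ := by
    intro x hx
    have h1 : (A x).ofLp ⬝ᵥ (1 - G (transition e e₀ 0)).mulVec (A x).ofLp
        ≤ (1 - 1 / ρ ^ 2) * ‖A x‖ ^ 2 := by
      refine (dotProduct_mulVec_le _ _).trans (mul_le_mul_of_nonneg_right ?_ (by positivity))
      have := hnear (x := transition e e₀ 0) (by rw [htr0]; simpa using hy1)
      rw [hG, h₀.isRadialMetric.zero, dist_eq_norm, norm_sub_rev] at this
      exact this.le
    rw [Matrix.sub_mulVec, dotProduct_sub, hA2, Matrix.one_mulVec, dotProduct_self_eq_norm_sq] at h1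
    have h2 : ‖A x‖ ^ 2 / ρ ^ 2 ≤ ‖x‖ ^ 2 := by
      have : ‖A x‖ ^ 2 / ρ ^ 2 = 1 / ρ ^ 2 * ‖A x‖ ^ 2 := by ring
      linarith
    rw [div_le_iff₀ (by positivity)] at h2
    have h3 := mem_ball_zero_iff.1 hx
    refine lt_of_pow_lt_pow_left₀ 2 hρ0.le (h2.trans_lt ?_)
    have : ‖x‖ ^ 2 < 1 := by nlinarith [norm_nonneg x]
    nlinarith [sq_pos_of_pos hρ0]
  have hflow : IsFlowFamily V Ω K CI 1
      (fun s x => (transition e e₀ (s • x), fderiv ℝ (transition e e₀) (s • x) x)) :=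
    isFlowFamily_transition he h₀ hCI0 hov hspeed hA3
  -- The metric of `e` is a smooth function of the second linearization of the geodesic flow,
  -- hence bounded with two derivatives by `C₃`.
  have hgram : ∀ i j, ∀ x ∈ Metric.ball (0 : E n) 1, gram g e x i j
      = pairing G (tangentFamily (EuclideanSpace.single j 1)
        (tangentFamily (EuclideanSpace.single i 1) (fun s x => (transition e e₀ (s • x),
          fderiv ℝ (transition e e₀) (s • x) x))) 1 x) := fun i j x hx =>
    gram_entry_eq_pairing heM he₀M (hov x hx).1 (by simp) i j (hflow.differentiableAt_one hx)
      ((h₁ 1 _ one_pos hflow _ (by simp)).differentiableAt_one hx)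
  have hbd := fun i j => hC₃ _ (h₂ 1 _ one_pos (h₁ 1 _ one_pos hflow
    (EuclideanSpace.single i 1) (by simp)) (EuclideanSpace.single j 1) (by simp))
  have hev : ∀ i j, ∀ x ∈ Metric.ball (0 : E n) 1, (fun z => gram g e z i j) =ᶠ[𝓝 x] _ :=
    fun i j x hx => by
      filter_upwards [Metric.isOpen_ball.mem_nhds hx] with z hz using hgram i j z hz
  refine ⟨fun x hx i j => ?_, fun x hx i j => ?_, fun x hx i j k => ?_, fun x hx i j k l => ?_⟩
  · rw [hgram i j x hx]
    exact ((hbd i j x hx).1).trans (le_max_left _ _)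
  · refine (abs_inv_le_of_posDef (he.isRadialMetric.metric x hx).self hc0 (fun v => ?_) i j).trans
      (le_max_right _ _)
    -- the differential expands `w`, which has norm `1 / CI`, by a definite factor
    have hlowD : ∀ w : E n, ‖w‖ = 1 / CI →
        1 / (2 * CG) * ‖w‖ ≤ ‖fderiv ℝ (transition e e₀) x w‖ := by
      intro w hw
      have h1 := hL e hflow x hx w (by rw [hw, div_le_one (by positivity)]; exact hCI1) (hA5 x hx)
        ((hA3 w).trans (by rw [hw]; field_simp; exact le_rfl))
      rw [htr0] at h1
      have h2 := norm_sub_norm_le (A w) (fderiv ℝ (transition e e₀) x w)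
      rw [norm_sub_rev] at h2
      have h3 := hA4 w
      have h4 : ‖w‖ / CG ≤ ‖A w‖ := by rw [div_le_iff₀ (by positivity)]; linarith
      have h5 : 1 / (2 * CI * CG) = ‖w‖ / CG - 1 / (2 * CG) * ‖w‖ := by
        rw [hw]; field_simp; ring
      linarith
    have hlowD' : 1 / (2 * CG) * ‖v‖ ≤ ‖fderiv ℝ (transition e e₀) x v‖ := by
      rcases eq_or_ne v 0 with rfl | hv
      · simp
      have hv0 : 0 < ‖v‖ := norm_pos_iff.2 hv
      have h1 := hlowD ((1 / (CI * ‖v‖)) • v) (by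
        rw [norm_smul, Real.norm_of_nonneg (by positivity)]; field_simp)
      rw [map_smul, norm_smul, norm_smul, Real.norm_of_nonneg (by positivity)] at h1
      have h2 : 0 < 1 / (CI * ‖v‖) := by positivity
      refine le_of_mul_le_mul_left ?_ h2
      linarith
    rw [dotProduct_gram heM he₀M (hov x hx).1]
    have h1 := hlow _ (hmem x hx) (fderiv ℝ (transition e e₀) x v)
    have h2 : (1 / (2 * CG) * ‖v‖) ^ 2 ≤ ‖fderiv ℝ (transition e e₀) x v‖ ^ 2 :=
      pow_le_pow_left₀ (by positivity) hlowD' 2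
    have h3 : c * ‖v‖ ^ 2 = 1 / CI * (1 / (2 * CG) * ‖v‖) ^ 2 := by rw [hc]; field_simp; ring
    rw [h3, one_div, inv_mul_le_iff₀ (by positivity)]
    exact h2.trans h1
  · rw [pd_congr (hev i j x hx)]
    exact ((hbd i j x hx).2.1 k).trans (le_max_left _ _)
  · have : pd k (fun z => gram g e z i j) =ᶠ[𝓝 x] pd k (fun z => pairing G
        (tangentFamily (EuclideanSpace.single j 1)
        (tangentFamily (EuclideanSpace.single i 1) (fun s x => (transition e e₀ (s • x),
          fderiv ℝ (transition e e₀) (s • x) x))) 1 z)) := by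
      filter_upwards [Metric.isOpen_ball.mem_nhds hx] with z hz using pd_congr (hev i j z hz)
    rw [pd_congr this]
    exact ((hbd i j x hx).2.2 k l).trans (le_max_left _ _)

/-- On a compact manifold of injectivity radius larger than one, the metric has uniform bounds in
all normal charts of radius one. -/
theorem exists_boundedGeometry [CompactSpace M] [T2Space M] (hinj : 1 < injectivityRadius g) :
    ∃ K : ℝ, 0 < K ∧ ∀ (y : M) (e : OpenPartialHomeomorph M (E n)), IsNormalChart g y 1 e →
      HasBoundedGeometry (gram g e) K := by
  have hloc : ∀ y₀ : M, ∃ K : ℝ, ∃ U ∈ 𝓝 y₀, ∀ y ∈ U, ∀ e, IsNormalChart g y 1 e →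
      HasBoundedGeometry (gram g e) K := by
    intro y₀
    have h1 : 1 < injectivityRadiusAt g y₀ := hinj.trans_le (iInf_le _ y₀)
    obtain ⟨r₀, hr⟩ := lt_iSup_iff.1 h1
    obtain ⟨⟨e₀, h₀⟩, hr₀⟩ := lt_iSup_iff.1 hr
    have hr1 : 1 < r₀ := by
      by_contra! hcon
      exact absurd hr₀ (not_lt.2 (ENNReal.ofReal_le_one.2 hcon))
    obtain ⟨K, ε, hε, hb⟩ := h₀.exists_boundedGeometry_near hr1
    refine ⟨K, e₀.source ∩ e₀ ⁻¹' Metric.ball 0 ε,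
      (e₀.isOpen_inter_preimage Metric.isOpen_ball).mem_nhds
        ⟨h₀.mem_source, by simpa [h₀.map_center] using hε⟩, fun y hy e he => ?_⟩
    exact hb y hy.1 (by simpa using hy.2) e he
  choose K U hU hb using hloc
  obtain ⟨t, ht⟩ := isCompact_univ.elim_nhds_subcover U fun y _ => hU y
  refine ⟨1 + ∑ y ∈ t, |K y|, by positivity, fun y e he => ?_⟩
  obtain ⟨z, hz, hyz⟩ := mem_iUnion₂.1 (ht.2 (mem_univ y))
  refine (hb z y hyz e he).mono ?_
  have := Finset.single_le_sum (f := fun y => |K y|) (fun _ _ => abs_nonneg _) hz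
  have h2 := le_abs_self (K z)
  linarith

end UniformBounds

/-! ### The inner product of endomorphisms -/

section Inner

variable {n : ℕ} {G : Mat n}

/-- Orthonormal frame and coframe of a metric. -/
theorem exists_frame (hG : G.PosDef) : ∃ L N : Mat n, G = N.transpose * N ∧
    G⁻¹ = L.transpose * L ∧ L * N.transpose = 1 ∧ N.transpose * L = 1 := by
  obtain ⟨N, hN⟩ := exists_transpose_mul_self hG.posSemidef
  have hu : IsUnit N.transpose.det := by
    have := hG.isUnit
    rw [Matrix.isUnit_iff_isUnit_det, hN, Matrix.det_mul] at this
    exact isUnit_of_mul_isUnit_left this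
  refine ⟨N.transpose⁻¹, N, hN, ?_, Matrix.nonsing_inv_mul _ hu, Matrix.mul_nonsing_inv _ hu⟩
  rw [hN, Matrix.mul_inv_rev, Matrix.transpose_nonsing_inv, Matrix.transpose_transpose]

theorem trace_mul_transpose_self (A : Mat n) : (A * A.transpose).trace = ‖A‖ ^ 2 := by
  rw [norm_sq_eq_sum]
  simp [Matrix.trace, Matrix.mul_apply, sq]

theorem inn_frame {L N : Mat n} (h1 : G = N.transpose * N) (h2 : G⁻¹ = L.transpose * L)
    (A B : Mat n) : inn G A B
      = ((L * A * N.transpose) * (L * B * N.transpose).transpose).trace := by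
  rw [inn, adj, h2]
  nth_rw 1 [h1]
  simp only [Matrix.transpose_mul, Matrix.transpose_transpose, ← Matrix.mul_assoc]
  rw [Matrix.trace_mul_comm _ L]
  simp only [← Matrix.mul_assoc]

theorem adj_add (A B : Mat n) : adj G (A + B) = adj G A + adj G B := by
  simp [adj, Matrix.mul_add, Matrix.add_mul]

theorem adj_smul (c : ℝ) (A : Mat n) : adj G (c • A) = c • adj G A := by
  simp [adj]

theorem adj_neg (A : Mat n) : adj G (-A) = -adj G A := by
  simp [adj]

theorem adj_sum {ι : Type*} (s : Finset ι) (A : ι → Mat n) :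
    adj G (∑ i ∈ s, A i) = ∑ i ∈ s, adj G (A i) := by
  simp [adj, Matrix.transpose_sum, Finset.mul_sum, Finset.sum_mul]

theorem adj_mul (hG : G.PosDef) (A B : Mat n) : adj G (A * B) = adj G B * adj G A := by
  have : G⁻¹ * G = 1 := Matrix.nonsing_inv_mul _ ((Matrix.isUnit_iff_isUnit_det _).1 hG.isUnit)
  simp only [adj, Matrix.transpose_mul, Matrix.mul_assoc]
  rw [← Matrix.mul_assoc G⁻¹ G, this, Matrix.one_mul]

theorem inn_comm (hG : G.PosDef) (A B : Mat n) : inn G A B = inn G B A := by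
  obtain ⟨L, N, h1, h2, -, -⟩ := exists_frame hG
  rw [inn_frame h1 h2, inn_frame h1 h2, ← Matrix.trace_transpose, Matrix.transpose_mul,
    Matrix.transpose_transpose]

theorem inn_add_left (A B C : Mat n) : inn G (A + B) C = inn G A C + inn G B C := by
  simp [inn, Matrix.add_mul]

theorem inn_smul_left (c : ℝ) (A B : Mat n) : inn G (c • A) B = c * inn G A B := by
  simp [inn]

theorem inn_smul_right (c : ℝ) (A B : Mat n) : inn G A (c • B) = c * inn G A B := by
  simp [inn, adj_smul]

theorem inn_sum_left {ι : Type*} (s : Finset ι) (A : ι → Mat n) (B : Mat n) :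
    inn G (∑ i ∈ s, A i) B = ∑ i ∈ s, inn G (A i) B := by
  simp [inn, Finset.sum_mul, Matrix.trace_sum]

theorem inn_sum_right {ι : Type*} (s : Finset ι) (A : Mat n) (B : ι → Mat n) :
    inn G A (∑ i ∈ s, B i) = ∑ i ∈ s, inn G A (B i) := by
  simp [inn, adj_sum, Finset.mul_sum, Matrix.trace_sum]

theorem trace_nonneg_of_posDef (hG : G.PosDef) : 0 ≤ G.trace := by
  obtain ⟨L, N, h1, -, -, -⟩ := exists_frame hG
  rw [h1, Matrix.trace_mul_comm, trace_mul_transpose_self]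
  positivity

theorem trace_inv_nonneg (hG : G.PosDef) : 0 ≤ (G⁻¹).trace := trace_nonneg_of_posDef hG.inv

theorem inn_self_nonneg (hG : G.PosDef) (A : Mat n) : 0 ≤ inn G A A := by
  obtain ⟨L, N, h1, h2, -, -⟩ := exists_frame hG
  rw [inn_frame h1 h2, trace_mul_transpose_self]
  positivity

/-- The condition number `tr G · tr G⁻¹` compares the metric and the Euclidean norm. -/
theorem norm_sq_le_inn (hG : G.PosDef) (A : Mat n) :
    ‖A‖ ^ 2 ≤ G.trace * (G⁻¹).trace * inn G A A := by
  obtain ⟨L, N, h1, h2, h3, h4⟩ := exists_frame hG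
  rw [inn_frame h1 h2, trace_mul_transpose_self, h2, Matrix.trace_mul_comm L.transpose,
    trace_mul_transpose_self, h1, Matrix.trace_mul_comm, trace_mul_transpose_self]
  have : A = N.transpose * (L * A * N.transpose) * L := by
    simp only [Matrix.mul_assoc]
    rw [h4, Matrix.mul_one, ← Matrix.mul_assoc, h4, Matrix.one_mul]
  have h5 : ‖A‖ ≤ ‖N‖ * ‖L * A * N.transpose‖ * ‖L‖ := by
    conv_lhs => rw [this]
    refine (norm_mul_le _ _).trans ?_
    gcongr
    refine (norm_mul_le _ _).trans ?_
    rw [Matrix.frobenius_norm_transpose]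
  calc ‖A‖ ^ 2 ≤ (‖N‖ * ‖L * A * N.transpose‖ * ‖L‖) ^ 2 := by gcongr
    _ = _ := by ring

theorem inn_le_norm_mul_norm (hG : G.PosDef) (A B : Mat n) :
    |inn G A B| ≤ G.trace * (G⁻¹).trace * (‖A‖ * ‖B‖) := by
  obtain ⟨L, N, h1, h2, h3, h4⟩ := exists_frame hG
  have hb : ∀ A : Mat n, ‖L * A * N.transpose‖ ≤ ‖L‖ * ‖A‖ * ‖N‖ := fun A => by
    refine (norm_mul_le _ _).trans ?_
    rw [Matrix.frobenius_norm_transpose]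
    gcongr
    exact norm_mul_le _ _
  have ht : ∀ X Y : Mat n, |(X * Y.transpose).trace| ≤ ‖X‖ * ‖Y‖ := fun X Y => by
    refine abs_le_of_sq_le_sq ?_ (by positivity)
    rw [mul_pow, norm_sq_eq_sum, norm_sq_eq_sum]
    simp only [Matrix.trace, Matrix.diag_apply, Matrix.mul_apply, Matrix.transpose_apply,
      ← Finset.sum_product']
    exact Finset.sum_mul_sq_le_sq_mul_sq _ _ _
  rw [inn_frame h1 h2, h2, Matrix.trace_mul_comm L.transpose,
    trace_mul_transpose_self, h1, Matrix.trace_mul_comm N.transpose, trace_mul_transpose_self]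
  refine (ht _ _).trans ?_
  calc _ ≤ (‖L‖ * ‖A‖ * ‖N‖) * (‖L‖ * ‖B‖ * ‖N‖) := by gcongr <;> exact hb _
    _ = _ := by ring

/-- The inner product `g^{pq} ⟨P_p, Q_q⟩` of endomorphism valued covectors. -/
def gradInn (G : Mat n) (P Q : Fin n → Mat n) : ℝ := ∑ p, ∑ q, G⁻¹ p q * inn G (P p) (Q q)

theorem gradInn_frame {L : Mat n} (h2 : G⁻¹ = L.transpose * L) (P Q : Fin n → Mat n) :
    gradInn G P Q = ∑ k, inn G (∑ p, L k p • P p) (∑ q, L k q • Q q) := by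
  simp only [gradInn, inn_sum_left, inn_sum_right, inn_smul_left, inn_smul_right]
  simp only [h2, Matrix.mul_apply, Matrix.transpose_apply, Finset.sum_mul]
  have : ∀ p : Fin n, ∑ q, ∑ k, L k p * L k q * inn G (P p) (Q q)
      = ∑ k, ∑ q, L k p * (L k q * inn G (P p) (Q q)) := fun p => by
    rw [Finset.sum_comm]
    simp only [mul_assoc]
  simp only [this]
  rw [Finset.sum_comm]
  refine Finset.sum_congr rfl fun k _ => ?_
  rw [Finset.sum_comm]
  simp only [Finset.mul_sum, mul_left_comm]

theorem gradInn_self_nonneg (hG : G.PosDef) (P : Fin n → Mat n) : 0 ≤ gradInn G P P := by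
  obtain ⟨L, N, h1, h2, -, -⟩ := exists_frame hG
  rw [gradInn_frame h2]
  exact Finset.sum_nonneg fun k _ => inn_self_nonneg hG _

theorem sum_norm_sq_le_gradInn (hG : G.PosDef) (P : Fin n → Mat n) :
    ∑ p, ‖P p‖ ^ 2 ≤ G.trace ^ 2 * (G⁻¹).trace * gradInn G P P := by
  obtain ⟨L, N, h1, h2, h3, h4⟩ := exists_frame hG
  set Q : Fin n → Mat n := fun k => ∑ p, L k p • P p with hQ
  have hP : ∀ p, P p = ∑ k, N k p • Q k := fun p => by
    have : ∀ k, N k p • Q k = ∑ q, (N k p * L k q) • P q := fun k => by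
      rw [hQ]
      simp only [Finset.smul_sum, smul_smul]
    simp only [this]
    rw [Finset.sum_comm]
    have h5 : ∀ q, ∑ k, (N k p * L k q) • P q = (1 : Mat n) p q • P q := fun q => by
      rw [← Finset.sum_smul, ← h4]
      rfl
    simp only [h5, Matrix.one_apply, ite_smul, one_smul, zero_smul, Finset.sum_ite_eq,
      Finset.mem_univ, if_true]
  have hPn : ∀ p, ‖P p‖ ^ 2 ≤ (∑ k, N k p ^ 2) * ∑ k, ‖Q k‖ ^ 2 := fun p => by
    have h5 : ‖P p‖ ≤ ∑ k, |N k p| * ‖Q k‖ := by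
      rw [hP p]
      refine (norm_sum_le _ _).trans (Finset.sum_le_sum fun k _ => ?_)
      rw [norm_smul, Real.norm_eq_abs]
    calc ‖P p‖ ^ 2 ≤ (∑ k, |N k p| * ‖Q k‖) ^ 2 := by gcongr
      _ ≤ (∑ k, |N k p| ^ 2) * ∑ k, ‖Q k‖ ^ 2 := Finset.sum_mul_sq_le_sq_mul_sq _ _ _
      _ = _ := by simp only [sq_abs]
  have hN : ∑ p, ∑ k, N k p ^ 2 = G.trace := by
    rw [h1, Matrix.trace_mul_comm, trace_mul_transpose_self, norm_sq_eq_sum]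
    exact Finset.sum_comm
  have hQn : ∑ k, ‖Q k‖ ^ 2 ≤ G.trace * (G⁻¹).trace * gradInn G P P := by
    rw [gradInn_frame h2, Finset.mul_sum]
    exact Finset.sum_le_sum fun k _ => norm_sq_le_inn hG _
  calc ∑ p, ‖P p‖ ^ 2 ≤ ∑ p, (∑ k, N k p ^ 2) * ∑ k, ‖Q k‖ ^ 2 :=
        Finset.sum_le_sum fun p _ => hPn p
    _ = G.trace * ∑ k, ‖Q k‖ ^ 2 := by rw [← Finset.sum_mul, hN]
    _ ≤ G.trace * (G.trace * (G⁻¹).trace * gradInn G P P) :=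
        mul_le_mul_of_nonneg_left hQn (trace_nonneg_of_posDef hG)
    _ = _ := by ring

end Inner

/-! ### Tensor fields given by their components in all charts -/

section Families

variable {n : ℕ} {M : Type*} [TopologicalSpace M] [ChartedSpace (E n) M]

/-- A function with values in `F` on the target of each chart of `M`. -/
abbrev ChartFamily (n : ℕ) (M F : Type*) [TopologicalSpace M] : Type _ :=
  OpenPartialHomeomorph M (E n) → E n → F

/-- The chart representatives `f e` are those of one function on `M`. -/
def IsScalarFamily (f : ChartFamily n M ℝ) : Prop :=
  ∀ e' ∈ smoothCharts n M, ∀ e ∈ smoothCharts n M, ∀ x ∈ overlap e' e,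
    f e' x = f e (transition e' e x)

/-- The chart representatives `A e` are those of one endomorphism field on `M`. -/
def IsEndFamily (A : ChartFamily n M (Mat n)) : Prop :=
  ∀ e' ∈ smoothCharts n M, ∀ e ∈ smoothCharts n M, ∀ x ∈ overlap e' e,
    A e' x * jac e' e x = jac e' e x * A e (transition e' e x)

/-- The chart representatives `P k e` are those of one covector field on `M` with values in the
endomorphisms. -/
def IsCovEndFamily (P : Fin n → ChartFamily n M (Mat n)) : Prop :=
  ∀ e' ∈ smoothCharts n M, ∀ e ∈ smoothCharts n M, ∀ x ∈ overlap e' e, ∀ k,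
    P k e' x * jac e' e x = jac e' e x * ∑ c, jac e' e x k c • P c e (transition e' e x)

/-- The chart representatives `η k e` are those of one covector field on `M`. -/
def IsCovectorFamily (η : Fin n → ChartFamily n M ℝ) : Prop :=
  ∀ e' ∈ smoothCharts n M, ∀ e ∈ smoothCharts n M, ∀ x ∈ overlap e' e, ∀ k,
    η k e' x = ∑ c, jac e' e x k c * η c e (transition e' e x)

theorem mul_jac_iff {J K A' A : Mat n} (h : J * K = 1) : A' * J = J * A ↔ A' = J * A * K := by
  have h' : K * J = 1 := mul_eq_one_comm.1 h
  constructor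
  · intro hA
    rw [← hA, Matrix.mul_assoc, h, Matrix.mul_one]
  · intro hA
    rw [hA, Matrix.mul_assoc, h', Matrix.mul_one]

theorem IsEndFamily.mul {A B : ChartFamily n M (Mat n)} (hA : IsEndFamily A) (hB : IsEndFamily B) :
    IsEndFamily fun e x => A e x * B e x := fun e' he' e he x hx => by
  rw [Matrix.mul_assoc, hB e' he' e he x hx, ← Matrix.mul_assoc, hA e' he' e he x hx,
    Matrix.mul_assoc]

theorem IsEndFamily.add {A B : ChartFamily n M (Mat n)} (hA : IsEndFamily A) (hB : IsEndFamily B) :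
    IsEndFamily fun e x => A e x + B e x := fun e' he' e he x hx => by
  rw [Matrix.add_mul, hA e' he' e he x hx, hB e' he' e he x hx, Matrix.mul_add]

theorem isEndFamily_one : IsEndFamily fun (_ : OpenPartialHomeomorph M (E n)) _ => (1 : Mat n) :=
  fun _ _ _ _ _ _ => by rw [Matrix.one_mul, Matrix.mul_one]

theorem isEndFamily_endCoeff (J : EndField n M) :
    IsEndFamily fun e x => (Matrix.of (endCoeff e J x) : Mat n) :=
  fun _ he' _ he _ hx => endCoeff_mul_jac he' he hx J

theorem IsEndFamily.trace {A : ChartFamily n M (Mat n)} (hA : IsEndFamily A) :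
    IsScalarFamily fun e x => (A e x).trace := fun e' he' e he x hx => by
  have h := jac_mul_jac he' he hx
  dsimp only
  rw [(mul_jac_iff h).1 (hA e' he' e he x hx), Matrix.trace_mul_comm, ← Matrix.mul_assoc,
    mul_eq_one_comm.1 h, Matrix.one_mul]

theorem IsCovEndFamily.trace_mul {B : ChartFamily n M (Mat n)}
    {P : Fin n → ChartFamily n M (Mat n)} (hB : IsEndFamily B) (hP : IsCovEndFamily P) :
    IsCovectorFamily fun k e x => (B e x * P k e x).trace := fun e' he' e he x hx k => by
  have h := jac_mul_jac he' he hx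
  dsimp only
  rw [(mul_jac_iff h).1 (hB e' he' e he x hx), (mul_jac_iff h).1 (hP e' he' e he x hx k)]
  set K := jac e e' (transition e' e x)
  have h' : K * jac e' e x = 1 := mul_eq_one_comm.1 h
  have e1 : jac e' e x * B e (transition e' e x) * K * (jac e' e x *
      (∑ c, jac e' e x k c • P c e (transition e' e x)) * K)
      = jac e' e x * (B e (transition e' e x) * (∑ c, jac e' e x k c • P c e (transition e' e x)))
        * K := by
    simp only [Matrix.mul_assoc]
    rw [← Matrix.mul_assoc K, h', Matrix.one_mul]
  rw [e1, Matrix.trace_mul_comm, ← Matrix.mul_assoc, h', Matrix.one_mul, Finset.mul_sum,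
    Matrix.trace_sum]
  simp

theorem IsScalarFamily.mul_covector {f : ChartFamily n M ℝ} {η : Fin n → ChartFamily n M ℝ}
    (hf : IsScalarFamily f) (hη : IsCovectorFamily η) :
    IsCovectorFamily fun k e x => f e x * η k e x := fun e' he' e he x hx k => by
  dsimp only
  rw [hf e' he' e he x hx, hη e' he' e he x hx k, Finset.mul_sum]
  exact Finset.sum_congr rfl fun c _ => by ring

theorem isScalarFamily_comp_symm (χ : M → ℝ) :
    IsScalarFamily (n := n) fun e x => χ (e.symm x) := fun e' _ e _ x hx => by
  dsimp only
  rw [symm_transition hx]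

section Metric

variable [IsManifold (𝓡 n) ∞ M] {g : Metric n M}

/-- Conjugation of the inverse metric. -/
theorem gram_inv_eq_jac {e' e : OpenPartialHomeomorph M (E n)} (he' : e' ∈ smoothCharts n M)
    (he : e ∈ smoothCharts n M) {x : E n} (hx : x ∈ overlap e' e) :
    (jac e' e x).transpose * (gram g e' x)⁻¹ * jac e' e x = (gram g e (transition e' e x))⁻¹ := by
  have h := jac_mul_jac he' he hx
  set K := jac e e' (transition e' e x)
  have h' : K * jac e' e x = 1 := mul_eq_one_comm.1 h
  have hu : IsUnit (jac e' e x) := isUnit_jac he' he hx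
  have hud := (Matrix.isUnit_iff_isUnit_det _).1 hu
  have hud' : IsUnit (jac e' e x).transpose.det := by rwa [Matrix.det_transpose]
  rw [gram_eq_jac g he' he hx, Matrix.mul_inv_rev, Matrix.mul_inv_rev]
  rw [← Matrix.mul_assoc, Matrix.mul_nonsing_inv _ hud', Matrix.one_mul, Matrix.mul_assoc,
    Matrix.nonsing_inv_mul _ hud, Matrix.mul_one]

theorem IsEndFamily.adj {A : ChartFamily n M (Mat n)} (hA : IsEndFamily A) :
    IsEndFamily fun e x => HarmonicFlow.adj (gram g e x) (A e x) := fun e' he' e he x hx => by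
  have h := jac_mul_jac he' he hx
  set K := jac e e' (transition e' e x)
  have h' : K * jac e' e x = 1 := mul_eq_one_comm.1 h
  have ht : K.transpose * (jac e' e x).transpose = 1 := by
    rw [← Matrix.transpose_mul, h, Matrix.transpose_one]
  have ht' : (jac e' e x).transpose * K.transpose = 1 := by
    rw [← Matrix.transpose_mul, h', Matrix.transpose_one]
  dsimp only [HarmonicFlow.adj]
  have e1 : (gram g e' x)⁻¹ * jac e' e x = K.transpose * (gram g e (transition e' e x))⁻¹ := by
    rw [← gram_inv_eq_jac he' he hx, ← Matrix.mul_assoc, ← Matrix.mul_assoc, ht, Matrix.one_mul]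
  rw [Matrix.mul_assoc, e1, gram_eq_jac g he' he hx, (mul_jac_iff h).1 (hA e' he' e he x hx)]
  simp only [Matrix.transpose_mul, Matrix.mul_assoc]
  rw [← Matrix.mul_assoc (jac e' e x).transpose K.transpose, ht', Matrix.one_mul,
    ← Matrix.mul_assoc (jac e' e x).transpose K.transpose, ht', Matrix.one_mul]

theorem IsEndFamily.cov {A : ChartFamily n M (Mat n)} (hA : IsEndFamily A)
    (hd : ∀ e ∈ smoothCharts n M, ∀ x ∈ e.target, DifferentiableAt ℝ (A e) x) :
    IsCovEndFamily fun k e x => HarmonicFlow.cov (gram g e) k (A e) x :=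
  fun e' he' e he x hx k => cov_mul_jac g he' he hx (hd e' he' x hx.1)
    (hd e he _ (transition_mem hx)) (fun z hz => hA e' he' e he z hz) k

theorem sum_inv_mul {e' e : OpenPartialHomeomorph M (E n)} (he' : e' ∈ smoothCharts n M)
    (he : e ∈ smoothCharts n M) {x : E n} (hx : x ∈ overlap e' e) {F : Type*} [AddCommGroup F]
    [Module ℝ F] (X : Fin n → Fin n → F) :
    ∑ p, ∑ q, (gram g e' x)⁻¹ p q • ∑ c, ∑ d, (jac e' e x p c * jac e' e x q d) • X c d
      = ∑ c, ∑ d, (gram g e (transition e' e x))⁻¹ c d • X c d := by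
  rw [← gram_inv_eq_jac he' he hx]
  simp only [Matrix.mul_apply, Matrix.transpose_apply, Finset.smul_sum, Finset.sum_smul,
    Finset.sum_mul, smul_smul]
  have : ∀ p, ∑ q, ∑ c, ∑ d, ((gram g e' x)⁻¹ p q * (jac e' e x p c * jac e' e x q d)) • X c d
      = ∑ c, ∑ d, ∑ q, ((gram g e' x)⁻¹ p q * (jac e' e x p c * jac e' e x q d)) • X c d := by
    intro p
    rw [Finset.sum_comm]
    exact Finset.sum_congr rfl fun c _ => Finset.sum_comm
  simp only [this]
  rw [Finset.sum_comm]
  refine Finset.sum_congr rfl fun c _ => ?_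
  rw [Finset.sum_comm]
  refine Finset.sum_congr rfl fun d _ => ?_
  rw [Finset.sum_comm]
  refine Finset.sum_congr rfl fun q _ => Finset.sum_congr rfl fun p _ => ?_
  congr 1
  ring

theorem IsCovEndFamily.contract {P Q : Fin n → ChartFamily n M (Mat n)} (hP : IsCovEndFamily P)
    (hQ : IsCovEndFamily Q) :
    IsEndFamily fun e x => ∑ p, ∑ q, (gram g e x)⁻¹ p q • (P p e x * Q q e x) :=
  fun e' he' e he x hx => by
  dsimp only
  have h1 : ∀ p q, P p e' x * Q q e' x * jac e' e x = jac e' e x * ∑ c, ∑ d,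
      (jac e' e x p c * jac e' e x q d) • (P c e (transition e' e x) * Q d e (transition e' e x)) :=
    fun p q => by
      rw [Matrix.mul_assoc, hQ e' he' e he x hx q, ← Matrix.mul_assoc, hP e' he' e he x hx p,
        Matrix.mul_assoc, Finset.sum_mul]
      simp only [Finset.mul_sum, smul_mul_assoc, mul_smul_comm, smul_smul]
      refine Finset.sum_congr rfl fun c _ => Finset.sum_congr rfl fun d _ => ?_
      rw [mul_comm]
  rw [← sum_inv_mul he' he hx]
  simp only [Finset.sum_mul, smul_mul_assoc, h1]
  simp only [← mul_smul_comm, ← Finset.mul_sum]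

/-- The divergence `g^{pq} (∂_p η_q - Γ^l_{pq} η_l)` of a covector field. -/
def covDiv (G : E n → Mat n) (η : Fin n → E n → ℝ) (x : E n) : ℝ :=
  ∑ p, ∑ q, (G x)⁻¹ p q * (pd p (η q) x - ∑ l, conn G q x p l * η l x)

theorem IsCovectorFamily.covDiv {η : Fin n → ChartFamily n M ℝ} (hη : IsCovectorFamily η)
    (hd : ∀ q, ∀ e ∈ smoothCharts n M, ∀ x ∈ e.target, DifferentiableAt ℝ (η q e) x) :
    IsScalarFamily fun e x => HarmonicFlow.covDiv (gram g e) (fun q => η q e) x :=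
  fun e' he' e he x hx => by
  have key : ∀ p q, pd p (η q e') x - ∑ l, conn (gram g e') q x p l * η l e' x
      = ∑ c, ∑ d, (jac e' e x p c * jac e' e x q d) * (pd c (η d e) (transition e' e x)
        - ∑ l, conn (gram g e) d (transition e' e x) c l * η l e (transition e' e x)) := by
    intro p q
    obtain ⟨z, hz⟩ : ∃ z, z = transition e' e x := ⟨_, rfl⟩
    rw [← hz]
    have hev : η q e' =ᶠ[𝓝 x] fun y => ∑ d, jac e' e y q d * η d e (transition e' e y) := by
      filter_upwards [isOpen_overlap.mem_nhds hx] with y hy using hη e' he' e he y hy q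
    have hJ : DifferentiableAt ℝ (jac e' e) x :=
      contDiffAt_infty_differentiableAt (contDiffAt_jac he' he hx)
    have hJe : ∀ d, DifferentiableAt ℝ (fun y => jac e' e y q d) x := fun d =>
      (entryCLM q d).differentiableAt.comp x hJ
    have hηd : ∀ d, DifferentiableAt ℝ (fun y => η d e (transition e' e y)) x := fun d =>
      DifferentiableAt.comp x (g := η d e) (hd d e he _ (transition_mem hx))
        (hasFDerivAt_transition he' he hx).differentiableAt
    have h1 : pd p (η q e') x = ∑ d, (pd p (jac e' e) x q d * η d e z
        + jac e' e x q d * ∑ c, jac e' e x p c * pd c (η d e) z) := by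
      rw [pd_congr hev, pd_sum fun d _ => (hJe d).fun_mul (hηd d)]
      refine Finset.sum_congr rfl fun d _ => ?_
      rw [pd_mul (hJe d) (hηd d), pd_entry hJ,
        pd_comp_transition he' he hx (hd d e he _ (transition_mem hx))]
      simp only [smul_eq_mul, hz]
    have h2 : ∑ l, conn (gram g e') q x p l * η l e' x
        = ∑ d, (pd q (jac e' e) x p d
          + ∑ a, jac e' e x p a * ∑ c, jac e' e x q c * conn (gram g e) c z a d) * η d e z := by
      have h3 := fun d => congrFun (congrFun (conn_mul_jac g he' he hx q) p) d
      simp only [Matrix.add_apply, Matrix.mul_apply, Matrix.sum_apply, Matrix.smul_apply,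
        smul_eq_mul] at h3
      rw [hz]
      simp only [← h3]
      simp only [hη e' he' e he x hx, Finset.mul_sum, Finset.sum_mul, mul_assoc]
      exact Finset.sum_comm
    rw [h1, h2, ← Finset.sum_sub_distrib]
    simp only [pd_jac_symm he' he hx p q, mul_sub, Finset.sum_sub_distrib, Finset.mul_sum,
      Finset.sum_mul, add_mul, Finset.sum_add_distrib]
    rw [add_sub_add_left_eq_sub]
    congr 1
    · rw [Finset.sum_comm]
      exact Finset.sum_congr rfl fun c _ => Finset.sum_congr rfl fun d _ => by ring
    · rw [Finset.sum_comm]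
      refine Finset.sum_congr rfl fun a _ => ?_
      rw [Finset.sum_comm]
      exact Finset.sum_congr rfl fun c _ => Finset.sum_congr rfl fun d _ => by ring
  have := sum_inv_mul (g := g) he' he hx fun c d => pd c (η d e) (transition e' e x)
        - ∑ l, conn (gram g e) d (transition e' e x) c l * η l e (transition e' e x)
  simp only [smul_eq_mul] at this
  simp only [HarmonicFlow.covDiv, key]
  exact this

end Metric
end Families

/-! ### The Riemannian volume measure -/

section Volume

variable {n : ℕ} {M : Type*} [TopologicalSpace M] [ChartedSpace (E n) M] [IsManifold (𝓡 n) ∞ M]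
  {g : Metric n M} {e e' : OpenPartialHomeomorph M (E n)}

theorem measurableSet_inter_preimage {X Y : Type*} [TopologicalSpace X] [MeasurableSpace X]
    [BorelSpace X] [TopologicalSpace Y] [MeasurableSpace Y] [BorelSpace Y] {f : X → Y} {s : Set X}
    (hf : ContinuousOn f s) (hs : MeasurableSet s) {A : Set Y} (hA : MeasurableSet A) :
    MeasurableSet (s ∩ f ⁻¹' A) := by
  have h1 := hf.domRestrict.measurable hA
  have h2 := hs.subtype_image h1
  convert h2 using 1
  ext x
  simp [and_comm]

theorem vol_eq_jac (he' : e' ∈ smoothCharts n M) (he : e ∈ smoothCharts n M) {x : E n}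
    (hx : x ∈ overlap e' e) : vol (gram g e') x
      = |(fderiv ℝ (transition e' e) x).det| * vol (gram g e) (transition e' e x) := by
  have hdet : (fderiv ℝ (transition e' e) x).det = (jac e' e x).det := by
    rw [ContinuousLinearMap.det,
      ← LinearMap.det_toMatrix (EuclideanSpace.basisFun (Fin n) ℝ).toBasis,
      ← Matrix.det_transpose]
    congr 1
  rw [hdet, vol, gram_eq_jac g he' he hx, Matrix.det_mul, Matrix.det_mul, Matrix.det_transpose,
    mul_right_comm, Real.sqrt_mul (mul_self_nonneg _), Real.sqrt_mul_self_eq_abs]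
  rfl

theorem continuousOn_vol (he : e ∈ smoothCharts n M) : ContinuousOn (vol (gram g e)) e.target :=
  fun _ hx => (isMetricAt_gram g he hx).smooth_vol.continuousAt.continuousWithinAt

theorem transition_image {A : Set M} (hA : A ⊆ e.source) :
    transition e' e '' (e'.target ∩ e'.symm ⁻¹' A) = e.target ∩ e.symm ⁻¹' (A ∩ e'.source) := by
  ext z
  constructor
  · rintro ⟨x, ⟨hx, hxA⟩, rfl⟩
    have hov : x ∈ overlap e' e := ⟨hx, hA hxA⟩
    refine ⟨transition_mem hov, ?_⟩
    rw [mem_preimage, symm_transition hov]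
    exact ⟨hxA, e'.map_target hx⟩
  · rintro ⟨hz, hzA, hz'⟩
    refine ⟨e' (e.symm z), ⟨e'.map_source hz', ?_⟩, ?_⟩
    · rwa [mem_preimage, e'.left_inv hz']
    · rw [transition, e'.left_inv hz', e.right_inv hz]

variable [MeasurableSpace M] [BorelSpace M]

theorem aemeasurable_symm (e : OpenPartialHomeomorph M (E n)) :
    AEMeasurable e.symm (volume.restrict e.target) :=
  e.continuousOn_symm.aemeasurable e.open_target.measurableSet

theorem chartVolume_apply {A : Set M} (hA : MeasurableSet A) :
    chartVolume g e A = ∫⁻ x in e.target ∩ e.symm ⁻¹' A, ENNReal.ofReal (vol (gram g e) x) := by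
  rw [chartVolume, Measure.map_apply_of_aemeasurable
    ((aemeasurable_symm e).mono_ac (withDensity_absolutelyContinuous _ _)) hA, withDensity_apply',
    Measure.restrict_restrict' e.open_target.measurableSet, inter_comm]
  rfl

theorem chartVolume_inter_source {A : Set M} (hA : MeasurableSet A) :
    chartVolume g e (A ∩ e.source) = chartVolume g e A := by
  rw [chartVolume_apply hA, chartVolume_apply (hA.inter e.open_source.measurableSet)]
  congr 2
  ext x
  simp only [mem_inter_iff, mem_preimage]
  exact ⟨fun h => ⟨h.1, h.2.1⟩, fun h => ⟨h.1, h.2, e.map_target h.1⟩⟩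

/-- The volume measures of two charts agree on the intersection of their domains. -/
theorem chartVolume_eq (he' : e' ∈ smoothCharts n M) (he : e ∈ smoothCharts n M) {A : Set M}
    (hA : MeasurableSet A) (h : A ⊆ e.source) (h' : A ⊆ e'.source) :
    chartVolume g e' A = chartVolume g e A := by
  have hm : MeasurableSet (e'.target ∩ e'.symm ⁻¹' A) :=
    measurableSet_inter_preimage e'.continuousOn_symm e'.open_target.measurableSet hA
  have hov : ∀ x ∈ e'.target ∩ e'.symm ⁻¹' A, x ∈ overlap e' e := fun x hx => ⟨hx.1, h hx.2⟩
  have himg := transition_image (e' := e') h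
  rw [inter_eq_left.2 h'] at himg
  have hinj : InjOn (transition e' e) (e'.target ∩ e'.symm ⁻¹' A) := fun x hx z hz hxz => by
    have h1 := symm_transition (hov x hx)
    rw [hxz, symm_transition (hov z hz)] at h1
    exact (e'.symm.injOn hz.1 hx.1 h1).symm
  rw [chartVolume_apply hA, chartVolume_apply hA, ← himg,
    lintegral_image_eq_lintegral_abs_det_fderiv_mul volume hm
      (fun x hx => (hasFDerivAt_transition he' he (hov x hx)).hasFDerivWithinAt) hinj]
  refine setLIntegral_congr_fun hm fun x hx => ?_
  rw [vol_eq_jac he' he (hov x hx), ENNReal.ofReal_mul (abs_nonneg _)]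

theorem riemannianVolume_apply [CompactSpace M] (he : e ∈ smoothCharts n M) {A : Set M}
    (hA : MeasurableSet A) (h : A ⊆ e.source) : riemannianVolume g A = chartVolume g e A := by
  refine le_antisymm ?_ (le_iSup₂ (f := fun (e : OpenPartialHomeomorph M (E n))
    (_ : e ∈ smoothCharts n M) => chartVolume g e) e he A)
  rcases isEmpty_or_nonempty M with hM | hM
  · rw [A.eq_empty_of_isEmpty]; simp
  obtain ⟨t, ht⟩ := isCompact_univ.elim_nhds_subcover (fun p : M => (chartAt (E n) p).source)
    fun p _ => chart_source_mem_nhds (E n) p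
  have htne : t.Nonempty := by
    obtain ⟨p⟩ := hM
    obtain ⟨q, hq, -⟩ := mem_iUnion₂.1 (ht.2 (mem_univ p))
    exact ⟨q, hq⟩
  obtain ⟨f, hf⟩ := t.countable_toSet.exists_eq_range htne
  set c : ℕ → OpenPartialHomeomorph M (E n) := fun i => chartAt (E n) (f i) with hc
  have hcs : ∀ i, c i ∈ smoothCharts n M := fun i => IsManifold.chart_mem_maximalAtlas _
  -- Cut `M` into disjoint measurable pieces, each in the domain of one chart.
  set D : ℕ → Set M := disjointed fun i => (c i).source with hD
  have hDm : ∀ i, MeasurableSet (D i) :=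
    fun i => MeasurableSet.disjointed (fun j => (c j).open_source.measurableSet) i
  have hDd : Pairwise (Function.onFun Disjoint D) := disjoint_disjointed _
  have hDU : ⋃ i, D i = univ := by
    rw [hD, iUnion_disjointed]
    refine eq_univ_of_univ_subset fun p _ => ?_
    obtain ⟨q, hq, hpq⟩ := mem_iUnion₂.1 (ht.2 (mem_univ p))
    have : q ∈ range f := hf ▸ hq
    obtain ⟨i, rfl⟩ := this
    exact mem_iUnion.2 ⟨i, hpq⟩
  have hDs : ∀ i, D i ⊆ (c i).source := fun i => disjointed_subset _ i
  have hsum : ∀ (ρ : Measure M) {B : Set M}, MeasurableSet B → ρ B = ∑' i, ρ (B ∩ D i) := by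
    intro ρ B hB
    rw [← measure_iUnion (fun i j hij => (hDd hij).mono inter_subset_right inter_subset_right)
      fun i => hB.inter (hDm i), ← inter_iUnion, hDU, inter_univ]
  -- The chart measures patched along this partition dominate every chart measure, because chart
  -- measures agree on overlaps.
  set ν : Measure M := Measure.sum fun i => (chartVolume g (c i)).restrict (D i) with hν
  have hνA : ∀ {B : Set M}, MeasurableSet B → ν B = ∑' i, chartVolume g (c i) (B ∩ D i) := by
    intro B hB
    rw [hν, Measure.sum_apply _ hB]
    exact tsum_congr fun i => Measure.restrict_apply hB
  have hle : riemannianVolume g ≤ ν := by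
    refine iSup₂_le fun e' he' => Measure.le_iff.2 fun B hB => ?_
    rw [hsum _ hB, hνA hB]
    refine ENNReal.tsum_le_tsum fun i => ?_
    have hBm := hB.inter (hDm i)
    rw [← chartVolume_inter_source hBm, chartVolume_eq he' (hcs i)
      (hBm.inter e'.open_source.measurableSet)
      (fun p hp => hDs i hp.1.2) inter_subset_right]
    exact measure_mono inter_subset_left
  refine (hle A).trans ?_
  rw [hνA hA, hsum (chartVolume g e) hA]
  exact ENNReal.tsum_le_tsum fun i => (chartVolume_eq (hcs i) he (hA.inter (hDm i))
    (inter_subset_left.trans h) (inter_subset_right.trans (hDs i))).le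

theorem riemannianVolume_restrict [CompactSpace M] (he : e ∈ smoothCharts n M) :
    (riemannianVolume g).restrict e.source = chartVolume g e := by
  refine Measure.ext fun A hA => ?_
  rw [Measure.restrict_apply hA, riemannianVolume_apply he (hA.inter e.open_source.measurableSet)
    inter_subset_right, chartVolume_inter_source hA]

theorem setIntegral_source [CompactSpace M] (he : e ∈ smoothCharts n M) {h : M → ℝ}
    (hh : ContinuousOn h e.source) :
    ∫ p in e.source, h p ∂(riemannianVolume g)
      = ∫ x in e.target, vol (gram g e) x * h (e.symm x) := by
  have hm : AEStronglyMeasurable h ((riemannianVolume g).restrict e.source) :=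
    hh.aestronglyMeasurable e.open_source.measurableSet
  rw [riemannianVolume_restrict he] at hm ⊢
  rw [chartVolume] at hm ⊢
  rw [integral_map ((aemeasurable_symm e).mono_ac (withDensity_absolutelyContinuous _ _)) hm]
  have hv : AEMeasurable (fun x => ENNReal.ofReal (Real.sqrt (gram g e x).det))
      (volume.restrict e.target) :=
    ((continuousOn_vol (g := g) he).aemeasurable e.open_target.measurableSet).ennreal_ofReal
  rw [integral_withDensity_eq_integral_toReal_smul₀ hv (by simp)]
  refine integral_congr_ae (Eventually.of_forall fun x => ?_)
  simp only [smul_eq_mul, ENNReal.toReal_ofReal (Real.sqrt_nonneg _)]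
  rfl

instance isFiniteMeasure_riemannianVolume [CompactSpace M] :
    IsFiniteMeasure (riemannianVolume g) := by
  have : IsLocallyFiniteMeasure (riemannianVolume g) := by
    refine ⟨fun p => ?_⟩
    set c := chartAt (E n) p with hc
    have hcs : c ∈ smoothCharts n M := IsManifold.chart_mem_maximalAtlas _
    have hp : p ∈ c.source := mem_chart_source (E n) p
    obtain ⟨r, hr, hrt⟩ := Metric.nhds_basis_closedBall.mem_iff.1
      (c.open_target.mem_nhds (c.map_source hp))
    refine ⟨c.source ∩ c ⁻¹' Metric.ball (c p) r,
      (c.isOpen_inter_preimage Metric.isOpen_ball).mem_nhds ⟨hp, by simpa using hr⟩, ?_⟩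
    have hm := (c.isOpen_inter_preimage (Metric.isOpen_ball (x := c p) (ε := r))).measurableSet
    rw [riemannianVolume_apply hcs hm inter_subset_left, chartVolume_apply hm]
    have hi : IntegrableOn (vol (gram g c)) (Metric.closedBall (c p) r) :=
      ((continuousOn_vol hcs).mono hrt).integrableOn_compact (isCompact_closedBall _ _)
    refine lt_of_le_of_lt (lintegral_mono_set ?_) hi.lintegral_lt_top
    rintro x ⟨hx, -, hx'⟩
    rw [mem_preimage, c.right_inv hx] at hx'
    exact Metric.ball_subset_closedBall hx'
  exact ⟨isCompact_univ.measure_lt_top⟩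

/-- A nonnegative continuous function with vanishing integral is zero. -/
theorem eq_zero_of_integral_eq_zero [CompactSpace M] {h : M → ℝ} (hh : Continuous h)
    (h0 : ∀ p, 0 ≤ h p) (hi : ∫ p, h p ∂(riemannianVolume g) ≤ 0) (p : M) : h p = 0 := by
  set c := chartAt (E n) p with hc
  have hcs : c ∈ smoothCharts n M := IsManifold.chart_mem_maximalAtlas _
  have hp : p ∈ c.source := mem_chart_source (E n) p
  have hint : Integrable h (riemannianVolume g) := by
    obtain ⟨C, hC⟩ := isCompact_univ.exists_bound_of_continuousOn hh.continuousOn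
    exact Integrable.of_bound hh.aestronglyMeasurable C (Eventually.of_forall fun p => hC p trivial)
  have h1 : ∫ p in c.source, h p ∂(riemannianVolume g) ≤ 0 :=
    (setIntegral_le_integral hint (Eventually.of_forall h0)).trans hi
  have hae : h =ᵐ[(riemannianVolume g).restrict c.source] 0 := by
    refine (integral_eq_zero_iff_of_nonneg h0 hint.integrableOn).1 (le_antisymm h1 ?_)
    exact integral_nonneg h0
  by_contra hne
  have hpos : 0 < h p := lt_of_le_of_ne (h0 p) (Ne.symm hne)
  have hU : IsOpen (c.source ∩ {q | 0 < h q}) := c.open_source.inter (isOpen_lt continuous_const hh)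
  have hz : riemannianVolume g (c.source ∩ {q | 0 < h q}) = 0 := by
    rw [Filter.EventuallyEq, ae_iff] at hae
    rw [Measure.restrict_apply
      (show MeasurableSet {a | ¬h a = (0 : M → ℝ) a} from
        hh.measurable (measurableSet_singleton (0 : ℝ)).compl)] at hae
    refine measure_mono_null ?_ hae
    rintro q ⟨hq, hq'⟩
    exact ⟨ne_of_gt hq', hq⟩
  rw [riemannianVolume_apply hcs hU.measurableSet inter_subset_left,
    chartVolume_apply hU.measurableSet] at hz
  have hO : IsOpen (c.target ∩ c.symm ⁻¹' (c.source ∩ {q | 0 < h q})) :=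
    c.isOpen_inter_preimage_symm hU
  have hmem : c p ∈ c.target ∩ c.symm ⁻¹' (c.source ∩ {q | 0 < h q}) := by
    refine ⟨c.map_source hp, ?_⟩
    rw [mem_preimage, c.left_inv hp]
    exact ⟨hp, hpos⟩
  have hvm : AEMeasurable (fun x => ENNReal.ofReal (vol (gram g c) x)) (volume.restrict
      (c.target ∩ c.symm ⁻¹' (c.source ∩ {q | 0 < h q}))) :=
    (((continuousOn_vol (g := g) hcs).mono inter_subset_left).aemeasurable
      hO.measurableSet).ennreal_ofReal
  have := hO.measure_pos (volume : Measure (E n)) ⟨_, hmem⟩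
  rw [lintegral_eq_zero_iff' hvm, Filter.EventuallyEq, ae_restrict_iff' hO.measurableSet,
    ae_iff] at hz
  refine this.ne' (measure_mono_null (fun x hx => ?_) hz)
  simp only [mem_ofPred_eq, Classical.not_imp, Pi.zero_apply, ENNReal.ofReal_eq_zero, not_le]
  exact ⟨hx, (isMetricAt_gram g hcs hx.1).vol_pos⟩

end Volume

/-! ### Global integrals and the divergence theorem -/

section Global

variable {n : ℕ} {M : Type*} [TopologicalSpace M] [ChartedSpace (E n) M] [IsManifold (𝓡 n) ∞ M]
  {g : Metric n M} {e : OpenPartialHomeomorph M (E n)}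

/-- The function on `M` represented by `f`, evaluated at `p` in the preferred chart at `p`. -/
def glob (f : ChartFamily n M ℝ) (p : M) : ℝ := f (chartAt (E n) p) (chartAt (E n) p p)

theorem chartAt_mem (p : M) : chartAt (E n) p ∈ smoothCharts n M :=
  IsManifold.chart_mem_maximalAtlas _

theorem IsScalarFamily.glob_eq {f : ChartFamily n M ℝ} (hf : IsScalarFamily f)
    (he : e ∈ smoothCharts n M) {p : M} (hp : p ∈ e.source) : glob f p = f e (e p) := by
  have hc := mem_chart_source (E n) p
  have hov : chartAt (E n) p p ∈ overlap (chartAt (E n) p) e := by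
    refine ⟨(chartAt (E n) p).map_source hc, ?_⟩
    rwa [mem_preimage, (chartAt (E n) p).left_inv hc]
  rw [glob, hf _ (chartAt_mem p) e he _ hov, transition, (chartAt (E n) p).left_inv hc]

theorem IsScalarFamily.glob_symm {f : ChartFamily n M ℝ} (hf : IsScalarFamily f)
    (he : e ∈ smoothCharts n M) {x : E n} (hx : x ∈ e.target) : glob f (e.symm x) = f e x := by
  rw [hf.glob_eq he (e.map_target hx), e.right_inv hx]

theorem continuousOn_glob {S : Set ℝ} {f : ℝ → ChartFamily n M ℝ}
    (hf : ∀ t ∈ S, IsScalarFamily (f t))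
    (hc : ∀ e ∈ smoothCharts n M, ContinuousOn (fun q : ℝ × E n => f q.1 e q.2) (S ×ˢ e.target)) :
    ContinuousOn (fun q : ℝ × M => glob (f q.1) q.2) (S ×ˢ univ) := by
  rintro ⟨t, p⟩ ⟨ht, -⟩
  set c := chartAt (E n) p with hcdef
  have hp : p ∈ c.source := mem_chart_source (E n) p
  have h1 : ContinuousOn (fun q : ℝ × M => f q.1 c (c q.2)) (S ×ˢ c.source) := by
    refine ContinuousOn.comp (g := fun q : ℝ × E n => f q.1 c q.2)
      (f := fun q : ℝ × M => (q.1, c q.2)) (hc c (chartAt_mem p)) ?_ ?_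
    · exact continuousOn_fst.prodMk (c.continuousOn.comp continuousOn_snd fun q hq => hq.2)
    · exact fun q hq => ⟨hq.1, c.map_source hq.2⟩
  have h2 : ContinuousWithinAt (fun q : ℝ × M => glob (f q.1) q.2) (S ×ˢ c.source) (t, p) :=
    (h1 (t, p) ⟨ht, hp⟩).congr (fun q hq => (hf _ hq.1).glob_eq (chartAt_mem p) hq.2)
      ((hf _ ht).glob_eq (chartAt_mem p) hp)
  refine h2.mono_of_mem_nhdsWithin ?_
  have : S ×ˢ c.source = (S ×ˢ univ) ∩ (univ ×ˢ c.source) := by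
    rw [prod_inter_prod, inter_univ, univ_inter]
  rw [this]
  exact inter_mem_nhdsWithin _ ((isOpen_univ.prod c.open_source).mem_nhds ⟨trivial, hp⟩)

theorem continuous_glob {f : ChartFamily n M ℝ} (hf : IsScalarFamily f)
    (hc : ∀ e ∈ smoothCharts n M, ContinuousOn (f e) e.target) : Continuous (glob f) := by
  have := continuousOn_glob (S := univ) (f := fun _ => f) (fun _ _ => hf)
    fun e he => (hc e he).comp continuousOn_snd fun q hq => hq.2
  rw [univ_prod_univ, continuousOn_univ] at this
  exact this.comp (Continuous.prodMk_right (0 : ℝ))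

/-- A derivative of a function with compact support in an open set has integral zero. -/
theorem setIntegral_pd_eq_zero {U K : Set (E n)} (hU : IsOpen U) (hK : IsCompact K) (hKU : K ⊆ U)
    {F : E n → ℝ} (hF : ∀ x ∈ U, ContDiffAt ℝ ∞ F x) (h0 : ∀ x ∈ U, x ∉ K → F x = 0) (p : Fin n) :
    IntegrableOn (pd p F) U ∧ ∫ x in U, pd p F x = 0 := by
  set F' : E n → ℝ := U.indicator F with hF'
  have hin : ∀ x ∈ U, F' =ᶠ[𝓝 x] F := fun x hx => by
    filter_upwards [hU.mem_nhds hx] with z hz using indicator_of_mem hz F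
  have hout : ∀ x, x ∉ K → F' x = 0 := fun x hx => by
    by_cases hxU : x ∈ U
    · rw [hF', indicator_of_mem hxU, h0 x hxU hx]
    · exact indicator_of_notMem hxU F
  have hout' : ∀ x, x ∉ K → F' =ᶠ[𝓝 x] fun _ => 0 := fun x hx => by
    filter_upwards [hK.isClosed.isOpen_compl.mem_nhds hx] with z hz using hout z hz
  have hsm : ContDiff ℝ ∞ F' := contDiff_iff_contDiffAt.2 fun x => by
    by_cases hx : x ∈ K
    · exact (hF x (hKU hx)).congr_of_eventuallyEq (hin x (hKU hx))
    · exact contDiffAt_const.congr_of_eventuallyEq (hout' x hx)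
  have hpd : ∀ x, x ∉ K → pd p F' x = 0 := fun x hx => by
    rw [pd_congr (hout' x hx), pd_const]
  have hcs : HasCompactSupport F' := HasCompactSupport.intro hK hout
  have hcs' : HasCompactSupport (pd p F') := HasCompactSupport.intro hK hpd
  have hpdc : Continuous (pd p F') :=
    continuous_iff_continuousAt.2 fun x => (hsm.contDiffAt.pd p).continuousAt
  have hi := hsm.continuous.integrable_of_hasCompactSupport (μ := volume) hcs
  have hi' := hpdc.integrable_of_hasCompactSupport (μ := volume) hcs'
  have hzero : ∫ x, pd p F' x = 0 := by
    have := integral_mul_fderiv_eq_neg_fderiv_mul_of_integrable (𝕜 := ℝ) (μ := volume)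
      (f := fun _ : E n => (1 : ℝ)) (g := F') (v := EuclideanSpace.single p 1)
      (by simp) (by simp only [one_mul]; exact hi') (by simpa using hi)
      (fun x _ => differentiableAt_const _)
      (fun x _ => hsm.contDiffAt.differentiableAt (by simp))
    simp only [one_mul, fderiv_fun_const, Pi.zero_apply, zero_apply, zero_mul,
      integral_zero, neg_zero] at this
    exact this
  have hcongr : EqOn (pd p F') (pd p F) U := fun x hx => pd_congr (hin x hx)
  refine ⟨(integrableOn_congr_fun hcongr hU.measurableSet).1 hi'.integrableOn, ?_⟩
  rw [← setIntegral_congr_fun hU.measurableSet hcongr,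
    setIntegral_eq_integral_of_forall_compl_eq_zero fun x hx =>
      hpd x fun hxK => hx (hKU hxK), hzero]

theorem divDensity_eq_vol_mul {G : E n → Mat n} {x : E n} (h : IsMetricAt G x)
    {η : Fin n → E n → ℝ} (hη : ∀ q, DifferentiableAt ℝ (η q) x) :
    divDensity G η x = vol G x * covDiv G η x := divDensity_eq h hη

theorem smooth_covDiv {G : E n → Mat n} {x : E n} (h : IsMetricAt G x)
    {η : Fin n → E n → ℝ} (hη : ∀ q, ContDiffAt ℝ ∞ (η q) x) : ContDiffAt ℝ ∞ (covDiv G η) x :=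
  ContDiffAt.sum fun p _ => ContDiffAt.sum fun q _ => (h.smooth_inv.matrix_entry p q).mul
    (((hη q).pd p).sub (ContDiffAt.sum fun l _ => ((h.smooth_conn q).matrix_entry p l).mul (hη l)))

theorem covDiv_congr {G : E n → Mat n} {x : E n} {η θ : Fin n → E n → ℝ}
    (h : ∀ q, η q =ᶠ[𝓝 x] θ q) : covDiv G η x = covDiv G θ x := by
  simp only [covDiv, fun p q => pd_congr (k := p) (h q), fun q => (h q).self_of_nhds]

theorem covDiv_sum {ι : Type*} (s : Finset ι) {G : E n → Mat n} {x : E n} {η : ι → Fin n → E n → ℝ}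
    (h : ∀ i ∈ s, ∀ q, DifferentiableAt ℝ (η i q) x) :
    covDiv G (fun q z => ∑ i ∈ s, η i q z) x = ∑ i ∈ s, covDiv G (η i) x := by
  have h1 : ∀ p q, pd p (fun z => ∑ i ∈ s, η i q z) x = ∑ i ∈ s, pd p (η i q) x := fun p q =>
    pd_sum fun i hi => h i hi q
  simp only [covDiv, h1]
  rw [Finset.sum_comm]
  conv_rhs => rw [Finset.sum_comm]
  rw [Finset.sum_comm]
  refine Finset.sum_congr rfl fun p _ => ?_
  rw [Finset.sum_comm]
  refine Finset.sum_congr rfl fun q _ => ?_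
  rw [← Finset.mul_sum, Finset.sum_sub_distrib]
  congr 2
  simp only [Finset.mul_sum]
  exact Finset.sum_comm

theorem covDiv_zero {G : E n → Mat n} {x : E n} : covDiv G (fun _ _ => 0) x = 0 := by
  simp [covDiv, pd_const]

variable [MeasurableSpace M] [BorelSpace M] [CompactSpace M]

theorem integrable_glob {f : ChartFamily n M ℝ} (hf : IsScalarFamily f)
    (hc : ∀ e ∈ smoothCharts n M, ContinuousOn (f e) e.target) :
    Integrable (glob f) (riemannianVolume g) := by
  have hh := continuous_glob hf hc
  obtain ⟨C, hC⟩ := isCompact_univ.exists_bound_of_continuousOn hh.continuousOn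
  exact Integrable.of_bound hh.aestronglyMeasurable C (Eventually.of_forall fun p => hC p trivial)

/-- The divergence theorem on a closed manifold. -/
theorem integral_covDiv_eq_zero [T2Space M] {η : Fin n → ChartFamily n M ℝ}
    (hη : IsCovectorFamily η)
    (hs : ∀ q, ∀ e ∈ smoothCharts n M, ∀ x ∈ e.target, ContDiffAt ℝ ∞ (η q e) x) :
    ∫ p, glob (fun e x => covDiv (gram g e) (fun q => η q e) x) p ∂(riemannianVolume g) = 0 := by
  obtain ⟨t, ht⟩ := isCompact_univ.elim_nhds_subcover (fun p : M => (chartAt (E n) p).source)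
    fun p _ => chart_source_mem_nhds (E n) p
  obtain ⟨χ, hχ⟩ := SmoothPartitionOfUnity.exists_isSubordinate (𝓡 n) isClosed_univ
    (fun i : t => (chartAt (E n) (i : M)).source) (fun i => (chartAt (E n) (i : M)).open_source)
    (fun p hp => by
      obtain ⟨q, hq, hpq⟩ := mem_iUnion₂.1 (ht.2 hp)
      exact mem_iUnion.2 ⟨⟨q, hq⟩, hpq⟩)
  have hsum : ∀ p, ∑ i, χ i p = 1 := fun p => by
    rw [← finsum_eq_sum_of_fintype]; exact χ.sum_eq_one (mem_univ p)
  have hχs : ∀ i, ∀ e ∈ smoothCharts n M, ∀ x ∈ e.target,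
      ContDiffAt ℝ ∞ (fun z => χ i (e.symm z)) x := fun i e he x hx => by
    have h1 : ContMDiffAt (𝓡 n) 𝓘(ℝ, ℝ) ∞ (χ i ∘ e.symm) x :=
      (χ i).contMDiff.contMDiffAt.comp x
        ((contMDiffOn_symm_of_mem_maximalAtlas he).contMDiffAt (e.open_target.mem_nhds hx))
    exact contMDiffAt_iff_contDiffAt.1 h1
  -- With a partition of unity `χ`, each `χ i η` is supported in one chart, where its divergence
  -- is a sum of partial derivatives of compactly supported functions.
  set θ : t → Fin n → ChartFamily n M ℝ := fun i q e x => χ i (e.symm x) * η q e x with hθ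
  have hθc : ∀ i, IsCovectorFamily (θ i) := fun i =>
    (isScalarFamily_comp_symm (χ i)).mul_covector hη
  have hθs : ∀ i q, ∀ e ∈ smoothCharts n M, ∀ x ∈ e.target, ContDiffAt ℝ ∞ (θ i q e) x :=
    fun i q e he x hx => (hχs i e he x hx).mul (hs q e he x hx)
  have hθd : ∀ i q, ∀ e ∈ smoothCharts n M, ∀ x ∈ e.target, DifferentiableAt ℝ (θ i q e) x :=
    fun i q e he x hx => contDiffAt_infty_differentiableAt (hθs i q e he x hx)
  have hD : ∀ i, IsScalarFamily fun e x => covDiv (gram g e) (fun q => θ i q e) x := fun i =>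
    (hθc i).covDiv (hθd i)
  have hDc : ∀ i, ∀ e ∈ smoothCharts n M,
      ContinuousOn (fun x => covDiv (gram g e) (fun q => θ i q e) x) e.target := fun i e he x hx =>
    (smooth_covDiv (isMetricAt_gram g he hx)
      fun q => hθs i q e he x hx).continuousAt.continuousWithinAt
  have hsplit : ∀ p, glob (fun e x => covDiv (gram g e) (fun q => η q e) x) p
      = ∑ i, glob (fun e x => covDiv (gram g e) (fun q => θ i q e) x) p := fun p => by
    have hx : chartAt (E n) p p ∈ (chartAt (E n) p).target :=
      (chartAt (E n) p).map_source (mem_chart_source _ p)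
    simp only [glob]
    rw [← covDiv_sum Finset.univ fun i _ q => hθd i q _ (chartAt_mem p) _ hx]
    refine covDiv_congr fun q => Eventually.of_forall fun z => ?_
    simp only [hθ]
    rw [← Finset.sum_mul, hsum, one_mul]
  simp only [hsplit]
  rw [integral_finsetSum _ fun i _ => integrable_glob (hD i) (hDc i)]
  refine Finset.sum_eq_zero fun i _ => ?_
  set c := chartAt (E n) (i : M) with hcdef
  have hcs : c ∈ smoothCharts n M := chartAt_mem _
  have hzero : ∀ e : OpenPartialHomeomorph M (E n), ∀ x ∈ e.target, e.symm x ∉ tsupport (χ i) →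
      ∀ q, θ i q e =ᶠ[𝓝 x] fun _ => 0 := fun e x hx hxs q => by
    have h1 : ∀ᶠ z in 𝓝 x, e.symm z ∉ tsupport (χ i) :=
      (e.continuousAt_symm hx).eventually ((isClosed_tsupport _).isOpen_compl.mem_nhds hxs)
    filter_upwards [h1] with z hz
    simp only [hθ]
    rw [image_eq_zero_of_notMem_tsupport hz, zero_mul]
  have hoff : ∀ p, p ∉ c.source →
      glob (fun e x => covDiv (gram g e) (fun q => θ i q e) x) p = 0 := fun p hp => by
    have hx : chartAt (E n) p p ∈ (chartAt (E n) p).target :=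
      (chartAt (E n) p).map_source (mem_chart_source _ p)
    rw [glob, covDiv_congr (hzero _ _ hx ?_), covDiv_zero]
    rw [(chartAt (E n) p).left_inv (mem_chart_source _ p)]
    exact fun h => hp (hχ i h)
  rw [← setIntegral_eq_integral_of_forall_compl_eq_zero hoff,
    setIntegral_source hcs (continuous_glob (hD i) (hDc i)).continuousOn]
  set K := c '' tsupport (χ i) with hK
  have hKc : IsCompact K :=
    (isClosed_tsupport _).isCompact.image_of_continuousOn (c.continuousOn.mono (hχ i))
  have hKt : K ⊆ c.target := by
    rintro _ ⟨p, hp, rfl⟩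
    exact c.map_source (hχ i hp)
  have hKz : ∀ x ∈ c.target, x ∉ K → c.symm x ∉ tsupport (χ i) := fun x hx hxK h =>
    hxK ⟨_, h, c.right_inv hx⟩
  have hV : ∀ p, ∀ x ∈ c.target, ContDiffAt ℝ ∞
      (fun z => ∑ q, vol (gram g c) z * (gram g c z)⁻¹ p q * θ i q c z) x := fun p x hx =>
    ContDiffAt.sum fun q _ => (((isMetricAt_gram g hcs hx).smooth_vol).mul
      ((isMetricAt_gram g hcs hx).smooth_inv.matrix_entry p q)).mul (hθs i q c hcs x hx)
  have hV0 : ∀ p, ∀ x ∈ c.target, x ∉ K →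
      ∑ q, vol (gram g c) x * (gram g c x)⁻¹ p q * θ i q c x = 0 := fun p x hx hxK =>
    Finset.sum_eq_zero fun q _ => by
      rw [(hzero c x hx (hKz x hx hxK) q).self_of_nhds, mul_zero]
  have hint := fun p => setIntegral_pd_eq_zero c.open_target hKc hKt (hV p) (hV0 p) p
  have hcong : EqOn (fun x => vol (gram g c) x *
      glob (fun e x => covDiv (gram g e) (fun q => θ i q e) x) (c.symm x))
      (fun x => ∑ p, pd p (fun z => ∑ q, vol (gram g c) z * (gram g c z)⁻¹ p q * θ i q c z) x)
      c.target := fun x hx => by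
    dsimp only
    rw [(hD i).glob_symm hcs hx, ← divDensity_eq_vol_mul (isMetricAt_gram g hcs hx)
      fun q => hθd i q c hcs x hx]
    rfl
  rw [setIntegral_congr_fun c.open_target.measurableSet hcong,
    integral_finsetSum _ fun p _ => (hint p).1]
  exact Finset.sum_eq_zero fun p _ => (hint p).2

/-- Differentiation of global integrals depending on a parameter. -/
theorem hasDerivAt_integral_glob {T : ℝ} {f f' : ℝ → ChartFamily n M ℝ}
    (hf : ∀ t ∈ Ico 0 T, IsScalarFamily (f t))
    (hc : ∀ e ∈ smoothCharts n M,
      ContinuousOn (fun q : ℝ × E n => f q.1 e q.2) (Ico 0 T ×ˢ e.target))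
    (hc' : ∀ e ∈ smoothCharts n M,
      ContinuousOn (fun q : ℝ × E n => f' q.1 e q.2) (Ioo 0 T ×ˢ e.target))
    (hd : ∀ e ∈ smoothCharts n M, ∀ t ∈ Ioo 0 T, ∀ x ∈ e.target,
      HasDerivAt (fun s => f s e x) (f' t e x) t) :
    ContinuousOn (fun t => ∫ p, glob (f t) p ∂(riemannianVolume g)) (Ico 0 T) ∧
      ∀ t ∈ Ioo 0 T, HasDerivAt (fun t => ∫ p, glob (f t) p ∂(riemannianVolume g))
        (∫ p, glob (f' t) p ∂(riemannianVolume g)) t := by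
  have hf' : ∀ t ∈ Ioo 0 T, IsScalarFamily (f' t) := fun t ht e' he' e he x hx => by
    refine (hd e' he' t ht x hx.1).unique ?_
    refine (hd e he t ht _ (transition_mem hx)).congr_of_eventuallyEq ?_
    filter_upwards [isOpen_Ioo.mem_nhds ht] with s hs
    exact hf s (Ioo_subset_Ico_self hs) e' he' e he x hx
  have hg := continuousOn_glob hf hc
  have hg' := continuousOn_glob hf' hc'
  have hslice : ∀ t ∈ Ico 0 T, Continuous (glob (f t)) := fun t ht =>
    continuous_glob (hf t ht) fun e he => (hc e he).comp (f := fun x => (t, x))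
      (continuous_const.prodMk continuous_id).continuousOn fun x hx => ⟨ht, hx⟩
  have hslice' : ∀ t ∈ Ioo 0 T, Continuous (glob (f' t)) := fun t ht =>
    continuous_glob (hf' t ht) fun e he => (hc' e he).comp (f := fun x => (t, x))
      (continuous_const.prodMk continuous_id).continuousOn fun x hx => ⟨ht, hx⟩
  constructor
  · intro t ht
    -- On `[0, b] × M` the integrand is bounded.
    set b := (t + T) / 2
    have hb : t < b ∧ b < T := by
      constructor <;> simp only [b] <;> linarith [ht.2]
    obtain ⟨C, hC⟩ := (isCompact_Icc.prod (isCompact_univ (X := M))).exists_bound_of_continuousOn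
      (hg.mono (prod_mono (Icc_subset_Ico_right hb.2 : Icc 0 b ⊆ Ico 0 T) le_rfl))
    have hev : ∀ᶠ s in 𝓝[Ico 0 T] t, s ∈ Icc 0 b := by
      filter_upwards [self_mem_nhdsWithin, mem_nhdsWithin_of_mem_nhds (Iio_mem_nhds hb.1)]
        with s h1 h2
      exact ⟨h1.1, le_of_lt h2⟩
    refine continuousWithinAt_of_dominated (bound := fun _ => C) ?_ ?_ (integrable_const C) ?_
    · filter_upwards [self_mem_nhdsWithin] with s hs using (hslice s hs).aestronglyMeasurable
    · filter_upwards [hev] with s hs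
      exact Eventually.of_forall fun p => hC (s, p) ⟨hs, trivial⟩
    · refine Eventually.of_forall fun p => ?_
      exact (hg (t, p) ⟨ht, trivial⟩).comp (f := fun s => (s, p))
        (continuous_id.prodMk continuous_const).continuousWithinAt fun s hs => ⟨hs, trivial⟩
  · intro t ht
    -- On the compact set `[a, b] × M` the derivative of the integrand is bounded.
    set a := t / 2
    set b := (t + T) / 2
    have hab : 0 < a ∧ a < t ∧ t < b ∧ b < T := by
      refine ⟨?_, ?_, ?_, ?_⟩ <;> simp only [a, b] <;> linarith [ht.1, ht.2]
    obtain ⟨C, hC⟩ := (isCompact_Icc.prod (isCompact_univ (X := M))).exists_bound_of_continuousOn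
      (hg'.mono (prod_mono (fun s hs => ⟨hab.1.trans_le hs.1, hs.2.trans_lt hab.2.2.2⟩ :
        Icc a b ⊆ Ioo 0 T) le_rfl))
    refine (hasDerivAt_integral_of_dominated_loc_of_deriv_le (s := Ioo a b) (bound := fun _ => C)
      (F' := fun t => glob (f' t))
      (isOpen_Ioo.mem_nhds ⟨hab.2.1, hab.2.2.1⟩) ?_ ?_ ?_ ?_ (integrable_const C) ?_).2
    · filter_upwards [isOpen_Ioo.mem_nhds ht] with s hs
      exact (hslice s (Ioo_subset_Ico_self hs)).aestronglyMeasurable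
    · obtain ⟨C', hC'⟩ := isCompact_univ.exists_bound_of_continuousOn
        (hslice t (Ioo_subset_Ico_self ht)).continuousOn
      exact Integrable.of_bound (hslice t (Ioo_subset_Ico_self ht)).aestronglyMeasurable C'
        (Eventually.of_forall fun p => hC' p trivial)
    · exact (hslice' t ht).aestronglyMeasurable
    · exact Eventually.of_forall fun p s hs => hC (s, p) ⟨Ioo_subset_Icc_self hs, trivial⟩
    · refine Eventually.of_forall fun p s hs => ?_
      exact hd _ (chartAt_mem p) s ⟨hab.1.trans hs.1, hs.2.trans hab.2.2.2⟩ _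
        ((chartAt (E n) p).map_source (mem_chart_source _ p))

end Global

/-! ### Functions of space and time -/

section SpaceTime

variable {n : ℕ} {V : Type*} [NormedAddCommGroup V] [NormedSpace ℝ V] {T : ℝ} {U : Set (E n)}

/-- Smoothness of a time dependent function on `[0, T) × U`, up to the initial time. -/
def IsSmoothFlow (T : ℝ) (U : Set (E n)) (F : ℝ → E n → V) : Prop :=
  ContDiffOn ℝ ∞ (fun q : ℝ × E n => F q.1 q.2) (Ico 0 T ×ˢ U)

/-- The time derivative. -/
def dt (F : ℝ → E n → V) (t : ℝ) (x : E n) : V := deriv (fun s => F s x) t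

variable {F : ℝ → E n → V}

theorem IsSmoothFlow.slice (h : IsSmoothFlow T U F) (hU : IsOpen U) {t : ℝ} (ht : t ∈ Ico 0 T)
    {x : E n} (hx : x ∈ U) : ContDiffAt ℝ ∞ (F t) x := by
  have h1 : ContDiffOn ℝ ∞ (fun z : E n => F t z) U :=
    ContDiffOn.comp (g := fun q : ℝ × E n => F q.1 q.2) (f := fun z => (t, z)) h
      (contDiff_const.prodMk contDiff_id).contDiffOn fun z hz => ⟨ht, hz⟩
  exact h1.contDiffAt (hU.mem_nhds hx)

theorem IsSmoothFlow.contDiffAt (h : IsSmoothFlow T U F) (hU : IsOpen U) {t : ℝ}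
    (ht : t ∈ Ioo 0 T) {x : E n} (hx : x ∈ U) :
    ContDiffAt ℝ ∞ (fun q : ℝ × E n => F q.1 q.2) (t, x) := by
  refine ContDiffOn.contDiffAt h ?_
  refine mem_of_superset ((isOpen_Ioo.prod hU).mem_nhds ⟨ht, hx⟩) ?_
  exact prod_mono Ioo_subset_Ico_self le_rfl

theorem IsSmoothFlow.continuousOn (h : IsSmoothFlow T U F) :
    ContinuousOn (fun q : ℝ × E n => F q.1 q.2) (Ico 0 T ×ˢ U) := ContDiffOn.continuousOn h

theorem uniqueDiffOn_cylinder (hU : IsOpen U) : UniqueDiffOn ℝ (Ico 0 T ×ˢ U) := by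
  rcases le_or_gt T 0 with hT | hT
  · rw [Ico_eq_empty (not_lt.2 hT), empty_prod]; exact uniqueDiffOn_empty
  · exact (uniqueDiffOn_Ico 0 T).prod hU.uniqueDiffOn

theorem IsSmoothFlow.pd (h : IsSmoothFlow T U F) (hU : IsOpen U) (k : Fin n) :
    IsSmoothFlow T U fun t => HarmonicFlow.pd k (F t) := by
  have h1 : ContDiffOn ℝ ∞ (fun q => fderivWithin ℝ (fun q : ℝ × E n => F q.1 q.2)
      (Ico 0 T ×ˢ U) q (0, EuclideanSpace.single k 1)) (Ico 0 T ×ˢ U) :=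
    (ContDiffOn.fderivWithin h (uniqueDiffOn_cylinder hU) (m := ∞) (by simp)).clm_apply
      contDiffOn_const
  refine h1.congr fun q hq => ?_
  have h2 := (h.differentiableOn (by simp) q hq).hasFDerivWithinAt
  have h3 : HasFDerivWithinAt (fun z : E n => (q.1, z)) (ContinuousLinearMap.inr ℝ ℝ (E n)) U q.2 :=
    (hasFDerivAt_prodMk_right q.1 q.2).hasFDerivWithinAt
  have h4 := HasFDerivWithinAt.comp q.2 (g := fun q : ℝ × E n => F q.1 q.2) (t := Ico 0 T ×ˢ U)
    (f := fun z : E n => (q.1, z)) h2 h3 fun z hz => ⟨hq.1, hz⟩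
  have h5 := (h4.hasFDerivAt (hU.mem_nhds hq.2)).fderiv
  change fderiv ℝ (F q.1) q.2 _ = _
  change fderiv ℝ (F q.1) q.2 = _ at h5
  rw [h5]
  rfl

theorem IsSmoothFlow.hasDerivAt (h : IsSmoothFlow T U F) (hU : IsOpen U) {t : ℝ}
    (ht : t ∈ Ioo 0 T) {x : E n} (hx : x ∈ U) : HasDerivAt (fun s => F s x) (dt F t x) t := by
  have h1 : DifferentiableAt ℝ (fun s => F s x) t :=
    DifferentiableAt.comp t (g := fun q : ℝ × E n => F q.1 q.2) (f := fun s => (s, x))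
      (contDiffAt_infty_differentiableAt (h.contDiffAt hU ht hx))
      (differentiableAt_id.prodMk (differentiableAt_const _))
  exact h1.hasDerivAt

theorem IsSmoothFlow.dt_eq (h : IsSmoothFlow T U F) (hU : IsOpen U) {t : ℝ}
    (ht : t ∈ Ioo 0 T) {x : E n} (hx : x ∈ U) :
    dt F t x = fderiv ℝ (fun q : ℝ × E n => F q.1 q.2) (t, x) (1, 0) := by
  have h1 := HasFDerivAt.comp_hasDerivAt t (l := fun q : ℝ × E n => F q.1 q.2)
    (f := fun s => (s, x))
    (contDiffAt_infty_differentiableAt (h.contDiffAt hU ht hx)).hasFDerivAt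
    ((hasDerivAt_id t).prodMk (hasDerivAt_const t x))
  exact h1.deriv

theorem IsSmoothFlow.contDiffAt_dt (h : IsSmoothFlow T U F) (hU : IsOpen U) {t : ℝ}
    (ht : t ∈ Ioo 0 T) {x : E n} (hx : x ∈ U) :
    ContDiffAt ℝ ∞ (fun q : ℝ × E n => dt F q.1 q.2) (t, x) := by
  have h1 := ((h.contDiffAt hU ht hx).fderiv_right (m := ∞) (by simp)).clm_apply
    (contDiffAt_const (c := ((1 : ℝ), (0 : E n))))
  refine h1.congr_of_eventuallyEq ?_
  filter_upwards [(isOpen_Ioo.prod hU).mem_nhds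
    (show (t, x) ∈ Ioo 0 T ×ˢ U from ⟨ht, hx⟩)] with q hq
  exact h.dt_eq hU hq.1 hq.2

theorem IsSmoothFlow.continuousOn_dt (h : IsSmoothFlow T U F) (hU : IsOpen U) :
    ContinuousOn (fun q : ℝ × E n => dt F q.1 q.2) (Ioo 0 T ×ˢ U) := fun _ hq =>
  (h.contDiffAt_dt hU hq.1 hq.2).continuousAt.continuousWithinAt

theorem IsSmoothFlow.contDiffAt_dt_slice (h : IsSmoothFlow T U F) (hU : IsOpen U) {t : ℝ}
    (ht : t ∈ Ioo 0 T) {x : E n} (hx : x ∈ U) : ContDiffAt ℝ ∞ (dt F t) x :=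
  ContDiffAt.comp x (g := fun q : ℝ × E n => dt F q.1 q.2) (f := fun z => (t, z))
    (h.contDiffAt_dt hU ht hx) (contDiffAt_const.prodMk contDiffAt_id)

/-- Time and space derivatives commute. -/
theorem IsSmoothFlow.hasDerivAt_pd (h : IsSmoothFlow T U F) (hU : IsOpen U) {t : ℝ}
    (ht : t ∈ Ioo 0 T) {x : E n} (hx : x ∈ U) (k : Fin n) :
    HasDerivAt (fun s => HarmonicFlow.pd k (F s) x) (HarmonicFlow.pd k (dt F t) x) t := by
  set Φ : ℝ × E n → V := fun q => F q.1 q.2 with hΦ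
  have hc := h.contDiffAt hU ht hx
  have hsym : fderiv ℝ (fderiv ℝ Φ) (t, x) (1, 0) (0, EuclideanSpace.single k 1)
      = fderiv ℝ (fderiv ℝ Φ) (t, x) (0, EuclideanSpace.single k 1) (1, 0) :=
    (hc.isSymmSndFDerivAt (by simpa using
      (WithTop.coe_le_coe.2 le_top : ((2 : ℕ∞) : ℕ∞ω) ≤ ((⊤ : ℕ∞) : ℕ∞ω)))) _ _
  have hd : DifferentiableAt ℝ (fderiv ℝ Φ) (t, x) :=
    contDiffAt_infty_differentiableAt (hc.fderiv_right (m := ∞) (by simp))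
  have hpd : ∀ s ∈ Ioo 0 T, HarmonicFlow.pd k (F s) x
      = fderiv ℝ Φ (s, x) (0, EuclideanSpace.single k 1) := fun s hs => by
    have h3 := HasFDerivAt.comp x (g := Φ) (f := fun z : E n => (s, z))
      (contDiffAt_infty_differentiableAt (h.contDiffAt hU hs hx)).hasFDerivAt
      (hasFDerivAt_prodMk_right s x)
    change fderiv ℝ (F s) x _ = _
    have h5 := h3.fderiv
    change fderiv ℝ (F s) x = _ at h5
    rw [h5]
    rfl
  have h1 : HasDerivAt (fun s => fderiv ℝ Φ (s, x) (0, EuclideanSpace.single k 1))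
      (fderiv ℝ (fderiv ℝ Φ) (t, x) (1, 0) (0, EuclideanSpace.single k 1)) t := by
    have h2 := HasFDerivAt.comp_hasDerivAt t (l := fderiv ℝ Φ) (f := fun s => (s, x))
      hd.hasFDerivAt ((hasDerivAt_id t).prodMk (hasDerivAt_const t x))
    exact h2.clm_apply (hasDerivAt_const t _) |>.congr_deriv (by simp)
  have h6 : HarmonicFlow.pd k (dt F t) x
      = fderiv ℝ (fderiv ℝ Φ) (t, x) (0, EuclideanSpace.single k 1) (1, 0) := by
    have hev : dt F t =ᶠ[𝓝 x] fun z => fderiv ℝ Φ (t, z) (1, 0) := by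
      filter_upwards [hU.mem_nhds hx] with z hz using h.dt_eq hU ht hz
    rw [pd_congr hev]
    have h7 := (HasFDerivAt.comp x (g := fderiv ℝ Φ) (f := fun z : E n => (t, z))
      hd.hasFDerivAt (hasFDerivAt_prodMk_right t x)).clm_apply
      (hasFDerivAt_const ((1 : ℝ), (0 : E n)) x)
    rw [HarmonicFlow.pd]
    change fderiv ℝ (fun z => (fderiv ℝ Φ ∘ fun z => (t, z)) z (1, 0)) x _ = _
    rw [h7.fderiv]
    simp
  rw [h6, ← hsym]
  refine h1.congr_of_eventuallyEq ?_
  filter_upwards [isOpen_Ioo.mem_nhds ht] with s hs using hpd s hs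

section Matrices

variable {G : E n → Mat n} {A B : ℝ → E n → Mat n}

theorem IsSmoothFlow.mul (hA : IsSmoothFlow T U A) (hB : IsSmoothFlow T U B) :
    IsSmoothFlow T U fun t x => A t x * B t x := ContDiffOn.mul hA hB

theorem isSmoothFlow_static {f : E n → V} (hf : ∀ x ∈ U, ContDiffAt ℝ ∞ f x) :
    IsSmoothFlow T U fun _ => f := by
  have h1 : ContDiffOn ℝ ∞ f U := fun x hx => (hf x hx).contDiffWithinAt
  exact h1.comp contDiffOn_snd fun q hq => hq.2

theorem IsSmoothFlow.add {F F' : ℝ → E n → V} (hA : IsSmoothFlow T U F) (hB : IsSmoothFlow T U F') :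
    IsSmoothFlow T U fun t x => F t x + F' t x := ContDiffOn.add hA hB

theorem IsSmoothFlow.sub {F F' : ℝ → E n → V} (hA : IsSmoothFlow T U F) (hB : IsSmoothFlow T U F') :
    IsSmoothFlow T U fun t x => F t x - F' t x := ContDiffOn.sub hA hB

theorem IsSmoothFlow.smul {f : ℝ → E n → ℝ} (hf : IsSmoothFlow T U f) (hA : IsSmoothFlow T U F) :
    IsSmoothFlow T U fun t x => f t x • F t x := ContDiffOn.smul hf hA

theorem IsSmoothFlow.sum {ι : Type*} {s : Finset ι} {F : ι → ℝ → E n → V}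
    (h : ∀ i ∈ s, IsSmoothFlow T U (F i)) : IsSmoothFlow T U fun t x => ∑ i ∈ s, F i t x :=
  ContDiffOn.sum h

theorem IsSmoothFlow.clm {V' : Type*} [NormedAddCommGroup V'] [NormedSpace ℝ V'] (L : V →L[ℝ] V')
    (h : IsSmoothFlow T U F) : IsSmoothFlow T U fun t x => L (F t x) :=
  L.contDiff.comp_contDiffOn h

theorem IsSmoothFlow.cov (h : IsSmoothFlow T U A) (hU : IsOpen U) (hG : ∀ x ∈ U, IsMetricAt G x)
    (k : Fin n) : IsSmoothFlow T U fun t => HarmonicFlow.cov G k (A t) := by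
  have hΓ : IsSmoothFlow T U fun _ => conn G k :=
    isSmoothFlow_static fun x hx => (hG x hx).smooth_conn k
  exact ((h.pd hU k).add (h.mul hΓ)).sub (hΓ.mul h)

theorem IsSmoothFlow.gradProd (hA : IsSmoothFlow T U A) (hB : IsSmoothFlow T U B) (hU : IsOpen U)
    (hG : ∀ x ∈ U, IsMetricAt G x) :
    IsSmoothFlow T U fun t => HarmonicFlow.gradProd G (A t) (B t) :=
  IsSmoothFlow.sum fun p _ => IsSmoothFlow.sum fun q _ => IsSmoothFlow.smul
    (isSmoothFlow_static fun x hx => (hG x hx).smooth_inv.matrix_entry p q)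
    ((hA.cov hU hG p).mul (hB.cov hU hG q))

theorem IsSmoothFlow.adj (hA : IsSmoothFlow T U A) (hG : ∀ x ∈ U, IsMetricAt G x) :
    IsSmoothFlow T U fun t x => HarmonicFlow.adj (G x) (A t x) := by
  have h1 : IsSmoothFlow T U fun _ : ℝ => G := isSmoothFlow_static fun x hx => (hG x hx).smooth
  have h2 : IsSmoothFlow T U fun (_ : ℝ) x => (G x)⁻¹ :=
    isSmoothFlow_static fun x hx => (hG x hx).smooth_inv
  exact (h1.mul (hA.clm (transposeCLM n))).mul h2

theorem IsSmoothFlow.hasDerivAt_cov (h : IsSmoothFlow T U A) (hU : IsOpen U) {t : ℝ}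
    (ht : t ∈ Ioo 0 T) {x : E n} (hx : x ∈ U) (k : Fin n) :
    HasDerivAt (fun s => HarmonicFlow.cov G k (A s) x) (HarmonicFlow.cov G k (dt A t) x) t := by
  have h1 := h.hasDerivAt hU ht hx
  exact ((h.hasDerivAt_pd hU ht hx k).add (h1.mul_const _)).sub (h1.const_mul _)

end Matrices

end SpaceTime

/-! ### Uniqueness for linear parabolic systems -/

section Uniqueness

variable {n : ℕ}

theorem inn_gradInn_bound {G : Mat n} (hG : G.PosDef) {κ C : ℝ} (hκ : 1 ≤ κ) (hC : 0 ≤ C)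
    (h1 : G.trace ≤ κ) (h2 : (G⁻¹).trace ≤ κ) {N W : Mat n} {P : Fin n → Mat n}
    (hN : ‖N‖ ≤ C * (‖W‖ + ∑ p, ‖P p‖)) :
    2 * inn G N W - 2 * gradInn G P P
      ≤ (2 * κ ^ 2 * C + n * (κ ^ 3 / 2 * (κ ^ 2 * C) ^ 2)) * κ ^ 2 * inn G W W := by
  have t1 := trace_nonneg_of_posDef hG
  have t2 := trace_inv_nonneg hG
  have ha : G.trace * (G⁻¹).trace ≤ κ ^ 2 := by nlinarith
  have hb : G.trace ^ 2 * (G⁻¹).trace ≤ κ ^ 3 := by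
    calc G.trace ^ 2 * (G⁻¹).trace = G.trace * (G.trace * (G⁻¹).trace) := by ring
      _ ≤ κ * κ ^ 2 := by gcongr
      _ = κ ^ 3 := by ring
  have hP : ∑ p, ‖P p‖ ^ 2 ≤ κ ^ 3 * gradInn G P P :=
    (sum_norm_sq_le_gradInn hG P).trans
      (mul_le_mul_of_nonneg_right hb (gradInn_self_nonneg hG P))
  have hW : ‖W‖ ^ 2 ≤ κ ^ 2 * inn G W W :=
    (norm_sq_le_inn hG W).trans (mul_le_mul_of_nonneg_right ha (inn_self_nonneg hG W))
  have hNW : inn G N W ≤ κ ^ 2 * (C * (‖W‖ + ∑ p, ‖P p‖) * ‖W‖) := by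
    refine (le_abs_self _).trans ((inn_le_norm_mul_norm hG N W).trans ?_)
    gcongr
  have hκ3 : 0 < κ ^ 3 := by positivity
  have hterm : ∀ p, 2 * (κ ^ 2 * C) * (‖P p‖ * ‖W‖)
      ≤ 2 / κ ^ 3 * ‖P p‖ ^ 2 + κ ^ 3 / 2 * (κ ^ 2 * C) ^ 2 * ‖W‖ ^ 2 := fun p => by
    have h3 := sq_nonneg (2 * ‖P p‖ - κ ^ 3 * (κ ^ 2 * C * ‖W‖))
    have h4 : 2 / κ ^ 3 * ‖P p‖ ^ 2 + κ ^ 3 / 2 * (κ ^ 2 * C) ^ 2 * ‖W‖ ^ 2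
        - 2 * (κ ^ 2 * C) * (‖P p‖ * ‖W‖)
        = (2 * ‖P p‖ - κ ^ 3 * (κ ^ 2 * C * ‖W‖)) ^ 2 / (2 * κ ^ 3) := by
      field_simp
      ring
    have h5 : 0 ≤ (2 * ‖P p‖ - κ ^ 3 * (κ ^ 2 * C * ‖W‖)) ^ 2 / (2 * κ ^ 3) := by positivity
    linarith
  have hsum := Finset.sum_le_sum fun p (_ : p ∈ Finset.univ) => hterm p
  rw [← Finset.mul_sum, ← Finset.sum_mul, Finset.sum_add_distrib, ← Finset.mul_sum,
    Finset.sum_const, Finset.card_univ, Fintype.card_fin, nsmul_eq_mul] at hsum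
  have h6 : 2 / κ ^ 3 * ∑ p, ‖P p‖ ^ 2 ≤ 2 * gradInn G P P := by
    calc 2 / κ ^ 3 * ∑ p, ‖P p‖ ^ 2 ≤ 2 / κ ^ 3 * (κ ^ 3 * gradInn G P P) := by gcongr
      _ = 2 * gradInn G P P := by field_simp
  have h7 : (2 * κ ^ 2 * C + n * (κ ^ 3 / 2 * (κ ^ 2 * C) ^ 2)) * ‖W‖ ^ 2
      ≤ (2 * κ ^ 2 * C + n * (κ ^ 3 / 2 * (κ ^ 2 * C) ^ 2)) * (κ ^ 2 * inn G W W) := by gcongr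
  nlinarith [h7, hsum, h6, hNW]

theorem hasDerivAt_inn {G : Mat n} (hG : G.PosDef) {W : ℝ → Mat n} {W' : Mat n} {t : ℝ}
    (h : HasDerivAt W W' t) : HasDerivAt (fun s => inn G (W s) (W s)) (2 * inn G W' (W t)) t := by
  have h1 : HasDerivAt (fun s => adj G (W s)) (adj G W') t :=
    (((transposeCLM n).hasFDerivAt.comp_hasDerivAt t h).const_mul G).mul_const G⁻¹
  have h2 := (traceCLM n).hasFDerivAt.comp_hasDerivAt t (h.mul h1)
  refine h2.congr_deriv ?_
  change (W' * adj G (W t) + W t * adj G W').trace = _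
  rw [Matrix.trace_add]
  change inn G W' (W t) + inn G (W t) W' = _
  rw [inn_comm hG (W t) W']
  ring

/-- Gronwall's inequality for a function vanishing at the initial time. -/
theorem nonpos_of_hasDerivAt_le {F F' : ℝ → ℝ} {T C : ℝ} (hc : ContinuousOn F (Icc 0 T))
    (hd : ∀ t ∈ Ioo 0 T, HasDerivAt F (F' t) t) (hF : ∀ t ∈ Ioo 0 T, F' t ≤ C * F t)
    (h0 : F 0 ≤ 0) {t : ℝ} (ht : t ∈ Icc 0 T) : F t ≤ 0 := by
  have hdH : ∀ s ∈ Ioo 0 T, HasDerivAt (fun s => Real.exp (-C * s) * F s)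
      (Real.exp (-C * s) * (-C) * F s + Real.exp (-C * s) * F' s) s := fun s hs => by
    have h1 : HasDerivAt (fun s => Real.exp (-C * s)) (Real.exp (-C * s) * (-C)) s := by
      have := ((hasDerivAt_id s).const_mul (-C)).exp
      simpa using this
    exact h1.mul (hd s hs)
  have hanti : AntitoneOn (fun s => Real.exp (-C * s) * F s) (Icc 0 T) := by
    refine antitoneOn_of_deriv_nonpos (convex_Icc 0 T) ?_ ?_ ?_
    · exact (Continuous.continuousOn (by fun_prop)).mul hc
    · rw [interior_Icc]
      exact fun s hs => (hdH s hs).differentiableAt.differentiableWithinAt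
    · rw [interior_Icc]
      intro s hs
      rw [(hdH s hs).deriv]
      have := hF s hs
      have he := Real.exp_pos (-C * s)
      nlinarith
  have h1 := hanti ⟨le_rfl, ht.1.trans ht.2⟩ ht ht.1
  simp only [mul_zero, Real.exp_zero, one_mul] at h1
  have he := Real.exp_pos (-C * t)
  by_contra! hcon
  have := mul_pos he hcon
  linarith

variable {M : Type*} [TopologicalSpace M] [ChartedSpace (E n) M] [IsManifold (𝓡 n) ∞ M]
  {g : Metric n M}

/-- A family of local estimates on compact subsets of charts gives a global one. -/
theorem exists_global_bound [CompactSpace M] {Q : ℝ → OpenPartialHomeomorph M (E n) → E n → Prop}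
    (hmono : ∀ e ∈ smoothCharts n M, ∀ x ∈ e.target, ∀ C C', C ≤ C' → Q C e x → Q C' e x)
    (h : ∀ e ∈ smoothCharts n M, ∀ K ⊆ e.target, IsCompact K → ∃ C, ∀ x ∈ K, Q C e x) :
    ∃ C, ∀ p : M, ∃ e ∈ smoothCharts n M, p ∈ e.source ∧ Q C e (e p) := by
  have hloc : ∀ p : M, ∃ C, ∃ U ∈ 𝓝 p, ∀ q ∈ U,
      ∃ e ∈ smoothCharts n M, q ∈ e.source ∧ Q C e (e q) := by
    intro p
    have hp := mem_chart_source (E n) p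
    obtain ⟨r, hr, hrt⟩ := Metric.nhds_basis_closedBall.mem_iff.1
      ((chartAt (E n) p).open_target.mem_nhds ((chartAt (E n) p).map_source hp))
    obtain ⟨C, hC⟩ := h _ (chartAt_mem p) _ hrt (isCompact_closedBall _ _)
    refine ⟨C, (chartAt (E n) p).source ∩ chartAt (E n) p ⁻¹' Metric.ball (chartAt (E n) p p) r,
      ((chartAt (E n) p).isOpen_inter_preimage Metric.isOpen_ball).mem_nhds
        ⟨hp, by simpa using hr⟩, fun q hq => ⟨_, chartAt_mem p, hq.1, ?_⟩⟩
    exact hC _ (Metric.ball_subset_closedBall hq.2)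
  choose C U hU hQ using hloc
  obtain ⟨t, ht⟩ := isCompact_univ.elim_nhds_subcover U fun p _ => hU p
  refine ⟨∑ p ∈ t, |C p|, fun p => ?_⟩
  obtain ⟨z, hz, hpz⟩ := mem_iUnion₂.1 (ht.2 (mem_univ p))
  obtain ⟨e, he, hpe, hq⟩ := hQ z p hpz
  refine ⟨e, he, hpe, hmono e he _ (e.map_source hpe) _ _ ?_ hq⟩
  exact (le_abs_self _).trans
    (Finset.single_le_sum (f := fun p => |C p|) (fun _ _ => abs_nonneg _) hz)

theorem IsScalarFamily.of_hasDerivAt {T : ℝ} {f f' : ℝ → ChartFamily n M ℝ}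
    (hf : ∀ t ∈ Ico 0 T, IsScalarFamily (f t))
    (hd : ∀ e ∈ smoothCharts n M, ∀ t ∈ Ioo 0 T, ∀ x ∈ e.target,
      HasDerivAt (fun s => f s e x) (f' t e x) t) {t : ℝ} (ht : t ∈ Ioo 0 T) :
    IsScalarFamily (f' t) := fun e' he' e he x hx => by
  refine (hd e' he' t ht x hx.1).unique ?_
  refine (hd e he t ht _ (transition_mem hx)).congr_of_eventuallyEq ?_
  filter_upwards [isOpen_Ioo.mem_nhds ht] with s hs
  exact hf s (Ioo_subset_Ico_self hs) e' he' e he x hx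

theorem covDiv_inn {G : E n → Mat n} {x : E n} (h : IsMetricAt G x)
    {W : E n → Mat n} (hW : ContDiffAt ℝ ∞ W x) :
    covDiv G (fun q z => (adj (G z) (W z) * cov G q W z).trace) x
      = gradInn (G x) (fun p => cov G p W x) (fun p => cov G p W x)
        + inn (G x) (lap G W x) (W x) := by
  have hB : ContDiffAt ℝ ∞ (fun z => adj (G z) (W z)) x :=
    (h.smooth.mul hW.matrix_transpose).mul h.smooth_inv
  have h1 := divDensity_trace h hW hB
  rw [divDensity_eq_vol_mul h fun q => contDiffAt_infty_differentiableAt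
    (hB.mul (hW.cov h q)).matrix_trace] at h1
  rw [mul_left_cancel₀ h.vol_pos.ne' h1]
  congr 1
  · simp only [gradInn, inn, cov_adj h (contDiffAt_infty_differentiableAt hW)]
    rw [Finset.sum_comm]
    refine Finset.sum_congr rfl fun p _ => Finset.sum_congr rfl fun q _ => ?_
    rw [h.inv_symm, Matrix.trace_mul_comm]
  · rw [inn, Matrix.trace_mul_comm]

variable [MeasurableSpace M] [BorelSpace M] [CompactSpace M] [T2Space M]

/-- A time dependent endomorphism field which vanishes initially and solves a linear parabolic
system `∂_t W = Δ W + O(|W| + |∇W|)` vanishes, by Gronwall's inequality for `∫ |W|²`. -/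
theorem eq_zero_of_linear_heat {T : ℝ} {W : ℝ → ChartFamily n M (Mat n)}
    (hEnd : ∀ t ∈ Ico 0 T, IsEndFamily (W t))
    (hsm : ∀ e ∈ smoothCharts n M, IsSmoothFlow T e.target fun t => W t e)
    (h0 : ∀ e ∈ smoothCharts n M, ∀ x ∈ e.target, W 0 e x = 0)
    (heq : ∀ e ∈ smoothCharts n M, ∀ K ⊆ e.target, IsCompact K → ∀ T' < T, ∃ C, ∀ t ∈ Ioo 0 T',
      ∀ x ∈ K, ‖dt (fun t => W t e) t x - lap (gram g e) (W t e) x‖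
        ≤ C * (‖W t e x‖ + ∑ p, ‖cov (gram g e) p (W t e) x‖))
    {t : ℝ} (ht : t ∈ Ico 0 T) {e : OpenPartialHomeomorph M (E n)} (he : e ∈ smoothCharts n M)
    {x : E n} (hx : x ∈ e.target) : W t e x = 0 := by
  have hG : ∀ e ∈ smoothCharts n M, ∀ x ∈ e.target, IsMetricAt (gram g e) x :=
    fun e he x hx => isMetricAt_gram g he hx
  set f : ℝ → ChartFamily n M ℝ := fun t e x => inn (gram g e x) (W t e x) (W t e x) with hfdef
  set f' : ℝ → ChartFamily n M ℝ := fun t e x =>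
    2 * inn (gram g e x) (dt (fun t => W t e) t x) (W t e x) with hf'def
  have hf : ∀ t ∈ Ico 0 T, IsScalarFamily (f t) := fun t ht =>
    ((hEnd t ht).mul (hEnd t ht).adj).trace
  have hd : ∀ e ∈ smoothCharts n M, ∀ t ∈ Ioo 0 T, ∀ x ∈ e.target,
      HasDerivAt (fun s => f s e x) (f' t e x) t := fun e he t ht x hx =>
    hasDerivAt_inn (hG e he x hx).self ((hsm e he).hasDerivAt e.open_target ht hx)
  have hc : ∀ e ∈ smoothCharts n M,
      ContinuousOn (fun q : ℝ × E n => f q.1 e q.2) (Ico 0 T ×ˢ e.target) := fun e he =>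
    (((hsm e he).mul ((hsm e he).adj (hG e he))).clm (traceCLM n)).continuousOn
  have hadj : ∀ e ∈ smoothCharts n M, ContinuousOn
      (fun q : ℝ × E n => adj (gram g e q.2) (W q.1 e q.2)) (Ioo 0 T ×ˢ e.target) := fun e he =>
    ((hsm e he).adj (hG e he)).continuousOn.mono (prod_mono Ioo_subset_Ico_self le_rfl)
  have hc' : ∀ e ∈ smoothCharts n M,
      ContinuousOn (fun q : ℝ × E n => f' q.1 e q.2) (Ioo 0 T ×ˢ e.target) := fun e he =>
    continuousOn_const.mul ((traceCLM n).continuous.comp_continuousOn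
      (((hsm e he).continuousOn_dt e.open_target).mul (hadj e he)))
  obtain ⟨hFc, hFd⟩ := hasDerivAt_integral_glob (g := g) hf hc hc' hd
  set F : ℝ → ℝ := fun t => ∫ p, glob (f t) p ∂(riemannianVolume g) with hF
  have hfnn : ∀ t p, 0 ≤ glob (f t) p := fun t p =>
    inn_self_nonneg (posDef_gram g (chartAt_mem p)
      ((chartAt (E n) p).map_source (mem_chart_source _ p))) _
  have hcs : ∀ t ∈ Ico 0 T, ∀ e ∈ smoothCharts n M, ContinuousOn (f t e) e.target :=
    fun t ht e he => (hc e he).comp (f := fun x => (t, x))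
      (continuous_const.prodMk continuous_id).continuousOn fun x hx => ⟨ht, hx⟩
  have hcs' : ∀ t ∈ Ioo 0 T, ∀ e ∈ smoothCharts n M, ContinuousOn (f' t e) e.target :=
    fun t ht e he => (hc' e he).comp (f := fun x => (t, x))
      (continuous_const.prodMk continuous_id).continuousOn fun x hx => ⟨ht, hx⟩
  set T' := (t + T) / 2 with hT'
  have hT't : t ≤ T' ∧ T' < T := by constructor <;> simp only [hT'] <;> linarith [ht.1, ht.2]
  have hsub : Ioo 0 T' ⊆ Ioo 0 T := Ioo_subset_Ioo_right hT't.2.le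
  -- The flux `⟨W, ∇_q W⟩`, whose divergence `|∇W|² + ⟨W, ΔW⟩` integrates to zero.
  set η : ℝ → Fin n → ChartFamily n M ℝ := fun t q e x =>
    (adj (gram g e x) (W t e x) * cov (gram g e) q (W t e) x).trace with hη
  have hWs : ∀ t ∈ Ico 0 T, ∀ e ∈ smoothCharts n M, ∀ x ∈ e.target, ContDiffAt ℝ ∞ (W t e) x :=
    fun t ht e he x hx => (hsm e he).slice e.open_target ht hx
  have hηc : ∀ t ∈ Ico 0 T, IsCovectorFamily (η t) := fun t ht =>
    IsCovEndFamily.trace_mul (hEnd t ht).adj ((hEnd t ht).cov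
      fun e he x hx => contDiffAt_infty_differentiableAt (hWs t ht e he x hx))
  have hηs : ∀ t ∈ Ico 0 T, ∀ q, ∀ e ∈ smoothCharts n M, ∀ x ∈ e.target,
      ContDiffAt ℝ ∞ (η t q e) x := fun t ht q e he x hx =>
    ((((hG e he x hx).smooth.mul (hWs t ht e he x hx).matrix_transpose).mul
      (hG e he x hx).smooth_inv).mul ((hWs t ht e he x hx).cov (hG e he x hx) q)).matrix_trace
  have hηd : ∀ t ∈ Ico 0 T, IsScalarFamily fun e x => covDiv (gram g e) (fun q => η t q e) x :=
    fun t ht => (hηc t ht).covDiv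
      fun q e he x hx => contDiffAt_infty_differentiableAt (hηs t ht q e he x hx)
  have hηdc : ∀ t ∈ Ico 0 T, ∀ e ∈ smoothCharts n M,
      ContinuousOn (fun x => covDiv (gram g e) (fun q => η t q e) x) e.target :=
    fun t ht e he x hx =>
    (smooth_covDiv (hG e he x hx) fun q => hηs t ht q e he x hx).continuousAt.continuousWithinAt
  -- Pointwise, `∂_t |W|²` minus twice the divergence is `O(|W|² + |W| |∇W|) - 2 |∇W|²`, and the
  -- gradient terms are absorbed.
  obtain ⟨C, hC⟩ := exists_global_bound (M := M) (n := n)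
    (Q := fun C e x => ∀ t ∈ Ioo 0 T',
      f' t e x - 2 * covDiv (gram g e) (fun q => η t q e) x ≤ C * f t e x) (by
    intro e he x hx C C' hCC hQ t ht
    exact (hQ t ht).trans (mul_le_mul_of_nonneg_right hCC
      (inn_self_nonneg (hG e he x hx).self _))) (by
    intro e he K hK hKc
    obtain ⟨C₀, hC₀⟩ := heq e he K hK hKc T' hT't.2
    have htr : ContinuousOn (fun x => (gram g e x).trace) K := fun x hx =>
      (hG e he x (hK hx)).smooth.matrix_trace.continuousAt.continuousWithinAt
    have htr' : ContinuousOn (fun x => ((gram g e x)⁻¹).trace) K := fun x hx =>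
      (hG e he x (hK hx)).smooth_inv.matrix_trace.continuousAt.continuousWithinAt
    obtain ⟨κ₁, hκ₁⟩ := hKc.exists_bound_of_continuousOn htr
    obtain ⟨κ₂, hκ₂⟩ := hKc.exists_bound_of_continuousOn htr'
    set κ := max 1 (max κ₁ κ₂)
    refine ⟨(2 * κ ^ 2 * |C₀| + n * (κ ^ 3 / 2 * (κ ^ 2 * |C₀|) ^ 2)) * κ ^ 2,
      fun x hx t ht => ?_⟩
    have htI : t ∈ Ico 0 T := Ioo_subset_Ico_self (hsub ht)
    have h1 : f' t e x - 2 * covDiv (gram g e) (fun q => η t q e) x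
        = 2 * inn (gram g e x) (dt (fun t => W t e) t x - lap (gram g e) (W t e) x) (W t e x)
          - 2 * gradInn (gram g e x) (fun p => cov (gram g e) p (W t e) x)
            (fun p => cov (gram g e) p (W t e) x) := by
      rw [covDiv_inn (hG e he x (hK hx)) (hWs t htI e he x (hK hx)),
        sub_eq_add_neg (dt (fun t => W t e) t x), inn_add_left, ← neg_one_smul ℝ (lap _ _ _),
        inn_smul_left]
      simp only [hf'def]
      ring
    rw [h1]
    refine inn_gradInn_bound (hG e he x (hK hx)).self (le_max_left _ _) (abs_nonneg _) ?_ ?_ ?_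
    · exact (le_abs_self _).trans ((hκ₁ x hx).trans ((le_max_left _ _).trans (le_max_right _ _)))
    · exact (le_abs_self _).trans ((hκ₂ x hx).trans ((le_max_right _ _).trans (le_max_right _ _)))
    · refine (hC₀ t ht x hx).trans ?_
      gcongr
      exact le_abs_self _)
  have hFle : ∀ s ∈ Ioo 0 T', (∫ p, glob (f' s) p ∂(riemannianVolume g)) ≤ C * F s := by
    intro s hs
    have hsI : s ∈ Ico 0 T := Ioo_subset_Ico_self (hsub hs)
    have hf's := IsScalarFamily.of_hasDerivAt hf hd (hsub hs)
    have i1 := integrable_glob (g := g) hf's (hcs' s (hsub hs))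
    have i2 := integrable_glob (g := g) (hηd s hsI) (hηdc s hsI)
    have i3 := integrable_glob (g := g) (hf s hsI) (hcs s hsI)
    have h1 : ∫ p, glob (f' s) p ∂(riemannianVolume g)
        = ∫ p, (glob (f' s) p - 2 * glob (fun e x => covDiv (gram g e) (fun q => η s q e) x) p)
          ∂(riemannianVolume g) := by
      rw [integral_sub i1 (i2.const_mul 2), integral_const_mul,
        integral_covDiv_eq_zero (hηc s hsI) (hηs s hsI)]
      ring
    rw [h1, hF]
    dsimp only
    rw [← integral_const_mul]
    refine integral_mono (i1.sub (i2.const_mul 2)) (i3.const_mul C) fun p => ?_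
    obtain ⟨e, he, hpe, hQ⟩ := hC p
    dsimp only
    rw [hf's.glob_eq he hpe, (hηd s hsI).glob_eq he hpe, (hf s hsI).glob_eq he hpe]
    exact hQ s hs
  have hF0 : F 0 ≤ 0 := by
    rw [hF]
    refine le_of_eq (integral_eq_zero_of_ae (Eventually.of_forall fun p => ?_))
    simp only [glob, hfdef]
    rw [h0 _ (chartAt_mem p) _ ((chartAt (E n) p).map_source (mem_chart_source _ p))]
    simp [inn]
  have hFt : F t ≤ 0 := nonpos_of_hasDerivAt_le (T := T')
    (hFc.mono (Icc_subset_Ico_right hT't.2)) (fun s hs => hFd s (hsub hs)) hFle hF0 ⟨ht.1, hT't.1⟩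
  have hz := eq_zero_of_integral_eq_zero (g := g) (continuous_glob (hf t ht) (hcs t ht)) (hfnn t)
    hFt (e.symm x)
  rw [(hf t ht).glob_symm he hx] at hz
  have h2 := norm_sq_le_inn (hG e he x hx).self (W t e x)
  rw [show inn (gram g e x) (W t e x) (W t e x) = 0 from hz, mul_zero] at h2
  exact norm_eq_zero.1 (pow_eq_zero_iff two_ne_zero |>.1 (le_antisymm h2 (sq_nonneg _)))

end Uniqueness

/-! ### Preservation of the compatibility conditions -/

section Laplacian

variable {n : ℕ} {G : E n → Mat n} {x : E n} {A B : E n → Mat n}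

theorem eventually_differentiableAt {V : Type*} [NormedAddCommGroup V] [NormedSpace ℝ V]
    {f : E n → V} (hf : ContDiffAt ℝ ∞ f x) : ∀ᶠ z in 𝓝 x, DifferentiableAt ℝ f z := by
  have h1 : ContDiffAt ℝ 1 f x := hf.of_le (by exact_mod_cast le_top)
  filter_upwards [h1.eventually (by simp)] with z hz using hz.differentiableAt (by simp)

theorem cov_mul_eventually (hA : ContDiffAt ℝ ∞ A x) (hB : ContDiffAt ℝ ∞ B x) (p : Fin n) :
    cov G p (fun z => A z * B z) =ᶠ[𝓝 x] fun z => cov G p A z * B z + A z * cov G p B z := by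
  filter_upwards [eventually_differentiableAt hA, eventually_differentiableAt hB] with z h1 h2
  exact cov_mul h1 h2

theorem sum_inv_comm (h : IsMetricAt G x) {V : Type*} [AddCommGroup V] [Module ℝ V]
    (X : Fin n → Fin n → V) :
    ∑ p, ∑ q, (G x)⁻¹ p q • X q p = ∑ p, ∑ q, (G x)⁻¹ p q • X p q := by
  rw [Finset.sum_comm]
  exact Finset.sum_congr rfl fun p _ => Finset.sum_congr rfl fun q _ => by rw [h.inv_symm]

theorem lap_mul (h : IsMetricAt G x) (hA : ContDiffAt ℝ ∞ A x) (hB : ContDiffAt ℝ ∞ B x) :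
    lap G (fun z => A z * B z) x
      = lap G A x * B x + A x * lap G B x + (2 : ℝ) • gradProd G A B x := by
  have dA := contDiffAt_infty_differentiableAt hA
  have dB := contDiffAt_infty_differentiableAt hB
  have dP : ∀ p, DifferentiableAt ℝ (cov G p A) x := fun p =>
    contDiffAt_infty_differentiableAt (hA.cov h p)
  have dQ : ∀ p, DifferentiableAt ℝ (cov G p B) x := fun p =>
    contDiffAt_infty_differentiableAt (hB.cov h p)
  have h2 : ∀ q p, cov G q (cov G p (fun z => A z * B z)) x
      = cov G q (cov G p A) x * B x + cov G p A x * cov G q B x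
        + (cov G q A x * cov G p B x + A x * cov G q (cov G p B) x) := fun q p => by
    rw [cov_congr (cov_mul_eventually hA hB p),
      cov_add ((dP p).fun_mul dB) (dA.fun_mul (dQ p)), cov_mul (dP p) dB, cov_mul dA (dQ p)]
  have h3 := sum_inv_comm h fun p q => cov G p A x * cov G q B x
  simp only [lap, h2, cov_mul dA dB, gradProd]
  rw [two_smul]
  nth_rw 1 [← h3]
  simp only [Finset.sum_mul, Finset.mul_sum, ← Finset.sum_add_distrib]
  refine Finset.sum_congr rfl fun p _ => Finset.sum_congr rfl fun q _ => ?_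
  simp only [smul_mul_assoc, mul_smul_comm, ← smul_add, sub_mul, mul_sub, Finset.sum_mul,
    Finset.mul_sum]
  congr 1
  simp only [smul_add, Finset.sum_add_distrib]
  abel

theorem lap_add (h : IsMetricAt G x) (hA : ContDiffAt ℝ ∞ A x) (hB : ContDiffAt ℝ ∞ B x) :
    lap G (fun z => A z + B z) x = lap G A x + lap G B x := by
  have dP : ∀ p, DifferentiableAt ℝ (cov G p A) x := fun p =>
    contDiffAt_infty_differentiableAt (hA.cov h p)
  have dQ : ∀ p, DifferentiableAt ℝ (cov G p B) x := fun p =>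
    contDiffAt_infty_differentiableAt (hB.cov h p)
  have h1 : ∀ p, cov G p (fun z => A z + B z) =ᶠ[𝓝 x] fun z => cov G p A z + cov G p B z :=
    fun p => by
    filter_upwards [eventually_differentiableAt hA, eventually_differentiableAt hB] with z h1 h2
    exact cov_add h1 h2
  have h2 : ∀ p q, cov G q (cov G p (fun z => A z + B z)) x
      = cov G q (cov G p A) x + cov G q (cov G p B) x := fun p q => by
    rw [cov_congr (h1 p), cov_add (dP p) (dQ p)]
  have h3 : ∀ p, cov G p (fun z => A z + B z) x = cov G p A x + cov G p B x :=
    fun p => (h1 p).self_of_nhds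
  simp only [lap, h2, h3, ← Finset.sum_add_distrib]
  refine Finset.sum_congr rfl fun p _ => Finset.sum_congr rfl fun q _ => ?_
  rw [← smul_add]
  congr 1
  simp only [smul_add, Finset.sum_add_distrib]
  abel

theorem cov_zero (k : Fin n) : cov G k (fun _ => 0) x = 0 := by
  simp [cov, pd_const]

theorem lap_one : lap G (fun _ => 1) x = 0 := by
  have h1 : ∀ p, cov G p (fun _ : E n => (1 : Mat n)) = fun _ => 0 := fun p => by
    funext z; exact cov_const_one
  simp [lap, h1, cov_zero]

theorem smooth_adj (h : IsMetricAt G x) (hA : ContDiffAt ℝ ∞ A x) :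
    ContDiffAt ℝ ∞ (fun z => adj (G z) (A z)) x :=
  (h.smooth.mul hA.matrix_transpose).mul h.smooth_inv

theorem lap_adj (hG : ∀ᶠ z in 𝓝 x, IsMetricAt G z) (hA : ContDiffAt ℝ ∞ A x) :
    lap G (fun z => adj (G z) (A z)) x = adj (G x) (lap G A x) := by
  have h := hG.self_of_nhds
  have h1 : ∀ p, cov G p (fun z => adj (G z) (A z)) =ᶠ[𝓝 x] fun z => adj (G z) (cov G p A z) :=
    fun p => by
      filter_upwards [eventually_differentiableAt hA, hG] with z h1 h2 using cov_adj h2 h1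
  have h2 : ∀ p q, cov G q (cov G p fun z => adj (G z) (A z)) x
      = adj (G x) (cov G q (cov G p A) x) := fun p q => by
    rw [cov_congr (h1 p), cov_adj h (contDiffAt_infty_differentiableAt (hA.cov h p))]
  have h3 : ∀ p, cov G p (fun z => adj (G z) (A z)) x = adj (G x) (cov G p A x) :=
    fun p => (h1 p).self_of_nhds
  simp only [lap, h2, h3, adj_sum, adj_smul, sub_eq_add_neg, adj_add, adj_neg]

theorem gradProd_adj (h : IsMetricAt G x) (hA : DifferentiableAt ℝ A x) :
    gradProd G (fun z => adj (G z) (A z)) (fun z => adj (G z) (A z)) x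
      = adj (G x) (gradProd G A A x) := by
  simp only [gradProd, cov_adj h hA, ← adj_mul h.self, adj_sum, adj_smul]
  exact sum_inv_comm h fun p q => adj (G x) (cov G p A x * cov G q A x)

theorem norm_contract_le {a : Fin n → Fin n → ℝ} {X : Fin n → Fin n → Mat n} {b y : ℝ}
    (hb : 0 ≤ b) (ha : ∀ p q, |a p q| ≤ b) (hX : ∀ p q, ‖X p q‖ ≤ y) :
    ‖∑ p, ∑ q, a p q • X p q‖ ≤ n ^ 2 * (b * y) := by
  have h1 : ∀ p q, ‖a p q • X p q‖ ≤ b * y := fun p q => by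
    rw [norm_smul, Real.norm_eq_abs]
    exact mul_le_mul (ha p q) (hX p q) (norm_nonneg _) hb
  calc ‖∑ p, ∑ q, a p q • X p q‖ ≤ ∑ _p : Fin n, ∑ _q : Fin n, b * y :=
        (norm_sum_le _ _).trans (Finset.sum_le_sum fun p _ =>
          (norm_sum_le _ _).trans (Finset.sum_le_sum fun q _ => h1 p q))
    _ = n ^ 2 * (b * y) := by simp; ring

/-- The defect `S = A² + 1` of a solution of the flow solves a linear equation. -/
theorem sq_defect_equation (h : IsMetricAt G x) (hA : ContDiffAt ℝ ∞ A x) :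
    (lap G A x - A x * gradProd G A A x) * A x + A x * (lap G A x - A x * gradProd G A A x)
      - lap G (fun z => A z * A z + 1) x
      = -(∑ p, ∑ q, (G x)⁻¹ p q • (cov G p (fun z => A z * A z + 1) x * cov G q A x * A x
          - cov G p A x * A x * cov G q (fun z => A z * A z + 1) x
          + cov G p A x * (A x * A x + 1) * cov G q A x))
        - (A x * A x + 1) * gradProd G A A x := by
  have dA := contDiffAt_infty_differentiableAt hA
  have hc : ∀ p, cov G p (fun z => A z * A z + 1) x = cov G p A x * A x + A x * cov G p A x :=
    fun p => by
      rw [cov_add (dA.fun_mul dA) (differentiableAt_const _), cov_mul dA dA, cov_const_one,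
        add_zero]
  have h1 : ∀ p q, cov G p (fun z => A z * A z + 1) x * cov G q A x * A x
      - cov G p A x * A x * cov G q (fun z => A z * A z + 1) x
      + cov G p A x * (A x * A x + 1) * cov G q A x
      = A x * (cov G p A x * cov G q A x) * A x + cov G p A x * cov G q A x := fun p q => by
    rw [hc, hc]
    noncomm_ring
  have h2 : ∑ p, ∑ q, (G x)⁻¹ p q • (A x * (cov G p A x * cov G q A x) * A x
      + cov G p A x * cov G q A x) = A x * gradProd G A A x * A x + gradProd G A A x := by
    simp only [gradProd, Finset.mul_sum, Finset.sum_mul, ← Finset.sum_add_distrib, smul_add,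
      mul_smul_comm, smul_mul_assoc]
  simp only [h1]
  rw [h2, lap_add h (hA.mul hA) contDiffAt_const, lap_mul h hA hA, lap_one, two_smul]
  noncomm_ring

/-- For a solution of the flow with `A² = -1`, the defect `W = A + A†` solves a linear equation. -/
theorem skew_defect_equation (hG : ∀ᶠ z in 𝓝 x, IsMetricAt G z) (hA : ContDiffAt ℝ ∞ A x)
    (hsq : ∀ᶠ z in 𝓝 x, A z * A z = -1) :
    (lap G A x - A x * gradProd G A A x) + adj (G x) (lap G A x - A x * gradProd G A A x)
      - lap G (fun z => A z + adj (G z) (A z)) x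
      = -(gradProd G A A x * (A x + adj (G x) (A x)) + (∑ p, ∑ q, (G x)⁻¹ p q •
          (cov G p (fun z => A z + adj (G z) (A z)) x * cov G q (fun z => adj (G z) (A z)) x
          - cov G p A x * cov G q (fun z => A z + adj (G z) (A z)) x)) * adj (G x) (A x)) := by
  have h := hG.self_of_nhds
  have dA := contDiffAt_infty_differentiableAt hA
  have hB := smooth_adj h hA
  have dB := contDiffAt_infty_differentiableAt hB
  set B : E n → Mat n := fun z => adj (G z) (A z) with hBdef
  have hanti : ∀ p, cov G p A x * A x = -(A x * cov G p A x) := fun p => by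
    have h1 : cov G p (fun z => A z * A z) x = 0 := by
      have hev : (fun z => A z * A z) =ᶠ[𝓝 x] fun _ => -1 := hsq
      rw [cov_congr hev]
      have := cov_neg (G := G) (A := fun _ : E n => (1 : Mat n)) (x := x) (k := p)
      rw [this, cov_const_one, neg_zero]
    rw [cov_mul dA dA] at h1
    exact eq_neg_of_add_eq_zero_left h1
  have hQ : A x * gradProd G A A x = gradProd G A A x * A x := by
    simp only [gradProd, Finset.mul_sum, Finset.sum_mul, mul_smul_comm, smul_mul_assoc]
    refine Finset.sum_congr rfl fun p _ => Finset.sum_congr rfl fun q _ => ?_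
    rw [mul_assoc (cov G p A x), hanti q, mul_neg, ← mul_assoc (cov G p A x), hanti p, neg_mul,
      neg_neg, mul_assoc]
  have hW : ∀ p, cov G p (fun z => A z + B z) x = cov G p A x + cov G p B x := fun p =>
    cov_add dA dB
  have h2 : ∑ p, ∑ q, (G x)⁻¹ p q • (cov G p (fun z => A z + B z) x * cov G q B x
      - cov G p A x * cov G q (fun z => A z + B z) x) = gradProd G B B x - gradProd G A A x := by
    simp only [gradProd, ← Finset.sum_sub_distrib, ← smul_sub]
    refine Finset.sum_congr rfl fun p _ => Finset.sum_congr rfl fun q _ => ?_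
    rw [hW, hW]
    congr 1
    noncomm_ring
  have h3 : adj (G x) (lap G A x - A x * gradProd G A A x)
      = lap G B x - gradProd G B B x * B x := by
    rw [sub_eq_add_neg, adj_add, adj_neg, adj_mul h.self, ← lap_adj hG hA, ← gradProd_adj h dA,
      ← sub_eq_add_neg]
  rw [h2, h3, lap_add h hA hB, hQ]
  change _ = -(gradProd G A A x * (A x + B x) + (gradProd G B B x - gradProd G A A x) * B x)
  noncomm_ring

end Laplacian

section Flow

variable {n : ℕ} {M : Type*} [TopologicalSpace M] [ChartedSpace (E n) M]

/-- The matrix of an endomorphism field in a chart. -/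
def endMat (J : EndField n M) : ChartFamily n M (Mat n) := fun e x => Matrix.of (endCoeff e J x)

theorem IsSmoothFlow.exists_bound {V : Type*} [NormedAddCommGroup V] [NormedSpace ℝ V] {T : ℝ}
    {U : Set (E n)} {F : ℝ → E n → V} (h : IsSmoothFlow T U F) {K : Set (E n)} (hK : IsCompact K)
    (hKU : K ⊆ U) {T' : ℝ} (hT : T' < T) :
    ∃ b, 0 ≤ b ∧ ∀ t ∈ Ioo 0 T', ∀ x ∈ K, ‖F t x‖ ≤ b := by
  obtain ⟨b, hb⟩ := (isCompact_Icc.prod hK).exists_bound_of_continuousOn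
    (h.continuousOn.mono (prod_mono (Icc_subset_Ico_right hT : Icc 0 T' ⊆ Ico 0 T) hKU))
  exact ⟨|b|, abs_nonneg b, fun t ht x hx =>
    (hb (t, x) ⟨Ioo_subset_Icc_self ht, hx⟩).trans (le_abs_self b)⟩

theorem exists_common_bound {ι V : Type*} [Fintype ι] [NormedAddCommGroup V] [NormedSpace ℝ V]
    {T : ℝ} {U : Set (E n)} {F : ι → ℝ → E n → V} (h : ∀ i, IsSmoothFlow T U (F i)) {K : Set (E n)}
    (hK : IsCompact K) (hKU : K ⊆ U) {T' : ℝ} (hT : T' < T) :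
    ∃ b, 0 ≤ b ∧ ∀ i, ∀ t ∈ Ioo 0 T', ∀ x ∈ K, ‖F i t x‖ ≤ b := by
  choose b hb0 hb using fun i => (h i).exists_bound hK hKU hT
  exact ⟨∑ i, b i, Finset.sum_nonneg fun i _ => hb0 i, fun i t ht x hx => (hb i t ht x hx).trans
    (Finset.single_le_sum (fun j _ => hb0 j) (Finset.mem_univ i))⟩

variable [IsManifold (𝓡 n) ∞ M] {g : Metric n M} {T : ℝ} {J : ℝ → EndField n M}
  {e : OpenPartialHomeomorph M (E n)}

theorem IsHarmonicHeatFlow.isSmoothFlow (h : IsHarmonicHeatFlow g T J)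
    (he : e ∈ smoothCharts n M) : IsSmoothFlow T e.target fun t => endMat (J t) e :=
  contDiffOn_matrix.2 fun α β => h.smooth e he α β

theorem IsHarmonicHeatFlow.dt_eq (h : IsHarmonicHeatFlow g T J) (he : e ∈ smoothCharts n M) {t : ℝ}
    (ht : t ∈ Ioo 0 T) {x : E n} (hx : x ∈ e.target) :
    HarmonicFlow.dt (fun t => endMat (J t) e) t x = lap (gram g e) (endMat (J t) e) x
      - endMat (J t) e x * gradProd (gram g e) (endMat (J t) e) (endMat (J t) e) x := by
  have hs := h.isSmoothFlow he
  have htI : t ∈ Ico 0 T := Ioo_subset_Ico_self ht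
  ext α β
  have h1 := (entryCLM α β).hasFDerivAt.comp_hasDerivAt t (hs.hasDerivAt e.open_target ht hx)
  have h2 := (h.equation e he t htI x hx α β).hasDerivAt (Ico_mem_nhds ht.1 ht.2)
  have h3 := h1.unique h2
  change HarmonicFlow.dt (fun t => endMat (J t) e) t x α β = _ at h3
  rw [h3]
  have hsl : ∀ᶠ z in 𝓝 x, ContDiffAt ℝ ∞ (endMat (J t) e) z := by
    filter_upwards [e.open_target.mem_nhds hx] with z hz using hs.slice e.open_target htI hz
  have hG : ∀ᶠ z in 𝓝 x, IsMetricAt (gram g e) z := by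
    filter_upwards [e.open_target.mem_nhds hx] with z hz using isMetricAt_gram g he hz
  have h4 := roughLaplacian_eq_lap hG hsl α β
  have h5 := quadraticTerm_eq (G := gram g e)
    (contDiffAt_infty_differentiableAt hsl.self_of_nhds) α β
  rw [Matrix.sub_apply, ← h4, ← h5]
  rfl

theorem dsymm_dchart (he : e ∈ smoothCharts n M) {x : E n} (hx : x ∈ e.target) (v : E n) :
    dsymm e x (dchart e (e.symm x) v) = v := by
  have h1 : Function.Injective (dsymm e x) := fun v w hvw => by
    rw [← dchart_comp_dsymm he hx v, hvw, dchart_comp_dsymm he hx]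
  have h2 : Function.Surjective (dsymm e x) :=
    (LinearMap.injective_iff_surjective (f := (dsymm e x : E n →ₗ[ℝ] E n))).1 h1
  obtain ⟨w, rfl⟩ := h2 v
  rw [dchart_comp_dsymm he hx]

theorem dsymm_sum_endMat (he : e ∈ smoothCharts n M) {x : E n} (hx : x ∈ e.target)
    (J : EndField n M) (α : Fin n) : ∑ β, endMat J e x α β • dsymm e x (EuclideanSpace.single β 1)
      = endAt J (e.symm x) (dsymm e x (EuclideanSpace.single α 1)) := by
  rw [← dsymm_dchart he hx (endAt J (e.symm x) (dsymm e x (EuclideanSpace.single α 1))),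
    clm_apply_eq_sum (dsymm e x)]
  rfl

theorem IsCompatible.endMat_sq {J : EndField n M} (h : IsCompatible g J) (he : e ∈ smoothCharts n M)
    {x : E n} (hx : x ∈ e.target) : endMat J e x * endMat J e x = -1 := by
  ext α γ
  have h1 : dchart e (e.symm x) (endAt J (e.symm x)
      (endAt J (e.symm x) (dsymm e x (EuclideanSpace.single α 1))))
      = -EuclideanSpace.single α 1 := by
    have := h.1 (e.symm x) (dsymm e x (EuclideanSpace.single α 1))
    change endAt J (e.symm x) (endAt J (e.symm x) (dsymm e x (EuclideanSpace.single α 1)))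
      = -dsymm e x (EuclideanSpace.single α 1) at this
    rw [this, map_neg, dchart_comp_dsymm he hx]
  rw [← dsymm_sum_endMat he hx, map_sum, map_sum] at h1
  have h2 := congrArg (fun v : E n => v γ) h1
  simp only [map_smul] at h2
  simp only [WithLp.ofLp_sum, Finset.sum_apply, PiLp.smul_apply, smul_eq_mul, PiLp.neg_apply,
    PiLp.single_apply] at h2
  rw [Matrix.mul_apply, Matrix.neg_apply, Matrix.one_apply]
  refine Eq.trans ?_ (h2.trans ?_)
  · exact Finset.sum_congr rfl fun β _ => rfl
  · simp only [eq_comm]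

theorem IsCompatible.endMat_adj {J : EndField n M} (h : IsCompatible g J)
    (he : e ∈ smoothCharts n M)
    {x : E n} (hx : x ∈ e.target) : adj (gram g e x) (endMat J e x) = -endMat J e x := by
  have hm := isMetricAt_gram g he hx
  have h1 : endMat J e x * gram g e x * (endMat J e x).transpose = gram g e x := by
    ext i j
    have h2 := h.2 (e.symm x) (dsymm e x (EuclideanSpace.single i 1))
      (dsymm e x (EuclideanSpace.single j 1))
    change metricAt g (e.symm x) (endAt J (e.symm x) (dsymm e x (EuclideanSpace.single i 1)))
      (endAt J (e.symm x) (dsymm e x (EuclideanSpace.single j 1))) = _ at h2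
    rw [← dsymm_sum_endMat he hx, ← dsymm_sum_endMat he hx] at h2
    rw [gram_apply]
    refine Eq.trans ?_ h2
    simp only [map_sum, map_smul, sum_apply, smul_apply, smul_eq_mul, Matrix.mul_apply,
      Matrix.transpose_apply, gram_apply, Finset.sum_mul, Finset.mul_sum]
    refine Finset.sum_congr rfl fun a _ => Finset.sum_congr rfl fun b _ => ?_
    ring
  have h3 : gram g e x * (endMat J e x).transpose = -(endMat J e x * gram g e x) := by
    have h4 := congrArg (fun X => endMat J e x * X) h1
    simp only [← Matrix.mul_assoc, h.endMat_sq he hx] at h4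
    rw [← h4, Matrix.neg_mul, Matrix.neg_mul, Matrix.one_mul, neg_neg]
  rw [adj, h3, Matrix.neg_mul, Matrix.mul_assoc, hm.mul_inv, Matrix.mul_one]

variable [MeasurableSpace M] [BorelSpace M] [CompactSpace M] [T2Space M]

/-- The flow preserves `J² = -1`. -/
theorem IsHarmonicHeatFlow.sq (h : IsHarmonicHeatFlow g T J) {t : ℝ} (ht : t ∈ Ico 0 T)
    (he : e ∈ smoothCharts n M) {x : E n} (hx : x ∈ e.target) :
    endMat (J t) e x * endMat (J t) e x = -1 := by
  refine eq_neg_of_add_eq_zero_left (eq_zero_of_linear_heat (g := g) (T := T)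
    (W := fun t e x => endMat (J t) e x * endMat (J t) e x + 1)
    (fun t _ => ((isEndFamily_endCoeff (J t)).mul (isEndFamily_endCoeff (J t))).add isEndFamily_one)
    (fun e he => ((h.isSmoothFlow he).mul (h.isSmoothFlow he)).add
      (isSmoothFlow_static fun _ _ => contDiffAt_const))
    (fun e he x hx => by rw [h.compatible_initial.endMat_sq he hx, neg_add_cancel])
    (fun e he K hK hKc T' hT' => ?_) ht he hx)
  have hs := h.isSmoothFlow he
  have hG : ∀ x ∈ e.target, IsMetricAt (gram g e) x := fun x hx => isMetricAt_gram g he hx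
  -- The coefficients of the linear equation for `A² + 1` are bounded on compact sets.
  obtain ⟨a, ha, hA⟩ := hs.exists_bound hKc hK hT'
  obtain ⟨c, hc, hP⟩ := exists_common_bound (fun p => hs.cov e.open_target hG p) hKc hK hT'
  obtain ⟨d, hd, hQ⟩ := (hs.gradProd hs e.open_target hG).exists_bound hKc hK hT'
  obtain ⟨b, hb, hg⟩ := (isSmoothFlow_static (T := T)
    fun x hx => (hG x hx).smooth_inv).exists_bound hKc hK hT'
  refine ⟨n ^ 2 * (b * (2 * a * c + c ^ 2)) + d, fun t ht x hx => ?_⟩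
  have htT : t ∈ Ioo 0 T := ⟨ht.1, ht.2.trans hT'⟩
  have hAx := hs.slice e.open_target (Ioo_subset_Ico_self htT) (hK hx)
  have hdt : dt (fun t x => endMat (J t) e x * endMat (J t) e x + 1) t x
      = dt (fun t => endMat (J t) e) t x * endMat (J t) e x
        + endMat (J t) e x * dt (fun t => endMat (J t) e) t x := by
    have h1 := hs.hasDerivAt e.open_target htT (hK hx)
    exact ((h1.mul h1).add_const 1).deriv
  have heq := sq_defect_equation (hG x (hK hx)) hAx
  rw [← h.dt_eq he htT (hK hx), ← hdt] at heq
  rw [heq]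
  set S := endMat (J t) e x * endMat (J t) e x + 1
  set D : Fin n → Mat n := fun p =>
    cov (gram g e) p (fun z => endMat (J t) e z * endMat (J t) e z + 1) x
  have hD : ∀ p, ‖D p‖ ≤ ‖S‖ + ∑ p, ‖D p‖ := fun p => by
    have := Finset.single_le_sum (f := fun p => ‖D p‖) (fun _ _ => norm_nonneg _)
      (Finset.mem_univ p)
    have h0 := norm_nonneg S
    linarith
  have hS : ‖S‖ ≤ ‖S‖ + ∑ p, ‖D p‖ :=
    le_add_of_nonneg_right (Finset.sum_nonneg fun _ _ => norm_nonneg _)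
  set Y := ‖S‖ + ∑ p, ‖D p‖
  have hY : 0 ≤ Y := (norm_nonneg S).trans hS
  have hAt := hA t ht x hx
  have hX : ∀ p q, ‖D p * cov (gram g e) q (endMat (J t) e) x * endMat (J t) e x
      - cov (gram g e) p (endMat (J t) e) x * endMat (J t) e x * D q
      + cov (gram g e) p (endMat (J t) e) x * S * cov (gram g e) q (endMat (J t) e) x‖
      ≤ (2 * a * c + c ^ 2) * Y := fun p q => by
    have h1 := hP p t ht x hx
    have h2 := hP q t ht x hx
    refine (norm_add_le _ _).trans ((add_le_add (norm_sub_le _ _) le_rfl).trans ?_)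
    have e1 : ‖D p * cov (gram g e) q (endMat (J t) e) x * endMat (J t) e x‖ ≤ Y * c * a :=
      (norm_mul_le _ _).trans (mul_le_mul ((norm_mul_le _ _).trans
        (mul_le_mul (hD p) h2 (norm_nonneg _) hY)) hAt (norm_nonneg _) (by positivity))
    have e2 : ‖cov (gram g e) p (endMat (J t) e) x * endMat (J t) e x * D q‖ ≤ c * a * Y :=
      (norm_mul_le _ _).trans (mul_le_mul ((norm_mul_le _ _).trans
        (mul_le_mul h1 hAt (norm_nonneg _) hc)) (hD q) (norm_nonneg _) (by positivity))
    have e3 : ‖cov (gram g e) p (endMat (J t) e) x * S * cov (gram g e) q (endMat (J t) e) x‖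
        ≤ c * Y * c :=
      (norm_mul_le _ _).trans (mul_le_mul ((norm_mul_le _ _).trans
        (mul_le_mul h1 hS (norm_nonneg _) hc)) h2 (norm_nonneg _) (by positivity))
    nlinarith
  have hlast : ‖S * gradProd (gram g e) (endMat (J t) e) (endMat (J t) e) x‖ ≤ Y * d :=
    (norm_mul_le _ _).trans (mul_le_mul hS (hQ t ht x hx) (norm_nonneg _) hY)
  have hmain := norm_contract_le hb (fun p q => (abs_entry_le_norm _ p q).trans (hg t ht x hx)) hX
  refine (norm_sub_le _ _).trans ?_
  rw [norm_neg]
  nlinarith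

/-- The flow preserves the compatibility with the metric. -/
theorem IsHarmonicHeatFlow.adj_eq (h : IsHarmonicHeatFlow g T J) {t : ℝ} (ht : t ∈ Ico 0 T)
    (he : e ∈ smoothCharts n M) {x : E n} (hx : x ∈ e.target) :
    adj (gram g e x) (endMat (J t) e x) = -endMat (J t) e x := by
  refine eq_neg_of_add_eq_zero_right (eq_zero_of_linear_heat (g := g) (T := T)
    (W := fun t e x => endMat (J t) e x + adj (gram g e x) (endMat (J t) e x))
    (fun t _ => (isEndFamily_endCoeff (J t)).add (isEndFamily_endCoeff (J t)).adj)
    (fun e he => (h.isSmoothFlow he).add ((h.isSmoothFlow he).adj fun x hx =>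
      isMetricAt_gram g he hx))
    (fun e he x hx => by rw [h.compatible_initial.endMat_adj he hx, add_neg_cancel])
    (fun e he K hK hKc T' hT' => ?_) ht he hx)
  have hs := h.isSmoothFlow he
  have hG : ∀ x ∈ e.target, IsMetricAt (gram g e) x := fun x hx => isMetricAt_gram g he hx
  have hsB := hs.adj hG
  -- The coefficients of the linear equation for `A + A†` are bounded on compact sets.
  obtain ⟨a, ha, hB⟩ := hsB.exists_bound hKc hK hT'
  obtain ⟨c, hc, hP⟩ := exists_common_bound (fun p => hs.cov e.open_target hG p) hKc hK hT'
  obtain ⟨c', hc', hP'⟩ := exists_common_bound (fun p => hsB.cov e.open_target hG p) hKc hK hT'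
  obtain ⟨d, hd, hQ⟩ := (hs.gradProd hs e.open_target hG).exists_bound hKc hK hT'
  obtain ⟨b, hb, hg⟩ := (isSmoothFlow_static (T := T)
    fun x hx => (hG x hx).smooth_inv).exists_bound hKc hK hT'
  refine ⟨d + n ^ 2 * (b * (c' + c)) * a, fun t ht x hx => ?_⟩
  have htT : t ∈ Ioo 0 T := ⟨ht.1, ht.2.trans hT'⟩
  have htI := Ioo_subset_Ico_self htT
  have hAx := hs.slice e.open_target htI (hK hx)
  have hdt : dt (fun t x => endMat (J t) e x + adj (gram g e x) (endMat (J t) e x)) t x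
      = dt (fun t => endMat (J t) e) t x
        + adj (gram g e x) (dt (fun t => endMat (J t) e) t x) := by
    have h1 := hs.hasDerivAt e.open_target htT (hK hx)
    exact (h1.add ((((transposeCLM n).hasFDerivAt.comp_hasDerivAt t h1).const_mul
      (gram g e x)).mul_const (gram g e x)⁻¹)).deriv
  have heq := skew_defect_equation
    (by filter_upwards [e.open_target.mem_nhds (hK hx)] with z hz using hG z hz) hAx
    (by filter_upwards [e.open_target.mem_nhds (hK hx)] with z hz using h.sq htI he hz)
  rw [← h.dt_eq he htT (hK hx), ← hdt] at heq
  rw [heq, norm_neg]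
  set B := adj (gram g e x) (endMat (J t) e x)
  set W := endMat (J t) e x + B
  set D : Fin n → Mat n := fun p => cov (gram g e) p
    (fun z => endMat (J t) e z + adj (gram g e z) (endMat (J t) e z)) x
  have hD : ∀ p, ‖D p‖ ≤ ‖W‖ + ∑ p, ‖D p‖ := fun p => by
    have := Finset.single_le_sum (f := fun p => ‖D p‖) (fun _ _ => norm_nonneg _)
      (Finset.mem_univ p)
    have h0 := norm_nonneg W
    linarith
  have hW : ‖W‖ ≤ ‖W‖ + ∑ p, ‖D p‖ :=
    le_add_of_nonneg_right (Finset.sum_nonneg fun _ _ => norm_nonneg _)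
  set Y := ‖W‖ + ∑ p, ‖D p‖
  have hY : 0 ≤ Y := (norm_nonneg W).trans hW
  have hX : ∀ p q, ‖D p * cov (gram g e) q (fun z => adj (gram g e z) (endMat (J t) e z)) x
      - cov (gram g e) p (endMat (J t) e) x * D q‖ ≤ (c' + c) * Y := fun p q => by
    refine (norm_sub_le _ _).trans ?_
    have e1 := (norm_mul_le (D p) (cov (gram g e) q
      (fun z => adj (gram g e z) (endMat (J t) e z)) x)).trans
      (mul_le_mul (hD p) (hP' q t ht x hx) (norm_nonneg _) hY)
    have e2 := (norm_mul_le (cov (gram g e) p (endMat (J t) e) x) (D q)).trans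
      (mul_le_mul (hP p t ht x hx) (hD q) (norm_nonneg _) hc)
    nlinarith
  have hfirst : ‖gradProd (gram g e) (endMat (J t) e) (endMat (J t) e) x * W‖ ≤ d * Y :=
    (norm_mul_le _ _).trans (mul_le_mul (hQ t ht x hx) hW (norm_nonneg _) hd)
  have hmain := norm_contract_le hb (fun p q => (abs_entry_le_norm _ p q).trans (hg t ht x hx)) hX
  refine (norm_add_le _ _).trans ?_
  have hsec := (norm_mul_le (∑ p, ∑ q, (gram g e x)⁻¹ p q •
    (D p * cov (gram g e) q (fun z => adj (gram g e z) (endMat (J t) e z)) x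
      - cov (gram g e) p (endMat (J t) e) x * D q)) B).trans
    (mul_le_mul hmain (hB t ht x hx) (norm_nonneg _) (by positivity))
  refine (add_le_add hfirst hsec).trans (le_of_eq ?_)
  ring

end Flow

/-! ### Compatible solutions in a chart, and monotonicity of the energy -/

section Skew

variable {n : ℕ} {G : E n → Mat n} {x : E n} {A : E n → Mat n}

theorem adj_cov_of_skew (h : IsMetricAt G x) (hA : DifferentiableAt ℝ A x)
    (hs : ∀ᶠ z in 𝓝 x, adj (G z) (A z) = -A z) (p : Fin n) :
    adj (G x) (cov G p A x) = -cov G p A x := by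
  rw [← cov_adj h hA, cov_congr hs, cov_neg]

theorem cov_mul_of_sq (hA : DifferentiableAt ℝ A x) (hs : ∀ᶠ z in 𝓝 x, A z * A z = -1)
    (p : Fin n) : cov G p A x * A x = -(A x * cov G p A x) := by
  refine eq_neg_of_add_eq_zero_left ?_
  have h1 : cov G p (fun z => A z * A z) x = 0 := by
    rw [cov_congr (B := fun _ => -1) hs, cov_neg (A := fun _ => 1), cov_const_one, neg_zero]
  rw [← cov_mul hA hA, h1]

theorem inn_self_of_skew {H B : Mat n} (h : adj H B = -B) : inn H B B = -(B * B).trace := by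
  rw [inn, h, Matrix.mul_neg, Matrix.trace_neg]

theorem gradInn_self_of_skew (h : IsMetricAt G x) (hA : DifferentiableAt ℝ A x)
    (hs : ∀ᶠ z in 𝓝 x, adj (G z) (A z) = -A z) :
    gradInn (G x) (fun p => cov G p A x) (fun p => cov G p A x) = -trEnergy G A x := by
  simp only [gradInn, trEnergy, inn, adj_cov_of_skew h hA hs, Matrix.trace_neg,
    mul_neg, Finset.sum_neg_distrib]

theorem gradNormSq_of_skew (h : IsMetricAt G x) (hA : DifferentiableAt ℝ A x)
    (hs : ∀ᶠ z in 𝓝 x, adj (G z) (A z) = -A z) : gradNormSq G A x = -trEnergy G A x := by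
  rw [gradNormSq_eq h hA]
  exact gradInn_self_of_skew h hA hs

/-- If `A² = -1` and `C` anticommutes with `A`, the quadratic term of the flow is orthogonal
to `C`. -/
theorem trace_mul_mul_gradProd {C : Mat n} (hA : DifferentiableAt ℝ A x)
    (hs : ∀ᶠ z in 𝓝 x, A z * A z = -1) (hC : C * A x = -(A x * C)) :
    (C * (A x * gradProd G A A x)).trace = 0 := by
  have h1 : A x * gradProd G A A x = gradProd G A A x * A x := by
    simp only [gradProd, Finset.mul_sum, Finset.sum_mul, mul_smul_comm, smul_mul_assoc]
    refine Finset.sum_congr rfl fun p _ => Finset.sum_congr rfl fun q _ => ?_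
    rw [Matrix.mul_assoc (cov G p A x), cov_mul_of_sq hA hs q, Matrix.mul_neg, ← Matrix.mul_assoc,
      ← Matrix.mul_assoc, cov_mul_of_sq hA hs p, Matrix.neg_mul, neg_neg]
  have h2 : (C * (A x * gradProd G A A x)).trace = -(C * (A x * gradProd G A A x)).trace := by
    calc (C * (A x * gradProd G A A x)).trace
        = -(A x * (C * gradProd G A A x)).trace := by
          rw [← Matrix.mul_assoc, hC, Matrix.neg_mul, Matrix.trace_neg, Matrix.mul_assoc]
      _ = -(C * (A x * gradProd G A A x)).trace := by
          rw [Matrix.trace_mul_comm, Matrix.mul_assoc, h1]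
  linarith

end Skew

section LocalFlow

variable {n : ℕ} {T : ℝ} {U : Set (E n)} {G : E n → Mat n} {A : ℝ → E n → Mat n}

/-- A smooth solution `A` of the flow in an open set `U` of `ℝⁿ` with the metric `G`, with values in
the almost complex structures compatible with `G`. -/
structure IsCompatibleFlow (T : ℝ) (U : Set (E n)) (G : E n → Mat n) (A : ℝ → E n → Mat n) :
    Prop where
  isOpen : IsOpen U
  metric : ∀ x ∈ U, IsMetricAt G x
  smooth : IsSmoothFlow T U A
  sq : ∀ t ∈ Ico 0 T, ∀ x ∈ U, A t x * A t x = -1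
  skew : ∀ t ∈ Ico 0 T, ∀ x ∈ U, adj (G x) (A t x) = -A t x
  equation : ∀ t ∈ Ioo 0 T, ∀ x ∈ U,
    dt A t x = lap G (A t) x - A t x * gradProd G (A t) (A t) x

theorem IsSmoothFlow.hasDerivAt_trEnergy (h : IsSmoothFlow T U A) (hU : IsOpen U)
    (hG : ∀ x ∈ U, IsMetricAt G x) {t : ℝ} (ht : t ∈ Ioo 0 T) {x : E n} (hx : x ∈ U) :
    HasDerivAt (fun s => HarmonicFlow.trEnergy G (A s) x)
      (2 * ∑ p, ∑ q, (G x)⁻¹ p q *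
        (HarmonicFlow.cov G p (HarmonicFlow.dt A t) x * HarmonicFlow.cov G q (A t) x).trace) t := by
  have h1 : ∀ p q, HasDerivAt
      (fun s => (HarmonicFlow.cov G p (A s) x * HarmonicFlow.cov G q (A s) x).trace)
      ((HarmonicFlow.cov G p (HarmonicFlow.dt A t) x * HarmonicFlow.cov G q (A t) x).trace
        + (HarmonicFlow.cov G q (HarmonicFlow.dt A t) x * HarmonicFlow.cov G p (A t) x).trace) t :=
    fun p q => by
      have h2 := (traceCLM n).hasFDerivAt.comp_hasDerivAt t
        ((h.hasDerivAt_cov (G := G) hU ht hx p).mul (h.hasDerivAt_cov (G := G) hU ht hx q))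
      refine h2.congr_deriv ?_
      change (_ + _ : Mat n).trace = _
      rw [Matrix.trace_add, Matrix.trace_mul_comm (HarmonicFlow.cov G p (A t) x)]
  have h3 : HasDerivAt (fun s => HarmonicFlow.trEnergy G (A s) x) _ t :=
    HasDerivAt.fun_sum fun p _ => HasDerivAt.fun_sum fun q _ => (h1 p q).const_mul ((G x)⁻¹ p q)
  refine h3.congr_deriv ?_
  have h4 := sum_inv_comm (hG x hx) fun p q =>
    (HarmonicFlow.cov G p (HarmonicFlow.dt A t) x * HarmonicFlow.cov G q (A t) x).trace
  simp only [smul_eq_mul] at h4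
  simp only [mul_add, Finset.sum_add_distrib]
  rw [h4]
  ring

theorem IsSmoothFlow.trEnergy (h : IsSmoothFlow T U A) (hU : IsOpen U)
    (hG : ∀ x ∈ U, IsMetricAt G x) :
    IsSmoothFlow T U fun t => HarmonicFlow.trEnergy G (A t) :=
  IsSmoothFlow.sum fun p _ => IsSmoothFlow.sum fun q _ =>
    (isSmoothFlow_static (f := fun x => (G x)⁻¹ p q)
      fun x hx => (hG x hx).smooth_inv.matrix_entry p q).smul
      (((h.cov hU hG p).mul (h.cov hU hG q)).clm (traceCLM n))

namespace IsCompatibleFlow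

theorem eventually_skew (h : IsCompatibleFlow T U G A) {t : ℝ} (ht : t ∈ Ico 0 T) {x : E n}
    (hx : x ∈ U) : ∀ᶠ z in 𝓝 x, adj (G z) (A t z) = -A t z := by
  filter_upwards [h.isOpen.mem_nhds hx] with z hz using h.skew t ht z hz

theorem eventually_sq (h : IsCompatibleFlow T U G A) {t : ℝ} (ht : t ∈ Ico 0 T) {x : E n}
    (hx : x ∈ U) : ∀ᶠ z in 𝓝 x, A t z * A t z = -1 := by
  filter_upwards [h.isOpen.mem_nhds hx] with z hz using h.sq t ht z hz

theorem contDiffAt (h : IsCompatibleFlow T U G A) {t : ℝ} (ht : t ∈ Ico 0 T) {x : E n}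
    (hx : x ∈ U) : ContDiffAt ℝ ∞ (A t) x := h.smooth.slice h.isOpen ht hx

theorem differentiableAt (h : IsCompatibleFlow T U G A) {t : ℝ} (ht : t ∈ Ico 0 T) {x : E n}
    (hx : x ∈ U) : DifferentiableAt ℝ (A t) x :=
  contDiffAt_infty_differentiableAt (h.contDiffAt ht hx)

theorem adj_cov (h : IsCompatibleFlow T U G A) {t : ℝ} (ht : t ∈ Ico 0 T) {x : E n}
    (hx : x ∈ U) (p : Fin n) : adj (G x) (cov G p (A t) x) = -cov G p (A t) x :=
  adj_cov_of_skew (h.metric x hx) (h.differentiableAt ht hx) (h.eventually_skew ht hx) p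

theorem cov_mul (h : IsCompatibleFlow T U G A) {t : ℝ} (ht : t ∈ Ico 0 T) {x : E n}
    (hx : x ∈ U) (p : Fin n) : cov G p (A t) x * A t x = -(A t x * cov G p (A t) x) :=
  cov_mul_of_sq (h.differentiableAt ht hx) (h.eventually_sq ht hx) p

theorem gradNormSq_eq (h : IsCompatibleFlow T U G A) {t : ℝ} (ht : t ∈ Ico 0 T) {x : E n}
    (hx : x ∈ U) : gradNormSq G (A t) x = -trEnergy G (A t) x :=
  gradNormSq_of_skew (h.metric x hx) (h.differentiableAt ht hx) (h.eventually_skew ht hx)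

theorem trEnergy_nonpos (h : IsCompatibleFlow T U G A) {t : ℝ} (ht : t ∈ Ico 0 T) {x : E n}
    (hx : x ∈ U) : trEnergy G (A t) x ≤ 0 := by
  have h1 := gradInn_self_nonneg (h.metric x hx).self fun p => cov G p (A t) x
  rw [gradInn_self_of_skew (h.metric x hx) (h.differentiableAt ht hx)
    (h.eventually_skew ht hx)] at h1
  linarith

theorem adj_dt (h : IsCompatibleFlow T U G A) {t : ℝ} (ht : t ∈ Ioo 0 T) {x : E n} (hx : x ∈ U) :
    adj (G x) (dt A t x) = -dt A t x := by
  have h1 := h.smooth.hasDerivAt h.isOpen ht hx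
  have h2 : HasDerivAt (fun s => adj (G x) (A s x)) (adj (G x) (dt A t x)) t :=
    (((transposeCLM n).hasFDerivAt.comp_hasDerivAt t h1).const_mul (G x)).mul_const (G x)⁻¹
  refine h2.unique (h1.neg.congr_of_eventuallyEq ?_)
  filter_upwards [isOpen_Ioo.mem_nhds ht] with s hs using h.skew s (Ioo_subset_Ico_self hs) x hx

theorem dt_mul (h : IsCompatibleFlow T U G A) {t : ℝ} (ht : t ∈ Ioo 0 T) {x : E n} (hx : x ∈ U) :
    dt A t x * A t x = -(A t x * dt A t x) := by
  have h1 := h.smooth.hasDerivAt h.isOpen ht hx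
  refine eq_neg_of_add_eq_zero_left ((h1.mul h1).unique
    ((hasDerivAt_const t (-1 : Mat n)).congr_of_eventuallyEq ?_))
  filter_upwards [isOpen_Ioo.mem_nhds ht] with s hs using h.sq s (Ioo_subset_Ico_self hs) x hx

theorem trace_mul_lap (h : IsCompatibleFlow T U G A) {t : ℝ} (ht : t ∈ Ioo 0 T) {x : E n}
    (hx : x ∈ U) {C : Mat n} (hC : C * A t x = -(A t x * C)) :
    (C * lap G (A t) x).trace = (C * dt A t x).trace := by
  rw [h.equation t ht x hx, Matrix.mul_sub, Matrix.trace_sub, trace_mul_mul_gradProd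
    (h.differentiableAt (Ioo_subset_Ico_self ht) hx)
    (h.eventually_sq (Ioo_subset_Ico_self ht) hx) hC,
    sub_zero]

/-- The time derivative of the energy density is a divergence up to the square of `∂_t A`. -/
theorem divDensity_dt (h : IsCompatibleFlow T U G A) {t : ℝ} (ht : t ∈ Ioo 0 T) {x : E n}
    (hx : x ∈ U) :
    divDensity G (fun q z => (dt A t z * cov G q (A t) z).trace) x
      = vol G x * ((∑ p, ∑ q, (G x)⁻¹ p q * (cov G p (dt A t) x * cov G q (A t) x).trace)
        + (dt A t x * dt A t x).trace) := by
  rw [divDensity_trace (h.metric x hx) (h.contDiffAt (Ioo_subset_Ico_self ht) hx)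
    (h.smooth.contDiffAt_dt_slice h.isOpen ht hx), h.trace_mul_lap ht hx (h.dt_mul ht hx)]

end IsCompatibleFlow

end LocalFlow

section Energy

variable {n : ℕ} {M : Type*} [TopologicalSpace M] [ChartedSpace (E n) M]
  [IsManifold (𝓡 n) ∞ M] {g : Metric n M} {T : ℝ} {J : ℝ → EndField n M}
  {e : OpenPartialHomeomorph M (E n)}
  [MeasurableSpace M] [BorelSpace M] [CompactSpace M] [T2Space M]

theorem IsHarmonicHeatFlow.isCompatibleFlow (h : IsHarmonicHeatFlow g T J)
    (he : e ∈ smoothCharts n M) :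
    IsCompatibleFlow T e.target (gram g e) fun t => endMat (J t) e where
  isOpen := e.open_target
  metric := fun _ hx => isMetricAt_gram g he hx
  smooth := h.isSmoothFlow he
  sq := fun _ ht _ hx => h.sq ht he hx
  skew := fun _ ht _ hx => h.adj_eq ht he hx
  equation := fun _ ht _ hx => h.dt_eq he ht hx

theorem IsHarmonicHeatFlow.isEndFamily_dt (h : IsHarmonicHeatFlow g T J) {t : ℝ}
    (ht : t ∈ Ioo 0 T) : IsEndFamily fun e x => dt (fun t => endMat (J t) e) t x :=
  fun e' he' e he x hx => by
    have h1 := ((h.isSmoothFlow he').hasDerivAt e'.open_target ht hx.1).mul_const (jac e' e x)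
    have h2 := ((h.isSmoothFlow he).hasDerivAt e.open_target ht
      (transition_mem hx)).const_mul (jac e' e x)
    refine h1.unique (h2.congr_of_eventuallyEq (Eventually.of_forall fun s => ?_))
    exact isEndFamily_endCoeff (J s) e' he' e he x hx

theorem IsHarmonicHeatFlow.isScalarFamily_trEnergy (h : IsHarmonicHeatFlow g T J) {t : ℝ}
    (ht : t ∈ Ico 0 T) : IsScalarFamily fun e x => trEnergy (gram g e) (endMat (J t) e) x := by
  have h1 := (isEndFamily_endCoeff (J t)).cov (g := g) fun e he x hx =>
    (h.isCompatibleFlow he).differentiableAt ht hx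
  refine fun e' he' e he x hx => Eq.trans ?_
    (((h1.contract (g := g) h1).trace e' he' e he x hx).trans ?_)
  · simp only [trEnergy, Matrix.trace_sum, Matrix.trace_smul, smul_eq_mul]
    rfl
  · simp only [trEnergy, Matrix.trace_sum, Matrix.trace_smul, smul_eq_mul]
    rfl

theorem IsHarmonicHeatFlow.energy_eq (h : IsHarmonicHeatFlow g T J) {t : ℝ} (ht : t ∈ Ico 0 T) :
    energy g (J t) = -∫ p, glob (fun e x => trEnergy (gram g e) (endMat (J t) e) x) p
      ∂(riemannianVolume g) := by
  rw [energy, ← integral_neg]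
  congr 1
  funext p
  exact (h.isCompatibleFlow (chartAt_mem p)).gradNormSq_eq ht
    ((chartAt (E n) p).map_source (mem_chart_source _ p))

/-- The energy does not increase along the flow. -/
theorem IsHarmonicHeatFlow.energy_le (h : IsHarmonicHeatFlow g T J) {t : ℝ} (ht : t ∈ Ico 0 T) :
    energy g (J t) ≤ energy g (J 0) := by
  have hf := fun t (ht : t ∈ Ico 0 T) => h.isScalarFamily_trEnergy ht
  have hd : ∀ e ∈ smoothCharts n M, ∀ t ∈ Ioo 0 T, ∀ x ∈ e.target, HasDerivAt _ _ t :=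
    fun e he t ht x hx => (h.isSmoothFlow he).hasDerivAt_trEnergy e.open_target
      (fun x hx => isMetricAt_gram g he hx) ht hx
  obtain ⟨hFc, hFd⟩ := hasDerivAt_integral_glob (g := g) hf
    (fun e he => ((h.isSmoothFlow he).trEnergy e.open_target
      fun x hx => isMetricAt_gram g he hx).continuousOn)
    (fun e he => by
      have hs := h.isSmoothFlow he
      have hG : ∀ x ∈ e.target, IsMetricAt (gram g e) x := fun x hx => isMetricAt_gram g he hx
      refine fun q hq => ContinuousAt.continuousWithinAt ?_
      have h1 := ((hs.trEnergy e.open_target hG).contDiffAt_dt e.open_target hq.1 hq.2).continuousAt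
      refine h1.congr ?_
      filter_upwards [(isOpen_Ioo.prod e.open_target).mem_nhds hq] with r hr
      exact (hd e he r.1 hr.1 r.2 hr.2).deriv)
    hd
  have hmono : MonotoneOn (fun t => ∫ p, glob (fun e x => trEnergy (gram g e) (endMat (J t) e) x) p
      ∂(riemannianVolume g)) (Ico 0 T) := by
    refine monotoneOn_of_deriv_nonneg (convex_Ico 0 T) hFc ?_ ?_
    · rw [interior_Ico]
      exact fun s hs => (hFd s hs).differentiableAt.differentiableWithinAt
    · rw [interior_Ico]
      intro s hs
      rw [(hFd s hs).deriv]
      have hsI : s ∈ Ico 0 T := Ioo_subset_Ico_self hs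
      have hηc : IsCovectorFamily fun q e x =>
          (dt (fun t => endMat (J t) e) s x * cov (gram g e) q (endMat (J s) e) x).trace :=
        IsCovEndFamily.trace_mul (h.isEndFamily_dt hs) ((isEndFamily_endCoeff (J s)).cov
          fun e he x hx => (h.isCompatibleFlow he).differentiableAt hsI hx)
      have hηs : ∀ q, ∀ e ∈ smoothCharts n M, ∀ x ∈ e.target, ContDiffAt ℝ ∞ (fun x =>
          (dt (fun t => endMat (J t) e) s x * cov (gram g e) q (endMat (J s) e) x).trace) x :=
        fun q e he x hx => (((h.isSmoothFlow he).contDiffAt_dt_slice e.open_target hs hx).mul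
          (((h.isCompatibleFlow he).contDiffAt hsI hx).cov
            (isMetricAt_gram g he hx) q)).matrix_trace
      have hηd := hηc.covDiv (g := g) fun q e he x hx =>
        contDiffAt_infty_differentiableAt (hηs q e he x hx)
      have hz := integral_covDiv_eq_zero (g := g) hηc hηs
      -- By `divDensity_dt`, `∂_t trEnergy` is twice the divergence of `tr(∂_t A ∇A)` plus twice
      -- the square of the norm of `∂_t A`.
      have hle : (2 : ℝ) * ∫ p, glob (fun e x => covDiv (gram g e) (fun q x =>
          (dt (fun t => endMat (J t) e) s x * cov (gram g e) q (endMat (J s) e) x).trace) x) p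
            ∂(riemannianVolume g) ≤ ∫ p, glob (fun e x => 2 * ∑ p, ∑ q, (gram g e x)⁻¹ p q *
              (cov (gram g e) p (dt (fun t => endMat (J t) e) s) x
                * cov (gram g e) q (endMat (J s) e) x).trace) p ∂(riemannianVolume g) := by
        rw [← integral_const_mul]
        refine integral_mono ((integrable_glob (g := g) hηd fun e he x hx =>
          (smooth_covDiv (isMetricAt_gram g he hx) fun q =>
            hηs q e he x hx).continuousAt.continuousWithinAt).const_mul 2) ?_ fun p => ?_
        · refine integrable_glob (IsScalarFamily.of_hasDerivAt hf hd hs) fun e he x hx => ?_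
          have hG : ∀ x ∈ e.target, IsMetricAt (gram g e) x := fun x hx => isMetricAt_gram g he hx
          refine ContinuousAt.continuousWithinAt ?_
          have h1 := (((h.isSmoothFlow he).trEnergy e.open_target hG).contDiffAt_dt_slice
            e.open_target hs hx).continuousAt
          refine h1.congr ?_
          filter_upwards [e.open_target.mem_nhds hx] with z hz
          exact (hd e he s hs z hz).deriv
        · have he := chartAt_mem (n := n) p
          have hx := (chartAt (E n) p).map_source (mem_chart_source _ p)
          set e := chartAt (E n) p
          have hm := isMetricAt_gram g he hx
          have h1 := (h.isCompatibleFlow he).divDensity_dt hs hx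
          rw [divDensity_eq_vol_mul hm fun q => contDiffAt_infty_differentiableAt
            (hηs q e he _ hx)] at h1
          have h2 := mul_left_cancel₀ hm.vol_pos.ne' h1
          have h3 := inn_self_nonneg hm.self (dt (fun t => endMat (J t) e) s (e p))
          rw [inn_self_of_skew ((h.isCompatibleFlow he).adj_dt hs hx)] at h3
          dsimp only [glob]
          rw [h2]
          linarith
      rw [hz, mul_zero] at hle
      exact hle
  have h0 : (0 : ℝ) ∈ Ico 0 T := ⟨le_rfl, ht.1.trans_lt ht.2⟩
  rw [h.energy_eq ht, h.energy_eq h0]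
  exact neg_le_neg (hmono h0 ht ht.1)

/-- The energy of the flow in a chart is bounded by the initial energy. -/
theorem IsHarmonicHeatFlow.setIntegral_le (h : IsHarmonicHeatFlow g T J) (he : e ∈ smoothCharts n M)
    {t : ℝ} (ht : t ∈ Ico 0 T) :
    ∫ x in e.target, vol (gram g e) x * -trEnergy (gram g e) (endMat (J t) e) x
      ≤ energy g (J 0) := by
  have hf := h.isScalarFamily_trEnergy ht
  have hfc : ∀ e ∈ smoothCharts n M,
      ContinuousOn (fun x => trEnergy (gram g e) (endMat (J t) e) x) e.target := fun e he x hx =>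
    (smooth_trEnergy (isMetricAt_gram g he hx)
      ((h.isCompatibleFlow he).contDiffAt ht hx)).continuousAt.continuousWithinAt
  have hc := continuous_glob hf hfc
  refine le_trans (le_of_eq ?_) ((setIntegral_le_integral (s := e.source)
    (integrable_glob (g := g) hf hfc).neg (Eventually.of_forall fun p => ?_)).trans
    (le_of_eq_of_le ?_ (h.energy_le ht)))
  · have h1 := setIntegral_source (g := g) he hc.neg.continuousOn
    refine Eq.trans ?_ h1.symm
    refine setIntegral_congr_fun e.open_target.measurableSet fun x hx => ?_
    simp only [Pi.neg_apply]
    rw [hf.glob_symm he hx]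
  · exact neg_nonneg.2 ((h.isCompatibleFlow (chartAt_mem p)).trEnergy_nonpos ht
      ((chartAt (E n) p).map_source (mem_chart_source _ p)))
  · rw [h.energy_eq ht, ← integral_neg]
    rfl

theorem IsHarmonicHeatFlow.integrableOn (h : IsHarmonicHeatFlow g T J) (he : e ∈ smoothCharts n M)
    {t : ℝ} (ht : t ∈ Ico 0 T) : IntegrableOn
      (fun x => vol (gram g e) x * -trEnergy (gram g e) (endMat (J t) e) x) e.target := by
  have hf := h.isScalarFamily_trEnergy ht
  have h1 := (integrable_glob (g := g) hf fun e he x hx =>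
    (smooth_trEnergy (isMetricAt_gram g he hx)
    ((h.isCompatibleFlow he).contDiffAt ht hx)).continuousAt.continuousWithinAt).neg.integrableOn
    (s := e.source)
  rw [IntegrableOn, riemannianVolume_restrict he, chartVolume] at h1
  have h2 := h1.comp_aemeasurable
    ((aemeasurable_symm e).mono_ac (withDensity_absolutelyContinuous _ _))
  have hv : AEMeasurable (fun x => ENNReal.ofReal (Real.sqrt (gram g e x).det))
      (volume.restrict e.target) :=
    ((continuousOn_vol (g := g) he).aemeasurable e.open_target.measurableSet).ennreal_ofReal
  rw [integrable_withDensity_iff_integrable_smul₀' hv (by simp)] at h2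
  refine (integrableOn_congr_fun (fun x hx => ?_) e.open_target.measurableSet).1 h2
  simp only [Function.comp_apply, Pi.neg_apply, smul_eq_mul,
    ENNReal.toReal_ofReal (Real.sqrt_nonneg _)]
  rw [hf.glob_symm he hx]
  rfl

end Energy

/-! ### The evolution of the localized energy -/

section Integral

variable {n : ℕ} {T : ℝ} {U K : Set (E n)} {F : ℝ → E n → ℝ}

/-- Differentiation under the integral sign for functions supported in a fixed compact set. -/
theorem IsSmoothFlow.hasDerivAt_integral (h : IsSmoothFlow T U F) (hU : IsOpen U)
    (hK : IsCompact K) (hKU : K ⊆ U) (h0 : ∀ t ∈ Ico 0 T, ∀ x ∈ U, x ∉ K → F t x = 0) :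
    ContinuousOn (fun t => ∫ x in U, F t x) (Ico 0 T) ∧
      ∀ t ∈ Ioo 0 T, IntegrableOn (F t) U ∧ IntegrableOn (dt F t) U ∧
        HasDerivAt (fun t => ∫ x in U, F t x) (∫ x in U, dt F t x) t := by
  have h0' : ∀ t ∈ Ioo 0 T, ∀ x ∈ U, x ∉ K → dt F t x = 0 := fun t ht x hx hxK =>
    ((hasDerivAt_const t (0 : ℝ)).congr_of_eventuallyEq (by
      filter_upwards [isOpen_Ioo.mem_nhds ht] with s hs
        using h0 s (Ioo_subset_Ico_self hs) x hx hxK)).deriv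
  have hUm := hU.measurableSet
  have hKm := hK.measurableSet
  have hKf : IsFiniteMeasure (volume.restrict K) := ⟨by
    rw [Measure.restrict_apply_univ]; exact hK.measure_lt_top⟩
  have hres : ∀ t ∈ Ico 0 T, ∫ x in U, F t x = ∫ x in K, F t x := fun t ht =>
    (setIntegral_eq_of_subset_of_forall_sdiff_eq_zero hUm hKU fun x hx => h0 t ht x hx.1 hx.2)
  have hres' : ∀ t ∈ Ioo 0 T, ∫ x in U, dt F t x = ∫ x in K, dt F t x := fun t ht =>
    (setIntegral_eq_of_subset_of_forall_sdiff_eq_zero hUm hKU fun x hx => h0' t ht x hx.1 hx.2)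
  have hc : ContinuousOn (fun q : ℝ × E n => F q.1 q.2) (Ico 0 T ×ˢ K) :=
    h.continuousOn.mono (prod_mono le_rfl hKU)
  have hc' : ContinuousOn (fun q : ℝ × E n => dt F q.1 q.2) (Ioo 0 T ×ˢ K) :=
    (h.continuousOn_dt hU).mono (prod_mono le_rfl hKU)
  have hsl : ∀ t ∈ Ico 0 T, ContinuousOn (F t) K := fun t ht => hc.comp (f := fun x => (t, x))
    (continuous_const.prodMk continuous_id).continuousOn fun x hx => ⟨ht, hx⟩
  have hsl' : ∀ t ∈ Ioo 0 T, ContinuousOn (dt F t) K := fun t ht =>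
    hc'.comp (f := fun x => (t, x))
      (continuous_const.prodMk continuous_id).continuousOn fun x hx => ⟨ht, hx⟩
  constructor
  · refine ContinuousOn.congr (fun t ht => ?_) hres
    set b := (t + T) / 2
    have hb : t < b ∧ b < T := by
      constructor <;> simp only [b] <;> linarith [ht.2]
    obtain ⟨C, hC⟩ := (isCompact_Icc.prod hK).exists_bound_of_continuousOn
      (hc.mono (prod_mono (Icc_subset_Ico_right hb.2 : Icc 0 b ⊆ Ico 0 T) le_rfl))
    have hev : ∀ᶠ s in 𝓝[Ico 0 T] t, s ∈ Icc 0 b := by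
      filter_upwards [self_mem_nhdsWithin, mem_nhdsWithin_of_mem_nhds (Iio_mem_nhds hb.1)]
        with s h1 h2
      exact ⟨h1.1, le_of_lt h2⟩
    refine continuousWithinAt_of_dominated (bound := fun _ => C) ?_ ?_ (integrable_const C) ?_
    · filter_upwards [self_mem_nhdsWithin] with s hs using (hsl s hs).aestronglyMeasurable hKm
    · filter_upwards [hev] with s hs
      exact ae_restrict_of_forall_mem hKm fun p hp => hC (s, p) ⟨hs, hp⟩
    · refine ae_restrict_of_forall_mem hKm fun p hp => ?_
      exact (hc (t, p) ⟨ht, hp⟩).comp (f := fun s => (s, p))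
        (continuous_id.prodMk continuous_const).continuousWithinAt fun s hs => ⟨hs, hp⟩
  · intro t ht
    refine ⟨((hsl t (Ioo_subset_Ico_self ht)).integrableOn_compact hK).of_forall_sdiff_eq_zero hUm
      fun x hx => h0 t (Ioo_subset_Ico_self ht) x hx.1 hx.2,
      ((hsl' t ht).integrableOn_compact hK).of_forall_sdiff_eq_zero hUm
      fun x hx => h0' t ht x hx.1 hx.2, ?_⟩
    rw [hres' t ht]
    refine HasDerivAt.congr_of_eventuallyEq ?_ (show (fun t => ∫ x in U, F t x)
      =ᶠ[𝓝 t] fun t => ∫ x in K, F t x by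
        filter_upwards [isOpen_Ioo.mem_nhds ht] with s hs using hres s (Ioo_subset_Ico_self hs))
    set a := t / 2
    set b := (t + T) / 2
    have hab : 0 < a ∧ a < t ∧ t < b ∧ b < T := by
      refine ⟨?_, ?_, ?_, ?_⟩ <;> simp only [a, b] <;> linarith [ht.1, ht.2]
    obtain ⟨C, hC⟩ := (isCompact_Icc.prod hK).exists_bound_of_continuousOn
      (hc'.mono (prod_mono (fun s hs => ⟨hab.1.trans_le hs.1, hs.2.trans_lt hab.2.2.2⟩ :
        Icc a b ⊆ Ioo 0 T) le_rfl))
    refine (hasDerivAt_integral_of_dominated_loc_of_deriv_le (s := Ioo a b) (bound := fun _ => C)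
      (F' := fun t => dt F t)
      (isOpen_Ioo.mem_nhds ⟨hab.2.1, hab.2.2.1⟩) ?_ ?_ ?_ ?_ (integrable_const C) ?_).2
    · filter_upwards [isOpen_Ioo.mem_nhds ht] with s hs
      exact (hsl s (Ioo_subset_Ico_self hs)).aestronglyMeasurable hKm
    · exact (hsl t (Ioo_subset_Ico_self ht)).integrableOn_compact hK
    · exact (hsl' t ht).aestronglyMeasurable hKm
    · exact ae_restrict_of_forall_mem hKm fun p hp s hs => hC (s, p) ⟨Ioo_subset_Icc_self hs, hp⟩
    · exact ae_restrict_of_forall_mem hKm fun p hp s hs =>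
        h.hasDerivAt hU ⟨hab.1.trans hs.1, hs.2.trans hab.2.2.2⟩ (hKU hp)

end Integral

section Weight

variable {n : ℕ}

theorem contDiffAt_heatKernel {q : ℝ × E n} (hq : 0 < q.1) :
    ContDiffAt ℝ ∞ (fun q : ℝ × E n => heatKernel q.1 q.2) q := by
  have h1 : (4 * Real.pi * q.1) ≠ 0 := by positivity
  have h2 : (4 * Real.pi * q.1) ^ ((n : ℝ) / 2) ≠ 0 := by positivity
  have h3 : 4 * q.1 ≠ 0 := by positivity
  unfold heatKernel
  refine (contDiffAt_const.div ((contDiffAt_const.mul contDiffAt_fst).rpow_const_of_ne h1) h2).mul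
    (ContDiffAt.exp (ContDiffAt.div ((contDiffAt_snd.norm_sq ℝ).neg) (contDiffAt_const.mul
      contDiffAt_fst) h3))

theorem heatKernel_pos {s : ℝ} (hs : 0 < s) (x : E n) : 0 < heatKernel s x := by
  unfold heatKernel; positivity

theorem pd_heatKernel (s : ℝ) (x : E n) (p : Fin n) :
    pd p (heatKernel s) x = -(x p / (2 * s)) * heatKernel s x := by
  have h1 := ((((hasStrictFDerivAt_norm_sq x).hasFDerivAt.neg.mul_const (4 * s)⁻¹).exp).const_mul
    (1 / (4 * Real.pi * s) ^ ((n : ℝ) / 2)))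
  have h2 : heatKernel s = fun x : E n => 1 / (4 * Real.pi * s) ^ ((n : ℝ) / 2)
      * Real.exp (-‖x‖ ^ 2 * (4 * s)⁻¹) := by
    funext x; rw [heatKernel, div_eq_mul_inv (-‖x‖ ^ 2)]
  have h3 := h1.fderiv
  rw [pd, h2]
  refine (congrArg (fun L : E n →L[ℝ] ℝ => L (EuclideanSpace.single p 1)) h3).trans ?_
  simp only [smul_apply, neg_apply, innerSL_apply_apply, smul_eq_mul, nsmul_eq_mul,
    EuclideanSpace.inner_single_right, Real.ringHom_apply, one_mul, Nat.cast_ofNat]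
  simp
  ring

theorem hasDerivAt_heatKernel {s : ℝ} (hs : 0 < s) (x : E n) :
    HasDerivAt (fun s => heatKernel s x) ((‖x‖ ^ 2 / (4 * s ^ 2) - n / (2 * s)) * heatKernel s x)
      s := by
  have h0 : (4 * Real.pi * s) ≠ 0 := by positivity
  have hp : (4 * Real.pi * s) ^ ((n : ℝ) / 2) ≠ 0 := by positivity
  have h1 : HasDerivAt (fun s : ℝ => 4 * Real.pi * s) (4 * Real.pi) s := by
    simpa using (hasDerivAt_id s).const_mul (4 * Real.pi)
  have h2 : HasDerivAt (fun s : ℝ => 4 * s) 4 s := by simpa using (hasDerivAt_id s).const_mul 4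
  have h3 := ((hasDerivAt_const s (1 : ℝ)).div (h1.rpow_const (p := (n : ℝ) / 2) (Or.inl h0)) hp).mul
    (((hasDerivAt_const s (-‖x‖ ^ 2)).div h2 (by positivity)).exp)
  refine h3.congr_deriv ?_
  rw [heatKernel, Real.rpow_sub_one h0]
  simp only [Pi.div_apply]
  field_simp
  ring

end Weight

section Identity

variable {n : ℕ} {T T₀ s t : ℝ} {U : Set (E n)} {G : E n → Mat n} {A : ℝ → E n → Mat n}
  {φ : E n → ℝ} {x : E n}

/-- The weight `k φ²`, where `k` is the heat kernel at time `s`. -/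
def weight (φ : E n → ℝ) (s : ℝ) (x : E n) : ℝ := heatKernel s x * φ x ^ 2

/-- The derivative `g^{pq} ∂_p φ ∇_q A` of `A` in the direction of the gradient of `φ`. -/
def gradCov (G : E n → Mat n) (φ : E n → ℝ) (A : E n → Mat n) (x : E n) : Mat n :=
  ∑ q, (∑ p, (G x)⁻¹ p q * pd p φ x) • cov G q A x

theorem contDiffAt_heatKernel_slice (hs : 0 < s) : ContDiffAt ℝ ∞ (heatKernel s) x :=
  ContDiffAt.comp x (g := fun q : ℝ × E n => heatKernel q.1 q.2) (f := fun z => (s, z))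
    (contDiffAt_heatKernel (q := (s, x)) hs) (contDiffAt_const.prodMk contDiffAt_id)

theorem contDiffAt_weight (hs : 0 < s) (hφ : ContDiff ℝ ∞ φ) : ContDiffAt ℝ ∞ (weight φ s) x :=
  (contDiffAt_heatKernel_slice hs).mul (hφ.contDiffAt.pow 2)

theorem pd_weight (hs : 0 < s) (hφ : ContDiff ℝ ∞ φ) (p : Fin n) : pd p (weight φ s) x
    = -(x p / (2 * s)) * weight φ s x + 2 * heatKernel s x * φ x * pd p φ x := by
  have h1 : DifferentiableAt ℝ φ x := contDiffAt_infty_differentiableAt hφ.contDiffAt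
  have h2 : DifferentiableAt ℝ (heatKernel s) x :=
    contDiffAt_infty_differentiableAt (contDiffAt_heatKernel_slice hs)
  have h3 : weight φ s = fun z => heatKernel s z * (φ z * φ z) := by
    funext z; rw [weight, sq]
  rw [h3, pd_mul h2 (h1.fun_mul h1), pd_mul h1 h1, pd_heatKernel]
  ring

/-- By the Gauss lemma, the gradient of the heat kernel is radial. -/
theorem contract_pd_weight (h : IsMetricAt G x) (hg : (G x).mulVec x.ofLp = x.ofLp) (hs : 0 < s)
    (hφ : ContDiff ℝ ∞ φ) (B : E n → Mat n) (C : Mat n) :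
    ∑ p, ∑ q, (G x)⁻¹ p q * pd p (weight φ s) x * (C * cov G q B x).trace
      = -(weight φ s x / (2 * s)) * (C * radialCov G B x).trace
        + 2 * heatKernel s x * φ x * (C * gradCov G φ B x).trace := by
  have hg' : ∀ q, ∑ p, (G x)⁻¹ p q * x p = x q := fun q => by
    have h1 : (G x)⁻¹.mulVec x.ofLp = x.ofLp := by
      conv_lhs => rw [← hg]
      rw [Matrix.mulVec_mulVec, h.inv_mul, Matrix.one_mulVec]
    have h2 := congrFun h1 q
    rw [Matrix.mulVec, dotProduct] at h2
    rw [← h2]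
    exact Finset.sum_congr rfl fun p _ => by rw [h.inv_symm]
  have h3 : ∀ q, ∑ p, (G x)⁻¹ p q * pd p (weight φ s) x
      = -(weight φ s x / (2 * s)) * x q
        + 2 * heatKernel s x * φ x * ∑ p, (G x)⁻¹ p q * pd p φ x := fun q => by
    rw [← hg', Finset.mul_sum, Finset.mul_sum, ← Finset.sum_add_distrib]
    refine Finset.sum_congr rfl fun p _ => ?_
    rw [pd_weight hs hφ]
    ring
  rw [Finset.sum_comm]
  simp only [← Finset.sum_mul, h3, radialCov, gradCov, Finset.mul_sum, Matrix.trace_sum,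
    mul_smul_comm, Matrix.trace_smul, smul_eq_mul, ← Finset.sum_add_distrib]
  refine Finset.sum_congr rfl fun q _ => ?_
  simp only [Finset.sum_mul, Finset.mul_sum, add_mul]
  congr 1
  · ring
  · exact Finset.sum_congr rfl fun p _ => by ring

theorem sum_mul_pd_weight (hs : 0 < s) (hφ : ContDiff ℝ ∞ φ) :
    ∑ r, x r * pd r (weight φ s) x = -(‖x‖ ^ 2 / (2 * s)) * weight φ s x
      + 2 * heatKernel s x * φ x * ∑ r, x r * pd r φ x := by
  rw [← dotProduct_self_eq_norm_sq, dotProduct, Finset.sum_div, ← Finset.sum_neg_distrib,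
    Finset.sum_mul, Finset.mul_sum, ← Finset.sum_add_distrib]
  refine Finset.sum_congr rfl fun r _ => ?_
  rw [pd_weight hs hφ]
  ring

/-- The density `√|g| τ |∇A|² k φ²` at backward time `τ = T₀ - t`; for a compatible solution,
`|∇A|²` is `-trEnergy`. -/
def localDensity (G : E n → Mat n) (φ : E n → ℝ) (A : ℝ → E n → Mat n) (T₀ t : ℝ) (x : E n) : ℝ :=
  vol G x * (weight φ (T₀ - t) x * ((T₀ - t) * -trEnergy G (A t) x))

/-- The matrix `φ B + ∇_{∇φ} A` with `B = ∂_t A - ∇_X A / 2s`. -/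
def selfSimilarDefect (G : E n → Mat n) (φ : E n → ℝ) (A : ℝ → E n → Mat n) (s t : ℝ) (x : E n) :
    Mat n :=
  φ x • (dt A t x - (1 / (2 * s)) • radialCov G (A t) x) + gradCov G φ (A t) x

/-- The part of the time derivative of the localized density that is not a divergence. -/
def evolutionError (G : E n → Mat n) (φ : E n → ℝ) (A : ℝ → E n → Mat n) (s t : ℝ) (x : E n) : ℝ :=
  2 * s * heatKernel s x * ((selfSimilarDefect G φ A s t x * selfSimilarDefect G φ A s t x).trace
      - (gradCov G φ (A t) x * gradCov G φ (A t) x).trace)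
    + heatKernel s x * φ x * (∑ r, x r * pd r φ x) * trEnergy G (A t) x
    - weight φ s x * stressError G (A t) x

theorem IsCompatibleFlow.radialCov_mul (h : IsCompatibleFlow T U G A) (ht : t ∈ Ico 0 T)
    (hx : x ∈ U) : radialCov G (A t) x * A t x = -(A t x * radialCov G (A t) x) := by
  simp only [radialCov, Finset.sum_mul, Finset.mul_sum, smul_mul_assoc, mul_smul_comm,
    h.cov_mul ht hx, smul_neg, Finset.sum_neg_distrib]

/-- The local monotonicity identity: multiplying the flow by the self-similar defect, the time
derivative of the localized density is a sum of divergences and of the error term. -/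
theorem IsCompatibleFlow.dt_localDensity (h : IsCompatibleFlow T U G A) (ht : t ∈ Ioo 0 T)
    (htT : t < T₀) (hx : x ∈ U) (hg : (G x).mulVec x.ofLp = x.ofLp) (hφ : ContDiff ℝ ∞ φ) :
    dt (localDensity G φ A T₀) t x
      = -2 * divDensity G (fun q z => (T₀ - t) * weight φ (T₀ - t) z *
            (dt A t z * cov G q (A t) z).trace) x
        + (divDensity G (fun q z => weight φ (T₀ - t) z *
              (cov G q (A t) z * radialCov G (A t) z).trace) x
          - (1 / 2) * ∑ r, pd r (fun z => vol G z * (weight φ (T₀ - t) z *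
              (z r * trEnergy G (A t) z))) x)
        + vol G x * evolutionError G φ A (T₀ - t) t x := by
  obtain ⟨s, hs⟩ : ∃ s, s = T₀ - t := ⟨_, rfl⟩
  have hs0 : 0 < s := by rw [hs]; linarith
  have htI : t ∈ Ico 0 T := Ioo_subset_Ico_self ht
  have hm := h.metric x hx
  have hAx := h.contDiffAt htI hx
  have hdt := h.smooth.contDiffAt_dt_slice h.isOpen ht hx
  have hw := contDiffAt_infty_differentiableAt (contDiffAt_weight (x := x) hs0 hφ)
  have hsub : HasDerivAt (fun t => T₀ - t) (-1) t := by
    simpa using (hasDerivAt_id t).const_sub T₀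
  have hk : HasDerivAt (fun t => heatKernel (T₀ - t) x)
      ((‖x‖ ^ 2 / (4 * s ^ 2) - n / (2 * s)) * heatKernel s x * (-1)) t := by
    rw [hs] at hs0 ⊢
    exact (hasDerivAt_heatKernel hs0 x).comp t hsub
  have hE := h.smooth.hasDerivAt_trEnergy h.isOpen h.metric ht hx
  have hD := (((hk.mul_const (φ x ^ 2)).mul (hsub.fun_mul hE.fun_neg)).const_mul (vol G x)).deriv
  change dt (localDensity G φ A T₀) t x = _ at hD
  -- In both Green formulas the equation replaces `Δ A` by `∂_t A`, since `∂_t A` and `∇_X A`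
  -- anticommute with `A`.
  rw [hD, ← hs, stress_identity hm hAx hw, divDensity_mul hm (hw.const_mul s)
    fun q => contDiffAt_infty_differentiableAt (hdt.mul (hAx.cov hm q)).matrix_trace,
    h.divDensity_dt ht hx, h.trace_mul_lap ht hx (h.radialCov_mul htI hx), sum_mul_pd_weight hs0 hφ]
  -- By the Gauss lemma the derivative of the weight contributes `-∇_X A / 2s` and a cutoff term.
  have e1 := contract_pd_weight hm hg hs0 hφ (A t) (dt A t x)
  have e2 := contract_pd_weight hm hg hs0 hφ (A t) (radialCov G (A t) x)
  have e3 : ∀ p, pd p (fun z => s * weight φ s z) x = s * pd p (weight φ s) x := fun p =>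
    pd_const_mul s hw
  have e4 : ∑ p, ∑ q, (G x)⁻¹ p q * (s * pd p (weight φ s) x) * (dt A t x * cov G q (A t) x).trace
      = s * ∑ p, ∑ q, (G x)⁻¹ p q * pd p (weight φ s) x * (dt A t x * cov G q (A t) x).trace := by
    simp only [Finset.mul_sum]
    exact Finset.sum_congr rfl fun p _ => Finset.sum_congr rfl fun q _ => by ring
  simp only [e3, Matrix.trace_mul_comm (cov G _ (A t) x) (radialCov G (A t) x)]
  rw [e4, e1, e2]
  -- The terms quadratic in `∂_t A`, `∇_X A` and `∇_{∇φ} A` form a complete square.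
  have e5 : (selfSimilarDefect G φ A s t x * selfSimilarDefect G φ A s t x).trace
      = φ x ^ 2 * ((dt A t x * dt A t x).trace - (dt A t x * radialCov G (A t) x).trace / s
          + (radialCov G (A t) x * radialCov G (A t) x).trace / (4 * s ^ 2))
        + 2 * φ x * ((dt A t x * gradCov G φ (A t) x).trace
          - (radialCov G (A t) x * gradCov G φ (A t) x).trace / (2 * s))
        + (gradCov G φ (A t) x * gradCov G φ (A t) x).trace := by
    simp only [selfSimilarDefect, mul_add, add_mul, sub_mul, mul_sub, smul_mul_assoc,
      mul_smul_comm, Matrix.trace_add, Matrix.trace_sub, Matrix.trace_smul, smul_eq_mul,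
      Matrix.trace_mul_comm (radialCov G (A t) x) (dt A t x),
      Matrix.trace_mul_comm (gradCov G φ (A t) x) (dt A t x),
      Matrix.trace_mul_comm (gradCov G φ (A t) x) (radialCov G (A t) x)]
    field_simp
    ring
  rw [evolutionError, e5]
  simp only [weight, Matrix.trace_mul_comm (radialCov G (A t) x) (dt A t x)]
  field_simp
  ring

end Identity

/-! ### Estimates for the error term -/

section Geometry

variable {n : ℕ} {G : E n → Mat n} {x : E n} {K : ℝ}

theorem norm_le_of_abs_entry_le {B : Mat n} {b : ℝ} (hb : 0 ≤ b) (h : ∀ i j, |B i j| ≤ b) :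
    ‖B‖ ≤ n * b := by
  refine le_of_sq_le_sq ?_ (by positivity)
  rw [norm_sq_eq_sum]
  calc ∑ i, ∑ j, B i j ^ 2 ≤ ∑ _i : Fin n, ∑ _j : Fin n, b ^ 2 :=
        Finset.sum_le_sum fun i _ => Finset.sum_le_sum fun j _ => by
          rw [← sq_abs]; exact pow_le_pow_left₀ (abs_nonneg _) (h i j) 2
    _ = (n * b) ^ 2 := by simp; ring

theorem abs_trace_le (B : Mat n) : |B.trace| ≤ n * ‖B‖ := by
  rw [Matrix.trace]
  refine (Finset.abs_sum_le_sum_abs _ _).trans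
    ((Finset.sum_le_sum fun i _ => abs_entry_le_norm B i i).trans (le_of_eq ?_))
  simp

theorem sum_fin_le {f : Fin n → ℝ} {b : ℝ} (h : ∀ i, f i ≤ b) : ∑ i, f i ≤ n * b := by
  refine (Finset.sum_le_sum fun i _ => h i).trans (le_of_eq ?_)
  simp

theorem abs_sum_fin_le {f : Fin n → ℝ} {b : ℝ} (h : ∀ i, |f i| ≤ b) : |∑ i, f i| ≤ n * b :=
  (Finset.abs_sum_le_sum_abs _ _).trans (sum_fin_le h)

theorem norm_sum_fin_le {f : Fin n → Mat n} {b : ℝ} (h : ∀ i, ‖f i‖ ≤ b) : ‖∑ i, f i‖ ≤ n * b :=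
  (norm_sum_le _ _).trans (sum_fin_le h)

theorem HasBoundedGeometry.trace_le (hb : HasBoundedGeometry G K)
    (hx : x ∈ Metric.ball (0 : E n) 1) : (G x).trace ≤ n * K :=
  sum_fin_le fun i => (le_abs_self _).trans (hb.entry x hx i i)

theorem HasBoundedGeometry.trace_inv_le (hb : HasBoundedGeometry G K)
    (hx : x ∈ Metric.ball (0 : E n) 1) : ((G x)⁻¹).trace ≤ n * K :=
  sum_fin_le fun i => (le_abs_self _).trans (hb.inv x hx i i)

theorem HasBoundedGeometry.vol_le (hb : HasBoundedGeometry G K)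
    (hx : x ∈ Metric.ball (0 : E n) 1) : vol G x ≤ Real.sqrt (n.factorial * K ^ n) := by
  refine Real.sqrt_le_sqrt ((le_abs_self _).trans ?_)
  have := Matrix.det_le (abv := (IsAbsoluteValue.toAbsoluteValue (abs : ℝ → ℝ)))
    (A := G x) (x := K) fun i j => hb.entry x hx i j
  simpa using this

theorem HasBoundedGeometry.norm_inv_le (hb : HasBoundedGeometry G K) (hK : 0 ≤ K)
    (hx : x ∈ Metric.ball (0 : E n) 1) : ‖(G x)⁻¹‖ ≤ n * K :=
  norm_le_of_abs_entry_le hK (hb.inv x hx)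

theorem HasBoundedGeometry.norm_connLow_le (hb : HasBoundedGeometry G K) (hK : 0 ≤ K)
    (hr : IsRadialMetric G 1) (hx : x ∈ Metric.ball (0 : E n) 1) (k : Fin n) :
    ‖connLow G k x‖ ≤ n * (3 / 2 * (n * K * ‖x‖)) := by
  refine norm_le_of_abs_entry_le (by positivity) fun i j => ?_
  have h1 : ∀ a b c, |pd a G x b c| ≤ n * K * ‖x‖ := fun a b c => by
    rw [← HarmonicFlow.pd_entry (hr.metric x hx).differentiableAt]; exact hb.pd_entry_le hr hx b c a
  rw [connLow, Matrix.of_apply, abs_mul, abs_of_nonneg (by norm_num : (0 : ℝ) ≤ 1 / 2)]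
  have h2 := abs_sub (pd i G x k j + pd k G x i j) (pd j G x i k)
  have h3 := abs_add_le (pd i G x k j) (pd k G x i j)
  have := h1 i k j
  have := h1 k i j
  have := h1 j i k
  linarith

theorem HasBoundedGeometry.norm_conn_le (hb : HasBoundedGeometry G K) (hK : 0 ≤ K)
    (hr : IsRadialMetric G 1) (hx : x ∈ Metric.ball (0 : E n) 1) (k : Fin n) :
    ‖conn G k x‖ ≤ n * (3 / 2 * (n * K)) * (n * K) * ‖x‖ := by
  rw [conn_eq (hr.metric x hx)]
  refine (norm_mul_le _ _).trans ((mul_le_mul (hb.norm_connLow_le hK hr hx k)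
    (hb.norm_inv_le hK hx) (norm_nonneg _) (by positivity)).trans (le_of_eq ?_))
  ring

theorem HasBoundedGeometry.exists_curv_le (n : ℕ) {K : ℝ} (hK : 0 ≤ K) : ∃ C, 0 ≤ C ∧
    ∀ G : E n → Mat n, HasBoundedGeometry G K → IsRadialMetric G 1 →
      ∀ x ∈ Metric.ball (0 : E n) 1, ∀ p r, ‖curv G p r x‖ ≤ C := by
  set a := n * (3 / 2 * (n * K)) with ha
  set b := n * (3 / 2 * (n * K)) * (n * K) with hb'
  set d := n * (3 / 2 * K) * (n * K) + a * (2 * (n * K * b)) with hd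
  refine ⟨2 * d + 2 * (b * b), by positivity, fun G hb hr x hx p r => ?_⟩
  have hx1 : ‖x‖ ≤ 1 := by simpa using (mem_ball_zero_iff.1 hx).le
  have hm := hr.metric x hx
  have hev : ∀ᶠ z in 𝓝 x, z ∈ Metric.ball (0 : E n) 1 := Metric.isOpen_ball.mem_nhds hx
  have hc : ∀ k, ‖conn G k x‖ ≤ b := fun k => (hb.norm_conn_le hK hr hx k).trans
    (mul_le_of_le_one_right (by positivity) hx1)
  have hl : ∀ k, ‖connLow G k x‖ ≤ a := fun k => (hb.norm_connLow_le hK hr hx k).trans (by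
    have h1 : n * K * ‖x‖ ≤ n * K := mul_le_of_le_one_right (by positivity) hx1
    rw [ha]
    gcongr n * (3 / 2 * ?_))
  have hi := hb.norm_inv_le hK hx
  have hpi : ∀ k, ‖pd k (fun z => (G z)⁻¹) x‖ ≤ 2 * (n * K * b) := fun k => by
    rw [pd_metric_inv hm, norm_neg]
    have h1 : ‖(conn G k x).transpose‖ = ‖conn G k x‖ := Matrix.frobenius_norm_transpose _
    refine (norm_add_le _ _).trans ?_
    have h2 := (norm_mul_le (conn G k x).transpose (G x)⁻¹).trans
      (mul_le_mul (h1.trans_le (hc k)) hi (norm_nonneg _) (by positivity))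
    have h3 := (norm_mul_le (G x)⁻¹ (conn G k x)).trans
      (mul_le_mul hi (hc k) (norm_nonneg _) (by positivity))
    linarith
  have hGe : ∀ i j, ∀ᶠ z in 𝓝 x, ∀ k, pd k G z i j = pd k (fun w => G w i j) z := fun i j => by
    filter_upwards [hev] with z hz k using
      (HarmonicFlow.pd_entry (hr.metric z hz).differentiableAt i j).symm
  have hsG : ∀ k, ContDiffAt ℝ ∞ (pd k G) x := fun k => hm.smooth.pd k
  have hsL : ∀ k, ContDiffAt ℝ ∞ (connLow G k) x := fun k => contDiffAt_matrix.2 fun i j =>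
    contDiffAt_const.mul ((((hsG i).matrix_entry k j).add ((hsG k).matrix_entry i j)).sub
      ((hsG j).matrix_entry i k))
  have hdG : ∀ k i j, DifferentiableAt ℝ (fun z => pd k G z i j) x := fun k i j =>
    contDiffAt_infty_differentiableAt ((hsG k).matrix_entry i j)
  have hpp : ∀ l k i j, |pd l (fun z => pd k G z i j) x| ≤ K := fun l k i j => by
    rw [pd_congr (g := pd k fun w => G w i j) (by filter_upwards [hGe i j] with z hz using hz k)]
    exact hb.pd_pd_entry x hx i j k l
  have hpl : ∀ l k, ‖pd l (connLow G k) x‖ ≤ n * (3 / 2 * K) := fun l k => by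
    refine norm_le_of_abs_entry_le (by positivity) fun i j => ?_
    rw [← HarmonicFlow.pd_entry (contDiffAt_infty_differentiableAt (hsL k))]
    have h1 : pd l (fun z => connLow G k z i j) x = (1 / 2) * (pd l (fun z => pd i G z k j) x
        + pd l (fun z => pd k G z i j) x - pd l (fun z => pd j G z i k) x) := by
      simp only [connLow, Matrix.of_apply]
      rw [pd_const_mul _ (((hdG i k j).fun_add (hdG k i j)).fun_sub (hdG j i k)),
        pd_sub ((hdG i k j).fun_add (hdG k i j)) (hdG j i k), pd_add (hdG i k j) (hdG k i j)]
    rw [h1, abs_mul, abs_of_nonneg (by norm_num : (0 : ℝ) ≤ 1 / 2)]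
    have h2 := abs_sub (pd l (fun z => pd i G z k j) x + pd l (fun z => pd k G z i j) x)
      (pd l (fun z => pd j G z i k) x)
    have h3 := abs_add_le (pd l (fun z => pd i G z k j) x) (pd l (fun z => pd k G z i j) x)
    have := hpp l i k j
    have := hpp l k i j
    have := hpp l j i k
    linarith
  have hpc : ∀ l k, ‖pd l (conn G k) x‖ ≤ d := fun l k => by
    rw [pd_congr (g := fun z => connLow G k z * (G z)⁻¹)
      (by filter_upwards [hev] with z hz using conn_eq (hr.metric z hz) k),
      pd_mul (contDiffAt_infty_differentiableAt (hsL k))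
        (contDiffAt_infty_differentiableAt hm.smooth_inv)]
    refine (norm_add_le _ _).trans (add_le_add ?_ ?_)
    · exact (norm_mul_le _ _).trans (mul_le_mul (hpl l k) hi (norm_nonneg _) (by positivity))
    · exact (norm_mul_le _ _).trans (mul_le_mul (hl k) (hpi l) (norm_nonneg _) (by positivity))
  have hcc : ∀ k l, ‖conn G k x * conn G l x‖ ≤ b * b := fun k l =>
    (norm_mul_le _ _).trans (mul_le_mul (hc k) (hc l) (norm_nonneg _) (by positivity))
  have h1 := norm_sub_le (pd p (conn G r) x - pd r (conn G p) x + conn G r x * conn G p x)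
    (conn G p x * conn G r x)
  have h2 := norm_add_le (pd p (conn G r) x - pd r (conn G p) x) (conn G r x * conn G p x)
  have h3 := norm_sub_le (pd p (conn G r) x) (pd r (conn G p) x)
  have := hpc p r
  have := hpc r p
  have := hcc r p
  have := hcc p r
  rw [curv]
  linarith

end Geometry

section KernelBounds

variable {n : ℕ} {s : ℝ} {x : E n}

theorem heatKernel_le (hs : 0 < s) (x : E n) :
    heatKernel s x ≤ 1 / (4 * Real.pi * s) ^ ((n : ℝ) / 2) := by
  refine mul_le_of_le_one_right (by positivity) (Real.exp_le_one_iff.2 ?_)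
  rw [neg_div]
  exact neg_nonpos.2 (by positivity)

/-- Away from the origin the heat kernel is bounded uniformly in time. -/
theorem heatKernel_le_of_half_le (hs : 0 < s) (hx : 1 / 2 ≤ ‖x‖) :
    heatKernel s x ≤ 2 ^ n * n.factorial := by
  have hpi := Real.pi_gt_three
  have hf : (1 : ℝ) ≤ n.factorial := by exact_mod_cast n.factorial_pos
  have h2 : (1 : ℝ) ≤ 2 ^ n := one_le_pow₀ (by norm_num)
  have hb : 0 < 4 * Real.pi * s := by positivity
  rcases le_total 1 (4 * Real.pi * s) with h1 | h1
  · refine (heatKernel_le hs x).trans (le_trans ?_ (one_le_mul_of_one_le_of_one_le h2 hf))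
    exact div_le_one_of_le₀ (Real.one_le_rpow h1 (by positivity)) (by positivity)
  · have e1 : (4 * Real.pi * s) ^ n ≤ (4 * Real.pi * s) ^ ((n : ℝ) / 2) := by
      rw [← Real.rpow_natCast]
      refine Real.rpow_le_rpow_of_exponent_ge hb h1 ?_
      have : (0 : ℝ) ≤ n := n.cast_nonneg
      linarith
    have e2 : Real.exp (-‖x‖ ^ 2 / (4 * s)) ≤ n.factorial * (16 * s) ^ n := by
      have e3 := Real.pow_div_factorial_le_exp (1 / (16 * s)) (by positivity) n
      have e4 : Real.exp (-‖x‖ ^ 2 / (4 * s)) ≤ (Real.exp (1 / (16 * s)))⁻¹ := by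
        rw [← Real.exp_neg]
        refine Real.exp_le_exp.2 ?_
        rw [neg_div, neg_le_neg_iff, div_le_div_iff₀ (by positivity) (by positivity)]
        have e5 : 1 / 4 ≤ ‖x‖ ^ 2 := by nlinarith
        nlinarith [mul_le_mul_of_nonneg_right e5 hs.le]
      refine e4.trans ((inv_anti₀ (by positivity) e3).trans (le_of_eq ?_))
      rw [one_div, inv_pow]
      field_simp
    rw [heatKernel]
    calc 1 / (4 * Real.pi * s) ^ ((n : ℝ) / 2) * Real.exp (-‖x‖ ^ 2 / (4 * s))
        ≤ 1 / (4 * Real.pi * s) ^ n * (n.factorial * (16 * s) ^ n) := by gcongr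
      _ = (4 / Real.pi) ^ n * n.factorial := by
        have e6 : (16 * s) ^ n = (4 / Real.pi) ^ n * (4 * Real.pi * s) ^ n := by
          rw [← mul_pow]
          congr 1
          field_simp
          norm_num
        rw [e6]
        have hB : (4 * Real.pi * s) ^ n ≠ 0 := (pow_pos hb n).ne'
        generalize (4 * Real.pi * s) ^ n = B at hB
        generalize (4 / Real.pi) ^ n = q
        field_simp
      _ ≤ 2 ^ n * n.factorial := by
        gcongr
        rw [div_le_iff₀ (by positivity)]
        linarith

/-- The heat kernel is concentrated, up to a bounded part, where `|x|² ≲ s |log s|`. -/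
theorem norm_sq_mul_heatKernel_le (hs : 0 < s) (hx : ‖x‖ ≤ 1) :
    ‖x‖ ^ 2 * heatKernel s x ≤ 2 * n * s * |Real.log s| * heatKernel s x + 1 := by
  have hk := (heatKernel_pos hs x).le
  have hpi := Real.pi_gt_three
  rcases le_total (‖x‖ ^ 2) (2 * n * s * |Real.log s|) with h1 | h1
  · have := mul_le_mul_of_nonneg_right h1 hk
    linarith
  · have h2 : heatKernel s x ≤ 1 := by
      rcases le_total 1 s with h3 | h3
      · refine (heatKernel_le hs x).trans (div_le_one_of_le₀ (Real.one_le_rpow ?_ ?_) ?_)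
        · nlinarith
        · positivity
        · positivity
      · have h4 : Real.exp (-‖x‖ ^ 2 / (4 * s)) ≤ s ^ ((n : ℝ) / 2) := by
          rw [Real.rpow_def_of_pos hs]
          refine Real.exp_le_exp.2 ?_
          rw [abs_of_nonpos (Real.log_nonpos hs.le h3)] at h1
          rw [div_le_iff₀ (by positivity)]
          nlinarith
        rw [heatKernel, one_div, Real.mul_rpow (by positivity) hs.le]
        have h5 : 1 ≤ (4 * Real.pi) ^ ((n : ℝ) / 2) :=
          Real.one_le_rpow (by linarith) (by positivity)
        have h6 : 0 < s ^ ((n : ℝ) / 2) := by positivity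
        calc _ ≤ ((4 * Real.pi) ^ ((n : ℝ) / 2) * s ^ ((n : ℝ) / 2))⁻¹
              * s ^ ((n : ℝ) / 2) := by gcongr
          _ = ((4 * Real.pi) ^ ((n : ℝ) / 2))⁻¹ := by field_simp
          _ ≤ 1 := inv_le_one_of_one_le₀ h5
    have h7 : ‖x‖ ^ 2 * heatKernel s x ≤ 1 * 1 :=
      mul_le_mul (pow_le_one₀ (norm_nonneg _) hx) h2 hk zero_le_one
    have h8 : 0 ≤ 2 * n * s * |Real.log s| * heatKernel s x := by positivity
    linarith

end KernelBounds

section ErrorBounds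

variable {n : ℕ}

theorem norm_cov_le {G : E n → Mat n} {A : ℝ → E n → Mat n} {K T t : ℝ} {x : E n}
    (hK : 0 ≤ K) (hb : HasBoundedGeometry G K) (h : IsCompatibleFlow T (Metric.ball 0 1) G A)
    (ht : t ∈ Ico 0 T) (hx : x ∈ Metric.ball (0 : E n) 1) (p : Fin n) :
    ‖cov G p (A t) x‖ ≤ Real.sqrt ((n * K) ^ 3) * Real.sqrt (-trEnergy G (A t) x) := by
  have hm := h.metric x hx
  rw [← Real.sqrt_mul (by positivity)]
  refine Real.le_sqrt_of_sq_le ?_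
  have h1 := sum_norm_sq_le_gradInn hm.self fun p => cov G p (A t) x
  rw [gradInn_self_of_skew hm (h.differentiableAt ht hx) (h.eventually_skew ht hx)] at h1
  have h2 := Finset.single_le_sum (f := fun p => ‖cov G p (A t) x‖ ^ 2)
    (fun _ _ => sq_nonneg _) (Finset.mem_univ p)
  refine h2.trans (h1.trans (mul_le_mul_of_nonneg_right ?_ ?_))
  · have := trace_nonneg_of_posDef hm.self
    have := trace_inv_nonneg hm.self
    have h3 := hb.trace_le hx
    have h4 := hb.trace_inv_le hx
    calc (G x).trace ^ 2 * ((G x)⁻¹).trace ≤ (n * K) ^ 2 * (n * K) := by gcongr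
      _ = (n * K) ^ 3 := by ring
  · linarith [h.trEnergy_nonpos ht hx]

theorem norm_le_of_compatible {G : E n → Mat n} {A : ℝ → E n → Mat n} {K T t : ℝ} {x : E n}
    (hK : 0 ≤ K) (hb : HasBoundedGeometry G K) (h : IsCompatibleFlow T (Metric.ball 0 1) G A)
    (ht : t ∈ Ico 0 T) (hx : x ∈ Metric.ball (0 : E n) 1) :
    ‖A t x‖ ≤ Real.sqrt ((n * K) ^ 2 * n) := by
  have hm := h.metric x hx
  refine Real.le_sqrt_of_sq_le ((norm_sq_le_inn hm.self _).trans ?_)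
  rw [inn_self_of_skew (h.skew t ht x hx), h.sq t ht x hx, Matrix.trace_neg, Matrix.trace_one,
    Fintype.card_fin, neg_neg]
  have := trace_nonneg_of_posDef hm.self
  have := trace_inv_nonneg hm.self
  have h3 := hb.trace_le hx
  have h4 := hb.trace_inv_le hx
  rw [sq]
  gcongr

theorem abs_trace_mul_le {P Q : Mat n} {a b : ℝ} (ha : 0 ≤ a) (hP : ‖P‖ ≤ a) (hQ : ‖Q‖ ≤ b) :
    |(P * Q).trace| ≤ n * (a * b) :=
  (abs_trace_le _).trans (mul_le_mul_of_nonneg_left ((norm_mul_le _ _).trans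
    (mul_le_mul hP hQ (norm_nonneg _) ha)) n.cast_nonneg)

/-- In normal coordinates the Christoffel symbols are `O(|x|)`; hence the error in the stress-energy
identity is of second order in `x` with respect to `|∇A|²` and of first order with respect to
`|∇A|`. -/
theorem exists_stressError_le (n : ℕ) {K : ℝ} (hK : 0 ≤ K) : ∃ C, 0 ≤ C ∧
    ∀ (G : E n → Mat n) (A : ℝ → E n → Mat n) (T t : ℝ) (x : E n), HasBoundedGeometry G K →
      IsRadialMetric G 1 → IsCompatibleFlow T (Metric.ball 0 1) G A → t ∈ Ico 0 T →
      x ∈ Metric.ball (0 : E n) 1 → |stressError G (A t) x|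
        ≤ C * (‖x‖ ^ 2 * -trEnergy G (A t) x + ‖x‖ * Real.sqrt (-trEnergy G (A t) x)) := by
  obtain ⟨F, hF0, hF⟩ := HasBoundedGeometry.exists_curv_le n hK
  obtain ⟨b, hb⟩ : ∃ b, b = n * (3 / 2 * (n * K)) * (n * K) := ⟨_, rfl⟩
  obtain ⟨a, ha⟩ : ∃ a, a = Real.sqrt ((n * K) ^ 2 * n) := ⟨_, rfl⟩
  obtain ⟨c, hc⟩ : ∃ c, c = Real.sqrt ((n * K) ^ 3) := ⟨_, rfl⟩
  have hb0 : 0 ≤ b := by rw [hb]; positivity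
  have ha0 : 0 ≤ a := by rw [ha]; positivity
  have hc0 : 0 ≤ c := by rw [hc]; positivity
  obtain ⟨c₁, hc₁⟩ : ∃ c₁, c₁ = n * (n * (n * K * b * (n * (c * c)))) + 1 / 2 * (n * b) := ⟨_, rfl⟩
  obtain ⟨c₃, hc₃⟩ : ∃ c₃, c₃ = n * (n * (K * (n * (c * (2 * (a * F)))))) := ⟨_, rfl⟩
  have hc₁0 : 0 ≤ c₁ := by rw [hc₁]; positivity
  have hc₃0 : 0 ≤ c₃ := by rw [hc₃]; positivity
  refine ⟨n * (c₁ + c₃), by positivity, fun G A T t x hG hr h ht hx => ?_⟩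
  have he0 : 0 ≤ -trEnergy G (A t) x := by linarith [h.trEnergy_nonpos ht hx]
  obtain ⟨e, he⟩ : ∃ e, e = Real.sqrt (-trEnergy G (A t) x) := ⟨_, rfl⟩
  have hee : -trEnergy G (A t) x = e * e := by rw [he, Real.mul_self_sqrt he0]
  have he00 : 0 ≤ e := by rw [he]; positivity
  have hP : ∀ p, ‖cov G p (A t) x‖ ≤ c * e := fun p => by
    rw [hc, he]; exact norm_cov_le hK hG h ht hx p
  have hA : ‖A t x‖ ≤ a := by rw [ha]; exact norm_le_of_compatible hK hG h ht hx
  have hΓ : ∀ r, ‖conn G r x‖ ≤ b * ‖x‖ := fun r => by rw [hb]; exact hG.norm_conn_le hK hr hx r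
  have hxr : ∀ r, |x r| ≤ ‖x‖ := fun r => by simpa using PiLp.norm_apply_le x r
  -- The Christoffel terms, quadratic in `∇A` and `O(|x|)`.
  have t1 : ∀ r, |∑ p, ∑ q, ((G x)⁻¹ * conn G r x) p q * (cov G p (A t) x * cov G q (A t) x).trace|
      ≤ n * (n * (n * K * (b * ‖x‖) * (n * (c * e * (c * e))))) := fun r => by
    refine abs_sum_fin_le fun p => abs_sum_fin_le fun q => ?_
    rw [abs_mul]
    refine mul_le_mul ((abs_entry_le_norm _ p q).trans ((norm_mul_le _ _).trans (mul_le_mul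
      (hG.norm_inv_le hK hx) (hΓ r) (norm_nonneg _) (by positivity))))
      (abs_trace_mul_le (by positivity) (hP p) (hP q)) (abs_nonneg _) (by positivity)
  have t2 : ∀ r, |1 / 2 * (conn G r x).trace * trEnergy G (A t) x|
      ≤ 1 / 2 * (n * (b * ‖x‖)) * (e * e) := fun r => by
    rw [abs_mul, abs_mul, abs_of_nonneg (by norm_num : (0 : ℝ) ≤ 1 / 2), ← abs_neg (trEnergy _ _ _),
      hee, abs_of_nonneg (mul_nonneg he00 he00)]
    gcongr
    exact (abs_trace_le _).trans (mul_le_mul_of_nonneg_left (hΓ r) n.cast_nonneg)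
  -- The curvature term, linear in `∇A`.
  have t3 : ∀ r, |∑ p, ∑ q, (G x)⁻¹ p q *
      (cov G q (A t) x * (A t x * curv G p r x - curv G p r x * A t x)).trace|
      ≤ n * (n * (K * (n * (c * e * (2 * (a * F)))))) := fun r => by
    refine abs_sum_fin_le fun p => abs_sum_fin_le fun q => ?_
    rw [abs_mul]
    refine mul_le_mul (hG.inv x hx p q) (abs_trace_mul_le (by positivity) (hP q) ?_)
      (abs_nonneg _) hK
    have hFx := hF G hG hr x hx p r
    have e1 := (norm_mul_le (A t x) (curv G p r x)).trans
      (mul_le_mul hA hFx (norm_nonneg _) ha0)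
    have e2 := (norm_mul_le (curv G p r x) (A t x)).trans
      (mul_le_mul hFx hA (norm_nonneg _) hF0)
    refine (norm_sub_le _ _).trans ?_
    linarith
  rw [← he, hee, stressError]
  have hmain : |∑ r, x r * ((∑ p, ∑ q, ((G x)⁻¹ * conn G r x) p q *
      (cov G p (A t) x * cov G q (A t) x).trace) - (1 / 2) * (conn G r x).trace * trEnergy G (A t) x
      + ∑ p, ∑ q, (G x)⁻¹ p q *
        (cov G q (A t) x * (A t x * curv G p r x - curv G p r x * A t x)).trace)|
      ≤ n * (‖x‖ * (c₁ * ‖x‖ * (e * e) + c₃ * e)) := by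
    refine abs_sum_fin_le fun r => ?_
    rw [abs_mul]
    refine mul_le_mul (hxr r) ?_ (abs_nonneg _) (norm_nonneg _)
    refine (abs_add_le _ _).trans ((add_le_add ((abs_sub _ _).trans
      (add_le_add (t1 r) (t2 r))) (t3 r)).trans (le_of_eq ?_))
    rw [hc₁, hc₃]
    ring
  have hn0 : (0 : ℝ) ≤ n := n.cast_nonneg
  refine hmain.trans ?_
  have e1 : 0 ≤ n * (c₁ * (‖x‖ * e) + c₃ * (‖x‖ ^ 2 * (e * e))) := by positivity
  nlinarith

/-- The estimate for the error term in the evolution of the localized energy. -/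
theorem exists_evolutionError_le (n : ℕ) {K Φ : ℝ} (hK : 0 ≤ K) (hΦ : 0 ≤ Φ) : ∃ C, 0 ≤ C ∧
    ∀ (G : E n → Mat n) (A : ℝ → E n → Mat n) (φ : E n → ℝ) (T t s : ℝ) (x : E n),
      HasBoundedGeometry G K → IsRadialMetric G 1 → IsCompatibleFlow T (Metric.ball 0 1) G A →
      t ∈ Ioo 0 T → 0 < s → s ≤ 4 → x ∈ Metric.ball (0 : E n) 1 →
      |φ x| ≤ Φ → (∀ p, |pd p φ x| ≤ Φ) → (‖x‖ < 1 / 2 → ∀ p, pd p φ x = 0) →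
      evolutionError G φ A s t x ≤ C * -trEnergy G (A t) x
        + C * |Real.log s| * (weight φ s x * (s * -trEnergy G (A t) x))
        + C * (weight φ s x * (‖x‖ * Real.sqrt (-trEnergy G (A t) x))) := by
  obtain ⟨S, hS0, hS⟩ := exists_stressError_le n hK
  obtain ⟨c, hc⟩ : ∃ c, c = Real.sqrt ((n * K) ^ 3) := ⟨_, rfl⟩
  have hc0 : 0 ≤ c := by rw [hc]; positivity
  obtain ⟨k₀, hk₀⟩ : ∃ k₀ : ℝ, k₀ = 2 ^ n * n.factorial := ⟨_, rfl⟩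
  have hk₀0 : 0 ≤ k₀ := by rw [hk₀]; positivity
  obtain ⟨d, hd⟩ : ∃ d, d = n * (n * (K * Φ) * c) := ⟨_, rfl⟩
  have hd0 : 0 ≤ d := by rw [hd]; positivity
  have hn0 : (0 : ℝ) ≤ n := n.cast_nonneg
  refine ⟨2 * 4 * k₀ * (n * (d * d)) + k₀ * Φ * (n * Φ) + S * Φ ^ 2 + 2 * n * S + S,
    by positivity, fun G A φ T t s x hG hr h ht hs hs4 hx hφ hφ' hφ0 => ?_⟩
  have htI : t ∈ Ico 0 T := Ioo_subset_Ico_self ht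
  have hm := h.metric x hx
  have hx1 : ‖x‖ ≤ 1 := (mem_ball_zero_iff.1 hx).le
  have he0 : 0 ≤ -trEnergy G (A t) x := by linarith [h.trEnergy_nonpos htI hx]
  have hstr := hS G A T t x hG hr h htI hx
  obtain ⟨e, he⟩ : ∃ e, e = Real.sqrt (-trEnergy G (A t) x) := ⟨_, rfl⟩
  have hee : -trEnergy G (A t) x = e * e := by rw [he, Real.mul_self_sqrt he0]
  have he00 : 0 ≤ e := by rw [he]; positivity
  have hP : ∀ p, ‖cov G p (A t) x‖ ≤ c * e := fun p => by
    rw [hc, he]; exact norm_cov_le hK hG h htI hx p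
  have hk := (heatKernel_pos hs x).le
  rw [← he, hee] at hstr ⊢
  -- the self-similar defect is skew, so the trace of its square is nonpositive
  have hskew : adj (G x) (selfSimilarDefect G φ A s t x) = -selfSimilarDefect G φ A s t x := by
    simp only [selfSimilarDefect, gradCov, radialCov, sub_eq_add_neg, adj_add, adj_smul, adj_sum,
      adj_neg, h.adj_cov htI hx, h.adj_dt ht hx, smul_neg, Finset.sum_neg_distrib, neg_add,
      smul_add]
  have hdef : (selfSimilarDefect G φ A s t x * selfSimilarDefect G φ A s t x).trace ≤ 0 := by
    have h1 := inn_self_nonneg hm.self (selfSimilarDefect G φ A s t x)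
    rw [inn_self_of_skew hskew] at h1
    linarith
  -- the terms with derivatives of the cutoff vanish near the origin
  have hcut : -(2 * s * heatKernel s x * (gradCov G φ (A t) x * gradCov G φ (A t) x).trace)
      + heatKernel s x * φ x * (∑ r, x r * pd r φ x) * trEnergy G (A t) x
      ≤ (2 * 4 * k₀ * (n * (d * d)) + k₀ * Φ * (n * Φ)) * (e * e) := by
    rcases lt_or_ge ‖x‖ (1 / 2) with hlt | hge
    · have h0 := hφ0 hlt
      have : gradCov G φ (A t) x = 0 := by simp [gradCov, h0]
      simp only [this, h0, mul_zero, Matrix.trace_zero, Finset.sum_const_zero, neg_zero, zero_mul,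
        add_zero]
      positivity
    · have hkk : heatKernel s x ≤ k₀ := by rw [hk₀]; exact heatKernel_le_of_half_le hs hge
      have hg : ‖gradCov G φ (A t) x‖ ≤ d * e := by
        rw [hd]
        refine (norm_sum_fin_le (b := n * (K * Φ) * (c * e)) fun q => ?_).trans
          (le_of_eq (by ring))
        rw [norm_smul, Real.norm_eq_abs]
        refine mul_le_mul (abs_sum_fin_le fun p => ?_) (hP q) (norm_nonneg _) (by positivity)
        rw [abs_mul]
        exact mul_le_mul (hG.inv x hx p q) (hφ' p) (abs_nonneg _) hK
      have h1 := abs_trace_mul_le (by positivity) hg hg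
      have h2 : |∑ r, x r * pd r φ x| ≤ n * Φ := abs_sum_fin_le fun r => by
        rw [abs_mul, ← one_mul Φ]
        exact mul_le_mul ((by simpa using PiLp.norm_apply_le x r : |x r| ≤ ‖x‖).trans hx1) (hφ' r)
          (abs_nonneg _) zero_le_one
      have h3 : -(2 * s * heatKernel s x * (gradCov G φ (A t) x * gradCov G φ (A t) x).trace)
          ≤ 2 * 4 * k₀ * (n * (d * e * (d * e))) := by
        rw [← mul_neg]
        calc _ ≤ 2 * s * heatKernel s x * |(gradCov G φ (A t) x * gradCov G φ (A t) x).trace| := by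
              gcongr; exact neg_le_abs _
          _ ≤ _ := by gcongr
      have h4 : heatKernel s x * φ x * (∑ r, x r * pd r φ x) * trEnergy G (A t) x
          ≤ k₀ * Φ * (n * Φ) * (e * e) := by
        refine (le_abs_self _).trans ?_
        rw [abs_mul, abs_mul, abs_mul, ← abs_neg (trEnergy _ _ _), hee, abs_of_nonneg hk,
          abs_of_nonneg (mul_nonneg he00 he00)]
        gcongr
      refine (add_le_add h3 h4).trans (le_of_eq ?_)
      ring
  have hw : weight φ s x = heatKernel s x * φ x ^ 2 := rfl
  have hw0 : 0 ≤ weight φ s x := by rw [hw]; positivity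
  have hφ2 : φ x ^ 2 ≤ Φ ^ 2 := by rw [← sq_abs]; exact pow_le_pow_left₀ (abs_nonneg _) hφ 2
  -- Where `|x|²` exceeds a multiple of `s |log s|`, the heat kernel is bounded.
  have hxw : ‖x‖ ^ 2 * weight φ s x ≤ 2 * n * s * |Real.log s| * weight φ s x + Φ ^ 2 := by
    have h1 := mul_le_mul_of_nonneg_right (norm_sq_mul_heatKernel_le hs hx1) (sq_nonneg (φ x))
    rw [hw]
    linarith
  have hQ : -(weight φ s x * stressError G (A t) x)
      ≤ S * ((2 * n * s * |Real.log s| * weight φ s x + Φ ^ 2) * (e * e))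
        + S * (weight φ s x * (‖x‖ * e)) := by
    rw [← mul_neg]
    calc weight φ s x * -stressError G (A t) x
        ≤ weight φ s x * (S * (‖x‖ ^ 2 * (e * e) + ‖x‖ * e)) := by
          gcongr; exact (neg_le_abs _).trans hstr
      _ = S * (‖x‖ ^ 2 * weight φ s x * (e * e)) + S * (weight φ s x * (‖x‖ * e)) := by ring
      _ ≤ _ := by gcongr
  have hfirst : 2 * s * heatKernel s x *
      (selfSimilarDefect G φ A s t x * selfSimilarDefect G φ A s t x).trace ≤ 0 :=
    mul_nonpos_of_nonneg_of_nonpos (by positivity) hdef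
  obtain ⟨c₄, hc₄⟩ : ∃ c₄, c₄ = 2 * 4 * k₀ * (n * (d * d)) + k₀ * Φ * (n * Φ) := ⟨_, rfl⟩
  have hc₄0 : 0 ≤ c₄ := by rw [hc₄]; positivity
  rw [← hc₄] at hcut ⊢
  obtain ⟨D, hD⟩ : ∃ D, D = |Real.log s| * (weight φ s x * (s * (e * e))) := ⟨_, rfl⟩
  obtain ⟨H, hH⟩ : ∃ H, H = weight φ s x * (‖x‖ * e) := ⟨_, rfl⟩
  have hD0 : 0 ≤ D := by rw [hD]; positivity
  have hH0 : 0 ≤ H := by rw [hH]; positivity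
  have hQ' : -(weight φ s x * stressError G (A t) x)
      ≤ 2 * n * S * D + S * Φ ^ 2 * (e * e) + S * H := by
    refine hQ.trans (le_of_eq ?_)
    rw [hD, hH]
    ring
  have hsplit : evolutionError G φ A s t x = 2 * s * heatKernel s x *
      (selfSimilarDefect G φ A s t x * selfSimilarDefect G φ A s t x).trace
      + (-(2 * s * heatKernel s x * (gradCov G φ (A t) x * gradCov G φ (A t) x).trace)
        + heatKernel s x * φ x * (∑ r, x r * pd r φ x) * trEnergy G (A t) x)
      + -(weight φ s x * stressError G (A t) x) := by
    rw [evolutionError]; ring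
  rw [hsplit, mul_assoc (_ + S) |Real.log s|, ← hD, ← hH]
  have p1 : 0 ≤ c₄ * D + S * Φ ^ 2 * D + S * D := by positivity
  have p2 : 0 ≤ c₄ * H + S * Φ ^ 2 * H + 2 * n * S * H := by positivity
  have p3 : 0 ≤ 2 * n * S * (e * e) + S * (e * e) := by positivity
  linarith

end ErrorBounds

/-! ### The differential inequality for the localized energy -/

section LocalEnergy

variable {n : ℕ} {T T₀ t : ℝ} {U S : Set (E n)} {G : E n → Mat n} {A : ℝ → E n → Mat n}
  {φ : E n → ℝ} {x : E n}

theorem setIntegral_divDensity_eq_zero (hU : IsOpen U) (hS : IsCompact S) (hSU : S ⊆ U)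
    (hG : ∀ x ∈ U, IsMetricAt G x) {η : Fin n → E n → ℝ}
    (hη : ∀ q, ∀ x ∈ U, ContDiffAt ℝ ∞ (η q) x) (h0 : ∀ q, ∀ x ∈ U, x ∉ S → η q x = 0) :
    IntegrableOn (divDensity G η) U ∧ ∫ x in U, divDensity G η x = 0 := by
  have h1 := fun p => setIntegral_pd_eq_zero (p := p) hU hS hSU
    (F := fun z => ∑ q, vol G z * (G z)⁻¹ p q * η q z)
    (fun x hx => ContDiffAt.sum fun q _ => ((hG x hx).smooth_vol.mul
      ((hG x hx).smooth_inv.matrix_entry p q)).mul (hη q x hx))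
    (fun x hx hxS => Finset.sum_eq_zero fun q _ => by rw [h0 q x hx hxS, mul_zero])
  refine ⟨integrable_finsetSum _ fun p _ => (h1 p).1, ?_⟩
  simp only [divDensity]
  rw [integral_finsetSum _ fun p _ => (h1 p).1]
  exact Finset.sum_eq_zero fun p _ => (h1 p).2

theorem IsCompatibleFlow.isSmoothFlow_localDensity (h : IsCompatibleFlow T U G A) (hT : T₀ ≤ T)
    (hφ : ContDiff ℝ ∞ φ) : IsSmoothFlow T₀ U (localDensity G φ A T₀) := by
  have hE : IsSmoothFlow T₀ U fun t => trEnergy G (A t) :=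
    ContDiffOn.mono (h.smooth.trEnergy h.isOpen h.metric)
      (prod_mono (Ico_subset_Ico_right hT) le_rfl)
  have hk : IsSmoothFlow T₀ U fun t => heatKernel (T₀ - t) := fun q hq =>
    (ContDiffAt.comp q (g := fun q : ℝ × E n => heatKernel q.1 q.2)
      (f := fun q : ℝ × E n => (T₀ - q.1, q.2))
      (contDiffAt_heatKernel (q := (T₀ - q.1, q.2)) (sub_pos.2 hq.1.2))
      ((contDiffAt_const.sub contDiffAt_fst).prodMk contDiffAt_snd)).contDiffWithinAt
  have hs : IsSmoothFlow T₀ U fun t (_ : E n) => T₀ - t :=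
    (contDiff_const.sub contDiff_fst).contDiffOn
  exact ContDiffOn.mul (isSmoothFlow_static fun x hx => (h.metric x hx).smooth_vol)
    ((ContDiffOn.mul hk (isSmoothFlow_static (f := fun x => φ x ^ 2)
      fun x _ => hφ.contDiffAt.pow 2)).mul (ContDiffOn.mul hs (ContDiffOn.neg hE)))

theorem integrableOn_combination {f₁ f₂ f₃ : E n → ℝ} (h₁ : IntegrableOn f₁ U ∧ ∫ x in U, f₁ x = 0)
    (h₂ : IntegrableOn f₂ U ∧ ∫ x in U, f₂ x = 0) (h₃ : IntegrableOn f₃ U ∧ ∫ x in U, f₃ x = 0)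
    (a b : ℝ) : IntegrableOn (fun x => a * f₁ x + (f₂ x - b * f₃ x)) U ∧
      ∫ x in U, (a * f₁ x + (f₂ x - b * f₃ x)) = 0 := by
  have i1 : IntegrableOn (fun x => a * f₁ x) U := h₁.1.const_mul a
  have i3 : IntegrableOn (fun x => b * f₃ x) U := h₃.1.const_mul b
  have i2 : IntegrableOn (fun x => f₂ x - b * f₃ x) U := h₂.1.sub i3
  refine ⟨i1.add i2, ?_⟩
  rw [integral_add i1 i2, integral_sub h₂.1 i3, integral_const_mul, integral_const_mul, h₁.2, h₂.2,
    h₃.2]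
  ring

/-- The localized energy at time `t`, multiplied by the backward time `τ = T₀ - t`. -/
def localEnergy (U : Set (E n)) (G : E n → Mat n) (φ : E n → ℝ) (A : ℝ → E n → Mat n)
    (T₀ t : ℝ) : ℝ := ∫ x in U, localDensity G φ A T₀ t x

/-- The evolution of the localized energy: the divergence terms of `dt_localDensity` integrate to
zero, because the cutoff has compact support. -/
theorem IsCompatibleFlow.hasDerivAt_localEnergy (h : IsCompatibleFlow T U G A) (hT : T₀ ≤ T)
    (hgauss : ∀ x ∈ U, (G x).mulVec x.ofLp = x.ofLp) (hφ : ContDiff ℝ ∞ φ)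
    (hφc : IsCompact (tsupport φ)) (hφU : tsupport φ ⊆ U) :
    ContinuousOn (localEnergy U G φ A T₀) (Ico 0 T₀) ∧ ∀ t ∈ Ioo 0 T₀,
      IntegrableOn (localDensity G φ A T₀ t) U ∧
      IntegrableOn (fun x => vol G x * evolutionError G φ A (T₀ - t) t x) U ∧
      HasDerivAt (localEnergy U G φ A T₀)
        (∫ x in U, vol G x * evolutionError G φ A (T₀ - t) t x) t := by
  have hφ0 : ∀ x, x ∉ tsupport φ → φ x = 0 := fun x hx => image_eq_zero_of_notMem_tsupport hx
  obtain ⟨h1, h2⟩ := (h.isSmoothFlow_localDensity hT hφ).hasDerivAt_integral h.isOpen hφc hφU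
    fun t _ x _ hx => by simp [localDensity, weight, hφ0 x hx]
  refine ⟨h1, fun t ht => ?_⟩
  obtain ⟨h3, h4, h5⟩ := h2 t ht
  have htT : t ∈ Ioo 0 T := ⟨ht.1, ht.2.trans_le hT⟩
  have htI := Ioo_subset_Ico_self htT
  have hs : 0 < T₀ - t := sub_pos.2 ht.2
  have hw0 : ∀ x, x ∉ tsupport φ → weight φ (T₀ - t) x = 0 := fun x hx => by
    simp [weight, hφ0 x hx]
  have hws : ∀ x, ContDiffAt ℝ ∞ (weight φ (T₀ - t)) x := fun x => contDiffAt_weight hs hφ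
  have hX : ∀ x ∈ U, ContDiffAt ℝ ∞ (radialCov G (A t)) x := fun x hx =>
    ContDiffAt.sum fun r _ => ((EuclideanSpace.proj r : E n →L[ℝ] ℝ).contDiff.contDiffAt).smul
      ((h.contDiffAt htI hx).cov (h.metric x hx) r)
  have d1 := setIntegral_divDensity_eq_zero h.isOpen hφc hφU h.metric
    (η := fun q z => (T₀ - t) * weight φ (T₀ - t) z * (dt A t z * cov G q (A t) z).trace)
    (fun q x hx => (contDiffAt_const.mul (hws x)).mul ((h.smooth.contDiffAt_dt_slice h.isOpen htT
      hx).mul ((h.contDiffAt htI hx).cov (h.metric x hx) q)).matrix_trace)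
    (fun q x _ hx => by rw [hw0 x hx]; ring)
  have d2 := setIntegral_divDensity_eq_zero h.isOpen hφc hφU h.metric
    (η := fun q z => weight φ (T₀ - t) z * (cov G q (A t) z * radialCov G (A t) z).trace)
    (fun q x hx => (hws x).mul (((h.contDiffAt htI hx).cov (h.metric x hx) q).mul
      (hX x hx)).matrix_trace)
    (fun q x _ hx => by rw [hw0 x hx]; ring)
  have d3 := fun r => setIntegral_pd_eq_zero (p := r) h.isOpen hφc hφU
    (F := fun z => vol G z * (weight φ (T₀ - t) z * (z r * trEnergy G (A t) z)))
    (fun x hx => (h.metric x hx).smooth_vol.mul ((hws x).mul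
      (((EuclideanSpace.proj r : E n →L[ℝ] ℝ).contDiff.contDiffAt).mul
        (smooth_trEnergy (h.metric x hx) (h.contDiffAt htI hx)))))
    (fun x _ hx => by rw [hw0 x hx]; ring)
  have d3i : IntegrableOn (fun x => ∑ r, pd r (fun z => vol G z * (weight φ (T₀ - t) z *
      (z r * trEnergy G (A t) z))) x) U := integrable_finsetSum _ fun r _ => (d3 r).1
  have d3z : ∫ x in U, (∑ r, pd r (fun z => vol G z * (weight φ (T₀ - t) z *
      (z r * trEnergy G (A t) z))) x) = 0 := by
    rw [integral_finsetSum _ fun r _ => (d3 r).1]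
    exact Finset.sum_eq_zero fun r _ => (d3 r).2
  set D : E n → ℝ := fun x => -2 * divDensity G (fun q z => (T₀ - t) * weight φ (T₀ - t) z *
            (dt A t z * cov G q (A t) z).trace) x
        + (divDensity G (fun q z => weight φ (T₀ - t) z *
              (cov G q (A t) z * radialCov G (A t) z).trace) x
          - (1 / 2) * ∑ r, pd r (fun z => vol G z * (weight φ (T₀ - t) z *
              (z r * trEnergy G (A t) z))) x) with hD
  obtain ⟨hDi, hDz⟩ : IntegrableOn D U ∧ ∫ x in U, D x = 0 :=
    integrableOn_combination d1 d2 ⟨d3i, d3z⟩ (-2) (1 / 2)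
  have hid : ∀ x ∈ U, dt (localDensity G φ A T₀) t x
      = D x + vol G x * evolutionError G φ A (T₀ - t) t x := fun x hx =>
    h.dt_localDensity htT ht.2 hx (hgauss x hx) hφ
  have hint : IntegrableOn (fun x => vol G x * evolutionError G φ A (T₀ - t) t x) U :=
    (integrableOn_congr_fun (fun x hx => by simp [hid x hx]) h.isOpen.measurableSet).1 (h4.sub hDi)
  refine ⟨h3, hint, h5.congr_deriv ?_⟩
  rw [setIntegral_congr_fun h.isOpen.measurableSet hid, integral_add hDi hint, hDz, zero_add]

end LocalEnergy

section Inequality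

variable {n : ℕ}

theorem integral_gaussian {s : ℝ} (hs : 0 < s) :
    ∫ x : E n, 1 / (4 * Real.pi * s) ^ ((n : ℝ) / 2) * Real.exp (-(1 / (8 * s)) * ‖x‖ ^ 2)
      = 2 ^ ((n : ℝ) / 2) := by
  have hpi := Real.pi_pos
  have e : (Real.pi / (1 / (8 * s))) ^ ((n : ℝ) / 2)
      = 2 ^ ((n : ℝ) / 2) * (4 * Real.pi * s) ^ ((n : ℝ) / 2) := by
    rw [← Real.mul_rpow (by positivity) (by positivity)]
    congr 1
    field_simp
    norm_num
  rw [integral_const_mul, GaussianFourier.integral_rexp_neg_mul_sq_norm (by positivity),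
    finrank_euclideanSpace_fin, e]
  have : (4 * Real.pi * s) ^ ((n : ℝ) / 2) ≠ 0 := by positivity
  rw [one_div, mul_left_comm, inv_mul_cancel₀ this, mul_one]

theorem integrable_gaussian {s : ℝ} (hs : 0 < s) : Integrable fun x : E n =>
    1 / (4 * Real.pi * s) ^ ((n : ℝ) / 2) * Real.exp (-(1 / (8 * s)) * ‖x‖ ^ 2) := by
  refine Integrable.of_integral_ne_zero ?_
  rw [integral_gaussian hs]
  positivity

theorem norm_sq_div_mul_heatKernel_le {s : ℝ} (hs : 0 < s) (x : E n) :
    ‖x‖ ^ 2 / s * heatKernel s x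
      ≤ 8 * (1 / (4 * Real.pi * s) ^ ((n : ℝ) / 2) * Real.exp (-(1 / (8 * s)) * ‖x‖ ^ 2)) := by
  have hpi := Real.pi_pos
  have h1 : ‖x‖ ^ 2 / (8 * s) ≤ Real.exp (‖x‖ ^ 2 / (8 * s)) :=
    (by linarith [Real.add_one_le_exp (‖x‖ ^ 2 / (8 * s))])
  have h2 : Real.exp (-‖x‖ ^ 2 / (4 * s))
      = Real.exp (-(1 / (8 * s)) * ‖x‖ ^ 2) * (Real.exp (‖x‖ ^ 2 / (8 * s)))⁻¹ := by
    rw [← Real.exp_neg, ← Real.exp_add]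
    congr 1
    field_simp
    ring
  have h3 : ‖x‖ ^ 2 / s = 8 * (‖x‖ ^ 2 / (8 * s)) := by field_simp
  rw [heatKernel, h2, h3]
  have h4 := Real.exp_pos (‖x‖ ^ 2 / (8 * s))
  have h5 : ‖x‖ ^ 2 / (8 * s) * (Real.exp (‖x‖ ^ 2 / (8 * s)))⁻¹ ≤ 1 := by
    rw [← div_eq_mul_inv]; exact div_le_one_of_le₀ h1 h4.le
  have h6 : 0 ≤ 8 * (1 / (4 * Real.pi * s) ^ ((n : ℝ) / 2)
    * Real.exp (-(1 / (8 * s)) * ‖x‖ ^ 2)) := by positivity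
  calc _ = 8 * (1 / (4 * Real.pi * s) ^ ((n : ℝ) / 2) * Real.exp (-(1 / (8 * s)) * ‖x‖ ^ 2))
        * (‖x‖ ^ 2 / (8 * s) * (Real.exp (‖x‖ ^ 2 / (8 * s)))⁻¹) := by ring
    _ ≤ _ := mul_le_of_le_one_right h6 h5

/-- The data of the local analysis: a compatible solution in normal coordinates with uniformly
controlled metric, cutoff and energy. -/
structure IsControlledFlow (K Φ E₀ T : ℝ) (G : E n → Mat n) (φ : E n → ℝ)
    (A : ℝ → E n → Mat n) : Prop where
  bounded : HasBoundedGeometry G K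
  radial : IsRadialMetric G 1
  flow : IsCompatibleFlow T (Metric.ball 0 1) G A
  smooth_cutoff : ContDiff ℝ ∞ φ
  tsupport_subset : tsupport φ ⊆ Metric.ball 0 1
  cutoff_le : ∀ x ∈ Metric.ball (0 : E n) 1, |φ x| ≤ Φ
  pd_cutoff_le : ∀ x ∈ Metric.ball (0 : E n) 1, ∀ p, |pd p φ x| ≤ Φ
  pd_cutoff_eq_zero : ∀ x : E n, ‖x‖ < 1 / 2 → ∀ p, pd p φ x = 0
  integrable : ∀ t ∈ Ico 0 T,
    IntegrableOn (fun x => vol G x * -trEnergy G (A t) x) (Metric.ball 0 1)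
  energy_le : ∀ t ∈ Ico 0 T,
    ∫ x in Metric.ball 0 1, vol G x * -trEnergy G (A t) x ≤ E₀

theorem IsControlledFlow.isCompact {K Φ E₀ T : ℝ} {G : E n → Mat n} {φ : E n → ℝ}
    {A : ℝ → E n → Mat n} (h : IsControlledFlow K Φ E₀ T G φ A) : IsCompact (tsupport φ) :=
  (isCompact_closedBall (0 : E n) 1).of_isClosed_subset (isClosed_tsupport φ)
    (h.tsupport_subset.trans Metric.ball_subset_closedBall)

theorem IsControlledFlow.localDensity_nonneg {K Φ E₀ T T₀ t : ℝ} {G : E n → Mat n} {φ : E n → ℝ}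
    {A : ℝ → E n → Mat n} (h : IsControlledFlow K Φ E₀ T G φ A) (ht : t ∈ Ico 0 T) (htT : t < T₀)
    {x : E n} (hx : x ∈ Metric.ball (0 : E n) 1) : 0 ≤ localDensity G φ A T₀ t x := by
  have h1 := h.flow.trEnergy_nonpos ht hx
  have h2 := (heatKernel_pos (sub_pos.2 htT) x).le
  have h3 : 0 ≤ vol G x := (h.flow.metric x hx).vol_pos.le
  have h4 : 0 ≤ T₀ - t := by linarith
  have h5 : 0 ≤ -trEnergy G (A t) x := by linarith
  rw [localDensity, weight]
  positivity

/-- A pointwise bound for the term of first order in `|∇A|` yields a differential inequality. -/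
theorem exists_deriv_localEnergy_le (n : ℕ) {K Φ : ℝ} (hK : 0 ≤ K) (hΦ : 0 ≤ Φ) : ∃ C, 0 ≤ C ∧
    ∀ (E₀ T T₀ t : ℝ) (G : E n → Mat n) (φ : E n → ℝ) (A : ℝ → E n → Mat n),
      IsControlledFlow K Φ E₀ T G φ A → T₀ ≤ T → t ∈ Ioo 0 T₀ → T₀ - t ≤ 4 →
      ∀ (a b c : ℝ) (χ : E n → ℝ), 0 ≤ b → IntegrableOn χ (Metric.ball 0 1) →
      (∀ x ∈ Metric.ball (0 : E n) 1,
        vol G x * (weight φ (T₀ - t) x * (‖x‖ * Real.sqrt (-trEnergy G (A t) x)))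
          ≤ a * localDensity G φ A T₀ t x + b * (vol G x * -trEnergy G (A t) x) + c * χ x) →
      deriv (localEnergy (Metric.ball 0 1) G φ A T₀) t
        ≤ C * (|Real.log (T₀ - t)| + a) * localEnergy (Metric.ball 0 1) G φ A T₀ t
          + C * ((1 + b) * E₀ + c * ∫ x in Metric.ball 0 1, χ x) := by
  obtain ⟨C, hC0, hC⟩ := exists_evolutionError_le n hK hΦ
  refine ⟨C, hC0, fun E₀ T T₀ t G φ A h hT ht hs4 a b c χ hb hχ hpt => ?_⟩
  have htT : t ∈ Ioo 0 T := ⟨ht.1, ht.2.trans_le hT⟩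
  have htI := Ioo_subset_Ico_self htT
  obtain ⟨i1, i2, hd⟩ := (h.flow.hasDerivAt_localEnergy hT (fun x hx => h.radial.gauss hx)
    h.smooth_cutoff h.isCompact h.tsupport_subset).2 t ht
  have i3 := h.integrable t htI
  rw [hd.deriv]
  have hpt' : ∀ x ∈ Metric.ball (0 : E n) 1, vol G x * evolutionError G φ A (T₀ - t) t x
      ≤ C * (|Real.log (T₀ - t)| + a) * localDensity G φ A T₀ t x
        + (C * (1 + b) * (vol G x * -trEnergy G (A t) x) + C * c * χ x) := fun x hx => by
    have h1 := hC G A φ T t (T₀ - t) x h.bounded h.radial h.flow htT (sub_pos.2 ht.2) hs4 hx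
      (h.cutoff_le x hx) (h.pd_cutoff_le x hx) (h.pd_cutoff_eq_zero x)
    have h2 := mul_le_mul_of_nonneg_left h1 (h.flow.metric x hx).vol_pos.le
    have h3 := mul_le_mul_of_nonneg_left (hpt x hx) hC0
    refine h2.trans ?_
    rw [localDensity] at h3 ⊢
    linarith
  have hmono := setIntegral_mono_on i2 ((i1.const_mul (C * (|Real.log (T₀ - t)| + a))).add
    ((i3.const_mul (C * (1 + b))).add (hχ.const_mul (C * c)))) measurableSet_ball hpt'
  refine hmono.trans ?_
  have e1 : IntegrableOn (fun x => C * (1 + b) * (vol G x * -trEnergy G (A t) x) + C * c * χ x)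
    (Metric.ball 0 1) := (i3.const_mul (C * (1 + b))).add (hχ.const_mul (C * c))
  simp only [Pi.add_apply]
  rw [integral_add (i1.const_mul _) e1, integral_add (i3.const_mul _) (hχ.const_mul _),
    integral_const_mul, integral_const_mul, integral_const_mul]
  have h4 := mul_le_mul_of_nonneg_left (h.energy_le t htI)
    (mul_nonneg hC0 (by linarith : 0 ≤ 1 + b))
  rw [localEnergy]
  linarith

end Inequality

/-! ### The differential inequality at a fixed scale -/

section Scales

variable {n : ℕ}

theorem abs_log_mul_le {R σ : ℝ} (hR : 0 < R) (hσ : 1 ≤ σ) (hσ4 : σ ≤ 4) :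
    |Real.log (R ^ 2 * σ)| ≤ 4 * (1 + 4 * Real.log R ^ 2) := by
  have h0 : 0 < σ := by linarith
  rw [Real.log_mul (by positivity) h0.ne', Real.log_pow]
  have h1 := Real.log_nonneg hσ
  have h2 := Real.log_le_sub_one_of_pos h0
  have h3 := sq_nonneg (Real.log R - 1)
  have h4 := sq_nonneg (Real.log R + 1)
  push_cast
  rw [abs_le]
  constructor <;> nlinarith [sq_nonneg (Real.log R)]

theorem heatKernel_le_rpow {s N : ℝ} (hs : 0 < s) (hN : 0 ≤ N) (h : 1 ≤ s * N) (x : E n) :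
    heatKernel s x ≤ N ^ ((n : ℝ) / 2) := by
  have hpi := Real.pi_gt_three
  refine (heatKernel_le hs x).trans ?_
  rw [div_le_iff₀ (by positivity), ← Real.mul_rpow hN (by positivity)]
  refine Real.one_le_rpow (h.trans ?_) (by positivity)
  calc s * N = N * (1 * s) := by ring
    _ ≤ N * (4 * Real.pi * s) := by gcongr; linarith

set_option maxHeartbeats 1000000 in
/-- The localized energy satisfies a differential inequality at the scale `R`. Below the scale
`N^{-1/2}` the term of first order in `|∇A|` is absorbed by Young's inequality with a weight growing
like `log² R`; above that scale the heat kernel is at most `N^{n/2}`. -/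
theorem exists_deriv_localEnergy_le_scale (n : ℕ) {K Φ : ℝ} (hK : 0 ≤ K) (hΦ : 0 ≤ Φ) :
    ∃ C, 0 ≤ C ∧
    ∀ (E₀ T T₀ : ℝ) (G : E n → Mat n) (φ : E n → ℝ) (A : ℝ → E n → Mat n),
      IsControlledFlow K Φ E₀ T G φ A → T₀ ≤ T → 0 ≤ E₀ →
      ∀ R σ N : ℝ, 0 < R → R ≤ 1 → 1 ≤ σ → σ ≤ 4 → 1 < N → R ^ 2 * σ < T₀ →
      deriv (localEnergy (Metric.ball 0 1) G φ A T₀) (T₀ - R ^ 2 * σ)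
        ≤ C * (1 + 4 * Real.log R ^ 2)
            * localEnergy (Metric.ball 0 1) G φ A T₀ (T₀ - R ^ 2 * σ)
          + C * (N ^ ((n : ℝ) / 2) * (E₀ + Real.sqrt E₀) + 1 / Real.log N ^ 2) := by
  obtain ⟨C, hC0, hC⟩ := exists_deriv_localEnergy_le n hK hΦ
  obtain ⟨V, hV⟩ : ∃ V : ℝ, V = Real.sqrt (n.factorial * K ^ n) := ⟨_, rfl⟩
  have hV0 : 0 ≤ V := by rw [hV]; positivity
  obtain ⟨B, hB⟩ : ∃ B : ℝ, B = ∫ _x in Metric.ball (0 : E n) 1, (1 : ℝ) := ⟨_, rfl⟩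
  have hB0 : 0 ≤ B := by rw [hB]; exact integral_nonneg fun _ => zero_le_one
  obtain ⟨γ, hγ⟩ : ∃ γ : ℝ, γ = 2 ^ ((n : ℝ) / 2) := ⟨_, rfl⟩
  have hγ0 : 0 ≤ γ := by rw [hγ]; positivity
  refine ⟨C * (5 + 4 * V * Φ ^ 2 * γ + Φ ^ 2 + Φ ^ 2 * V * B), by positivity,
    fun E₀ T T₀ G φ A h hT hE₀ R σ N hR hR1 hσ hσ4 hN hlt => ?_⟩
  obtain ⟨s, hs⟩ : ∃ s, s = R ^ 2 * σ := ⟨_, rfl⟩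
  have hlog : |Real.log s| ≤ 4 * (1 + 4 * Real.log R ^ 2) := by
    rw [hs]; exact abs_log_mul_le hR hσ hσ4
  have hRs : R ^ 2 ≤ s := by rw [hs]; exact le_mul_of_one_le_right (by positivity) hσ
  have hs0 : 0 < s := lt_of_lt_of_le (by positivity) hRs
  have hs4 : s ≤ 4 := by
    rw [hs]
    calc R ^ 2 * σ ≤ 1 * 4 := mul_le_mul (pow_le_one₀ hR.le hR1) hσ4 (by linarith) zero_le_one
      _ = 4 := one_mul 4
  rw [← hs] at hlt ⊢
  obtain ⟨t, ht⟩ : ∃ t, t = T₀ - s := ⟨_, rfl⟩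
  have hst : T₀ - t = s := by rw [ht]; ring
  have ht0 : t ∈ Ioo 0 T₀ := ⟨by linarith, by linarith⟩
  have htI : t ∈ Ico 0 T := ⟨ht0.1.le, ht0.2.trans_le hT⟩
  rw [← ht]
  have hmain := hC E₀ T T₀ t G φ A h hT ht0 (hst.le.trans hs4)
  simp only [hst] at hmain
  have hZ0 : 0 ≤ localEnergy (Metric.ball 0 1) G φ A T₀ t :=
    setIntegral_nonneg measurableSet_ball fun x hx => h.localDensity_nonneg htI ht0.2 hx
  obtain ⟨Z, hZ⟩ : ∃ Z, Z = localEnergy (Metric.ball 0 1) G φ A T₀ t := ⟨_, rfl⟩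
  obtain ⟨L, hL⟩ : ∃ L, L = 1 + 4 * Real.log R ^ 2 := ⟨_, rfl⟩
  obtain ⟨M, hM⟩ : ∃ M, M = N ^ ((n : ℝ) / 2) := ⟨_, rfl⟩
  have hM1 : 1 ≤ M := by rw [hM]; exact Real.one_le_rpow hN.le (by positivity)
  have hL1 : 1 ≤ L := by rw [hL]; nlinarith [sq_nonneg (Real.log R)]
  have hlogN : 0 < Real.log N := Real.log_pos hN
  rw [← hZ] at hmain hZ0 ⊢
  rw [← hL] at hlog ⊢
  rw [← hM]
  obtain ⟨r, hr⟩ : ∃ r, r = Real.sqrt E₀ := ⟨_, rfl⟩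
  have hr0 : 0 ≤ r := by rw [hr]; positivity
  have hrr : E₀ = r * r := by rw [hr, Real.mul_self_sqrt hE₀]
  rw [← hr]
  have hvol : ∀ x ∈ Metric.ball (0 : E n) 1, 0 ≤ vol G x ∧ vol G x ≤ V := fun x hx =>
    ⟨(h.flow.metric x hx).vol_pos.le, by rw [hV]; exact h.bounded.vol_le hx⟩
  have he : ∀ x ∈ Metric.ball (0 : E n) 1, 0 ≤ -trEnergy G (A t) x := fun x hx => by
    linarith [h.flow.trEnergy_nonpos htI hx]
  have hφ2 : ∀ x ∈ Metric.ball (0 : E n) 1, φ x ^ 2 ≤ Φ ^ 2 := fun x hx => by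
    rw [← sq_abs]; exact pow_le_pow_left₀ (abs_nonneg _) (h.cutoff_le x hx) 2
  have hCL : C * |Real.log s| * Z ≤ C * (4 * L) * Z := by gcongr
  have hE0M : E₀ ≤ M * (E₀ + r) := by nlinarith
  have hP0 : 0 ≤ M * (E₀ + r) := by positivity
  have hN0 : 0 ≤ 1 / Real.log N ^ 2 := by positivity
  -- Below the scale `N^{-1/2}` one has `2 |log R| > log N`, so that `1 / L ≤ 1 / log² N`.
  rcases lt_or_ge (R ^ 2 * N) 1 with hlow | hhigh
  · have hlogs : Real.log N ^ 2 ≤ L := by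
      have h1 : Real.log (R ^ 2 * N) < 0 := Real.log_neg (by positivity) hlow
      rw [Real.log_mul (by positivity) (by linarith), Real.log_pow] at h1
      push_cast at h1
      rw [hL]
      nlinarith
    have hLL : 1 / L ≤ 1 / Real.log N ^ 2 := one_div_le_one_div_of_le (by positivity) hlogs
    have hL0 : 0 < L := by linarith
    have key := hmain (L / 2) 0 (4 * V * Φ ^ 2 / L)
      (fun x => 1 / (4 * Real.pi * s) ^ ((n : ℝ) / 2) * Real.exp (-(1 / (8 * s)) * ‖x‖ ^ 2))
      le_rfl (integrable_gaussian hs0).integrableOn (fun x hx => by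
        obtain ⟨hv0, hv1⟩ := hvol x hx
        have hk := norm_sq_div_mul_heatKernel_le hs0 x
        obtain ⟨χ, hχ⟩ : ∃ χ, χ = 1 / (4 * Real.pi * s) ^ ((n : ℝ) / 2) *
          Real.exp (-(1 / (8 * s)) * ‖x‖ ^ 2) := ⟨_, rfl⟩
        have hχ0 : 0 ≤ χ := by rw [hχ]; have := Real.pi_pos; positivity
        rw [← hχ] at hk ⊢
        have hw0 : 0 ≤ weight φ s x := by
          have := (heatKernel_pos hs0 x).le
          rw [weight]; positivity
        have hwx : weight φ s x * (‖x‖ ^ 2 / s) ≤ 8 * χ * Φ ^ 2 := by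
          calc weight φ s x * (‖x‖ ^ 2 / s) = ‖x‖ ^ 2 / s * heatKernel s x * φ x ^ 2 := by
                rw [weight]; ring
            _ ≤ 8 * χ * Φ ^ 2 := mul_le_mul hk (hφ2 x hx) (sq_nonneg _) (by positivity)
        obtain ⟨ε, hε⟩ : ∃ ε, ε = Real.sqrt (-trEnergy G (A t) x) := ⟨_, rfl⟩
        have hεε : -trEnergy G (A t) x = ε * ε := by rw [hε, Real.mul_self_sqrt (he x hx)]
        rw [localDensity, hst, ← hε, hεε]
        -- Young's inequality with weight `L s`
        have hy : ‖x‖ * ε ≤ L / 2 * (s * (ε * ε)) + ‖x‖ ^ 2 / s / (2 * L) := by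
          have h1 := sq_nonneg (L * s * ε - ‖x‖)
          have h2 : L / 2 * (s * (ε * ε)) + ‖x‖ ^ 2 / s / (2 * L) - ‖x‖ * ε
              = (L * s * ε - ‖x‖) ^ 2 / (2 * L * s) := by
            field_simp
            ring
          have h3 : 0 ≤ (L * s * ε - ‖x‖) ^ 2 / (2 * L * s) := by positivity
          linarith
        calc vol G x * (weight φ s x * (‖x‖ * ε))
            ≤ vol G x * (weight φ s x * (L / 2 * (s * (ε * ε)) + ‖x‖ ^ 2 / s / (2 * L))) := by
              gcongr
          _ = L / 2 * (vol G x * (weight φ s x * (s * (ε * ε))))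
              + vol G x * (weight φ s x * (‖x‖ ^ 2 / s)) / (2 * L) := by ring
          _ ≤ L / 2 * (vol G x * (weight φ s x * (s * (ε * ε))))
              + V * (8 * χ * Φ ^ 2) / (2 * L) := by gcongr
          _ = _ := by
            field_simp
            ring)
    have hint : ∫ x in Metric.ball (0 : E n) 1, 1 / (4 * Real.pi * s) ^ ((n : ℝ) / 2) *
        Real.exp (-(1 / (8 * s)) * ‖x‖ ^ 2) ≤ γ := by
      rw [hγ, ← integral_gaussian (n := n) hs0]
      refine setIntegral_le_integral (integrable_gaussian hs0) (Eventually.of_forall fun x => ?_)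
      have := Real.pi_pos
      simp only [Pi.zero_apply]
      positivity
    refine key.trans ?_
    have h1 : C * ((1 + 0) * E₀ + 4 * V * Φ ^ 2 / L * ∫ x in Metric.ball (0 : E n) 1,
        1 / (4 * Real.pi * s) ^ ((n : ℝ) / 2) * Real.exp (-(1 / (8 * s)) * ‖x‖ ^ 2))
        ≤ C * (M * (E₀ + r) + 4 * V * Φ ^ 2 * γ * (1 / Real.log N ^ 2)) := by
      rw [add_zero, one_mul]
      have h2 : 4 * V * Φ ^ 2 / L * ∫ x in Metric.ball (0 : E n) 1,
          1 / (4 * Real.pi * s) ^ ((n : ℝ) / 2) * Real.exp (-(1 / (8 * s)) * ‖x‖ ^ 2)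
          ≤ 4 * V * Φ ^ 2 * γ * (1 / Real.log N ^ 2) := by
        calc _ ≤ 4 * V * Φ ^ 2 / L * γ := by gcongr
          _ = 4 * V * Φ ^ 2 * γ * (1 / L) := by ring
          _ ≤ _ := by gcongr
      gcongr
    have h3 : 0 ≤ C * (4 * V * Φ ^ 2 * γ + Φ ^ 2 + Φ ^ 2 * V * B) * L * Z := by positivity
    have h4 : 0 ≤ C * (4 + 4 * V * Φ ^ 2 * γ + Φ ^ 2 + Φ ^ 2 * V * B) * (M * (E₀ + r)) := by
      positivity
    have h5 : 0 ≤ C * (5 + Φ ^ 2 + Φ ^ 2 * V * B) * (1 / Real.log N ^ 2) := by positivity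
    have h6 : 0 ≤ C * L * Z := by positivity
    linarith
  -- Above that scale the first order term is at most `N^{n/2} (ε + |∇A|² / ε)` up to a constant,
  -- for every `ε > 0`.
  · have hbound : ∀ ε, 0 < ε → deriv (localEnergy (Metric.ball 0 1) G φ A T₀) t
        ≤ C * (|Real.log s| + 0) * Z
          + C * ((1 + Φ ^ 2 * M / ε) * E₀ + Φ ^ 2 * M * V * ε * B) := fun ε hε => by
      rw [hB]
      refine hmain 0 (Φ ^ 2 * M / ε) (Φ ^ 2 * M * V * ε) (fun _ => 1) (by positivity)
        (integrableOn_const measure_ball_lt_top.ne) (fun x hx => ?_)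
      obtain ⟨hv0, hv1⟩ := hvol x hx
      have hx1 : ‖x‖ ≤ 1 := (mem_ball_zero_iff.1 hx).le
      have hw : weight φ s x ≤ Φ ^ 2 * M := by
        have h1 : heatKernel s x ≤ M := by
          rw [hM]
          exact heatKernel_le_rpow hs0 (by linarith)
            (hhigh.trans (mul_le_mul_of_nonneg_right hRs (by linarith))) x
        rw [weight, mul_comm (Φ ^ 2)]
        exact mul_le_mul h1 (hφ2 x hx) (sq_nonneg _) (by linarith)
      obtain ⟨δ, hδ⟩ : ∃ δ, δ = Real.sqrt (-trEnergy G (A t) x) := ⟨_, rfl⟩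
      have hδδ : -trEnergy G (A t) x = δ * δ := by rw [hδ, Real.mul_self_sqrt (he x hx)]
      have hδ0 : 0 ≤ δ := by rw [hδ]; positivity
      rw [← hδ, hδδ, zero_mul, zero_add]
      have hw0 : 0 ≤ weight φ s x := by
        have := (heatKernel_pos hs0 x).le
        rw [weight]; positivity
      have hy : ‖x‖ * δ ≤ ε + δ * δ / ε := by
        have h1 : ‖x‖ * δ ≤ 1 * δ := by gcongr
        have h2 := sq_nonneg (δ - ε)
        have h3 : ε + δ * δ / ε - δ = ((δ - ε) ^ 2 + δ * ε) / ε := by field_simp; ring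
        have h4 : 0 ≤ ((δ - ε) ^ 2 + δ * ε) / ε := by positivity
        linarith
      calc vol G x * (weight φ s x * (‖x‖ * δ))
          ≤ vol G x * (Φ ^ 2 * M * (ε + δ * δ / ε)) := by gcongr
        _ = Φ ^ 2 * M / ε * (vol G x * (δ * δ)) + Φ ^ 2 * M * vol G x * ε := by
          field_simp
          ring
        _ ≤ Φ ^ 2 * M / ε * (vol G x * (δ * δ)) + Φ ^ 2 * M * V * ε * 1 := by
          rw [mul_one]
          gcongr
    -- Take `ε = √E₀`; if the energy vanishes, let `ε` tend to zero instead.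
    have hfin : deriv (localEnergy (Metric.ball 0 1) G φ A T₀) t ≤ C * |Real.log s| * Z
        + C * (E₀ + Φ ^ 2 * M * r + Φ ^ 2 * M * V * B * r) := by
      rcases hr0.eq_or_lt with h0 | h0
      · rw [← h0] at hrr ⊢
        have hlim : Tendsto (fun ε : ℝ => C * |Real.log s| * Z + C * (Φ ^ 2 * M * V * ε * B))
            (𝓝[>] 0) (𝓝 (C * |Real.log s| * Z + C * (Φ ^ 2 * M * V * 0 * B))) := by
          refine Tendsto.mono_left (Continuous.tendsto ?_ 0) nhdsWithin_le_nhds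
          fun_prop
        have := ge_of_tendsto hlim (b := deriv (localEnergy (Metric.ball 0 1) G φ A T₀) t) (by
          filter_upwards [self_mem_nhdsWithin] with ε hε
          have := hbound ε hε
          rw [hrr] at this
          linarith)
        rw [hrr]
        linarith
      · have h1 := hbound r h0
        have h2 : Φ ^ 2 * M / r * E₀ = Φ ^ 2 * M * r := by
          rw [hrr]; field_simp
        rw [add_zero, add_mul, one_mul, h2] at h1
        linarith
    refine hfin.trans ?_
    have h3 : 0 ≤ C * (1 + 4 * V * Φ ^ 2 * γ + Φ ^ 2 + Φ ^ 2 * V * B) * L * Z := by positivity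
    have h4 : 0 ≤ C * (4 + 4 * V * Φ ^ 2 * γ) * (M * (E₀ + r)) := by positivity
    have h5 : 0 ≤ C * (5 + 4 * V * Φ ^ 2 * γ + Φ ^ 2 + Φ ^ 2 * V * B) * (1 / Real.log N ^ 2) := by
      positivity
    have h6 : C * E₀ ≤ C * (M * (E₀ + r)) := by gcongr
    have h7 : 0 ≤ C * (Φ ^ 2 + Φ ^ 2 * V * B) * (M * E₀) := by positivity
    linarith

end Scales

/-! ### Almost monotonicity in the scale -/

section Gronwall

theorem hasDerivAt_fTilde {R : ℝ} (hR : 0 < R) :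
    HasDerivAt fTilde (-2 * R * (1 + 4 * Real.log R ^ 2)) R := by
  have h1 := Real.hasDerivAt_log hR.ne'
  have h2 : HasDerivAt (fun R : ℝ => R ^ 2) (2 * R) R := by simpa using hasDerivAt_pow 2 R
  have h3 := (((h2.const_mul (-4)).fun_mul (h1.fun_pow 2)).fun_add
    ((h2.const_mul 4).fun_mul h1)).fun_sub (h2.const_mul 3)
  refine h3.congr_deriv ?_
  field_simp
  push_cast
  ring

theorem antitoneOn_fTilde : AntitoneOn fTilde (Ioi 0) := by
  refine antitoneOn_of_deriv_nonpos (convex_Ioi 0)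
    (fun R hR => (hasDerivAt_fTilde hR).continuousAt.continuousWithinAt) ?_ ?_
  · rw [interior_Ioi]
    exact fun R hR => (hasDerivAt_fTilde hR).differentiableAt.differentiableWithinAt
  · rw [interior_Ioi]
    intro R hR
    rw [(hasDerivAt_fTilde hR).deriv]
    have : 0 < R := hR
    have h : 0 ≤ R * (1 + 4 * Real.log R ^ 2) := by positivity
    linarith

theorem fTilde_nonpos {R : ℝ} (hR : 0 < R) (hR1 : R ≤ 1) : fTilde R ≤ 0 := by
  have h1 := Real.log_nonpos hR.le hR1
  have h2 : 0 ≤ R ^ 2 * Real.log R ^ 2 := by positivity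
  have h3 : R ^ 2 * Real.log R ≤ 0 := mul_nonpos_of_nonneg_of_nonpos (sq_nonneg R) h1
  have h4 := sq_nonneg R
  rw [fTilde]
  linarith

theorem neg_three_le_fTilde {R : ℝ} (hR : 0 < R) (hR1 : R ≤ 1) : -3 ≤ fTilde R := by
  have h := antitoneOn_fTilde hR (mem_Ioi.2 zero_lt_one) hR1
  have h1 : fTilde 1 = -3 := by simp [fTilde]
  linarith

/-- Gronwall's inequality for `y' ≥ c f̃' y - b`. -/
theorem gronwall_fTilde {y y' : ℝ → ℝ} {R₁ R₂ c b : ℝ} (h0 : 0 < R₂) (h12 : R₂ ≤ R₁) (h1 : R₁ ≤ 1)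
    (hc : 0 ≤ c) (hb : 0 ≤ b) (hy : ContinuousOn y (Icc R₂ R₁))
    (hd : ∀ R ∈ Ioo R₂ R₁, HasDerivAt y (y' R) R)
    (hineq : ∀ R ∈ Ioo R₂ R₁, c * (-2 * R * (1 + 4 * Real.log R ^ 2)) * y R - b ≤ y' R) :
    y R₂ ≤ Real.exp (c * (fTilde R₂ - fTilde R₁)) * y R₁ + b * Real.exp (3 * c) * (R₁ - R₂) := by
  have hcf : ContinuousOn fTilde (Icc R₂ R₁) := fun R hR =>
    (hasDerivAt_fTilde (h0.trans_le hR.1)).continuousAt.continuousWithinAt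
  have hder : ∀ R ∈ Ioo R₂ R₁, HasDerivAt
      (fun R => Real.exp (-c * fTilde R) * y R + b * Real.exp (3 * c) * R)
      (Real.exp (-c * fTilde R) * (-c * (-2 * R * (1 + 4 * Real.log R ^ 2))) * y R
        + Real.exp (-c * fTilde R) * y' R + b * Real.exp (3 * c)) R := fun R hR => by
    have e1 := (((hasDerivAt_fTilde (h0.trans hR.1)).const_mul (-c)).exp.fun_mul (hd R hR)).fun_add
      ((hasDerivAt_id' R).const_mul (b * Real.exp (3 * c)))
    rwa [mul_one] at e1
  -- The quantity `exp(-c f̃) y + b exp(3c) R` increases, because `-3 ≤ f̃` on `(0, 1]`.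
  have hmono : MonotoneOn (fun R => Real.exp (-c * fTilde R) * y R + b * Real.exp (3 * c) * R)
      (Icc R₂ R₁) := by
    refine monotoneOn_of_deriv_nonneg (convex_Icc _ _) ?_ ?_ ?_
    · exact ((Real.continuous_exp.comp_continuousOn (continuousOn_const.mul hcf)).mul hy).add
        (continuousOn_const.mul continuousOn_id)
    · rw [interior_Icc]
      exact fun R hR => (hder R hR).differentiableAt.differentiableWithinAt
    · rw [interior_Icc]
      intro R hR
      rw [(hder R hR).deriv]
      have hRpos := h0.trans hR.1
      have e2 : Real.exp (-c * fTilde R) ≤ Real.exp (3 * c) :=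
        Real.exp_le_exp.2 (by nlinarith [neg_three_le_fTilde hRpos (hR.2.le.trans h1)])
      have e3 := mul_le_mul_of_nonneg_left (hineq R hR) (Real.exp_pos (-c * fTilde R)).le
      have e4 := mul_le_mul_of_nonneg_left e2 hb
      linarith
  have h2 := hmono (left_mem_Icc.2 h12) (right_mem_Icc.2 h12) h12
  dsimp only at h2
  have e5 : Real.exp (c * fTilde R₂) * Real.exp (-c * fTilde R₂) = 1 := by
    rw [← Real.exp_add]; simp
  have e6 : Real.exp (c * fTilde R₂) * Real.exp (-c * fTilde R₁)
      = Real.exp (c * (fTilde R₂ - fTilde R₁)) := by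
    rw [← Real.exp_add]; congr 1; ring
  have e7 : Real.exp (c * fTilde R₂) ≤ 1 := Real.exp_le_one_iff.2
    (mul_nonpos_of_nonneg_of_nonpos hc (fTilde_nonpos h0 (h12.trans h1)))
  have h3 : Real.exp (-c * fTilde R₂) * y R₂ ≤ Real.exp (-c * fTilde R₁) * y R₁
      + b * Real.exp (3 * c) * (R₁ - R₂) := by linarith
  have h4 := mul_le_mul_of_nonneg_left h3 (Real.exp_pos (c * fTilde R₂)).le
  rw [← mul_assoc, e5, one_mul, mul_add, ← mul_assoc, e6] at h4
  have h5 : 0 ≤ b * Real.exp (3 * c) * (R₁ - R₂) :=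
    mul_nonneg (mul_nonneg hb (Real.exp_pos _).le) (sub_nonneg.2 h12)
  have h6 := mul_le_mul_of_nonneg_right e7 h5
  linarith

/-- The almost monotonicity of `R ↦ Z(T₀ - R² σ) / σ` for each fixed `σ`, integrated over
`1 ≤ σ ≤ 4`. -/
theorem exists_localEnergy_monotone (n : ℕ) {K Φ : ℝ} (hK : 0 ≤ K) (hΦ : 0 ≤ Φ) :
    ∃ C, 0 < C ∧
    ∀ (E₀ T T₀ : ℝ) (G : E n → Mat n) (φ : E n → ℝ) (A : ℝ → E n → Mat n),
      IsControlledFlow K Φ E₀ T G φ A → T₀ ≤ T → 0 ≤ E₀ →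
      ∀ R₁ R₂ N : ℝ, 0 < R₂ → R₂ ≤ R₁ → R₁ ≤ 1 → 4 * R₁ ^ 2 ≤ T₀ → 1 < N →
      (∫ σ in (1 : ℝ)..4, σ⁻¹ * localEnergy (Metric.ball 0 1) G φ A T₀ (T₀ - R₂ ^ 2 * σ))
        ≤ Real.exp (C * (fTilde R₂ - fTilde R₁)) *
            (∫ σ in (1 : ℝ)..4, σ⁻¹ * localEnergy (Metric.ball 0 1) G φ A T₀ (T₀ - R₁ ^ 2 * σ))
          + C * (N ^ ((n : ℝ) / 2) * (E₀ + Real.sqrt E₀) + 1 / Real.log N ^ 2) * (R₁ - R₂) := by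
  obtain ⟨C, hC0, hC⟩ := exists_deriv_localEnergy_le_scale n hK hΦ
  refine ⟨4 * C + 6 * C * Real.exp (3 * (4 * C)) + 1, by positivity,
    fun E₀ T T₀ G φ A h hT hE₀ R₁ R₂ N hR₂ h12 hR₁ h4 hN => ?_⟩
  have hR₁0 := hR₂.trans_le h12
  obtain ⟨hcont, hder⟩ := h.flow.hasDerivAt_localEnergy hT (fun x hx => h.radial.gauss hx)
    h.smooth_cutoff h.isCompact h.tsupport_subset
  obtain ⟨Z, hZ⟩ : ∃ Z, Z = localEnergy (Metric.ball 0 1) G φ A T₀ := ⟨_, rfl⟩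
  have hC' := hC E₀ T T₀ G φ A h hT hE₀
  have hZ0 : ∀ t ∈ Ico 0 T₀, 0 ≤ Z t := fun t ht => by
    rw [hZ]
    exact setIntegral_nonneg measurableSet_ball fun x hx =>
      h.localDensity_nonneg ⟨ht.1, ht.2.trans_le hT⟩ ht.2 hx
  rw [← hZ] at hcont hder hC' ⊢
  obtain ⟨B, hB⟩ : ∃ B, B = N ^ ((n : ℝ) / 2) * (E₀ + Real.sqrt E₀) + 1 / Real.log N ^ 2 :=
    ⟨_, rfl⟩
  have hB0 : 0 ≤ B := by rw [hB]; positivity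
  rw [← hB]
  have hmem : ∀ R ∈ Icc R₂ R₁, ∀ σ ∈ Icc (1 : ℝ) 4, T₀ - R ^ 2 * σ ∈ Ico 0 T₀ :=
    fun R hR σ hσ => by
    have hR0 : 0 < R := hR₂.trans_le hR.1
    have e1 : R ^ 2 * σ ≤ R₁ ^ 2 * 4 :=
      mul_le_mul (pow_le_pow_left₀ hR0.le hR.2 2) hσ.2 (by linarith [hσ.1]) (by positivity)
    have e2 : 0 < R ^ 2 * σ := mul_pos (by positivity) (by linarith [hσ.1])
    exact ⟨by linarith, by linarith⟩
  have hpoint : ∀ σ ∈ Icc (1 : ℝ) 4, σ⁻¹ * Z (T₀ - R₂ ^ 2 * σ)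
      ≤ Real.exp (4 * C * (fTilde R₂ - fTilde R₁)) * (σ⁻¹ * Z (T₀ - R₁ ^ 2 * σ))
        + 2 * C * B * Real.exp (3 * (4 * C)) * (R₁ - R₂) := fun σ hσ => by
    have hσ0 : 0 < σ := by linarith [hσ.1]
    refine gronwall_fTilde (y := fun R => σ⁻¹ * Z (T₀ - R ^ 2 * σ))
      (y' := fun R => -2 * R * deriv Z (T₀ - R ^ 2 * σ)) hR₂ h12 hR₁ (by positivity) (by positivity)
      ?_ ?_ ?_
    · refine continuousOn_const.mul (hcont.comp (f := fun R : ℝ => T₀ - R ^ 2 * σ)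
        (Continuous.continuousOn (by fun_prop)) fun R hR => hmem R hR σ hσ)
    · intro R hR
      have hRp : 0 < R := hR₂.trans hR.1
      have hlt : R ^ 2 * σ < T₀ := by
        have : R ^ 2 < R₁ ^ 2 := pow_lt_pow_left₀ hR.2 hRp.le two_ne_zero
        nlinarith [hσ.2, hσ.1]
      have ht : T₀ - R ^ 2 * σ ∈ Ioo 0 T₀ :=
        ⟨by linarith, (hmem R (Ioo_subset_Icc_self hR) σ hσ).2⟩
      have e1 : HasDerivAt (fun R : ℝ => T₀ - R ^ 2 * σ) (-(2 * R * σ)) R := by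
        have := ((hasDerivAt_pow 2 R).mul_const σ).const_sub T₀
        simpa using this
      have e2 := ((hder _ ht).2.2.differentiableAt.hasDerivAt.comp R e1).const_mul σ⁻¹
      refine e2.congr_deriv ?_
      field_simp
    · intro R hR
      have hRp : 0 < R := hR₂.trans hR.1
      have hRI := Ioo_subset_Icc_self hR
      have hlt : R ^ 2 * σ < T₀ := by
        have : R ^ 2 < R₁ ^ 2 := pow_lt_pow_left₀ hR.2 hRp.le two_ne_zero
        nlinarith [hσ.2, hσ.1]
      have e1 := hC' R σ N hRp (hR.2.le.trans hR₁) hσ.1 hσ.2 hN hlt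
      rw [← hB] at e1
      have e2 := hZ0 _ (hmem R hRI σ hσ)
      obtain ⟨z, hz⟩ : ∃ z, z = Z (T₀ - R ^ 2 * σ) := ⟨_, rfl⟩
      obtain ⟨L, hL⟩ : ∃ L, L = 1 + 4 * Real.log R ^ 2 := ⟨_, rfl⟩
      rw [← hz] at e1 e2
      rw [← hL] at e1
      have hL0 : 0 ≤ L := by rw [hL]; positivity
      rw [← hz, ← hL]
      -- The derivative in `R` of `σ⁻¹ Z(T₀ - R² σ)` has the factor `2R` instead of `2R / σ`,
      -- whence the constant `4 C` in place of `C`.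
      have e3 : 1 ≤ 4 * σ⁻¹ := by
        rw [← div_eq_mul_inv, le_div_iff₀ hσ0]; linarith [hσ.2]
      have e4 := mul_le_mul_of_nonneg_left e1 (by positivity : (0 : ℝ) ≤ 2 * R)
      have e5 : C * L * z * (2 * R) * 1 ≤ C * L * z * (2 * R) * (4 * σ⁻¹) := by gcongr
      have e6 : 2 * C * B * R ≤ 2 * C * B * 1 := by
        gcongr
        exact hR.2.le.trans hR₁
      linarith
  have hi : ∀ R ∈ Icc R₂ R₁, IntervalIntegrable (fun σ => σ⁻¹ * Z (T₀ - R ^ 2 * σ)) volume 1 4 :=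
    fun R hR => by
    refine ContinuousOn.intervalIntegrable ?_
    rw [uIcc_of_le (by norm_num)]
    refine (continuousOn_id.inv₀ fun σ hσ => ?_).mul
      (hcont.comp (f := fun σ : ℝ => T₀ - R ^ 2 * σ) (Continuous.continuousOn (by fun_prop))
        fun σ hσ => hmem R hR σ hσ)
    exact (zero_lt_one.trans_le hσ.1).ne'
  have hi2 := hi R₂ (left_mem_Icc.2 h12)
  have hi1 := hi R₁ (right_mem_Icc.2 h12)
  have hint := intervalIntegral.integral_mono_on (by norm_num) hi2
    ((hi1.const_mul (Real.exp (4 * C * (fTilde R₂ - fTilde R₁)))).add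
      intervalIntegrable_const) hpoint
  rw [intervalIntegral.integral_add (hi1.const_mul _) intervalIntegrable_const,
    intervalIntegral.integral_const_mul, intervalIntegral.integral_const, smul_eq_mul] at hint
  have hI0 : 0 ≤ ∫ σ in (1 : ℝ)..4, σ⁻¹ * Z (T₀ - R₁ ^ 2 * σ) :=
    intervalIntegral.integral_nonneg (by norm_num) fun σ hσ =>
      mul_nonneg (inv_nonneg.2 (by linarith [hσ.1])) (hZ0 _ (hmem R₁ (right_mem_Icc.2 h12) σ hσ))
  refine hint.trans (add_le_add (mul_le_mul_of_nonneg_right (Real.exp_le_exp.2 ?_) hI0) ?_)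
  · refine mul_le_mul_of_nonneg_right ?_ (sub_nonneg.2 (antitoneOn_fTilde hR₂ hR₁0 h12))
    have : 0 ≤ 6 * C * Real.exp (3 * (4 * C)) := by positivity
    linarith
  · have hR : 0 ≤ R₁ - R₂ := sub_nonneg.2 h12
    have : 0 ≤ (4 * C + 1) * B * (R₁ - R₂) := by positivity
    linarith

end Gronwall

/-! ### The localized energy in a normal chart -/

section NormalChart

variable {n : ℕ}

theorem exists_cutoff_bound {φ : E n → ℝ} (hφ : ContDiff ℝ ∞ φ) :
    ∃ Φ, 0 ≤ Φ ∧ ∀ x ∈ Metric.ball (0 : E n) 1, |φ x| ≤ Φ ∧ ∀ p, |pd p φ x| ≤ Φ := by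
  have hK := isCompact_closedBall (0 : E n) 1
  have hc : ∀ p, Continuous (pd p φ) := fun p =>
    (hφ.continuous_fderiv (by simp)).clm_apply continuous_const
  obtain ⟨a, ha⟩ := hK.exists_bound_of_continuousOn hφ.continuous.continuousOn
  choose b hb using fun p => hK.exists_bound_of_continuousOn (hc p).continuousOn
  refine ⟨|a| + ∑ p, |b p|, by positivity, fun x hx => ⟨?_, fun p => ?_⟩⟩
  · have h1 := ha x (Metric.ball_subset_closedBall hx)
    have h2 : 0 ≤ ∑ p, |b p| := by positivity
    rw [Real.norm_eq_abs] at h1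
    linarith [le_abs_self a]
  · have h1 := hb p x (Metric.ball_subset_closedBall hx)
    have h2 := Finset.single_le_sum (f := fun p => |b p|) (fun i _ => abs_nonneg _)
      (Finset.mem_univ p)
    rw [Real.norm_eq_abs] at h1
    linarith [le_abs_self (b p), abs_nonneg a]

theorem pd_eq_zero_of_eq_one {φ : E n → ℝ} (h : ∀ x ∈ Metric.ball (0 : E n) (1 / 2), φ x = 1)
    {x : E n} (hx : ‖x‖ < 1 / 2) (p : Fin n) : pd p φ x = 0 := by
  have h1 : φ =ᶠ[𝓝 x] fun _ => (1 : ℝ) := by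
    filter_upwards [Metric.isOpen_ball.mem_nhds (mem_ball_zero_iff.2 hx)] with z hz using h z hz
  rw [pd, h1.fderiv_eq]
  simp

variable {M : Type*} [TopologicalSpace M] [ChartedSpace (E n) M]
  [IsManifold (𝓡 n) ∞ M] {g : Metric n M} {T : ℝ} {J : ℝ → EndField n M}
  {e : OpenPartialHomeomorph M (E n)} {φ : E n → ℝ}

variable [MeasurableSpace M] [BorelSpace M] [CompactSpace M] [T2Space M]

/-- The substitution `t = T₀ - R² σ` turns the localized space-time energy into an integral over
the fixed interval `[1, 4]`. -/
theorem IsHarmonicHeatFlow.psi_eq (h : IsHarmonicHeatFlow g T J) (he : e ∈ smoothCharts n M)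
    (hφ : tsupport φ ⊆ e.target) {T₀ R : ℝ} (hT : T₀ ≤ T) (hR : 0 < R) (hR4 : 4 * R ^ 2 ≤ T₀) :
    Psi g φ e J T₀ R = ∫ σ in (1 : ℝ)..4, σ⁻¹ *
      localEnergy e.target (gram g e) φ (fun t => endMat (J t) e) T₀ (T₀ - R ^ 2 * σ) := by
  have hR2 : 0 < R ^ 2 := by positivity
  obtain ⟨Z, hZ⟩ : ∃ Z, Z = localEnergy e.target (gram g e) φ (fun t => endMat (J t) e) T₀ :=
    ⟨_, rfl⟩
  have hinner : ∀ t ∈ uIcc (T₀ - 4 * R ^ 2) (T₀ - R ^ 2), (∫ x : E n,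
      gradNormSq (gram g e) (endCoeff e (J t)) x * heatKernel (T₀ - t) x * φ x ^ 2
        * Real.sqrt (gram g e x).det) = (T₀ - t)⁻¹ * Z t := fun t ht => by
    rw [uIcc_of_le (by linarith)] at ht
    have hs : 0 < T₀ - t := by linarith [ht.2]
    have htI : t ∈ Ico 0 T := ⟨by linarith [ht.1], by linarith⟩
    rw [← setIntegral_eq_integral_of_forall_compl_eq_zero (s := e.target), hZ, localEnergy,
      ← integral_const_mul]
    · refine setIntegral_congr_fun e.open_target.measurableSet fun x hx => ?_
      have h1 : gradNormSq (gram g e) (endCoeff e (J t)) x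
        = -trEnergy (gram g e) (endMat (J t) e) x := (h.isCompatibleFlow he).gradNormSq_eq htI hx
      rw [h1, localDensity, weight, vol]
      field_simp
    · intro x hx
      have : φ x = 0 := image_eq_zero_of_notMem_tsupport fun hx' => hx (hφ hx')
      simp [this]
  rw [Psi, intervalIntegral.integral_congr hinner, ← hZ]
  have h1 := intervalIntegral.integral_comp_sub_mul (a := 1) (b := 4)
    (fun t => (T₀ - t)⁻¹ * Z t) hR2.ne' T₀
  rw [mul_one, mul_comm (R ^ 2) 4, smul_eq_mul, eq_inv_mul_iff_mul_eq₀ hR2.ne',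
    ← intervalIntegral.integral_const_mul] at h1
  rw [← h1]
  refine intervalIntegral.integral_congr fun σ hσ => ?_
  rw [sub_sub_cancel, mul_inv]
  field_simp

theorem IsHarmonicHeatFlow.energy_nonneg (h : IsHarmonicHeatFlow g T J) {t : ℝ} (ht : t ∈ Ico 0 T) :
    0 ≤ energy g (J t) :=
  integral_nonneg fun p => by
    dsimp only [Pi.zero_apply]
    have hx := (chartAt (E n) p).map_source (mem_chart_source _ p)
    exact (neg_nonneg.2 ((h.isCompatibleFlow (chartAt_mem p)).trEnergy_nonpos ht hx)).trans_eq
      ((h.isCompatibleFlow (chartAt_mem p)).gradNormSq_eq ht hx).symm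

theorem IsHarmonicHeatFlow.isControlledFlow (h : IsHarmonicHeatFlow g T J) {y : M}
    (he : IsNormalChart g y 1 e) {K Φ : ℝ} (hK : HasBoundedGeometry (gram g e) K)
    (hφ : ContDiff ℝ ∞ φ) (hφ_supp : tsupport φ ⊆ Metric.ball 0 1)
    (hφ_one : ∀ x ∈ Metric.ball (0 : E n) (1 / 2), φ x = 1)
    (hΦ : ∀ x ∈ Metric.ball (0 : E n) 1, |φ x| ≤ Φ ∧ ∀ p, |pd p φ x| ≤ Φ) :
    IsControlledFlow K Φ (energy g (J 0)) T (gram g e) φ fun t => endMat (J t) e where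
  bounded := hK
  radial := he.isRadialMetric
  flow := he.target_eq ▸ h.isCompatibleFlow he.mem_maximalAtlas
  smooth_cutoff := hφ
  tsupport_subset := hφ_supp
  cutoff_le := fun x hx => (hΦ x hx).1
  pd_cutoff_le := fun x hx => (hΦ x hx).2
  pd_cutoff_eq_zero := fun _ hx => pd_eq_zero_of_eq_one hφ_one hx
  integrable := fun _ ht => he.target_eq ▸ h.integrableOn he.mem_maximalAtlas ht
  energy_le := fun _ ht => he.target_eq ▸ h.setIntegral_le he.mem_maximalAtlas ht

end NormalChart

end HarmonicFlow

end

theorem mainTheorem6 {n : ℕ} {M : Type*} [TopologicalSpace M]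
    [ChartedSpace (EuclideanSpace ℝ (Fin n)) M] [IsManifold (𝓡 n) ∞ M]
    [CompactSpace M] [T2Space M] [MeasurableSpace M] [BorelSpace M]
    (g : HarmonicFlow.Metric n M) (hinj : 1 < HarmonicFlow.injectivityRadius g)
    (φ : EuclideanSpace ℝ (Fin n) → ℝ) (hφ : ContDiff ℝ ∞ φ)
    (hφ_supp : tsupport φ ⊆ Metric.ball 0 1)
    (hφ_one : ∀ x ∈ Metric.ball (0 : EuclideanSpace ℝ (Fin n)) (1 / 2), φ x = 1) :
    ∃ C : ℝ, 0 < C ∧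
      ∀ (T : ℝ) (J : ℝ → HarmonicFlow.EndField n M), HarmonicFlow.IsHarmonicHeatFlow g T J →
      ∀ (y : M) (e : OpenPartialHomeomorph M (EuclideanSpace ℝ (Fin n))),
        HarmonicFlow.IsNormalChart g y 1 e →
      ∀ T₀ : ℝ, 0 < T₀ → T₀ ≤ T →
      ∀ R₁ R₂ N : ℝ, 0 < R₂ → R₂ ≤ R₁ → R₁ ≤ min (Real.sqrt T₀ / 2) 1 → 1 < N →
        HarmonicFlow.Psi g φ e J T₀ R₂ ≤
          Real.exp (C * (HarmonicFlow.fTilde R₂ - HarmonicFlow.fTilde R₁)) *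
              HarmonicFlow.Psi g φ e J T₀ R₁ +
            C * (N ^ ((n : ℝ) / 2) *
                (HarmonicFlow.energy g (J 0) + Real.sqrt (HarmonicFlow.energy g (J 0))) +
              1 / Real.log N ^ 2) * (R₁ - R₂) := by
  obtain ⟨K, hK, hgeom⟩ := HarmonicFlow.exists_boundedGeometry hinj
  obtain ⟨Φ, hΦ, hφΦ⟩ := HarmonicFlow.exists_cutoff_bound hφ
  obtain ⟨C, hC, hmono⟩ := HarmonicFlow.exists_localEnergy_monotone n hK.le hΦ
  refine ⟨C, hC, fun T J hJ y e he T₀ hT₀ hT R₁ R₂ N hR₂ h12 hR₁ hN => ?_⟩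
  have hR₁0 : 0 < R₁ := hR₂.trans_le h12
  have h4 : 4 * R₁ ^ 2 ≤ T₀ := by
    have h1 : 2 * R₁ ≤ Real.sqrt T₀ := by linarith [hR₁.trans (min_le_left _ _)]
    have h2 := pow_le_pow_left₀ (by positivity) h1 2
    rw [Real.sq_sqrt hT₀.le] at h2
    linarith
  have h4' : 4 * R₂ ^ 2 ≤ T₀ := by
    have := pow_le_pow_left₀ hR₂.le h12 2
    linarith
  have hsupp : tsupport φ ⊆ e.target := he.target_eq ▸ hφ_supp
  rw [hJ.psi_eq he.mem_maximalAtlas hsupp hT hR₂ h4',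
    hJ.psi_eq he.mem_maximalAtlas hsupp hT hR₁0 h4,
    he.target_eq]
  exact hmono _ T T₀ _ φ _ (hJ.isControlledFlow he (hgeom y e he) hφ hφ_supp hφ_one hφΦ) hT
    (hJ.energy_nonneg ⟨le_rfl, hT₀.trans_le hT⟩) R₁ R₂ N hR₂ h12
    (hR₁.trans (min_le_right _ _)) h4 hN
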